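/- Let $\mathcal S^\downarrow$ be the set of non-increasing sequences $m=(m_k)_{k\ge1}$ in $[0,\infty)$ (with the Borel sets of pointwise convergence), $\ell_{0+}$ the set of those with $m_k=0$ for some $k$ (finitely many particles), and, for $\lambda\in(0,1]$, $\ell_\lambda=\{m:\sum_k m_k^\lambda<\infty\}$ with distance $\delta_\lambda(m,\tilde m)=\sum_k|m_k^\lambda-\tilde m_k^\lambda|$. Let $\Theta=\{\theta=(\theta_k)_{k\ge1}:1>\theta_1\ge\theta_2\ge\dots\ge0\}$. For $m\in\ell_\lambda$ let $c_{ij}(m)$ ($i<j$) be the decreasing reordering of $m$ after $m_i,m_j$ are replaced by $m_i+m_j$, and $f_{i\theta}(m)$ the decreasing reordering of $m$ after $m_i$ is replaced by $\theta_1m_i,\theta_2m_i,\dots$ Let $\lambda\in(0,1]$. Let $K:[0,\infty)^2\to[0,\infty)$ be measurable and symmetric, $F:[0,\infty)\to[0,\infty)$ measurable, both bounded on bounded sets, with $K(x,0)=0$ and $F(0)=0$ (a mass $0$ is an absent particle). Let $\beta$ be a finite measure on $\Theta$ with $\beta(\sum_k\theta_k>1)=0$ such that, for some $k\in\mathbb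 N$, $\theta_{n}=0$ for all $n>k$, for $\beta$-a.e. $\theta$. For bounded measurable $\Phi$ and $m\in\ell_{0+}$ put $$\mathcal L_{K,F}^\beta\Phi(m)=\sum_{i<j}K(m_i,m_j)[\Phi(c_{ij}(m))-\Phi(m)]+\sum_{i}F(m_i)\int_\Theta[\Phi(f_{i\theta}(m))-\Phi(m)]\,\beta(d\theta).$$ A *finite coalescence-fragmentation process* started at $m\in\ell_{0+}$ is an adapted process $X$ on a filtered probability space with $X_0=m$ a.s., with a.s. $\ell_{0+}$-valued paths in $\mathbb D([0,\infty),\ell_\lambda)$, that is strong Markov and has generator $\mathcal L_{K,F}^\beta$, in the sense that for every bounded measurable $\Phi$ the process $\Phi(X_t)-\Phi(X_0)-\int_0^t\mathcal L_{K,F}^\beta\Phi(X_s)\,ds$ is well defined and a local martingale. Then there is a measurable family of laws $\kappa(m,\cdot)$ on path space such that for every $m\in\ell_{0+}$: 1. (Existence and uniqueness in law.) There is a finite coalescence-fragmentation process started at $m$, strong Markov with the family $\kappa$ (given $\mathcal F_\tau$ and on $\{\tau<\infty\}$, $(X_{\tau+t})_{t\ge0}$ has law $\kappa(X_\tau,\cdot)$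 for every stopping time $\tau$); every finite coalescence-fragmentation process started at $m$ has law $\kappa(m,\cdot)$. 2. (Poisson-driven equation.) On any probability space, let $\mathcal N(dt,d(i,j),dz)$ and $\mathcal M(dt,di,d\theta,dz)$ be independent Poisson measures with intensities $dt\,\big(\sum_{k<l}\delta_{(k,l)}\big)(d(i,j))\,dz$ and $dt\,\big(\sum_k\delta_k\big)(di)\,\beta(d\theta)\,dz$, and $(\mathcal H_t)$ their completed canonical filtration. Call an $(\mathcal H_t)$-adapted process $M$ with paths a.s. in $\mathbb D([0,\infty),\ell_\lambda)$ a solution if for all $t$, a.s., coordinatewise and with convergent integrals, $$M_t=m+\int_0^t\!\!\int_{i<j}\!\int_0^\infty[c_{ij}(M_{s-})-M_{s-}]\mathbf 1_{\{z\le K(M_i(s-),M_j(s-))\}}\,\mathcal N(ds,d(i,j),dz)+\int_0^t\!\!\int_i\!\int_\Theta\!\int_0^\infty[f_{i\theta}(M_{s-})-M_{s-}]\mathbf 1_{\{z\le F(M_i(s-))\}}\,\mathcal M(ds,di,d\theta,dz).$$ Then there is a solution $M$ which is a finite coalescence-fragmentation process started at $m$ relative to $(\mathcal H_t)$, strong Markov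 with the family $\kappa$, and which does not explode: a.s., for all $t$, $\sup_{s\le t}\#\{i:M_i(s)>0\}<\infty$ and $\sup_{s\le t}\big(\sum_{i<j}K(M_i(s),M_j(s))+\beta(\Theta)\sum_iF(M_i(s))\big)<\infty$. It is pathwise unique: every solution with a.s. finitely many particles at all times is indistinguishable from $M$; if $\lambda<1/2$ every solution is indistinguishable from $M$, without this finiteness requirement. -/

import Mathlib

open MeasureTheory ProbabilityTheory Filter Topology
open scoped NNReal ENNReal

namespace CoagFrag

noncomputable section

/-- Lebesgue measure on `[0, ∞)`. -/
def leb : Measure ℝ≥0 := Measure.comap (fun x : ℝ≥0 => (x : ℝ)) volume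

/-! ### States and their distances -/

/-- Non-increasing sequences of masses in `[0, ∞)`, indexed from `0`.  A zero entry stands for an
absent particle.  The type carries the topology of pointwise convergence and its Borel sets. -/
abbrev MassSeq : Type := {m : ℕ → ℝ≥0 // Antitone m}

/-- The set of states with finitely many particles. -/
def finiteStates : Set MassSeq := {m | ∃ n, m.1 n = 0}

/-- The `λ`-moment `∑ₖ mₖ ^ λ`. -/
def moment (lam : ℝ) (m : MassSeq) : ℝ≥0∞ := ∑' k, ((m.1 k ^ lam : ℝ≥0) : ℝ≥0∞)

/-- The space `ℓ_λ` of states with finite `λ`-moment. -/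
def ell (lam : ℝ) : Set MassSeq := {m | moment lam m < ∞}

/-- The distance `δ_λ(m, m') = ∑ₖ |mₖ ^ λ - m'ₖ ^ λ|`. -/
def delta (lam : ℝ) (m m' : MassSeq) : ℝ≥0∞ := ∑' k, edist (m.1 k ^ lam) (m'.1 k ^ lam)

/-- The number of particles. -/
def numParticles (m : MassSeq) : ℕ∞ := {k | 0 < m.1 k}.encard

/-- The path `x` belongs to the Skorokhod space `𝔻([0, ∞), ℓ_λ)`, where `ℓ_λ` has the
distance `δ_λ`. -/
structure IsCadlag (lam : ℝ) (x : ℝ≥0 → MassSeq) : Prop where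
  mem : ∀ t, x t ∈ ell lam
  right : ∀ t, Tendsto (fun s => delta lam (x s) (x t)) (𝓝[>] t) (𝓝 0)
  left : ∀ t, 0 < t → ∃ y ∈ ell lam, Tendsto (fun s => delta lam (x s) y) (𝓝[<] t) (𝓝 0)

/-! ### Reordering, coalescence and fragmentation of states -/

/-- The `k`-th largest value (`k = 0, 1, …`) of a family of masses: the least `x` such that at most
`k` members of the family exceed `x`. -/
def kthLargest {ι : Type} (u : ι → ℝ≥0) (k : ℕ) : ℝ≥0 :=
  sInf {x : ℝ≥0 | {i | x < u i}.encard ≤ (k : ℕ∞)}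

theorem kthLargest_antitone {ι : Type} (u : ι → ℝ≥0) : Antitone (kthLargest u) := by
  intro k l hkl
  unfold kthLargest
  have hsub : {x : ℝ≥0 | {i | x < u i}.encard ≤ (k : ℕ∞)} ⊆
      {x : ℝ≥0 | {i | x < u i}.encard ≤ (l : ℕ∞)} := fun x hx =>
    le_trans (show _ ≤ (k : ℕ∞) from hx) (Nat.cast_le.mpr hkl)
  rcases Set.eq_empty_or_nonempty {x : ℝ≥0 | {i | x < u i}.encard ≤ (k : ℕ∞)} with h | h
  · rcases Set.eq_empty_or_nonempty {x : ℝ≥0 | {i | x < u i}.encard ≤ (l : ℕ∞)} with h' | ⟨x, hx⟩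
    · rw [h, h']
    · exfalso
      have hfin : {i | x < u i}.Finite := Set.finite_of_encard_le_coe hx
      obtain ⟨b, hb⟩ := (hfin.image u).bddAbove
      have hmem : max x b ∈ {x : ℝ≥0 | {i | x < u i}.encard ≤ (k : ℕ∞)} := by
        have he : {i | max x b < u i} = ∅ := by
          refine Set.eq_empty_iff_forall_notMem.mpr fun i hi => ?_
          have hlt : max x b < u i := hi
          have hxi : x < u i := lt_of_le_of_lt (le_max_left _ _) hlt
          have hbi : u i ≤ b := hb ⟨i, hxi, rfl⟩
          exact absurd (lt_of_le_of_lt (le_max_right x b) hlt) (not_lt.mpr hbi)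
        change {i | max x b < u i}.encard ≤ (k : ℕ∞)
        rw [he, Set.encard_empty]
        exact zero_le
      rw [h] at hmem
      exact hmem
  · exact csInf_le_csInf (OrderBot.bddBelow _) h hsub

/-- Arrange a family of masses in decreasing order. -/
def reorder {ι : Type} (u : ι → ℝ≥0) : MassSeq := ⟨kthLargest u, kthLargest_antitone u⟩

/-- `c_{ij}(m)`: particles `i` and `j` merge. -/
def coalesce (i j : ℕ) (m : MassSeq) : MassSeq :=
  reorder fun k : ℕ => if k = i then m.1 i + m.1 j else if k = j then 0 else m.1 k

/-- The set of ratios `Θ`: sequences `1 > θ₀ ≥ θ₁ ≥ … ≥ 0`. -/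
abbrev Ratios : Type := {θ : ℕ → ℝ≥0 // Antitone θ ∧ θ 0 < 1}

/-- `f_{iθ}(m)`: particle `i` is replaced by the fragments `θ₀ mᵢ, θ₁ mᵢ, …`. -/
def fragment (i : ℕ) (θ : Ratios) (m : MassSeq) : MassSeq :=
  reorder (Sum.elim (fun k : ℕ => if k = i then 0 else m.1 k) (fun l : ℕ => θ.1 l * m.1 i))

/-- Pairs of indices `i < j`. -/
abbrev IdxPair : Type := {p : ℕ × ℕ // p.1 < p.2}

/-! ### Hypotheses on the kernels and on the dislocation measure -/

/-- A coagulation kernel: symmetric, measurable, bounded on bounded sets, and extended by the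
convention that it vanishes when one of the masses is `0`. -/
structure IsCoagKernel (K : ℝ≥0 → ℝ≥0 → ℝ≥0) : Prop where
  measurable : Measurable fun p : ℝ≥0 × ℝ≥0 => K p.1 p.2
  symm : ∀ x y, K x y = K y x
  zero : ∀ x, K x 0 = 0
  locallyBounded : ∀ a : ℝ≥0, ∃ C : ℝ≥0, ∀ x ≤ a, ∀ y ≤ a, K x y ≤ C

/-- A fragmentation kernel: measurable, bounded on bounded sets, zero at `0`. -/
structure IsFragKernel (F : ℝ≥0 → ℝ≥0) : Prop where
  measurable : Measurable F
  zero : F 0 = 0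
  locallyBounded : ∀ a : ℝ≥0, ∃ C : ℝ≥0, ∀ x ≤ a, F x ≤ C

/-- A finite dislocation measure without gain of mass and with a bounded number of fragments. -/
structure IsFiniteDislocation (β : Measure Ratios) : Prop where
  finite : β Set.univ < ∞
  mass : β {θ | 1 < ∑' k, (θ.1 k : ℝ≥0∞)} = 0
  fragments : ∃ k : ℕ, β {θ | ¬ ∀ n, k ≤ n → θ.1 n = 0} = 0

/-! ### Jump rates and generator -/

/-- The total coalescence rate `ρ_c = ∑_{i<j} K(mᵢ, mⱼ)`. -/
def coagRate (K : ℝ≥0 → ℝ≥0 → ℝ≥0) (m : MassSeq) : ℝ≥0∞ :=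
  ∑' p : IdxPair, (K (m.1 p.1.1) (m.1 p.1.2) : ℝ≥0∞)

/-- The total fragmentation rate `ρ_f = β(Θ) ∑ᵢ F(mᵢ)`. -/
def fragRate (F : ℝ≥0 → ℝ≥0) (β : Measure Ratios) (m : MassSeq) : ℝ≥0∞ :=
  β Set.univ * ∑' i : ℕ, (F (m.1 i) : ℝ≥0∞)

/-- The operator `L_{K,F}^β`.  On `finiteStates` both sums are finite. -/
def generator (K : ℝ≥0 → ℝ≥0 → ℝ≥0) (F : ℝ≥0 → ℝ≥0) (β : Measure Ratios)
    (Φ : MassSeq → ℝ) (m : MassSeq) : ℝ :=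
  (∑' p : IdxPair,
    (K (m.1 p.1.1) (m.1 p.1.2) : ℝ) * (Φ (coalesce p.1.1 p.1.2 m) - Φ m)) +
  ∑' i : ℕ, (F (m.1 i) : ℝ) * ∫ θ, (Φ (fragment i θ m) - Φ m) ∂β

/-! ### Strong Markov processes with a given generator -/

section Processes

variable {Ω : Type*} {mΩ : MeasurableSpace Ω}

/-- The adapted process `X` has generator `L_{K,F}^β`: for each bounded measurable `Φ`, the
process `Φ(X_t) - Φ(X_0) - ∫₀ᵗ L Φ(X_s) ds` is well defined and a local martingale. -/
def HasGenerator (K : ℝ≥0 → ℝ≥0 → ℝ≥0) (F : ℝ≥0 → ℝ≥0) (β : Measure Ratios)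
    (𝓕 : Filtration ℝ≥0 mΩ) (X : ℝ≥0 → Ω → MassSeq) (P : Measure Ω) : Prop :=
  ∀ Φ : MassSeq → ℝ, Measurable Φ → (∃ C, ∀ m, |Φ m| ≤ C) →
    (∀ᵐ ω ∂P, ∀ t : ℝ≥0,
      IntegrableOn (fun s : ℝ≥0 => generator K F β Φ (X s ω)) (Set.Iic t) leb) ∧
    Locally (fun Y : ℝ≥0 → Ω → ℝ => Martingale Y 𝓕 P) 𝓕
      (fun t ω => Φ (X t ω) - Φ (X 0 ω) -
        ∫ s in Set.Iic t, generator K F β Φ (X s ω) ∂leb) P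

/-- The strong Markov property with the family of laws `κ`: for each stopping time `τ`, given
`𝓕_τ` and on `{τ < ∞}`, the path `(X_{τ+t})_{t ≥ 0}` has the law `κ(X_τ)`. -/
def HasStrongMarkovProperty (κ : Kernel MassSeq (ℝ≥0 → MassSeq))
    (𝓕 : Filtration ℝ≥0 mΩ) (X : ℝ≥0 → Ω → MassSeq) (P : Measure Ω) : Prop :=
  ∀ (τ : Ω → WithTop ℝ≥0) (hτ : IsStoppingTime 𝓕 τ) (A : Set Ω),
    MeasurableSet[hτ.measurableSpace] A →
    ∀ B : Set (ℝ≥0 → MassSeq), MeasurableSet B →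
      P {ω | ω ∈ A ∧ τ ω ≠ ⊤ ∧ (fun t => X ((τ ω).untopD 0 + t) ω) ∈ B} =
        ∫⁻ ω in {ω | ω ∈ A ∧ τ ω ≠ ⊤}, κ (X ((τ ω).untopD 0) ω) B ∂P

/-- `X` is a finite coalescence-fragmentation process started at `m`: an adapted process of
finitely many particles with paths in `𝔻([0, ∞), ℓ_λ)`, strong Markov with family of laws `κ`,
with generator `L_{K,F}^β`. -/
structure IsFiniteCFProcess (K : ℝ≥0 → ℝ≥0 → ℝ≥0) (F : ℝ≥0 → ℝ≥0) (β : Measure Ratios)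
    (lam : ℝ) (m : MassSeq) (κ : Kernel MassSeq (ℝ≥0 → MassSeq))
    (𝓕 : Filtration ℝ≥0 mΩ) (X : ℝ≥0 → Ω → MassSeq) (P : Measure Ω) : Prop where
  adapted : ∀ t, Measurable[𝓕 t] (X t)
  start : ∀ᵐ ω ∂P, X 0 ω = m
  cadlag : ∀ᵐ ω ∂P, IsCadlag lam fun t => X t ω
  finite : ∀ᵐ ω ∂P, ∀ t, X t ω ∈ finiteStates
  strongMarkov : HasStrongMarkovProperty κ 𝓕 X P
  hasGenerator : HasGenerator K F β 𝓕 X P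

/-! ### Poisson random measures and the stochastic equation -/

/-- `N` is a Poisson random measure with intensity `ν`. -/
structure IsPoissonRandomMeasure {E : Type*} [MeasurableSpace E] (N : Ω → Measure E)
    (ν : Measure E) (P : Measure Ω) : Prop where
  measurable : Measurable N
  poisson : ∀ A, MeasurableSet A → ν A ≠ ∞ →
    P.map (fun ω => N ω A) =
      (poissonMeasure (ν A).toNNReal).map (fun n : ℕ => (n : ℝ≥0∞))
  indep : ∀ (n : ℕ) (A : Fin n → Set E), (∀ i, MeasurableSet (A i)) →
    Pairwise (fun i j => Disjoint (A i) (A j)) → iIndepFun (fun i ω => N ω (A i)) P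

/-- The marks `(t, (i, j), z)` of the coalescence events. -/
abbrev CoagMark : Type := ℝ≥0 × IdxPair × ℝ≥0

/-- The marks `(t, i, θ, z)` of the fragmentation events. -/
abbrev FragMark : Type := ℝ≥0 × ℕ × Ratios × ℝ≥0

/-- The intensity `dt (∑_{k<l} δ_{(k,l)}) dz`. -/
def coagIntensity : Measure CoagMark :=
  leb.prod ((Measure.count : Measure IdxPair).prod leb)

/-- The intensity `dt (∑_k δ_k) β(dθ) dz`. -/
def fragIntensity (β : Measure Ratios) : Measure FragMark :=
  leb.prod
    ((Measure.count : Measure ℕ).prod (β.prod leb))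

/-- `N` and `M` are the independent Poisson measures that drive the equation. -/
structure IsDrivingPair (β : Measure Ratios) (N : Ω → Measure CoagMark)
    (M : Ω → Measure FragMark) (P : Measure Ω) : Prop where
  coag : IsPoissonRandomMeasure N coagIntensity P
  frag : IsPoissonRandomMeasure M (fragIntensity β) P
  indep : IndepFun N M P

/-- The `σ`-algebra generated by a random measure on `[0, t] × E`. -/
abbrev pastSigma {E : Type*} [MeasurableSpace E] (N : Ω → Measure (ℝ≥0 × E)) (t : ℝ≥0) :
    MeasurableSpace Ω :=
  MeasurableSpace.comap (fun ω => (N ω).restrict (Set.Iic t ×ˢ Set.univ)) inferInstance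

theorem measurable_restrict_measure {E : Type*} [MeasurableSpace E] {S : Set E}
    (hS : MeasurableSet S) : Measurable fun μ : Measure E => μ.restrict S := by
  refine Measure.measurable_of_measurable_coe _ fun A hA => ?_
  simp only [Measure.restrict_apply hA]
  exact Measure.measurable_coe (hA.inter hS)

theorem pastSigma_mono {E : Type*} [MeasurableSpace E] (N : Ω → Measure (ℝ≥0 × E))
    {s t : ℝ≥0} (h : s ≤ t) : pastSigma N s ≤ pastSigma N t := by
  have hS : ∀ r : ℝ≥0, MeasurableSet (Set.Iic r ×ˢ (Set.univ : Set E)) := fun r =>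
    measurableSet_Iic.prod MeasurableSet.univ
  have he : (fun ω => (N ω).restrict (Set.Iic s ×ˢ (Set.univ : Set E))) =
      (fun μ : Measure (ℝ≥0 × E) => μ.restrict (Set.Iic s ×ˢ Set.univ)) ∘
        (fun ω => (N ω).restrict (Set.Iic t ×ˢ Set.univ)) := by
    funext ω
    simp only [Function.comp]
    rw [Measure.restrict_restrict (hS s), Set.inter_eq_left.mpr
      (Set.prod_mono (Set.Iic_subset_Iic.mpr h) (le_refl _))]
  unfold pastSigma
  rw [he, ← MeasurableSpace.comap_comp]
  exact MeasurableSpace.comap_mono (measurable_restrict_measure (hS s)).comap_le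

theorem pastSigma_le {E : Type*} [MeasurableSpace E] {N : Ω → Measure (ℝ≥0 × E)}
    (hN : Measurable N) (t : ℝ≥0) : pastSigma N t ≤ mΩ :=
  ((measurable_restrict_measure
    (measurableSet_Iic.prod MeasurableSet.univ)).comp hN).comap_le

/-- The canonical filtration of the pair of random measures, completed by the null events. -/
def canonicalFiltration {N : Ω → Measure CoagMark} {M : Ω → Measure FragMark}
    (hN : Measurable N) (hM : Measurable M) (P : Measure Ω) : Filtration ℝ≥0 mΩ where
  seq t := (pastSigma N t ⊔ pastSigma M t) ⊔
    MeasurableSpace.generateFrom {A | MeasurableSet A ∧ P A = 0}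
  mono' _ _ h := sup_le_sup_right (sup_le_sup (pastSigma_mono N h) (pastSigma_mono M h)) _
  le' t := sup_le (sup_le (pastSigma_le hN t) (pastSigma_le hM t))
    (MeasurableSpace.generateFrom_le fun _ hA => hA.1)

/-- The `k`-th coordinate of the jump `[c_{ij}(x_{s-}) - x_{s-}] 1_{z ≤ K(x_i(s-), x_j(s-))}`. -/
def coagJump (K : ℝ≥0 → ℝ≥0 → ℝ≥0) (x : ℝ≥0 → MassSeq) (k : ℕ) (e : CoagMark) : ℝ :=
  let y := Function.leftLim x e.1
  let i := e.2.1.1.1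
  let j := e.2.1.1.2
  if e.2.2 ≤ K (y.1 i) (y.1 j) then ((coalesce i j y).1 k : ℝ) - (y.1 k : ℝ) else 0

/-- The `k`-th coordinate of the jump `[f_{iθ}(x_{s-}) - x_{s-}] 1_{z ≤ F(x_i(s-))}`. -/
def fragJump (F : ℝ≥0 → ℝ≥0) (x : ℝ≥0 → MassSeq) (k : ℕ) (e : FragMark) : ℝ :=
  let y := Function.leftLim x e.1
  let i := e.2.1
  if e.2.2.2 ≤ F (y.1 i) then ((fragment i e.2.2.1 y).1 k : ℝ) - (y.1 k : ℝ) else 0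

/-- `X` solves `SDE(K, F, m, N, M)`: it is adapted to `𝓗`, has a.s. paths in `𝔻([0, ∞), ℓ_λ)`,
and satisfies the equation coordinate by coordinate, with convergent integrals. -/
structure IsSDESolution (K : ℝ≥0 → ℝ≥0 → ℝ≥0) (F : ℝ≥0 → ℝ≥0) (lam : ℝ) (m : MassSeq)
    (N : Ω → Measure CoagMark) (M : Ω → Measure FragMark) (𝓗 : Filtration ℝ≥0 mΩ)
    (X : ℝ≥0 → Ω → MassSeq) (P : Measure Ω) : Prop where
  adapted : ∀ t, Measurable[𝓗 t] (X t)
  cadlag : ∀ᵐ ω ∂P, IsCadlag lam fun t => X t ω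
  equation : ∀ t, ∀ᵐ ω ∂P, ∀ k,
    IntegrableOn (coagJump K (fun s => X s ω) k) (Set.Iic t ×ˢ Set.univ) (N ω) ∧
    IntegrableOn (fragJump F (fun s => X s ω) k) (Set.Iic t ×ˢ Set.univ) (M ω) ∧
    ((X t ω).1 k : ℝ) = (m.1 k : ℝ) +
      (∫ e in Set.Iic t ×ˢ Set.univ, coagJump K (fun s => X s ω) k e ∂(N ω)) +
      ∫ e in Set.Iic t ×ˢ Set.univ, fragJump F (fun s => X s ω) k e ∂(M ω)

end Processes

end

end CoagFrag

/-!
The equation is solved path by path. The two Poisson measures are joined into one measure of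
*events*, times with marks; almost surely it is an `IsConfig`, Dirac masses at distinct times. Up to
the exit from `levelSet K F n`, where particles and rates are bounded by `n`, only the locally
finitely many events in `markBox n` matter, and `truncPath` executes them in order; `path` is the
limit. The mean number of particles grows at most exponentially, since the mass does not increase
and a fragmentation has at most `k` pieces: no explosion (`IsDriver.ae_noExplosion`). Expanding over
short intervals yields Dynkin's formula for the truncations (`IsDriver.dynkin`), hence the
martingale problem (`IsDriver.hasGenerator_path`).

For uniqueness in law, let `R` be the operator `dwell` and `Q` the operator `jumpOp`. The discounted
occupation measure `U` of a solution with initial law `μ` satisfies `μ R + U Q R ≤ U`; iterated, it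
dominates `μ ∑ R (Q R) ^ j`. Without explosion both have the same total mass, hence agree
(`lintegral_eq_green`). Inverting the Laplace transform gives the one-time laws, conditioning on the
past the Markov property, and approximation of stopping times the strong one.

For pathwise uniqueness, a solution whose mass does not increase cannot move before the next event
in some box, because its particles cannot lose mass (`IsPathSolution.eq_of_antitone`). The mass of
finitely many particles is a finite sum of coordinates, which follow the equation. If `λ < 1/2`,
then `m_j = O(j ^ (-1 / λ))` is small enough for the gain of mass of the first `l` particles, from
pairs `i < l ≤ j`, to vanish as `l → ∞`.
-/

namespace CoagFrag

noncomputable section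

open Set (Ioc Iic univ indicator_of_mem Ici indicator_of_notMem Ioo mem_ofPred_eq indicator Icc
  mem_preimage mem_Iic)
open Finset (range sum_congr mem_filter card_range sum_insert sum_le_sum sum_range_succ
  induction_on_max)
open ENNReal (ofReal coe_ne_top tsum_le_tsum coe_lt_top coe_toNNReal mul_ne_top toReal_mul
  ofReal_coe_nnreal coe_toReal toReal_nonneg toReal_mono mul_lt_top ofReal_add ofReal_ne_top
  natCast_ne_top tsum_add ofReal_le_ofReal toReal_add ofReal_mul ofReal_toReal sum_le_tsum)
open Function (leftLim)
open MeasureTheory.Measure (measurable_coe map_apply infinitePi restrict_apply prod_prod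
  restrict_apply_univ real dirac sum restrict_univ bind_apply dirac_apply')
open Real (exp norm_of_nonneg)
open NNReal (coe_nonneg)

variable {K : ℝ≥0 → ℝ≥0 → ℝ≥0} {F : ℝ≥0 → ℝ≥0} {β : Measure Ratios} {k : ℕ} {lam : ℝ}
  {Ω : Type*} {mΩ : MeasurableSpace Ω} {P : Measure Ω} {ℋ : Filtration ℝ≥0 mΩ}
    {ℱ : Filtration ℝ≥0 mΩ}
  (hlam : 0 < lam) (hK : IsCoagKernel K) (hF : IsFragKernel F) (hβ : IsFiniteDislocation β)
  {x y : MassSeq} {s t₀ t α : ℝ≥0} {n : ℕ} {M : ℝ≥0∞} {Ψ : MassSeq → ℝ≥0∞} {Φ : MassSeq → ℝ}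
    {A : Set Ω}

/-! ### Decreasing rearrangements -/

/-- The `k`-th largest value exceeds `x` exactly when more than `k` members of the family do. -/
lemma lt_kthLargest_iff {ι : Type} {u : ι → ℝ≥0} (hb : BddAbove (Set.range u)) (k : ℕ)
    (x : ℝ≥0) : x < kthLargest u k ↔ (k : ℕ∞) < {i | x < u i}.encard := by
  constructor
  · intro h
    by_contra hc
    have : kthLargest u k ≤ x := csInf_le (OrderBot.bddBelow _) (not_lt.mp hc)
    exact absurd this (not_le.mpr h)
  · intro h
    have h1 : ((k + 1 : ℕ) : ℕ∞) ≤ {i | x < u i}.encard := by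
      push_cast; exact Order.add_one_le_of_lt h
    obtain ⟨t, ht, htc⟩ := Set.exists_subset_encard_eq h1
    have htf : t.Finite := Set.finite_of_encard_eq_coe htc
    have hne : t.Nonempty := by
      rw [← Set.encard_pos, htc]; positivity
    obtain ⟨a, hat, ha⟩ := Set.exists_min_image t u htf hne
    refine lt_of_lt_of_le (ht hat) (le_csInf ?_ ?_)
    · obtain ⟨b, hb⟩ := hb
      refine ⟨b, ?_⟩
      have : {i | b < u i} = ∅ := Set.eq_empty_iff_forall_notMem.mpr fun i hi =>
        absurd (hb ⟨i, rfl⟩) (not_le.mpr hi)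
      change {i | b < u i}.encard ≤ _
      simp [this]
    · intro z hz
      by_contra hlt
      have hsub : t ⊆ {i | z < u i} := fun i hi => lt_of_lt_of_le (not_le.mp hlt) (ha i hi)
      have := (Set.encard_le_encard hsub).trans (show _ ≤ (k : ℕ∞) from hz)
      rw [htc] at this
      exact absurd (Nat.cast_le.mp this) (by omega)

lemma measurable_reorder {ι : Type} [Countable ι] {α : Type*} [MeasurableSpace α]
    {u : α → ι → ℝ≥0} (hu : ∀ i, Measurable fun a => u a i)
    (hb : ∀ a, BddAbove (Set.range (u a))) : Measurable fun a => reorder (u a) := by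
  refine Measurable.subtype_mk (measurable_pi_lambda _ fun k => measurable_of_Ioi fun x => ?_)
  have : (fun a => kthLargest (u a) k) ⁻¹' Set.Ioi x =
      ⋃ s ∈ {s : Finset ι | s.card = k + 1}, ⋂ i ∈ s, {a | x < u a i} := by
    ext a
    simp only [mem_preimage, Set.mem_Ioi, lt_kthLargest_iff (hb a), Set.mem_iUnion,
      Set.mem_iInter, mem_ofPred_eq]
    constructor
    · intro h
      have h1 : ((k + 1 : ℕ) : ℕ∞) ≤ {i | x < u a i}.encard := by
        push_cast; exact Order.add_one_le_of_lt h
      obtain ⟨t, ht, htc⟩ := Set.exists_subset_encard_eq h1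
      have htf : t.Finite := Set.finite_of_encard_eq_coe htc
      refine ⟨htf.toFinset, ?_, fun i hi => ht (htf.mem_toFinset.mp hi)⟩
      rw [htf.encard_eq_coe_toFinset_card] at htc
      exact_mod_cast htc
    · rintro ⟨s, hs, h⟩
      have h2 : (s : Set ι).encard ≤ {i | x < u a i}.encard :=
        Set.encard_le_encard fun i hi => h i hi
      rw [Set.encard_coe_eq_coe_finsetCard, hs] at h2
      exact lt_of_lt_of_le (by exact_mod_cast Nat.lt_succ_self k) h2
  rw [this]
  refine MeasurableSet.biUnion (Set.to_countable _) fun s _ => ?_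
  exact Finset.measurableSet_biInter s fun i _ => measurableSet_lt measurable_const (hu i)

lemma encard_setOf_natCast_lt (N : ℕ∞) : {k : ℕ | (k : ℕ∞) < N}.encard = N := by
  induction N with
  | top => simp
  | coe n =>
    have : {k : ℕ | (k : ℕ∞) < (n : ℕ∞)} = ((range n : Finset ℕ) : Set ℕ) := by
      ext k; simp
    rw [this, Set.encard_coe_eq_coe_finsetCard, card_range]

lemma numParticles_reorder {ι : Type} {u : ι → ℝ≥0} (hb : BddAbove (Set.range u)) :
    numParticles (reorder u) = {i | 0 < u i}.encard := by
  rw [← encard_setOf_natCast_lt {i | 0 < u i}.encard]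
  unfold numParticles reorder
  simp only [lt_kthLargest_iff hb]

/-- If every `n` members of a family add up to at most `b`, then so do its `n` largest values. -/
lemma sum_kthLargest_le {ι : Type} {u : ι → ℝ≥0} (hb : BddAbove (Set.range u)) (n : ℕ) (b : ℝ≥0)
    (h : ∀ s : Finset ι, s.card ≤ n → ∑ i ∈ s, u i ≤ b) :
    ∑ k ∈ range n, kthLargest u k ≤ b := by
  classical
  have key : ∀ ε : ℝ≥0, 0 < ε → ∀ n : ℕ, ∃ s : Finset ι, s.card ≤ n ∧
      ∑ k ∈ range n, kthLargest u k ≤ ∑ i ∈ s, u i + n * ε := by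
    intro ε hε n
    induction n with
    | zero => exact ⟨∅, by simp, by simp⟩
    | succ n ih =>
      obtain ⟨s, hs, hsum⟩ := ih
      rcases le_or_gt (kthLargest u n) ε with hle | hlt
      · refine ⟨s, hs.trans (Nat.le_succ n), ?_⟩
        rw [sum_range_succ]
        calc _ ≤ (∑ i ∈ s, u i + n * ε) + ε := add_le_add hsum hle
          _ = _ := by push_cast; ring
      · have hx : kthLargest u n - ε < kthLargest u n := tsub_lt_self (hε.trans hlt) hε
        rw [lt_kthLargest_iff hb] at hx
        have : ∃ i, kthLargest u n - ε < u i ∧ i ∉ s := by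
          by_contra hc
          push Not at hc
          have hsub : {i | kthLargest u n - ε < u i} ⊆ (s : Set ι) := fun i hi => hc i hi
          have h2 := Set.encard_le_encard hsub
          rw [Set.encard_coe_eq_coe_finsetCard] at h2
          exact absurd (hx.trans_le h2) (by simpa using hs)
        obtain ⟨i, hi, his⟩ := this
        refine ⟨insert i s, (Finset.card_insert_le _ _).trans (by omega), ?_⟩
        rw [sum_range_succ, sum_insert his]
        have h3 : kthLargest u n ≤ u i + ε := tsub_le_iff_right.mp hi.le
        calc _ ≤ (∑ i ∈ s, u i + n * ε) + (u i + ε) := add_le_add hsum h3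
          _ = _ := by push_cast; ring
  refine le_of_forall_pos_le_add fun δ hδ => ?_
  obtain ⟨s, hs, hsum⟩ := key (δ / (n + 1)) (by positivity) n
  refine hsum.trans (add_le_add (h s hs) ?_)
  rw [← mul_div_assoc]
  refine div_le_of_le_mul₀ (by positivity) (by positivity) ?_
  rw [mul_comm]; gcongr; exact le_self_add

lemma sum_finset_le_sum_range {y : ℕ → ℝ≥0} (hy : Antitone y) {s : Finset ℕ} (hs : s.card ≤ n) :
    ∑ i ∈ s, y i ≤ ∑ i ∈ range n, y i := by
  refine le_trans ?_ (Finset.sum_le_sum_of_subset (Finset.range_subset_range.mpr hs))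
  clear hs
  induction s using induction_on_max with
  | empty => simp
  | insert a s ha ih =>
    have has : a ∉ s := fun h => lt_irrefl _ (ha a h)
    rw [sum_insert has, Finset.card_insert_of_notMem has, sum_range_succ, add_comm]
    refine add_le_add ih (hy ?_)
    have : s ⊆ range a := fun x hx => Finset.mem_range.mpr (ha x hx)
    simpa using Finset.card_le_card this

/-! ### Coalescence and fragmentation of states -/

lemma MassSeq.le_zero_index (m : MassSeq) (k : ℕ) : m.1 k ≤ m.1 0 := m.2 (Nat.zero_le k)

lemma bddAbove_coalesce (i j : ℕ) (m : MassSeq) :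
    BddAbove (Set.range fun k : ℕ =>
      if k = i then m.1 i + m.1 j else if k = j then 0 else m.1 k) := by
  refine ⟨m.1 0 + m.1 0, ?_⟩
  rintro _ ⟨k, rfl⟩
  dsimp only
  split_ifs
  · exact add_le_add (m.le_zero_index _) (m.le_zero_index _)
  · exact zero_le
  · exact (m.le_zero_index k).trans le_self_add

lemma Ratios.le_one (θ : Ratios) (l : ℕ) : θ.1 l ≤ 1 := (θ.2.1 (Nat.zero_le l)).trans θ.2.2.le

lemma bddAbove_fragment (i : ℕ) (θ : Ratios) (m : MassSeq) :
    BddAbove (Set.range (Sum.elim (fun k : ℕ => if k = i then 0 else m.1 k)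
      (fun l : ℕ => θ.1 l * m.1 i))) := by
  refine ⟨m.1 0, ?_⟩
  rintro _ ⟨k | l, rfl⟩
  · simp only [Sum.elim_inl]
    split_ifs
    · exact zero_le
    · exact m.le_zero_index k
  · simp only [Sum.elim_inr]
    calc θ.1 l * m.1 i ≤ 1 * m.1 0 := mul_le_mul' (θ.le_one l) (m.le_zero_index i)
      _ = _ := one_mul _

lemma MassSeq.measurable_apply (k : ℕ) : Measurable fun m : MassSeq => m.1 k :=
  (measurable_pi_apply k).comp measurable_subtype_coe

lemma measurable_coalesce (i j : ℕ) : Measurable (coalesce i j) := by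
  refine measurable_reorder (fun k => ?_) fun m => bddAbove_coalesce i j m
  split_ifs
  · exact (MassSeq.measurable_apply i).add (MassSeq.measurable_apply j)
  · exact measurable_const
  · exact MassSeq.measurable_apply k

lemma measurable_fragment (i : ℕ) : Measurable fun p : Ratios × MassSeq => fragment i p.1 p.2 := by
  refine measurable_reorder (fun k => ?_) fun p => bddAbove_fragment i p.1 p.2
  rcases k with k | l
  · simp only [Sum.elim_inl]
    split_ifs
    · exact measurable_const
    · exact (MassSeq.measurable_apply k).comp measurable_snd
  · simp only [Sum.elim_inr]
    exact (((measurable_pi_apply l).comp measurable_subtype_coe).comp measurable_fst).mul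
      ((MassSeq.measurable_apply i).comp measurable_snd)

lemma numParticles_coalesce_le {i j : ℕ} (hij : i < j) (m : MassSeq) :
    numParticles (coalesce i j m) ≤ numParticles m := by
  unfold coalesce
  rw [numParticles_reorder (bddAbove_coalesce i j m)]
  refine Set.encard_le_encard fun k hk => ?_
  simp only [mem_ofPred_eq] at hk ⊢
  split_ifs at hk with h1 h2
  · subst h1
    rcases (add_pos_iff.mp hk) with h | h
    · exact h
    · exact h.trans_le (m.2 hij.le)
  · exact absurd hk (lt_irrefl _)
  · exact hk

lemma numParticles_fragment_le (i : ℕ) {θ : Ratios} (hθ : ∀ n, k ≤ n → θ.1 n = 0) (m : MassSeq) :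
    numParticles (fragment i θ m) ≤ numParticles m + k := by
  unfold fragment
  rw [numParticles_reorder (bddAbove_fragment i θ m)]
  have hsub : {a : ℕ ⊕ ℕ | 0 < Sum.elim (fun k : ℕ => if k = i then 0 else m.1 k)
      (fun l : ℕ => θ.1 l * m.1 i) a} ⊆
      Sum.inl '' {k | 0 < m.1 k} ∪ Sum.inr '' ((range k : Finset ℕ) : Set ℕ) := by
    rintro (a | l) h
    · left
      simp only [mem_ofPred_eq, Sum.elim_inl] at h
      refine ⟨a, ?_, rfl⟩
      split_ifs at h with h1
      · exact absurd h (lt_irrefl _)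
      · exact h
    · right
      simp only [mem_ofPred_eq, Sum.elim_inr] at h
      refine ⟨l, ?_, rfl⟩
      by_contra hc
      rw [hθ l (by simpa using hc)] at h
      simp at h
  refine (Set.encard_le_encard hsub).trans ((Set.encard_union_le _ _).trans ?_)
  rw [Sum.inl_injective.encard_image, Sum.inr_injective.encard_image,
    Set.encard_coe_eq_coe_finsetCard, card_range]
  exact le_rfl

lemma mem_finiteStates_iff {m : MassSeq} : m ∈ finiteStates ↔ numParticles m < ⊤ := by
  constructor
  · rintro ⟨n, hn⟩
    have : {k | 0 < m.1 k} ⊆ ((range n : Finset ℕ) : Set ℕ) := fun k hk => by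
      simp only [Finset.coe_range, Set.mem_Iio]
      by_contra hc
      exact absurd (show 0 < m.1 k from hk) (not_lt.mpr (hn ▸ m.2 (not_lt.mp hc)))
    refine (Set.encard_le_encard this).trans_lt ?_
    rw [Set.encard_coe_eq_coe_finsetCard]
    exact ENat.natCast_lt_top _
  · intro h
    by_contra hc
    have : {k | 0 < m.1 k} = univ := Set.eq_univ_of_forall fun k =>
      pos_iff_ne_zero.mpr fun h0 => hc ⟨k, h0⟩
    unfold numParticles at h
    rw [this] at h
    simp at h

/-- The `n` largest masses add up to at most `y_{max n j}` more after the coalescence of `i` and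
`j`. -/
lemma sum_range_coalesce_le {i j : ℕ} (hij : i < j) (y : MassSeq) (n : ℕ) :
    ∑ k ∈ range n, (coalesce i j y).1 k ≤
      ∑ k ∈ range n, y.1 k + y.1 (max n j) := by
  refine sum_kthLargest_le (bddAbove_coalesce i j y) n _ fun s hs => ?_
  set u : ℕ → ℝ≥0 := fun k => if k = i then y.1 i + y.1 j else if k = j then 0 else y.1 k with hu
  by_cases hi : i ∈ s
  · have h1 : ∑ k ∈ s, u k = y.1 i + y.1 j + ∑ k ∈ (s.erase i).erase j, y.1 k := by
      rw [← Finset.add_sum_erase s u hi]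
      congr 1
      · simp [hu]
      · by_cases hj : j ∈ s.erase i
        · rw [← Finset.add_sum_erase _ u hj]
          have : u j = 0 := by simp [hu, hij.ne']
          rw [this, zero_add]
          refine sum_congr rfl fun k hk => ?_
          simp only [Finset.mem_erase] at hk
          simp [hu, hk.1, hk.2.1]
        · rw [Finset.erase_eq_of_notMem hj]
          refine sum_congr rfl fun k hk => ?_
          have hkj : k ≠ j := fun h => hj (h ▸ hk)
          simp only [Finset.mem_erase] at hk
          simp [hu, hk.1, hkj]
    have h2 : ∑ k ∈ s, u k = ∑ k ∈ insert j s, y.1 k := by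
      rw [h1]
      have hj' : j ∉ s.erase j := by simp
      have : insert j s = insert j (s.erase j) := by
        ext k; by_cases h : k = j <;> simp [h]
      rw [this, sum_insert hj', ← Finset.add_sum_erase (s.erase j) y.1
        (Finset.mem_erase.mpr ⟨hij.ne, hi⟩), Finset.erase_right_comm]
      ring
    rw [h2]
    rcases le_or_gt n j with hnj | hnj
    · rw [max_eq_right hnj]
      refine (Finset.sum_le_sum_of_subset_of_nonneg (Finset.insert_subset_insert j
        (Finset.subset_insert j s) ) (fun _ _ _ => zero_le)).trans ?_
      rw [Finset.insert_idem]
      by_cases hjs : j ∈ s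
      · rw [Finset.insert_eq_of_mem hjs]
        exact (sum_finset_le_sum_range y.2 hs).trans le_self_add
      · rw [sum_insert hjs, add_comm]
        exact add_le_add (sum_finset_le_sum_range y.2 hs) le_rfl
    · rw [max_eq_left hnj.le, ← sum_range_succ]
      exact sum_finset_le_sum_range y.2 ((Finset.card_insert_le _ _).trans (by omega))
  · refine le_trans (sum_le_sum (g := y.1) fun k hk => ?_)
      ((sum_finset_le_sum_range y.2 hs).trans le_self_add)
    have hki : k ≠ i := fun h => hi (h ▸ hk)
    simp only [hki, if_false]
    split_ifs
    · exact zero_le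
    · exact le_rfl

/-- A fragmentation without gain of mass does not increase the sum of the `n` largest masses. -/
lemma sum_range_fragment_le (i : ℕ) {θ : Ratios} (hθ : ∑' k, (θ.1 k : ℝ≥0∞) ≤ 1) (y : MassSeq)
    (n : ℕ) : ∑ k ∈ range n, (fragment i θ y).1 k ≤ ∑ k ∈ range n, y.1 k := by
  refine sum_kthLargest_le (bddAbove_fragment i θ y) n _ fun s hs => ?_
  have hθs : ∀ t : Finset ℕ, ∑ l ∈ t, θ.1 l ≤ 1 := fun t => by
    have := (sum_le_tsum (f := fun k => (θ.1 k : ℝ≥0∞)) t).trans hθ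
    exact_mod_cast this
  rw [← Finset.toLeft_disjSum_toRight (u := s), Finset.sum_disjSum]
  have hcard : s.toLeft.card + s.toRight.card ≤ n := by
    rw [Finset.card_toLeft_add_card_toRight]; exact hs
  simp only [Sum.elim_inl, Sum.elim_inr]
  have hl : ∑ k ∈ s.toLeft, (if k = i then 0 else y.1 k) = ∑ k ∈ s.toLeft.erase i, y.1 k := by
    rw [← Finset.sum_subset (Finset.erase_subset i s.toLeft)]
    · refine sum_congr rfl fun k hk => ?_
      simp [(Finset.mem_erase.mp hk).1]
    · intro k hk hk'
      have : k = i := by by_contra h; exact hk' (Finset.mem_erase.mpr ⟨h, hk⟩)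
      simp [this]
  rw [hl]
  rcases Finset.eq_empty_or_nonempty s.toRight with h0 | h0
  · rw [h0, Finset.sum_empty, add_zero]
    exact sum_finset_le_sum_range y.2 ((Finset.card_erase_le).trans (by omega))
  · have h1 : 1 ≤ s.toRight.card := h0.card_pos
    rw [← Finset.sum_mul]
    calc _ ≤ ∑ k ∈ s.toLeft.erase i, y.1 k + 1 * y.1 i := by gcongr; exact hθs _
      _ = ∑ k ∈ insert i (s.toLeft.erase i), y.1 k := by
        rw [sum_insert (by simp), one_mul, add_comm]
      _ ≤ _ := sum_finset_le_sum_range y.2 ((Finset.card_insert_le _ _).trans (by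
        have := Finset.card_erase_le (s := s.toLeft) (a := i); omega))

lemma le_kthLargest_of_forall_le {u : ℕ → ℝ≥0} {ι : Type} {v : ι → ℝ≥0}
    (hb : BddAbove (Set.range v)) (f : ℕ → ι) (hf : f.Injective) (hu : Antitone u)
    (h : ∀ a ≤ k, u a ≤ v (f a)) : u k ≤ kthLargest v k := by
  refine le_of_forall_lt fun x hx => (lt_kthLargest_iff hb k x).mpr ?_
  have hsub : f '' ((range (k + 1) : Finset ℕ) : Set ℕ) ⊆ {i | x < v i} := by
    rintro _ ⟨a, ha, rfl⟩
    have hak : a ≤ k := by simpa [Nat.lt_succ_iff] using ha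
    exact hx.trans_le ((hu hak).trans (h a hak))
  refine lt_of_lt_of_le ?_ (Set.encard_le_encard hsub)
  rw [hf.encard_image, Set.encard_coe_eq_coe_finsetCard, card_range]
  exact_mod_cast Nat.lt_succ_self k

lemma le_coalesce_apply {i j k : ℕ} (hkj : k < j) (y : MassSeq) :
    y.1 k ≤ (coalesce i j y).1 k := by
  refine le_kthLargest_of_forall_le (bddAbove_coalesce i j y) id Function.injective_id y.2
    fun a ha => ?_
  simp only [id]
  split_ifs with h1 h2
  · rw [h1]; exact le_self_add
  · omega
  · exact le_rfl

lemma le_fragment_apply {i k : ℕ} (hki : k < i) (θ : Ratios) (y : MassSeq) :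
    y.1 k ≤ (fragment i θ y).1 k := by
  refine le_kthLargest_of_forall_le (bddAbove_fragment i θ y) Sum.inl Sum.inl_injective y.2
    fun a ha => ?_
  simp only [Sum.elim_inl]
  split_ifs with h1
  · omega
  · exact le_rfl

/-- The total mass. -/
def mass (m : MassSeq) : ℝ≥0∞ := ∑' k, (m.1 k : ℝ≥0∞)

lemma sum_range_le_mass (m : MassSeq) (n : ℕ) :
    ((∑ k ∈ range n, m.1 k : ℝ≥0) : ℝ≥0∞) ≤ mass m := by
  push_cast; exact sum_le_tsum _

lemma mass_le_iff {m : MassSeq} {a : ℝ≥0∞} :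
    mass m ≤ a ↔ ∀ n, ((∑ k ∈ range n, m.1 k : ℝ≥0) : ℝ≥0∞) ≤ a := by
  constructor
  · exact fun h n => (sum_range_le_mass m n).trans h
  · intro h
    unfold mass
    rw [ENNReal.tsum_eq_iSup_nat]
    refine iSup_le fun n => ?_
    have := h n
    push_cast at this
    exact this

lemma mass_coalesce_le {i j : ℕ} (hij : i < j) (y : MassSeq) :
    mass (coalesce i j y) ≤ mass y := by
  refine mass_le_iff.mpr fun n => ?_
  -- use a larger number of terms, so that the added mass belongs to the tail
  have h1 := sum_range_coalesce_le hij y (max n j)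
  have h2 : ∑ k ∈ range n, (coalesce i j y).1 k ≤
      ∑ k ∈ range (max n j), (coalesce i j y).1 k :=
    Finset.sum_le_sum_of_subset (Finset.range_subset_range.mpr (le_max_left _ _))
  rw [max_eq_left (le_max_right n j), ← sum_range_succ] at h1
  exact (ENNReal.coe_le_coe.mpr (h2.trans h1)).trans (sum_range_le_mass y _)

lemma mass_fragment_le (i : ℕ) {θ : Ratios} (hθ : ∑' k, (θ.1 k : ℝ≥0∞) ≤ 1) (y : MassSeq) :
    mass (fragment i θ y) ≤ mass y :=
  mass_le_iff.mpr fun n => (ENNReal.coe_le_coe.mpr (sum_range_fragment_le i hθ y n)).trans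
    (sum_range_le_mass y n)

lemma apply_le_mass (m : MassSeq) (k : ℕ) : (m.1 k : ℝ≥0∞) ≤ mass m := ENNReal.le_tsum k

lemma measurable_mass : Measurable mass :=
  Measurable.tsum fun k => (MassSeq.measurable_apply k).coe_nnreal_ennreal

lemma mass_eq_sum {m : MassSeq} (hn : m.1 n = 0) :
    mass m = ((∑ k ∈ range n, m.1 k : ℝ≥0) : ℝ≥0∞) := by
  push_cast
  refine tsum_eq_sum fun k hk => ?_
  have : m.1 k ≤ m.1 n := m.2 (by simpa using hk)
  rw [hn] at this
  simpa using this

lemma mass_lt_top {m : MassSeq} (hm : m ∈ finiteStates) : mass m < ∞ := by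
  obtain ⟨n, hn⟩ := hm
  rw [mass_eq_sum hn]
  exact coe_lt_top

lemma measurableSet_finiteStates : MeasurableSet finiteStates := by
  have : finiteStates = ⋃ n, {m : MassSeq | m.1 n = 0} := by
    ext m; simp [finiteStates]
  rw [this]
  exact MeasurableSet.iUnion fun n => MassSeq.measurable_apply n (measurableSet_singleton 0)

lemma finiteStates_subset_ell (hlam : 0 < lam) : finiteStates ⊆ ell lam := by
  rintro m ⟨n, hn⟩
  have h0 : ∀ k, n ≤ k → m.1 k = 0 := fun k hk => le_antisymm (hn ▸ m.2 hk) zero_le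
  change moment lam m < ∞
  unfold moment
  rw [tsum_eq_sum (s := range n)]
  · exact ENNReal.sum_lt_top.mpr fun k _ => coe_lt_top
  · intro k hk
    rw [h0 k (by simpa using hk), NNReal.zero_rpow hlam.ne']
    rfl

attribute [local irreducible] coalesce fragment

/-! ### Lebesgue measure on the half-line -/

lemma IsFiniteDislocation.isFinite {β : Measure Ratios} (hβ : IsFiniteDislocation β) :
    IsFiniteMeasure β := ⟨hβ.finite⟩

lemma measurableEmbedding_coe_nnreal : MeasurableEmbedding fun x : ℝ≥0 => (x : ℝ) :=
  MeasurableEmbedding.subtype_coe measurableSet_Ici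

lemma leb_Iic (c : ℝ≥0) : leb (Iic c) = c := by
  have : (fun x : ℝ≥0 => (x : ℝ)) '' Iic c = Icc 0 (c : ℝ) := by
    ext x
    constructor
    · rintro ⟨y, hy, rfl⟩
      exact ⟨y.2, NNReal.coe_le_coe.mpr hy⟩
    · rintro ⟨h0, h1⟩
      exact ⟨⟨x, h0⟩, h1, rfl⟩
  rw [leb, measurableEmbedding_coe_nnreal.comap_apply, this, Real.volume_Icc, sub_zero,
    ofReal_coe_nnreal]

instance : SigmaFinite leb :=
  ⟨⟨{ set := fun n : ℕ => Iic (n : ℝ≥0)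
      set_mem := fun _ => trivial
      finite := fun n => by rw [leb_Iic]; exact coe_lt_top
      spanning := Set.eq_univ_of_forall fun x => by
        obtain ⟨n, hn⟩ := exists_nat_ge x
        exact Set.mem_iUnion.mpr ⟨n, hn⟩ }⟩⟩

lemma leb_singleton (a : ℝ≥0) : leb {a} = 0 := by
  rw [leb, measurableEmbedding_coe_nnreal.comap_apply, Set.image_singleton, Real.volume_singleton]

instance : NullSingletonClass leb := ⟨leb_singleton⟩

lemma leb_Ioc {a b : ℝ≥0} (h : a ≤ b) : leb (Ioc a b) = (b - a : ℝ≥0) := by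
  have h1 : Iic b \ Iic a = Ioc a b := by
    ext x; simp [and_comm]
  rw [← h1, measure_sdiff (Set.Iic_subset_Iic.mpr h) measurableSet_Iic.nullMeasurableSet
    (by rw [leb_Iic]; exact coe_ne_top), leb_Iic, leb_Iic, ENNReal.coe_sub]

lemma map_coe_leb : leb.map (fun x : ℝ≥0 => (x : ℝ)) = volume.restrict (Ici 0) := by
  rw [leb, measurableEmbedding_coe_nnreal.map_comap]
  congr 1
  ext x
  exact ⟨fun ⟨y, hy⟩ => hy ▸ y.2, fun h => ⟨⟨x, h⟩, rfl⟩⟩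

/-! ### Marks, transitions and rates -/

/-- The marks of both kinds of events: `((i, j), z)` for a coalescence and `(i, θ, z)` for a
fragmentation. -/
abbrev Mark : Type := (IdxPair × ℝ≥0) ⊕ (ℕ × Ratios × ℝ≥0)

variable (K F) in
/-- The state after an event with mark `e` in the state `y`.  Marks with `z = 0`, which do not
occur almost surely, are discarded, so that only finitely many pairs of indices and finitely many
indices matter in a state with finitely many particles. -/
def act (y : MassSeq) : Mark → MassSeq
  | .inl (p, z) => if 0 < z ∧ z ≤ K (y.1 p.1.1) (y.1 p.1.2) then coalesce p.1.1 p.1.2 y else y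
  | .inr (i, θ, z) => if 0 < z ∧ z ≤ F (y.1 i) then fragment i θ y else y

/-- The intensity of the marks per unit of time. -/
def markMeasure (β : Measure Ratios) : Measure Mark :=
  ((Measure.count : Measure IdxPair).prod leb).map Sum.inl +
    ((Measure.count : Measure ℕ).prod (β.prod leb)).map Sum.inr

variable (K F) in
/-- States with at most `n` particles all of whose individual rates are at most `n`. -/
def levelSet (n : ℕ) : Set MassSeq :=
  {y | y.1 n = 0 ∧ (∀ p : IdxPair, K (y.1 p.1.1) (y.1 p.1.2) ≤ n) ∧ ∀ i, F (y.1 i) ≤ n}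

/-- The marks that can change a state of `levelSet K F n`. -/
def markBox (n : ℕ) : Set Mark :=
  Sum.inl '' {q : IdxPair × ℝ≥0 | q.1.1.2 < n ∧ q.2 ≤ n} ∪
    Sum.inr '' {q : ℕ × Ratios × ℝ≥0 | q.1 < n ∧ q.2.2 ≤ n}

variable (K F β) in
/-- The jump part `∑_{i<j} K(yᵢ, yⱼ) Ψ(c_{ij}(y)) + ∑ᵢ F(yᵢ) ∫ Ψ(f_{iθ}(y)) β(dθ)` of the
generator, for test functions with values in `[0, ∞]`. -/
def jumpOp (Ψ : MassSeq → ℝ≥0∞) (y : MassSeq) : ℝ≥0∞ :=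
  (∑' p : IdxPair, (K (y.1 p.1.1) (y.1 p.1.2) : ℝ≥0∞) * Ψ (coalesce p.1.1 p.1.2 y)) +
    ∑' i : ℕ, (F (y.1 i) : ℝ≥0∞) * ∫⁻ θ, Ψ (fragment i θ y) ∂β

variable (K F β) in
/-- The total jump rate. -/
def jumpRate (y : MassSeq) : ℝ≥0∞ :=
  coagRate K y + fragRate F β y

section Rates

lemma apply_eq_zero_of_le {n k : ℕ} (h : y.1 n = 0) (hk : n ≤ k) : y.1 k = 0 :=
  le_antisymm ((y.2 hk).trans_eq h) zero_le

lemma IsCoagKernel.zero_left (hK : IsCoagKernel K) (x : ℝ≥0) : K 0 x = 0 := by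
  rw [hK.symm, hK.zero]

lemma measurable_sum_elim_mark {α γ : Type*} [MeasurableSpace α] [MeasurableSpace γ]
    {f : α × Mark → γ} (h1 : Measurable fun q : α × (IdxPair × ℝ≥0) => f (q.1, .inl q.2))
    (h2 : Measurable fun q : α × (ℕ × Ratios × ℝ≥0) => f (q.1, .inr q.2)) : Measurable f := by
  have h : Measurable fun q : α × (IdxPair × ℝ≥0) ⊕ α × (ℕ × Ratios × ℝ≥0) =>
      f ((MeasurableEquiv.prodSumDistrib α (IdxPair × ℝ≥0) (ℕ × Ratios × ℝ≥0)).symm q) :=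
    measurable_fun_sum h1 h2
  have h' := h.comp (MeasurableEquiv.prodSumDistrib α (IdxPair × ℝ≥0) (ℕ × Ratios × ℝ≥0)).measurable
  simpa [Function.comp_def] using h'

lemma _root_.Measurable.massSeq_apply {α : Type*} [MeasurableSpace α] {g : α → MassSeq}
    (hg : Measurable g) (k : ℕ) : Measurable fun a => (g a).1 k :=
  (MassSeq.measurable_apply k).comp hg

lemma _root_.Measurable.coalesce {α : Type*} [MeasurableSpace α] {g : α → MassSeq}
    (hg : Measurable g) (i j : ℕ) : Measurable fun a => CoagFrag.coalesce i j (g a) :=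
  (measurable_coalesce i j).comp hg

lemma _root_.Measurable.fragment {α : Type*} [MeasurableSpace α] {f : α → Ratios}
    {g : α → MassSeq} (hf : Measurable f) (hg : Measurable g) (i : ℕ) :
    Measurable fun a => CoagFrag.fragment i (f a) (g a) :=
  (measurable_fragment i).comp (hf.prodMk hg)

lemma IsCoagKernel.measurable_comp (hK : IsCoagKernel K) {α : Type*} [MeasurableSpace α]
    {f g : α → ℝ≥0} (hf : Measurable f) (hg : Measurable g) :
    Measurable fun a => K (f a) (g a) :=
  hK.measurable.comp (hf.prodMk hg)

include hK hF in
lemma measurable_act :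
    Measurable fun q : MassSeq × Mark => act K F q.1 q.2 := by
  refine measurable_sum_elim_mark ?_ ?_
  · have : Measurable fun q : (MassSeq × ℝ≥0) × IdxPair =>
        act K F q.1.1 (.inl (q.2, q.1.2)) := by
      refine measurable_from_prod_countable_left fun p => ?_
      refine Measurable.ite ?_ (measurable_fst.coalesce p.1.1 p.1.2) measurable_fst
      have h1 : Measurable fun q : MassSeq × ℝ≥0 => q.2 := measurable_snd
      have h2 : Measurable fun q : MassSeq × ℝ≥0 => K (q.1.1 p.1.1) (q.1.1 p.1.2) :=
        hK.measurable_comp (measurable_fst.massSeq_apply _) (measurable_fst.massSeq_apply _)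
      have h3 := measurableSet_le h1 h2
      exact (measurableSet_lt (f := fun _ => 0) measurable_const h1).inter h3
    have h : Measurable fun q : MassSeq × (IdxPair × ℝ≥0) => ((q.1, q.2.2), q.2.1) :=
      (measurable_fst.prodMk measurable_snd.snd).prodMk measurable_snd.fst
    exact this.comp h
  · have : Measurable fun q : (MassSeq × Ratios × ℝ≥0) × ℕ =>
        act K F q.1.1 (.inr (q.2, q.1.2)) := by
      refine measurable_from_prod_countable_left fun i => ?_
      refine Measurable.ite ?_ (measurable_snd.fst.fragment measurable_fst i) measurable_fst
      have h1 : Measurable fun q : MassSeq × Ratios × ℝ≥0 => q.2.2 := measurable_snd.snd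
      have h2 : Measurable fun q : MassSeq × Ratios × ℝ≥0 => F (q.1.1 i) :=
        hF.measurable.comp (measurable_fst.massSeq_apply _)
      have h3 := measurableSet_le h1 h2
      exact (measurableSet_lt (f := fun _ => 0) measurable_const h1).inter h3
    have h : Measurable fun q : MassSeq × (ℕ × Ratios × ℝ≥0) => ((q.1, q.2.2), q.2.1) :=
      (measurable_fst.prodMk measurable_snd.snd).prodMk measurable_snd.fst
    exact this.comp h

include hK hF in
lemma measurableSet_levelSet (n : ℕ) :
    MeasurableSet (levelSet K F n) := by
  have h1 : MeasurableSet {y : MassSeq | y.1 n = 0} :=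
    MassSeq.measurable_apply n (measurableSet_singleton 0)
  have h2 : MeasurableSet {y : MassSeq | ∀ p : IdxPair, K (y.1 p.1.1) (y.1 p.1.2) ≤ n} := by
    rw [Set.ofPred_forall]
    exact MeasurableSet.iInter fun p => measurableSet_le (hK.measurable.comp
      ((MassSeq.measurable_apply _).prodMk (MassSeq.measurable_apply _))) measurable_const
  have h3 : MeasurableSet {y : MassSeq | ∀ i, F (y.1 i) ≤ n} := by
    rw [Set.ofPred_forall]
    exact MeasurableSet.iInter fun i => measurableSet_le (hF.measurable.comp
      (MassSeq.measurable_apply _)) measurable_const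
  exact h1.inter (h2.inter h3)

lemma levelSet_mono (K : ℝ≥0 → ℝ≥0 → ℝ≥0) (F : ℝ≥0 → ℝ≥0) : Monotone (levelSet K F) := by
  rintro n n' h y ⟨h1, h2, h3⟩
  have hc : (n : ℝ≥0) ≤ n' := by exact_mod_cast h
  exact ⟨apply_eq_zero_of_le h1 h, fun p => (h2 p).trans hc, fun i => (h3 i).trans hc⟩

lemma levelSet_subset_finiteStates (n : ℕ) : levelSet K F n ⊆ finiteStates :=
  fun _ hy => ⟨n, hy.1⟩

include hK hF in
/-- A state with at most `n` particles all of whose masses are bounded by `a` belongs to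
`levelSet K F n` as soon as the kernels are bounded by `n` on `[0, a]`. -/
lemma exists_mem_levelSet (a : ℝ≥0) :
    ∃ c : ℕ, ∀ y : MassSeq, y.1 0 ≤ a → ∀ n, c ≤ n → y.1 n = 0 → y ∈ levelSet K F n := by
  obtain ⟨C₁, h₁⟩ := hK.locallyBounded a
  obtain ⟨C₂, h₂⟩ := hF.locallyBounded a
  obtain ⟨c, hc⟩ := exists_nat_ge (max C₁ C₂)
  refine ⟨c, fun y hy n hn h0 => ⟨h0, fun p => ?_, fun i => ?_⟩⟩
  · exact (h₁ _ ((y.le_zero_index _).trans hy) _ ((y.le_zero_index _).trans hy)).trans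
      (((le_max_left _ _).trans hc).trans (by exact_mod_cast hn))
  · exact (h₂ _ ((y.le_zero_index _).trans hy)).trans
      (((le_max_right _ _).trans hc).trans (by exact_mod_cast hn))

include hK hF in
lemma exists_mem_levelSet_of_finite (hy : y ∈ finiteStates) : ∃ n, y ∈ levelSet K F n := by
  obtain ⟨k, hk⟩ := hy
  obtain ⟨c, hc⟩ := exists_mem_levelSet hK hF (y.1 0)
  exact ⟨max c k, hc y le_rfl _ (le_max_left _ _) (apply_eq_zero_of_le hk (le_max_right _ _))⟩

lemma measurableSet_markBox (n : ℕ) : MeasurableSet (markBox n) := by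
  have h1 : Measurable fun q : IdxPair × ℝ≥0 => q.2 := measurable_snd
  have h2 : Measurable fun q : ℕ × Ratios × ℝ≥0 => q.2.2 := measurable_snd.snd
  refine MeasurableSet.union ?_ ?_
  · refine MeasurableSet.inl_image ?_
    exact (measurableSet_lt (measurable_fst.subtype_val.snd) measurable_const).inter
      (measurableSet_le (f := fun q : IdxPair × ℝ≥0 => q.2) h1 measurable_const)
  · refine measurableSet_inr_image.mpr ?_
    exact (measurableSet_lt measurable_fst measurable_const).inter
      (measurableSet_le (f := fun q : ℕ × Ratios × ℝ≥0 => q.2.2) h2 measurable_const)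

lemma inl_mem_markBox {p : IdxPair} {z : ℝ≥0} :
    (Sum.inl (p, z) : Mark) ∈ markBox n ↔ p.1.2 < n ∧ z ≤ n := by
  simp [markBox]

lemma inr_mem_markBox {n i : ℕ} {θ : Ratios} {z : ℝ≥0} :
    (Sum.inr (i, θ, z) : Mark) ∈ markBox n ↔ i < n ∧ z ≤ n := by
  simp [markBox]

lemma markBox_mono : Monotone markBox := by
  intro n n' h e he
  have hc : (n : ℝ≥0) ≤ n' := by exact_mod_cast h
  rcases e with ⟨p, z⟩ | ⟨i, θ, z⟩
  · rw [inl_mem_markBox] at he ⊢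
    exact ⟨he.1.trans_le h, he.2.trans hc⟩
  · rw [inr_mem_markBox] at he ⊢
    exact ⟨he.1.trans_le h, he.2.trans hc⟩

lemma exists_mem_markBox (e : Mark) : ∃ n, e ∈ markBox n := by
  rcases e with ⟨p, z⟩ | ⟨i, θ, z⟩
  · obtain ⟨n, hn⟩ := exists_nat_ge z
    refine ⟨max n (p.1.2 + 1), inl_mem_markBox.mpr ⟨?_, hn.trans ?_⟩⟩
    · exact lt_of_lt_of_le (Nat.lt_succ_self _) (le_max_right _ _)
    · exact_mod_cast le_max_left _ _
  · obtain ⟨n, hn⟩ := exists_nat_ge z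
    refine ⟨max n (i + 1), inr_mem_markBox.mpr ⟨?_, hn.trans ?_⟩⟩
    · exact lt_of_lt_of_le (Nat.lt_succ_self _) (le_max_right _ _)
    · exact_mod_cast le_max_left _ _

include hK hF in
/-- A mark outside the box leaves the states of the level set unchanged. -/
lemma act_eq_self (hy : y ∈ levelSet K F n) {e : Mark} (he : e ∉ markBox n) :
    act K F y e = y := by
  obtain ⟨h1, h2, h3⟩ := hy
  rcases e with ⟨p, z⟩ | ⟨i, θ, z⟩
  · rw [inl_mem_markBox, not_and_or, not_lt, not_le] at he
    refine if_neg fun ⟨hz, hzK⟩ => ?_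
    rcases he with he | he
    · rw [apply_eq_zero_of_le h1 he, hK.zero] at hzK
      exact absurd (hz.trans_le hzK) (lt_irrefl _)
    · exact absurd (hzK.trans (h2 p)) (not_le.mpr he)
  · rw [inr_mem_markBox, not_and_or, not_lt, not_le] at he
    refine if_neg fun ⟨hz, hzF⟩ => ?_
    rcases he with he | he
    · rw [apply_eq_zero_of_le h1 he, hF.zero] at hzF
      exact absurd (hz.trans_le hzF) (lt_irrefl _)
    · exact absurd (hzF.trans (h3 i)) (not_le.mpr he)

lemma lintegral_markMeasure {g : Mark → ℝ≥0∞} (hg : Measurable g) [SFinite β] :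
    ∫⁻ e, g e ∂markMeasure β = (∑' p : IdxPair, ∫⁻ z, g (.inl (p, z)) ∂leb) +
      ∑' i : ℕ, ∫⁻ θ, ∫⁻ z, g (.inr (i, θ, z)) ∂leb ∂β := by
  rw [markMeasure, lintegral_add_measure, lintegral_map hg measurable_inl,
    lintegral_map hg measurable_inr,
    lintegral_prod (fun q => g (.inl q)) (hg.comp measurable_inl).aemeasurable,
    lintegral_prod (fun q => g (.inr q)) (hg.comp measurable_inr).aemeasurable, lintegral_count,
    lintegral_count]
  congr 2
  funext i
  exact lintegral_prod (fun q => g (.inr (i, q)))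
    ((hg.comp measurable_inr).comp measurable_prodMk_left).aemeasurable

lemma lintegral_ite_leb (κ : ℝ≥0) (hκ : κ ≤ n) (a b : ℝ≥0∞) :
    (∫⁻ z, (Iic (n : ℝ≥0)).indicator (fun z => if 0 < z ∧ z ≤ κ then a else b) z ∂leb) + κ * b =
      κ * a + n * b := by
  have h : (Iic (n : ℝ≥0)).indicator (fun z : ℝ≥0 => if 0 < z ∧ z ≤ κ then a else b) =ᵐ[leb]
      fun z => (Iic κ).indicator (fun _ => a) z +
        (Ioc κ (n : ℝ≥0)).indicator (fun _ => b) z := by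
    have h0 : ∀ᵐ z ∂leb, z ≠ 0 := by
      rw [ae_iff]; simp
    filter_upwards [h0] with z hz
    have hz' : 0 < z := pos_iff_ne_zero.mpr hz
    rcases le_or_gt z κ with h1 | h1
    · simp [indicator, h1, hz', h1.trans hκ, not_lt.mpr h1]
    · simp [indicator, h1, hz', not_le.mpr h1]
  rw [lintegral_congr_ae h, lintegral_add_left (measurable_const.indicator measurableSet_Iic),
    lintegral_indicator_const measurableSet_Iic, lintegral_indicator_const measurableSet_Ioc,
    leb_Iic, leb_Ioc hκ, mul_comm a, mul_comm b, add_assoc, ← add_mul, ← ENNReal.coe_add,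
    tsub_add_cancel_of_le hκ]
  simp

include hβ in
lemma finite_markBox (n : ℕ) : markMeasure β (markBox n) < ∞ := by
  have := hβ.isFinite
  rw [← lintegral_indicator_one (measurableSet_markBox n), lintegral_markMeasure
    (measurable_one.indicator (measurableSet_markBox n))]
  have hz : ∀ P : Prop, [Decidable P] → ∫⁻ z, (if P ∧ z ≤ n then 1 else 0) ∂leb =
      if P then (n : ℝ≥0∞) else 0 := by
    intro P _
    by_cases hP : P
    · have := lintegral_indicator_one (μ := leb) (measurableSet_Iic (a := (n : ℝ≥0)))
      rw [leb_Iic] at this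
      simpa only [hP, true_and, indicator, mem_Iic, Pi.one_apply, ENNReal.coe_natCast,
        if_true] using this
    · simp [hP]
  classical
  simp only [indicator, inl_mem_markBox, inr_mem_markBox, Pi.one_apply, hz, lintegral_const]
  refine ENNReal.add_lt_top.mpr ⟨?_, ?_⟩
  · have hfin : {p : IdxPair | p.1.2 < n}.Finite := by
      refine Set.Finite.of_finite_image (f := Subtype.val) (Set.Finite.subset
        ((Set.finite_Iio n).prod (Set.finite_Iio n)) ?_) Subtype.val_injective.injOn
      rintro _ ⟨p, hp, rfl⟩
      exact ⟨p.2.trans hp, hp⟩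
    rw [tsum_eq_sum (s := hfin.toFinset) (fun p hp => by
      rw [Set.Finite.mem_toFinset] at hp; exact if_neg hp)]
    refine ENNReal.sum_lt_top.mpr fun p _ => ?_
    split_ifs <;> simp
  · rw [tsum_eq_sum (s := range n) (fun i hi => by
      rw [if_neg (by simpa using hi), zero_mul])]
    refine ENNReal.sum_lt_top.mpr fun p _ => mul_lt_top ?_ (measure_lt_top _ _)
    split_ifs <;> simp

lemma jumpOp_const (c : ℝ≥0∞) (y : MassSeq) :
    jumpOp K F β (fun _ => c) y = jumpRate K F β y * c := by
  simp only [jumpOp, jumpRate, coagRate, fragRate, lintegral_const, ENNReal.tsum_mul_right,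
    ← mul_assoc]
  rw [add_mul, mul_right_comm, mul_comm (β univ), mul_right_comm]

lemma jumpOp_mono {Ψ Ψ' : MassSeq → ℝ≥0∞} (h : ∀ y, Ψ y ≤ Ψ' y) (y : MassSeq) :
    jumpOp K F β Ψ y ≤ jumpOp K F β Ψ' y :=
  add_le_add (tsum_le_tsum fun _ => mul_le_mul_right (h _) _)
    (tsum_le_tsum fun _ => mul_le_mul_right (lintegral_mono fun _ => h _) _)

lemma measurable_comp_fragment (hΨ : Measurable Ψ) (i : ℕ) (y : MassSeq) :
    Measurable fun θ => Ψ (fragment i θ y) :=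
  hΨ.comp (measurable_id.fragment measurable_const i)

lemma jumpOp_add {Ψ Ψ' : MassSeq → ℝ≥0∞} (hΨ : Measurable Ψ) (y : MassSeq) :
    jumpOp K F β (fun y => Ψ y + Ψ' y) y = jumpOp K F β Ψ y + jumpOp K F β Ψ' y := by
  simp only [jumpOp, mul_add, tsum_add,
    lintegral_add_left (measurable_comp_fragment hΨ _ y)]
  ring

lemma jumpOp_const_mul (hΨ : Measurable Ψ) (c : ℝ≥0∞) (y : MassSeq) :
    jumpOp K F β (fun y => c * Ψ y) y = c * jumpOp K F β Ψ y := by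
  simp only [jumpOp, lintegral_const_mul _ (measurable_comp_fragment hΨ _ y), mul_left_comm _ c,
    ENNReal.tsum_mul_left, mul_add]

include hK hF in
lemma measurable_jumpOp [SFinite β] (hΨ : Measurable Ψ) : Measurable (jumpOp K F β Ψ) := by
  refine Measurable.add (Measurable.tsum fun p => ?_) (Measurable.tsum fun i => ?_)
  · exact (hK.measurable_comp (MassSeq.measurable_apply _)
      (MassSeq.measurable_apply _)).coe_nnreal_ennreal.mul (hΨ.comp (measurable_coalesce _ _))
  · refine (hF.measurable.comp (MassSeq.measurable_apply _)).coe_nnreal_ennreal.mul ?_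
    exact Measurable.lintegral_prod_right' (f := fun q : MassSeq × Ratios => Ψ (fragment i q.2 q.1))
      (hΨ.comp (measurable_snd.fragment measurable_fst i))

include hK hF in
lemma measurable_jumpRate [SFinite β] :
    Measurable (jumpRate K F β) := by
  have := measurable_jumpOp (β := β) hK hF (measurable_const (a := (1 : ℝ≥0∞)))
  have h : jumpRate K F β = jumpOp K F β fun _ => 1 := by
    funext y
    rw [jumpOp_const, mul_one]
  rwa [h]

include hK hF hβ

/-- Integration over the marks of a box, in a state of the level set: each mark either realises a
transition of the generator or leaves the state unchanged. -/
lemma lintegral_act (hy : y ∈ levelSet K F n) (hΨ : Measurable Ψ) :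
    (∫⁻ e in markBox n, Ψ (act K F y e) ∂markMeasure β) + jumpRate K F β y * Ψ y =
      jumpOp K F β Ψ y + markMeasure β (markBox n) * Ψ y := by
  have := hβ.isFinite
  have hm : Measurable fun e => Ψ (act K F y e) :=
    hΨ.comp ((measurable_act hK hF).comp (measurable_const.prodMk measurable_id))
  have hb := measurableSet_markBox n
  have hconst : markMeasure β (markBox n) * Ψ y = ∫⁻ e in markBox n, Ψ y ∂markMeasure β := by
    rw [setLIntegral_const, mul_comm]
  rw [hconst, ← lintegral_indicator hb, ← lintegral_indicator hb,
    lintegral_markMeasure (hm.indicator hb), lintegral_markMeasure (measurable_const.indicator hb)]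
  have hK0 : ∀ p : IdxPair, ¬ p.1.2 < n → K (y.1 p.1.1) (y.1 p.1.2) = 0 := fun p hp => by
    rw [apply_eq_zero_of_le hy.1 (not_lt.mp hp), hK.zero]
  have hF0 : ∀ i : ℕ, ¬ i < n → F (y.1 i) = 0 := fun i hi => by
    rw [apply_eq_zero_of_le hy.1 (not_lt.mp hi), hF.zero]
  have hc : ∀ b : ℝ≥0∞, ∫⁻ z, (Iic (n : ℝ≥0)).indicator (fun _ => b) z ∂leb = n * b := by
    intro b
    rw [lintegral_indicator_const measurableSet_Iic, leb_Iic, mul_comm]; simp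
  have e1 : ∀ p : IdxPair, (∫⁻ z, (markBox n).indicator (fun e => Ψ (act K F y e)) (.inl (p, z))
      ∂leb) + (K (y.1 p.1.1) (y.1 p.1.2) : ℝ≥0∞) * Ψ y =
      (K (y.1 p.1.1) (y.1 p.1.2) : ℝ≥0∞) * Ψ (coalesce p.1.1 p.1.2 y) +
      ∫⁻ z, (markBox n).indicator (fun _ => Ψ y) (.inl (p, z)) ∂leb := by
    intro p
    by_cases hp : p.1.2 < n
    · have h1 : ∀ z, (markBox n).indicator (fun e => Ψ (act K F y e)) (.inl (p, z)) =
          (Iic (n : ℝ≥0)).indicator (fun z => if 0 < z ∧ z ≤ K (y.1 p.1.1) (y.1 p.1.2) then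
            Ψ (coalesce p.1.1 p.1.2 y) else Ψ y) z := by
        intro z
        classical
        simp only [indicator, inl_mem_markBox, hp, true_and, mem_Iic, act, apply_ite Ψ]
      have h2 : ∀ z, (markBox n).indicator (fun _ => Ψ y) (.inl (p, z)) =
          (Iic (n : ℝ≥0)).indicator (fun _ => Ψ y) z := by
        intro z
        classical
        simp only [indicator, inl_mem_markBox, hp, true_and, mem_Iic]
      simp only [h1, h2, lintegral_ite_leb _ (hy.2.1 p), hc]
    · have h1 : ∀ z, (Sum.inl (p, z) : Mark) ∉ markBox n := fun z h =>
        hp (inl_mem_markBox.mp h).1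
      simp [h1, hK0 p hp]
  have e2 : ∀ i : ℕ, (∫⁻ θ, ∫⁻ z, (markBox n).indicator (fun e => Ψ (act K F y e)) (.inr (i, θ, z))
      ∂leb ∂β) + (F (y.1 i) : ℝ≥0∞) * β univ * Ψ y =
      (F (y.1 i) : ℝ≥0∞) * ∫⁻ θ, Ψ (fragment i θ y) ∂β +
      ∫⁻ θ, ∫⁻ z, (markBox n).indicator (fun _ => Ψ y) (.inr (i, θ, z)) ∂leb ∂β := by
    intro i
    by_cases hp : i < n
    · have h1 : ∀ θ z, (markBox n).indicator (fun e => Ψ (act K F y e)) (.inr (i, θ, z)) =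
          (Iic (n : ℝ≥0)).indicator (fun z => if 0 < z ∧ z ≤ F (y.1 i) then
            Ψ (fragment i θ y) else Ψ y) z := by
        intro θ z
        classical
        simp only [indicator, inr_mem_markBox, hp, true_and, mem_Iic, act, apply_ite Ψ]
      have h2 : ∀ (θ : Ratios) z, (markBox n).indicator (fun _ => Ψ y) (.inr (i, θ, z)) =
          (Iic (n : ℝ≥0)).indicator (fun _ => Ψ y) z := by
        intro θ z
        classical
        simp only [indicator, inr_mem_markBox, hp, true_and, mem_Iic]
      have h3 : (F (y.1 i) : ℝ≥0∞) * β univ * Ψ y = ∫⁻ _, (F (y.1 i) : ℝ≥0∞) * Ψ y ∂β := by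
        rw [lintegral_const]; ring
      rw [h3, ← lintegral_add_right _ measurable_const,
        ← lintegral_const_mul _ (measurable_comp_fragment hΨ i y),
        ← lintegral_add_left ((measurable_comp_fragment hΨ i y).const_mul _)]
      simp only [h1, h2, lintegral_ite_leb _ (hy.2.2 i), hc]
    · have h1 : ∀ θ z, (Sum.inr (i, θ, z) : Mark) ∉ markBox n := fun θ z h =>
        hp (inr_mem_markBox.mp h).1
      simp [h1, hF0 i hp]
  have hr : jumpRate K F β y * Ψ y = (∑' p : IdxPair, (K (y.1 p.1.1) (y.1 p.1.2) : ℝ≥0∞) * Ψ y) +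
      ∑' i : ℕ, (F (y.1 i) : ℝ≥0∞) * β univ * Ψ y := by
    rw [jumpRate, coagRate, fragRate, add_mul, ENNReal.tsum_mul_right, ENNReal.tsum_mul_right,
      ENNReal.tsum_mul_right, mul_comm (β univ)]
  have s1 := tsum_congr (L := .unconditional _) e1
  have s2 := tsum_congr (L := .unconditional _) e2
  rw [tsum_add, tsum_add] at s1 s2
  rw [hr, jumpOp, add_add_add_comm, s1, s2, add_add_add_comm]

lemma exists_jumpRate_le (n : ℕ) : ∃ C < ∞, ∀ y ∈ levelSet K F n, jumpRate K F β y ≤ C := by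
  have hf : {p : IdxPair | p.1.2 < n}.Finite := by
    refine Set.Finite.of_finite_image (f := Subtype.val) (Set.Finite.subset
      ((Set.finite_Iio n).prod (Set.finite_Iio n)) ?_) Subtype.val_injective.injOn
    rintro _ ⟨p, hp, rfl⟩
    exact ⟨p.2.trans hp, hp⟩
  refine ⟨(∑ _p ∈ hf.toFinset, (n : ℝ≥0∞)) + β univ * ∑ _i ∈ range n, (n : ℝ≥0∞),
    ENNReal.add_lt_top.2 ⟨ENNReal.sum_lt_top.2 fun _ _ => ENNReal.natCast_lt_top n,
      mul_lt_top hβ.finite (ENNReal.sum_lt_top.2 fun _ _ => ENNReal.natCast_lt_top n)⟩, ?_⟩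
  rintro y ⟨h1, h2, h3⟩
  refine add_le_add ?_ (mul_le_mul_right ?_ _)
  · unfold coagRate
    rw [tsum_eq_sum (s := hf.toFinset) (fun p hp => by
      rw [Set.Finite.mem_toFinset] at hp
      rw [apply_eq_zero_of_le h1 (not_lt.mp hp), hK.zero]; rfl)]
    exact sum_le_sum fun p _ => by exact_mod_cast h2 p
  · rw [tsum_eq_sum (s := range n) (fun i hi => by
      rw [Finset.mem_range] at hi
      rw [apply_eq_zero_of_le h1 (not_lt.mp hi), hF.zero]; rfl)]
    exact sum_le_sum fun i _ => by exact_mod_cast h3 i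

lemma jumpRate_lt_top (hy : y ∈ finiteStates) : jumpRate K F β y < ∞ := by
  obtain ⟨n, hn⟩ := exists_mem_levelSet_of_finite hK hF hy
  obtain ⟨C, hC, h⟩ := exists_jumpRate_le hK hF hβ n
  exact (h y hn).trans_lt hC

omit hK hF hβ

end Rates

section Resolvent

/-! ### A Lyapunov function: the number of particles -/

/-- The number of particles, as an extended nonnegative real. -/
def count (y : MassSeq) : ℝ≥0∞ := ∑' k, if y.1 k = 0 then 0 else 1

lemma measurable_count : Measurable count :=
  Measurable.tsum fun k => Measurable.ite (MassSeq.measurable_apply k (measurableSet_singleton 0))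
    measurable_const measurable_const

lemma count_eq_coe (y : MassSeq) : count y = (numParticles y : ℝ≥0∞) := by
  have h : (Measure.count {k | 0 < y.1 k} : ℝ≥0∞) = count y := by
    rw [← lintegral_indicator_one (MeasurableSet.of_discrete), lintegral_count]
    refine tsum_congr fun k => ?_
    by_cases hk : y.1 k = 0
    · simp [hk]
    · simp [hk, pos_iff_ne_zero]
  rw [← h, Measure.count_apply (MeasurableSet.of_discrete)]
  rfl

lemma count_lt_top (hy : y ∈ finiteStates) : count y < ∞ := by
  rw [count_eq_coe]
  have := mem_finiteStates_iff.mp hy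
  lift numParticles y to ℕ using this.ne with k hk
  simp

lemma count_coalesce_le {i j : ℕ} (hij : i < j) (y : MassSeq) :
    count (coalesce i j y) ≤ count y := by
  rw [count_eq_coe, count_eq_coe]
  exact ENat.toENNReal_mono (numParticles_coalesce_le hij y)

lemma count_fragment_le (i : ℕ) {θ : Ratios} (hθ : ∀ n, k ≤ n → θ.1 n = 0) (y : MassSeq) :
    count (fragment i θ y) ≤ count y + k := by
  rw [count_eq_coe, count_eq_coe]
  refine (ENat.toENNReal_mono (numParticles_fragment_le i hθ y)).trans ?_
  simp

/-- A ratio sequence without gain of mass and with at most `k` fragments. -/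
def IsGoodRatio (k : ℕ) (θ : Ratios) : Prop :=
  ∑' l, (θ.1 l : ℝ≥0∞) ≤ 1 ∧ ∀ n, k ≤ n → θ.1 n = 0

lemma measurableSet_isGoodRatio (k : ℕ) : MeasurableSet {θ | IsGoodRatio k θ} := by
  have hθ : ∀ l, Measurable fun θ : Ratios => θ.1 l := fun l =>
    (measurable_pi_apply l).comp measurable_subtype_coe
  refine MeasurableSet.inter (measurableSet_le (Measurable.tsum fun l =>
    (hθ l).coe_nnreal_ennreal) measurable_const) ?_
  change MeasurableSet {θ : Ratios | ∀ n, k ≤ n → θ.1 n = 0}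
  simp only [Set.ofPred_forall]
  exact MeasurableSet.iInter fun n => MeasurableSet.iInter fun _ =>
    hθ n (measurableSet_singleton 0)

lemma IsFiniteDislocation.exists_isGoodRatio (hβ : IsFiniteDislocation β) :
    ∃ k, ∀ᵐ θ ∂β, IsGoodRatio k θ := by
  obtain ⟨k, hk⟩ := hβ.fragments
  refine ⟨k, ?_⟩
  have h1 : ∀ᵐ θ ∂β, ∑' l, (θ.1 l : ℝ≥0∞) ≤ 1 := by
    rw [ae_iff]; simpa only [not_le] using hβ.mass
  have h2 : ∀ᵐ θ ∂β, ∀ n, k ≤ n → θ.1 n = 0 := by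
    rw [ae_iff]; exact hk
  filter_upwards [h1, h2] with θ h h' using ⟨h, h'⟩

/-- The states with finitely many particles and total mass at most `M`. -/
def massSet (M : ℝ≥0∞) : Set MassSeq := {y | y ∈ finiteStates ∧ mass y ≤ M}

lemma measurableSet_massSet (M : ℝ≥0∞) : MeasurableSet (massSet M) :=
  measurableSet_finiteStates.inter (measurableSet_le measurable_mass measurable_const)

lemma coalesce_mem_massSet {i j : ℕ} (hij : i < j) (hy : y ∈ massSet M) :
    coalesce i j y ∈ massSet M :=
  ⟨mem_finiteStates_iff.mpr ((numParticles_coalesce_le hij y).trans_lt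
    (mem_finiteStates_iff.mp hy.1)), (mass_coalesce_le hij y).trans hy.2⟩

lemma fragment_mem_massSet (i : ℕ) {θ : Ratios} (hθ : IsGoodRatio k θ) (hy : y ∈ massSet M) :
    fragment i θ y ∈ massSet M := by
  refine ⟨mem_finiteStates_iff.mpr ((numParticles_fragment_le i hθ.2 y).trans_lt ?_),
    (mass_fragment_le i hθ.1 y).trans hy.2⟩
  exact ENat.add_lt_top.mpr ⟨mem_finiteStates_iff.mp hy.1, ENat.natCast_lt_top k⟩

include hβ in
lemma jumpOp_mono_on {Ψ Ψ' : MassSeq → ℝ≥0∞} (h : ∀ y ∈ massSet M, Ψ y ≤ Ψ' y)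
    (hy : y ∈ massSet M) :
    jumpOp K F β Ψ y ≤ jumpOp K F β Ψ' y := by
  obtain ⟨k, hk⟩ := hβ.exists_isGoodRatio
  refine add_le_add (tsum_le_tsum fun p => mul_le_mul_right
    (h _ (coalesce_mem_massSet p.2 hy)) _) (tsum_le_tsum fun i => mul_le_mul_right ?_ _)
  refine lintegral_mono_ae ?_
  filter_upwards [hk] with θ hθ using h _ (fragment_mem_massSet i hθ hy)

lemma apply_zero_le_of_mem_massSet {M : ℝ≥0} (hy : y ∈ massSet M) :
    y.1 0 ≤ M := ENNReal.coe_le_coe.mp ((apply_le_mass y 0).trans hy.2)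

include hF in
lemma tsum_fragKernel_le (M : ℝ≥0) :
    ∃ C : ℝ≥0, ∀ y ∈ massSet M, ∑' i, (F (y.1 i) : ℝ≥0∞) ≤ C * count y := by
  obtain ⟨C, hC⟩ := hF.locallyBounded M
  refine ⟨C, fun y hy => ?_⟩
  rw [count, ← ENNReal.tsum_mul_left]
  refine tsum_le_tsum fun i => ?_
  split_ifs with h
  · rw [h, hF.zero]; simp
  · rw [mul_one]
    exact ENNReal.coe_le_coe.mpr (hC _ ((y.le_zero_index i).trans
      (apply_zero_le_of_mem_massSet hy)))

include hF hβ in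
/-- The number of particles grows at most at a linear rate, for a bounded total mass. -/
lemma jumpOp_count_le (M : ℝ≥0) : ∃ c : ℝ≥0, ∀ y ∈ massSet M,
      jumpOp K F β count y ≤ (jumpRate K F β y + c) * count y := by
  obtain ⟨k, hk⟩ := hβ.exists_isGoodRatio
  obtain ⟨C, hC⟩ := tsum_fragKernel_le hF M
  refine ⟨k * (β univ).toNNReal * C, fun y hy => ?_⟩
  have hfr : ∀ i, ∫⁻ θ, count (fragment i θ y) ∂β ≤ (count y + k) * β univ := fun i => by
    rw [← lintegral_const]
    refine lintegral_mono_ae ?_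
    filter_upwards [hk] with θ hθ using count_fragment_le i hθ.2 y
  calc jumpOp K F β count y
      ≤ (∑' p : IdxPair, (K (y.1 p.1.1) (y.1 p.1.2) : ℝ≥0∞) * count y) +
        ∑' i : ℕ, (F (y.1 i) : ℝ≥0∞) * ((count y + k) * β univ) :=
        add_le_add (tsum_le_tsum fun p => mul_le_mul_right (count_coalesce_le p.2 y) _)
          (tsum_le_tsum fun i => mul_le_mul_right (hfr i) _)
    _ = jumpRate K F β y * count y + k * β univ * ∑' i : ℕ, (F (y.1 i) : ℝ≥0∞) := by
        rw [ENNReal.tsum_mul_right, ENNReal.tsum_mul_right, jumpRate, coagRate, fragRate]; ring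
    _ ≤ jumpRate K F β y * count y + k * β univ * (C * count y) := by
        gcongr; exact hC y hy
    _ = _ := by
        push_cast
        rw [coe_toNNReal hβ.finite.ne]; ring

include hK hF hβ in
lemma jumpRate_le (M : ℝ≥0) : ∃ C : ℝ≥0, ∀ y ∈ massSet M,
      jumpRate K F β y ≤ C * (count y * count y) + C * count y := by
  obtain ⟨C₁, hC₁⟩ := hK.locallyBounded M
  obtain ⟨C₂, hC₂⟩ := tsum_fragKernel_le hF M
  refine ⟨C₁ + (β univ).toNNReal * C₂, fun y hy => add_le_add ?_ ?_⟩
  · calc coagRate K y ≤ ∑' p : IdxPair, (fun q : ℕ × ℕ => (C₁ : ℝ≥0∞) *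
          ((if y.1 q.1 = 0 then 0 else 1) * (if y.1 q.2 = 0 then 0 else 1))) p.1 := by
          refine tsum_le_tsum fun p => ?_
          dsimp only
          split_ifs with h1 h2 h2
          · rw [h1, hK.zero_left]; simp
          · rw [h1, hK.zero_left]; simp
          · rw [h2, hK.zero]; simp
          · rw [mul_one, mul_one]
            have h0 := apply_zero_le_of_mem_massSet hy
            exact ENNReal.coe_le_coe.mpr (hC₁ _ ((y.le_zero_index _).trans h0) _
              ((y.le_zero_index _).trans h0))
      _ ≤ ∑' q : ℕ × ℕ, (C₁ : ℝ≥0∞) *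
          ((if y.1 q.1 = 0 then 0 else 1) * (if y.1 q.2 = 0 then 0 else 1)) :=
          ENNReal.tsum_comp_le_tsum_of_injective Subtype.val_injective _
      _ = C₁ * (count y * count y) := by
          rw [ENNReal.tsum_mul_left, ENNReal.tsum_prod (f := fun i j =>
            (if y.1 i = 0 then 0 else 1) * (if y.1 j = 0 then 0 else 1))]
          simp only [ENNReal.tsum_mul_left, ENNReal.tsum_mul_right]
          rfl
      _ ≤ _ := by gcongr; exact le_self_add
  · calc fragRate F β y ≤ β univ * (C₂ * count y) := by
          unfold fragRate; gcongr; exact hC₂ y hy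
      _ ≤ _ := by
          push_cast
          rw [coe_toNNReal hβ.finite.ne, ← mul_assoc]
          gcongr
          exact le_add_self

/-! ### The resolvent of the minimal jump process -/

variable (K F β) in
/-- The expected discounted holding time `(α + rate)⁻¹`, as a multiplication operator. -/
def dwell (α : ℝ≥0) (Ψ : MassSeq → ℝ≥0∞) (y : MassSeq) :
    ℝ≥0∞ := (α + jumpRate K F β y)⁻¹ * Ψ y

variable (K F β) in
/-- The discounted occupation of the jump process before its `n`-th jump: the partial sum
`∑_{j < n} R (Q R) ^ j Ψ`, where `R` is `dwell` and `Q` is `jumpOp`. -/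
def green (α : ℝ≥0) :
    ℕ → (MassSeq → ℝ≥0∞) → MassSeq → ℝ≥0∞
  | 0, _ => 0
  | n + 1, Ψ => fun y => dwell K F β α Ψ y +
      green α n (jumpOp K F β (dwell K F β α Ψ)) y

variable (K F β) in
/-- The expected discount `E[exp (-α Tₙ)]` up to the `n`-th jump time, `(R Q) ^ n 1`. -/
def discount (α : ℝ≥0) :
    ℕ → MassSeq → ℝ≥0∞
  | 0 => fun _ => 1
  | n + 1 => dwell K F β α (jumpOp K F β (discount α n))

include hK hF

lemma measurable_dwell [SFinite β] (α : ℝ≥0) (hΨ : Measurable Ψ) : Measurable (dwell K F β α Ψ) :=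
  ((measurable_jumpRate (β := β) hK hF).const_add _).inv.mul hΨ

lemma measurable_green [SFinite β] (α : ℝ≥0) (n : ℕ) (hΨ : Measurable Ψ) :
    Measurable (green K F β α n Ψ) := by
  induction n generalizing Ψ with
  | zero => exact measurable_zero
  | succ n ih =>
    exact (measurable_dwell hK hF α hΨ).add
      (ih (measurable_jumpOp hK hF (measurable_dwell hK hF α hΨ)))

lemma green_succ [SFinite β] (α : ℝ≥0) (n : ℕ) (hΨ : Measurable Ψ) (y : MassSeq) :
    green K F β α (n + 1) Ψ y =
      dwell K F β α Ψ y + dwell K F β α (jumpOp K F β (green K F β α n Ψ)) y := by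
  induction n generalizing Ψ y with
  | zero =>
    have h0 : jumpOp K F β (green K F β α 0 Ψ) y = 0 := by
      have : green K F β α 0 Ψ = fun _ => 0 := rfl
      rw [this, jumpOp_const, mul_zero]
    simp only [green, dwell] at h0 ⊢
    rw [h0, mul_zero, Pi.zero_apply]
  | succ n ih =>
    have h1 : ∀ Ψ y, green K F β α (n + 1 + 1) Ψ y = dwell K F β α Ψ y +
        green K F β α (n + 1) (jumpOp K F β (dwell K F β α Ψ)) y := fun _ _ => rfl
    have h2 : green K F β α (n + 1) Ψ = fun y => dwell K F β α Ψ y +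
        green K F β α n (jumpOp K F β (dwell K F β α Ψ)) y := rfl
    rw [h1, ih (measurable_jumpOp hK hF (measurable_dwell hK hF α hΨ)), h2]
    simp only [dwell]
    rw [← mul_add]
    congr 2
    exact (jumpOp_add (measurable_dwell hK hF α hΨ) y).symm

lemma green_mono_index [SFinite β] (α : ℝ≥0) (hΨ : Measurable Ψ) (y : MassSeq) :
    Monotone fun n => green K F β α n Ψ y := by
  refine monotone_nat_of_le_succ fun n => ?_
  induction n generalizing y with
  | zero => exact zero_le
  | succ n ih =>
    rw [green_succ hK hF α n hΨ, green_succ hK hF α (n + 1) hΨ]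
    exact add_le_add le_rfl (mul_le_mul_right (jumpOp_mono ih y) _)

lemma green_add [SFinite β] (α : ℝ≥0) (n : ℕ) {Ψ Ψ' : MassSeq → ℝ≥0∞} (hΨ : Measurable Ψ)
    (hΨ' : Measurable Ψ') (y : MassSeq) :
    green K F β α n (fun y => Ψ y + Ψ' y) y = green K F β α n Ψ y + green K F β α n Ψ' y := by
  induction n generalizing Ψ Ψ' y with
  | zero => simp [green]
  | succ n ih =>
    have h1 : dwell K F β α (fun y => Ψ y + Ψ' y) =
        fun y => dwell K F β α Ψ y + dwell K F β α Ψ' y := by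
      funext y; simp only [dwell, mul_add]
    have h2 : jumpOp K F β (fun y => dwell K F β α Ψ y + dwell K F β α Ψ' y) =
        fun y => jumpOp K F β (dwell K F β α Ψ) y + jumpOp K F β (dwell K F β α Ψ') y := by
      funext y; exact jumpOp_add (measurable_dwell hK hF α hΨ) y
    simp only [green]
    rw [h1, h2, ih (measurable_jumpOp hK hF (measurable_dwell hK hF α hΨ))
      (measurable_jumpOp hK hF (measurable_dwell hK hF α hΨ'))]
    simp only
    ring

omit hK hF

include hK hF hβ

lemma dwell_mul_cancel (hα : 0 < α) (hy : y ∈ finiteStates) :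
    (α + jumpRate K F β y)⁻¹ * (α + jumpRate K F β y) = 1 :=
  ENNReal.inv_mul_cancel (by simp [hα.ne'])
    (ENNReal.add_ne_top.mpr ⟨coe_ne_top, (jumpRate_lt_top hK hF hβ hy).ne⟩)

lemma green_one_add_discount (hα : 0 < α) (n : ℕ) (hy : y ∈ massSet M) :
    α * green K F β α n (fun _ => 1) y + discount K F β α n y = 1 := by
  have := hβ.isFinite
  induction n generalizing y with
  | zero => simp [green, discount]
  | succ n ih =>
    have hm := measurable_green (β := β) hK hF α n (measurable_const (a := (1 : ℝ≥0∞)))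
    have h1 : jumpOp K F β (fun y => α * green K F β α n (fun _ => 1) y + discount K F β α n y) y =
        jumpRate K F β y := by
      have h := jumpOp_const (K := K) (F := F) (β := β) 1 y
      rw [mul_one] at h
      rw [← h]
      exact le_antisymm (jumpOp_mono_on hβ (fun y hy => (ih hy).le) hy)
        (jumpOp_mono_on hβ (fun y hy => (ih hy).ge) hy)
    rw [jumpOp_add (hm.const_mul _), jumpOp_const_mul hm] at h1
    rw [green_succ hK hF α n measurable_const, discount, dwell, dwell, dwell, mul_one]
    calc _ = (α + jumpRate K F β y)⁻¹ * (α + (α * jumpOp K F β (green K F β α n fun _ => 1) y +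
          jumpOp K F β (discount K F β α n) y)) := by ring
      _ = 1 := by rw [h1]; exact dwell_mul_cancel hK hF hβ hα hy.1

lemma discount_le_one (hα : 0 < α) (n : ℕ) (hy : y ∈ massSet M) : discount K F β α n y ≤ 1 :=
  le_of_le_of_eq le_add_self (green_one_add_discount hK hF hβ hα n hy)

/-- Non-explosion: the discount up to the `n`-th jump vanishes as `n → ∞`.  With
`w = count`, the Lyapunov bound gives `R Q w ≤ w`, while the rates are bounded on `{ε w < 1}`;
hence `(R Q) ^ n 1 ≤ ε w + q ^ n` for some `q < 1` depending on `ε`. -/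
lemma tendsto_discount (M : ℝ≥0) : ∃ c : ℝ≥0, ∀ α : ℝ≥0, c < α → ∀ y ∈ massSet M,
      Tendsto (fun n => discount K F β α n y) atTop (𝓝 0) := by
  have := hβ.isFinite
  obtain ⟨c, hc⟩ := jumpOp_count_le (K := K) hF hβ M
  obtain ⟨C, hC⟩ := jumpRate_le hK hF hβ M
  refine ⟨c, fun α hα => ?_⟩
  have hα0 : 0 < α := lt_of_le_of_lt zero_le hα
  have key : ∀ ε : ℝ≥0, 0 < ε → ∃ q : ℝ≥0∞, q < 1 ∧ ∀ n, ∀ y ∈ massSet M,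
      discount K F β α n y ≤ ε * count y + q ^ n := by
    intro ε hε
    set r : ℝ≥0 := C * (ε⁻¹ * ε⁻¹) + C * ε⁻¹ with hr
    set q : ℝ≥0 := r / (α + r) with hq
    have hq1 : q < 1 := by
      rw [hq, div_lt_one (by positivity)]; exact lt_add_of_pos_left _ hα0
    refine ⟨q, by exact_mod_cast hq1, fun n => ?_⟩
    induction n with
    | zero => intro y _; simp [discount]
    | succ n ih =>
      intro y hy
      by_cases hbig : 1 ≤ ε * count y
      · exact (discount_le_one hK hF hβ hα0 _ hy).trans (hbig.trans le_self_add)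
      rw [not_le] at hbig
      have hw : count y ≤ (ε⁻¹ : ℝ≥0) := by
        rw [ENNReal.coe_inv hε.ne', ← one_div, ENNReal.le_div_iff_mul_le (by simp [hε.ne'])
          (by simp), mul_comm]
        exact hbig.le
      have hrate : jumpRate K F β y ≤ r := by
        refine (hC y hy).trans ?_
        rw [hr]; push_cast; gcongr
      obtain ⟨ρ, hρ⟩ : ∃ ρ : ℝ≥0, jumpRate K F β y = ρ :=
        ⟨_, (coe_toNNReal (hrate.trans_lt coe_lt_top).ne).symm⟩
      rw [hρ] at hrate
      have hrate' : ρ ≤ r := by exact_mod_cast hrate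
      have h1 : jumpOp K F β (discount K F β α n) y ≤
          ε * ((ρ + c) * count y) + ρ * (q : ℝ≥0∞) ^ n := by
        refine (jumpOp_mono_on hβ ih hy).trans ?_
        rw [jumpOp_add (measurable_count.const_mul _), jumpOp_const_mul measurable_count,
          jumpOp_const, hρ]
        gcongr
        have := hc y hy
        rwa [hρ] at this
      have h2 : ((α + ρ : ℝ≥0)⁻¹ * (ρ + c) : ℝ≥0) ≤ 1 := by
        rw [inv_mul_le_iff₀ (by positivity), mul_one, add_comm]
        gcongr
      have h3 : ((α + ρ : ℝ≥0)⁻¹ * ρ : ℝ≥0) ≤ q := by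
        rw [hq, inv_mul_le_iff₀ (by positivity), mul_div_assoc', le_div_iff₀ (by positivity)]
        rw [mul_add, add_mul, mul_comm ρ α]
        gcongr
      change (α + jumpRate K F β y)⁻¹ * jumpOp K F β (discount K F β α n) y ≤ _
      have hinv : ((α : ℝ≥0∞) + jumpRate K F β y)⁻¹ = ((α + ρ : ℝ≥0)⁻¹ : ℝ≥0) := by
        rw [hρ, ENNReal.coe_inv (by positivity)]; push_cast; rfl
      rw [hinv]
      calc _ ≤ (((α + ρ : ℝ≥0)⁻¹ : ℝ≥0) : ℝ≥0∞) *
            (ε * ((ρ + c) * count y) + ρ * (q : ℝ≥0∞) ^ n) := by gcongr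
        _ = (((α + ρ : ℝ≥0)⁻¹ * (ρ + c) : ℝ≥0) : ℝ≥0∞) * (ε * count y) +
            (((α + ρ : ℝ≥0)⁻¹ * ρ : ℝ≥0) : ℝ≥0∞) * (q : ℝ≥0∞) ^ n := by push_cast; ring
        _ ≤ 1 * (ε * count y) + q * (q : ℝ≥0∞) ^ n := by
            gcongr
            exact_mod_cast h2
        _ = _ := by rw [one_mul, pow_succ']
  intro y hy
  refine ENNReal.tendsto_nhds_zero.mpr fun δ hδ => ?_
  obtain ⟨δ', hδ', hδδ⟩ := ENNReal.lt_iff_exists_nnreal_btwn.mp hδ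
  have hδ0 : 0 < δ' := by exact_mod_cast hδ'
  have hcount := count_lt_top hy.1
  set w := (count y).toNNReal with hwdef
  have hw : count y = w := (coe_toNNReal hcount.ne).symm
  obtain ⟨q, hq1, hq⟩ := key (δ' / 2 / (w + 1)) (by positivity)
  have hpow := ENNReal.tendsto_pow_atTop_nhds_zero_of_lt_one hq1
  have hev := ENNReal.tendsto_nhds_zero.mp hpow ((δ' / 2 : ℝ≥0) : ℝ≥0∞)
    (by exact_mod_cast (by positivity : (0 : ℝ≥0) < δ' / 2))
  filter_upwards [hev] with n hn
  refine (hq n y hy).trans (le_trans (add_le_add (b := ((δ' / 2 : ℝ≥0) : ℝ≥0∞)) ?_ hn) ?_)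
  · rw [hw, ← ENNReal.coe_mul]
    refine ENNReal.coe_le_coe.mpr ?_
    rw [div_mul_eq_mul_div]
    refine div_le_of_le_mul₀ (by positivity) (by positivity) ?_
    gcongr
    exact le_self_add
  · rw [← ENNReal.coe_add, add_halves]
    exact hδδ.le

/-- Uniqueness for the resolvent equation: a measure `U` of the right total mass that dominates
`μ R + U Q R` is the discounted occupation measure of the minimal jump process. -/
lemma lintegral_eq_green (M : ℝ≥0) :
    ∃ c : ℝ≥0, ∀ α : ℝ≥0, c < α → ∀ μ U : Measure MassSeq, IsFiniteMeasure μ →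
      (∀ᵐ y ∂μ, y ∈ massSet M) → α * U univ = μ univ →
      (∀ Ψ, Measurable Ψ → (∫⁻ y, dwell K F β α Ψ y ∂μ) +
        (∫⁻ y, jumpOp K F β (dwell K F β α Ψ) y ∂U) ≤ ∫⁻ y, Ψ y ∂U) →
      ∀ Ψ, Measurable Ψ → (∀ y, Ψ y ≤ 1) →
        ∫⁻ y, Ψ y ∂U = ∫⁻ y, ⨆ n, green K F β α n Ψ y ∂μ := by
  have := hβ.isFinite
  obtain ⟨c, hc⟩ := tendsto_discount hK hF hβ M
  refine ⟨c, fun α hα μ U hμ hμM hU hUΨ Ψ hΨ hΨ1 => ?_⟩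
  have hα0 : 0 < α := lt_of_le_of_lt zero_le hα
  have hge : ∀ n, ∀ Ψ, Measurable Ψ → ∫⁻ y, green K F β α n Ψ y ∂μ ≤ ∫⁻ y, Ψ y ∂U := by
    intro n
    induction n with
    | zero => intro Ψ _; simp [green]
    | succ n ih =>
      intro Ψ hΨ
      have hd := measurable_dwell (β := β) hK hF α hΨ
      refine le_trans ?_ (hUΨ Ψ hΨ)
      simp only [green]
      rw [lintegral_add_left hd]
      exact add_le_add le_rfl (ih _ (measurable_jumpOp hK hF hd))
  have hsup : ∀ Ψ, Measurable Ψ → ∫⁻ y, ⨆ n, green K F β α n Ψ y ∂μ ≤ ∫⁻ y, Ψ y ∂U := by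
    intro Ψ hΨ
    rw [lintegral_iSup (fun n => measurable_green (β := β) hK hF α n hΨ)
      (fun n n' h y => green_mono_index hK hF α hΨ y h)]
    exact iSup_le fun n => hge n Ψ hΨ
  refine le_antisymm ?_ (hsup Ψ hΨ)
  have hΨ' : Measurable fun y => 1 - Ψ y := hΨ.const_sub 1
  have hsum : ∀ᵐ y ∂μ, (⨆ n, green K F β α n Ψ y) + (⨆ n, green K F β α n (fun y => 1 - Ψ y) y) =
      (α : ℝ≥0∞)⁻¹ := by
    filter_upwards [hμM] with y hy
    rw [ENNReal.iSup_add_iSup_of_monotone (green_mono_index hK hF α hΨ y)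
      (green_mono_index hK hF α hΨ' y)]
    have h1 : ∀ n, green K F β α n Ψ y + green K F β α n (fun y => 1 - Ψ y) y =
        green K F β α n (fun _ => 1) y := fun n => by
      rw [← green_add hK hF α n hΨ hΨ']
      congr 1
      funext y
      exact add_tsub_cancel_of_le (hΨ1 y)
    simp only [h1]
    have h2 := tendsto_atTop_iSup (green_mono_index (β := β) hK hF α
      (measurable_const (a := (1 : ℝ≥0∞))) y)
    have h3 : Tendsto (fun n => (α : ℝ≥0∞) * green K F β α n (fun _ => 1) y +
        discount K F β α n y) atTop (𝓝 (α * (⨆ n, green K F β α n (fun _ => 1) y) + 0)) :=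
      (ENNReal.Tendsto.const_mul h2 (Or.inr coe_ne_top)).add (hc α hα y hy)
    simp only [green_one_add_discount hK hF hβ hα0 _ hy, add_zero] at h3
    have h4 := tendsto_nhds_unique h3 tendsto_const_nhds
    rw [← one_div, ENNReal.eq_div_iff (by simp [hα0.ne']) coe_ne_top]
    exact h4
  have hfin : ∫⁻ y, (⨆ n, green K F β α n (fun y => 1 - Ψ y) y) ∂μ ≠ ∞ := by
    refine ((hsup _ hΨ').trans_lt ?_).ne
    calc ∫⁻ y, (1 - Ψ y) ∂U ≤ ∫⁻ _, 1 ∂U := lintegral_mono fun _ => tsub_le_self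
      _ = U univ := lintegral_one
      _ < ∞ := by
        by_contra hc
        rw [not_lt, top_le_iff] at hc
        rw [hc, ENNReal.mul_top (by simp [hα0.ne'])] at hU
        exact measure_ne_top μ _ hU.symm
  have htot : ∫⁻ y, Ψ y ∂U + ∫⁻ y, (1 - Ψ y) ∂U =
      (∫⁻ y, ⨆ n, green K F β α n Ψ y ∂μ) +
        ∫⁻ y, (⨆ n, green K F β α n (fun y => 1 - Ψ y) y) ∂μ := by
    rw [← lintegral_add_left hΨ, ← lintegral_add_left (Measurable.iSup fun n =>
      measurable_green (β := β) hK hF α n hΨ), lintegral_congr_ae hsum]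
    simp only [fun y => add_tsub_cancel_of_le (hΨ1 y), lintegral_const, one_mul]
    rw [← hU, ← mul_assoc, ENNReal.inv_mul_cancel (by simp [hα0.ne']) coe_ne_top, one_mul]
  have h5 : ∫⁻ y, Ψ y ∂U + ∫⁻ y, (⨆ n, green K F β α n (fun y => 1 - Ψ y) y) ∂μ ≤
      (∫⁻ y, ⨆ n, green K F β α n Ψ y ∂μ) +
        ∫⁻ y, (⨆ n, green K F β α n (fun y => 1 - Ψ y) y) ∂μ := by
    rw [← htot]
    exact add_le_add le_rfl (hsup _ hΨ')
  exact (ENNReal.add_le_add_iff_right hfin).mp h5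

omit hK hF hβ

/-! ### The generator on bounded nonnegative functions -/

include hK hF hβ in
lemma generator_eq (hy : y ∈ finiteStates) (hΦ : Measurable Φ) (h0 : ∀ y, 0 ≤ Φ y) {C : ℝ}
    (hC : ∀ y, Φ y ≤ C) :
    generator K F β Φ y = (jumpOp K F β (fun y => ofReal (Φ y)) y).toReal -
      (jumpRate K F β y).toReal * Φ y := by
  have := hβ.isFinite
  have hr := jumpRate_lt_top hK hF hβ hy
  have hr1 : coagRate K y ≠ ∞ := (lt_of_le_of_lt le_self_add hr).ne
  have hr2 : fragRate F β y ≠ ∞ := (lt_of_le_of_lt le_add_self hr).ne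
  have hint : ∀ i, Integrable (fun θ => Φ (fragment i θ y)) β := fun i => by
    refine Integrable.of_bound (C := C)
      (hΦ.comp (measurable_id.fragment measurable_const i)).aestronglyMeasurable ?_
    exact ae_of_all _ fun θ => by rw [norm_of_nonneg (h0 _)]; exact hC _
  have hQ : jumpOp K F β (fun y => ofReal (Φ y)) y ≠ ∞ := by
    refine (lt_of_le_of_lt (jumpOp_mono (Ψ' := fun _ => ofReal C)
      (fun y => ofReal_le_ofReal (hC y)) y) ?_).ne
    rw [jumpOp_const]
    exact mul_lt_top hr ENNReal.ofReal_lt_top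
  unfold jumpOp at hQ ⊢
  obtain ⟨hQ1, hQ2⟩ := ENNReal.add_ne_top.mp hQ
  have hl : ∀ i, ∫⁻ θ, ofReal (Φ (fragment i θ y)) ∂β ≠ ∞ := fun i =>
    (hint i).lintegral_lt_top.ne
  have hs1 := ENNReal.summable_toReal hQ1
  have hs2 := ENNReal.summable_toReal hQ2
  have hs3 := ENNReal.summable_toReal hr1
  have hs4 : Summable fun i => (F (y.1 i) : ℝ≥0∞).toReal * (β univ).toReal := by
    have := ENNReal.summable_toReal (f := fun i => β univ * (F (y.1 i) : ℝ≥0∞))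
      (by rw [ENNReal.tsum_mul_left]; exact hr2)
    simpa [toReal_mul, mul_comm] using this
  have e1 : (∑' p : IdxPair, (K (y.1 p.1.1) (y.1 p.1.2) : ℝ) *
      (Φ (coalesce p.1.1 p.1.2 y) - Φ y)) =
      (∑' p : IdxPair, (K (y.1 p.1.1) (y.1 p.1.2) : ℝ≥0∞) *
        ofReal (Φ (coalesce p.1.1 p.1.2 y))).toReal - (coagRate K y).toReal * Φ y := by
    rw [coagRate, ENNReal.tsum_toReal_eq (fun p => coe_ne_top), ← tsum_mul_right,
      ENNReal.tsum_toReal_eq (fun p => mul_ne_top coe_ne_top ofReal_ne_top),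
      ← Summable.tsum_sub hs1 (hs3.mul_right _)]
    refine tsum_congr fun p => ?_
    rw [toReal_mul, ENNReal.toReal_ofReal (h0 _), coe_toReal]
    ring
  have e2 : (∑' i : ℕ, (F (y.1 i) : ℝ) * ∫ θ, (Φ (fragment i θ y) - Φ y) ∂β) =
      (∑' i : ℕ, (F (y.1 i) : ℝ≥0∞) * ∫⁻ θ, ofReal (Φ (fragment i θ y)) ∂β).toReal -
        (fragRate F β y).toReal * Φ y := by
    rw [fragRate, toReal_mul, ENNReal.tsum_toReal_eq (fun p => coe_ne_top),
      ENNReal.tsum_toReal_eq (fun i => mul_ne_top coe_ne_top (hl i)),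
      mul_comm (β univ).toReal, ← tsum_mul_right, ← tsum_mul_right,
      ← Summable.tsum_sub hs2 (hs4.mul_right _)]
    refine tsum_congr fun i => ?_
    rw [integral_sub (hint i) (integrable_const _), integral_const, toReal_mul,
      integral_eq_lintegral_of_nonneg_ae (ae_of_all _ fun _ => h0 _)
        (hint i).aestronglyMeasurable, coe_toReal, smul_eq_mul, real]
    ring
  rw [generator, e1, e2, jumpRate, toReal_add hQ1 hQ2, toReal_add hr1 hr2]
  ring

/-- The generator does not change when a constant is added to the test function. -/
lemma generator_add_const (Φ : MassSeq → ℝ) (c : ℝ) (y : MassSeq) :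
    generator K F β (fun y => Φ y + c) y = generator K F β Φ y := by
  simp only [generator, add_sub_add_right_eq_sub]

end Resolvent

/-! ### Existence of Poisson random measures -/

lemma norm_prod_range_apply_le {E : Type} {φ : E → ℂ} (hφ1 : ∀ x, ‖φ x‖ ≤ 1) (p : ℕ × (ℕ → E)) :
    ‖∏ j ∈ range p.1, φ (p.2 j)‖ ≤ 1 := by
  rw [norm_prod]
  exact Finset.prod_le_one (fun _ _ => norm_nonneg _) fun _ _ => hφ1 _

/-- The unimodular function `exp (i ∑ᵢ tᵢ 1_{Aᵢ})`. -/
def phase {E : Type} {l : ℕ} (A : Fin l → Set E) (t : Fin l → ℝ) (x : E) : ℂ :=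
  Complex.exp ((∑ i, t i * (A i).indicator (1 : E → ℝ) x : ℝ) * Complex.I)

lemma norm_phase_le {E : Type} {l : ℕ} (A : Fin l → Set E) (t : Fin l → ℝ) (x : E) :
    ‖phase A t x‖ ≤ 1 :=
  (Complex.norm_exp_ofReal_mul_I _).le

section PoissonExistence

variable {E : Type} [MeasurableSpace E]

/-- The sum of the Dirac masses at the first `p.1` terms of the sequence `p.2`. -/
def diracSum (p : ℕ × (ℕ → E)) : Measure E := ∑ j ∈ range p.1, dirac (p.2 j)

lemma diracSum_apply (p : ℕ × (ℕ → E)) {A : Set E} (hA : MeasurableSet A) :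
    diracSum p A = ∑ j ∈ range p.1, A.indicator 1 (p.2 j) := by
  simp [diracSum, dirac_apply' _ hA]

lemma measurable_diracSum : Measurable (diracSum : ℕ × (ℕ → E) → Measure E) := by
  refine measurable_from_prod_countable_right fun k => ?_
  refine Measure.measurable_of_measurable_coe _ fun A hA => ?_
  simp only [diracSum_apply _ hA]
  refine Finset.measurable_fun_sum _ fun j _ => ?_
  exact (measurable_one.indicator hA).comp (measurable_pi_apply j)

lemma measurable_prod_range_apply {φ : E → ℂ} (hφ : Measurable φ) :
    Measurable fun p : ℕ × (ℕ → E) => ∏ j ∈ range p.1, φ (p.2 j) := by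
  refine measurable_from_prod_countable_right fun k => ?_
  exact Finset.measurable_fun_prod (range k) fun j _ => hφ.comp (measurable_pi_apply j)

/-- The law of a Poisson number (mean `a`) together with an independent sequence of points with
law `μ`. -/
def poissonSample (a : ℝ≥0) (μ : Measure E) : Measure (ℕ × (ℕ → E)) :=
  (poissonMeasure a).prod (infinitePi fun _ => μ)

instance (a : ℝ≥0) (μ : Measure E) [IsProbabilityMeasure μ] :
    IsProbabilityMeasure (poissonSample a μ) := by
  unfold poissonSample; infer_instance

lemma integral_prod_poissonSample (a : ℝ≥0) (μ : Measure E) [IsProbabilityMeasure μ]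
    {φ : E → ℂ} (hφ : Measurable φ) (hφ1 : ∀ x, ‖φ x‖ ≤ 1) :
    ∫ p, ∏ j ∈ range p.1, φ (p.2 j) ∂(poissonSample a μ) =
      Complex.exp (a * (∫ x, φ x ∂μ - 1)) := by
  have hint : Integrable (fun p : ℕ × (ℕ → E) => ∏ j ∈ range p.1, φ (p.2 j))
      (poissonSample a μ) :=
    Integrable.of_bound (measurable_prod_range_apply hφ).aestronglyMeasurable 1
      (.of_forall (norm_prod_range_apply_le hφ1))
  have hk : ∀ k : ℕ, ∫ ξ : ℕ → E, ∏ j ∈ range k, φ (ξ j)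
      ∂(infinitePi fun _ => μ) = (∫ x, φ x ∂μ) ^ k := by
    intro k
    have hind : iIndepFun (fun (i : Fin k) (ξ : ℕ → E) => ξ i)
        (infinitePi fun _ : ℕ => μ) :=
      .precomp (g := Fin.val) Fin.val_injective
        (iIndepFun_infinitePi (P := fun _ : ℕ => μ) (X := fun _ x => x) fun _ => measurable_id)
    have h := hind.integral_fun_prod_comp (f := fun _ => φ)
      (fun i => (measurable_pi_apply _).aemeasurable) (fun i => hφ.aestronglyMeasurable)
    simp only [Finset.prod_range, h]
    have : ∀ i : Fin k, ∫ ξ : ℕ → E, φ (ξ i) ∂(infinitePi fun _ => μ) = ∫ x, φ x ∂μ := by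
      intro i
      have := (measurePreserving_eval_infinitePi (fun _ : ℕ => μ) (i : ℕ)).map_eq
      conv_rhs => rw [← this]
      rw [integral_map (measurable_pi_apply _).aemeasurable hφ.aestronglyMeasurable]
    simp [this]
  have hz : ‖∫ x, φ x ∂μ‖ ≤ 1 := by
    refine (norm_integral_le_of_norm_le_const (.of_forall hφ1)).trans ?_
    simp
  unfold poissonSample at hint ⊢
  rw [integral_prod _ hint]
  simp only [hk]
  rw [integral_poissonMeasure]
  set z := ∫ x, φ x ∂μ
  have h1 : HasSum (fun n : ℕ => ((a : ℂ) * z) ^ n / (n.factorial : ℂ)) (Complex.exp (a * z)) := by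
    rw [Complex.exp_eq_exp_ℂ]
    exact NormedSpace.expSeries_div_hasSum_exp _
  have h2 := h1.mul_left (Complex.exp (-a))
  rw [← Complex.exp_add] at h2
  rw [show (a : ℂ) * (z - 1) = -a + a * z by ring, ← h2.tsum_eq]
  refine tsum_congr fun n => ?_
  rw [Complex.real_smul]
  push_cast
  rw [mul_pow]
  ring

variable (a : ℕ → ℝ≥0) (μ : ℕ → Measure E) [∀ n, IsProbabilityMeasure (μ n)]

/-- The superposition of the first `m` samples. -/
def partialSample (m : ℕ) (ω : ℕ → ℕ × (ℕ → E)) : Measure E :=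
  ∑ n ∈ range m, diracSum (ω n)

lemma partialSample_apply (m : ℕ) (ω : ℕ → ℕ × (ℕ → E)) (A : Set E) :
    partialSample m ω A = ∑ n ∈ range m, diracSum (ω n) A := by
  simp [partialSample]

lemma partialSample_toReal (m : ℕ) (ω : ℕ → ℕ × (ℕ → E)) {A : Set E} (hA : MeasurableSet A) :
    (partialSample m ω A).toReal =
      ∑ n ∈ range m, ∑ j ∈ range (ω n).1, A.indicator (1 : E → ℝ) ((ω n).2 j) := by
  have h0 : ∀ x : E, A.indicator (1 : E → ℝ≥0∞) x ≠ ∞ := fun x => by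
    by_cases h : x ∈ A <;> simp [h]
  rw [partialSample_apply, ENNReal.toReal_sum]
  · refine sum_congr rfl fun n _ => ?_
    rw [diracSum_apply _ hA, ENNReal.toReal_sum fun j _ => h0 _]
    refine sum_congr rfl fun j _ => ?_
    by_cases h : (ω n).2 j ∈ A <;> simp [h]
  · intro n _
    rw [diracSum_apply _ hA]
    exact ENNReal.sum_ne_top.2 fun j _ => h0 _

lemma partialSample_ne_top (m : ℕ) (ω : ℕ → ℕ × (ℕ → E)) (A : Set E) :
    partialSample m ω A ≠ ∞ := by
  rw [partialSample_apply]
  refine ENNReal.sum_ne_top.2 fun n _ => ?_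
  simp only [diracSum, Measure.finsetSum_apply]
  exact ENNReal.sum_ne_top.2 fun j _ => measure_ne_top _ _

lemma measurable_partialSample (m : ℕ) :
    Measurable (partialSample m : (ℕ → ℕ × (ℕ → E)) → Measure E) := by
  refine Measure.measurable_of_measurable_coe _ fun A hA => ?_
  simp only [partialSample_apply]
  exact Finset.measurable_fun_sum _ fun n _ =>
    (measurable_coe hA).comp (measurable_diracSum.comp (measurable_pi_apply n))

lemma measurable_phase {l : ℕ} {A : Fin l → Set E} (hA : ∀ i, MeasurableSet (A i))
    (t : Fin l → ℝ) : Measurable (phase A t) := by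
  refine Complex.measurable_exp.comp (Measurable.mul_const ?_ _)
  refine Complex.measurable_ofReal.comp ?_
  exact Finset.measurable_fun_sum _ fun i _ => (measurable_one.indicator (hA i)).const_mul _

lemma integral_phase {l : ℕ} {A : Fin l → Set E} (hA : ∀ i, MeasurableSet (A i))
    (hd : Pairwise fun i j => Disjoint (A i) (A j)) (t : Fin l → ℝ) (μ : Measure E)
    [IsProbabilityMeasure μ] :
    ∫ x, phase A t x ∂μ - 1 =
      ∑ i, (μ.real (A i) : ℂ) * (Complex.exp (t i * Complex.I) - 1) := by
  -- the sets being disjoint, `phase - 1` is the sum of the indicators weighted by `exp (i tᵢ) - 1`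
  have h1 : ∀ x, phase A t x =
      1 + ∑ i, (A i).indicator (fun _ => Complex.exp (t i * Complex.I) - 1) x := by
    intro x
    unfold phase
    by_cases hx : ∃ i, x ∈ A i
    · obtain ⟨i, hi⟩ := hx
      have hne : ∀ j, j ≠ i → x ∉ A j := fun j hj hxj =>
        Set.disjoint_left.1 (hd hj) hxj hi
      rw [Finset.sum_eq_single i (fun j _ hj => by simp [hne j hj]) (by simp),
        Finset.sum_eq_single i (fun j _ hj => by simp [hne j hj]) (by simp)]
      simp [hi]
    · push Not at hx
      simp [hx]
  simp only [h1]
  have hI : ∀ i, Integrable ((A i).indicator fun _ : E => Complex.exp (t i * Complex.I) - 1) μ :=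
    fun i => (integrable_const _).indicator (hA i)
  rw [integral_add (integrable_const _) (integrable_finsetSum _ fun i _ => hI i),
    integral_finsetSum _ fun i _ => hI i]
  simp only [integral_indicator_const _ (hA _), integral_const, probReal_univ, one_smul,
    Complex.real_smul]
  ring

lemma exp_partialSample (m : ℕ) {l : ℕ} {A : Fin l → Set E}
    (hA : ∀ i, MeasurableSet (A i)) (t : Fin l → ℝ) (ω : ℕ → ℕ × (ℕ → E)) :
    Complex.exp ((∑ i, t i * (partialSample m ω (A i)).toReal : ℝ) * Complex.I) =
      ∏ n : Fin m, ∏ j ∈ range (ω n).1, phase A t ((ω n).2 j) := by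
  rw [← Finset.prod_range (f := fun n => ∏ j ∈ range (ω n).1, phase A t ((ω n).2 j))]
  simp only [phase, ← Complex.exp_sum, ← Finset.sum_mul, ← Complex.ofReal_sum]
  congr 3
  simp only [partialSample_toReal _ _ (hA _), Finset.mul_sum]
  rw [Finset.sum_comm]
  exact sum_congr rfl fun n _ => Finset.sum_comm

/-- The joint characteristic function of the numbers of points of a partial superposition in
disjoint sets. -/
lemma integral_exp_partialSample (m : ℕ) {l : ℕ} (A : Fin l → Set E)
    (hA : ∀ i, MeasurableSet (A i)) (hd : Pairwise fun i j => Disjoint (A i) (A j))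
    (t : Fin l → ℝ) :
    ∫ ω, Complex.exp ((∑ i, t i * (partialSample m ω (A i)).toReal : ℝ) * Complex.I)
        ∂(infinitePi fun n => poissonSample (a n) (μ n)) =
      ∏ i, Complex.exp ((∑ n ∈ range m, (a n * (μ n).real (A i)) : ℝ) *
        (Complex.exp (t i * Complex.I) - 1)) := by
  simp only [exp_partialSample m hA]
  have hφ := measurable_phase hA t
  have hφ1 := norm_phase_le A t
  generalize hg : phase A t = φ at hφ hφ1
  have hφint : ∀ n, ∫ x, φ x ∂(μ n) - 1 =
      ∑ i, ((μ n).real (A i) : ℂ) * (Complex.exp (t i * Complex.I) - 1) := fun n => by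
    rw [← hg]; exact integral_phase hA hd t (μ n)
  have hind : iIndepFun (fun (n : Fin m) (ω : ℕ → ℕ × (ℕ → E)) => ω n)
      (infinitePi fun n => poissonSample (a n) (μ n)) :=
    .precomp (g := Fin.val) Fin.val_injective
      (iIndepFun_infinitePi (P := fun n => poissonSample (a n) (μ n)) (X := fun _ x => x)
        fun _ => measurable_id)
  rw [hind.integral_fun_prod_comp
    (f := fun _ p => ∏ j ∈ range p.1, φ (p.2 j))
      (fun i => (measurable_pi_apply _).aemeasurable)
      (fun i => (measurable_prod_range_apply hφ).aestronglyMeasurable)]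
  have h2 : ∀ n : Fin m, ∫ ω : ℕ → ℕ × (ℕ → E), ∏ j ∈ range (ω n).1, φ ((ω n).2 j)
      ∂(infinitePi fun n => poissonSample (a n) (μ n)) =
      Complex.exp (∑ i, (a n * (μ n).real (A i) : ℝ) * (Complex.exp (t i * Complex.I) - 1)) := by
    intro n
    have hmp := (measurePreserving_eval_infinitePi
      (fun n : ℕ => poissonSample (a n) (μ n)) (n : ℕ)).map_eq
    have := integral_prod_poissonSample (a n) (μ n) hφ hφ1
    rw [← hmp, integral_map (measurable_pi_apply _).aemeasurable
      (measurable_prod_range_apply hφ).aestronglyMeasurable, hφint, Finset.mul_sum] at this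
    refine this.trans ?_
    congr 1
    refine sum_congr rfl fun i _ => ?_
    push_cast
    ring
  simp only [h2]
  rw [← Complex.exp_sum, Finset.sum_comm, Complex.exp_sum]
  refine Finset.prod_congr rfl fun i _ => ?_
  congr 1
  rw [← Finset.sum_mul, Finset.sum_range]
  push_cast
  rfl

lemma map_partialSample (m : ℕ) {A : Set E} (hA : MeasurableSet A) :
    (infinitePi fun n => poissonSample (a n) (μ n)).map
        (fun ω => (partialSample m ω A).toReal) =
      (poissonMeasure (∑ n ∈ range m, a n * (μ n A).toNNReal)).map (fun n : ℕ => (n : ℝ)) := by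
  have hm : Measurable fun ω : ℕ → ℕ × (ℕ → E) => (partialSample m ω A).toReal :=
    ((measurable_coe hA).comp (measurable_partialSample m)).ennreal_toReal
  have : IsProbabilityMeasure ((infinitePi fun n => poissonSample (a n) (μ n)).map
        (fun ω => (partialSample m ω A).toReal)) :=
    Measure.isProbabilityMeasure_map hm.aemeasurable
  have : IsProbabilityMeasure ((poissonMeasure (∑ n ∈ range m,
      a n * (μ n A).toNNReal)).map (fun n : ℕ => (n : ℝ))) :=
    Measure.isProbabilityMeasure_map (by fun_prop)
  refine Measure.ext_of_charFun ?_
  funext s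
  rw [charFun_map_cast_poissonMeasure, charFun_apply_real, integral_map hm.aemeasurable
    (by fun_prop)]
  have h := integral_exp_partialSample a μ m (l := 1) (fun _ => A) (fun _ => hA)
    (fun i j hij => absurd (Subsingleton.elim i j) hij) (fun _ => s)
  simp only [Finset.univ_unique, Finset.sum_singleton, Finset.prod_singleton] at h
  push_cast at h ⊢
  rw [h]
  congr 1

lemma iIndepFun_partialSample (m : ℕ) {l : ℕ} (A : Fin l → Set E)
    (hA : ∀ i, MeasurableSet (A i)) (hd : Pairwise fun i j => Disjoint (A i) (A j)) :
    iIndepFun (fun i ω => (partialSample m ω (A i)).toReal)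
      (infinitePi fun n => poissonSample (a n) (μ n)) := by
  have hm : ∀ i, Measurable fun ω : ℕ → ℕ × (ℕ → E) => (partialSample m ω (A i)).toReal :=
    fun i => ((measurable_coe (hA i)).comp (measurable_partialSample m)).ennreal_toReal
  rw [iIndepFun_iff_charFun_pi fun i => (hm i).aemeasurable]
  intro t
  have hm' : Measurable fun ω : ℕ → ℕ × (ℕ → E) =>
      WithLp.toLp 2 fun i => (partialSample m ω (A i)).toReal :=
    (WithLp.measurable_toLp 2 _).comp (measurable_pi_iff.2 hm)
  rw [charFun_apply, integral_map hm'.aemeasurable (by fun_prop)]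
  have h := integral_exp_partialSample a μ m A hA hd (fun i => t i)
  have e : ∀ ω : ℕ → ℕ × (ℕ → E), (inner ℝ (WithLp.toLp 2 fun i => (partialSample m ω
    (A i)).toReal) t : ℝ)
      = ∑ i, t i * (partialSample m ω (A i)).toReal := fun ω => by
    simp [PiLp.inner_apply]
  simp only [e]
  rw [h]
  refine Finset.prod_congr rfl fun i _ => ?_
  rw [map_partialSample a μ m (hA i), charFun_map_cast_poissonMeasure]
  push_cast
  rfl

/-- The superposition of all the samples. -/
def fullSample (ω : ℕ → ℕ × (ℕ → E)) : Measure E := sum fun n => diracSum (ω n)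

lemma measurable_fullSample : Measurable (fullSample : (ℕ → ℕ × (ℕ → E)) → Measure E) := by
  refine Measure.measurable_of_measurable_coe _ fun A hA => ?_
  simp only [fullSample, Measure.sum_apply _ hA]
  exact Measurable.tsum fun n =>
    (measurable_coe hA).comp (measurable_diracSum.comp (measurable_pi_apply n))

lemma fullSample_apply (ω : ℕ → ℕ × (ℕ → E)) {A : Set E} (hA : MeasurableSet A) :
    fullSample ω A = ⨆ m, partialSample m ω A := by
  simp only [fullSample, Measure.sum_apply _ hA, partialSample_apply]
  exact ENNReal.tsum_eq_iSup_nat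

lemma partialSample_mono (ω : ℕ → ℕ × (ℕ → E)) (A : Set E) :
    Monotone fun m => partialSample m ω A := by
  intro m m' h
  simp only [partialSample_apply]
  exact Finset.sum_le_sum_of_subset (Finset.range_mono h)

lemma iIndepFun_partialSample_ennreal (m : ℕ) {l : ℕ} (A : Fin l → Set E)
    (hA : ∀ i, MeasurableSet (A i)) (hd : Pairwise fun i j => Disjoint (A i) (A j)) :
    iIndepFun (fun i ω => partialSample m ω (A i))
      (infinitePi fun n => poissonSample (a n) (μ n)) := by
  have h := (iIndepFun_partialSample a μ m A hA hd).comp (fun _ => ofReal)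
    fun _ => ENNReal.measurable_ofReal
  simpa only [Function.comp_def, ofReal_toReal (partialSample_ne_top m _ _)] using h

/-- Independence passes to increasing limits, by testing on the rays `(c, ∞]`. -/
lemma iIndepFun_fullSample {l : ℕ} (A : Fin l → Set E)
    (hA : ∀ i, MeasurableSet (A i)) (hd : Pairwise fun i j => Disjoint (A i) (A j)) :
    iIndepFun (fun i ω => fullSample ω (A i))
      (infinitePi fun n => poissonSample (a n) (μ n)) := by
  have hm : ∀ i, Measurable fun ω : ℕ → ℕ × (ℕ → E) => fullSample ω (A i) :=
    fun i => (measurable_coe (hA i)).comp measurable_fullSample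
  rw [iIndepFun_iff_iIndep]
  refine iIndepSets.iIndep (fun i => (hm i).comap_le)
    (fun i => {s | ∃ t ∈ Set.range (Set.Ioi : ℝ≥0∞ → Set ℝ≥0∞),
      (fun ω => fullSample ω (A i)) ⁻¹' t = s})
    (fun i => isPiSystem_Ioi.comap _) (fun i => ?_) ?_
  · rw [BorelSpace.measurable_eq (α := ℝ≥0∞), borel_eq_generateFrom_Ioi ℝ≥0∞,
      MeasurableSpace.comap_generateFrom]
    rfl
  · rw [iIndepSets_iff]
    intro S f hf
    have hc : ∀ i, ∃ c : ℝ≥0∞, i ∈ S → f i = (fun ω => fullSample ω (A i)) ⁻¹' Set.Ioi c := by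
      intro i
      by_cases hi : i ∈ S
      · obtain ⟨t, ⟨c, rfl⟩, h⟩ := hf i hi
        exact ⟨c, fun _ => h.symm⟩
      · exact ⟨0, fun h => absurd h hi⟩
    choose c hc using hc
    have hU : ∀ i, i ∈ S → f i = ⋃ m, {ω | c i < partialSample m ω (A i)} := by
      intro i hi
      rw [hc i hi]
      ext ω
      simp [fullSample_apply _ (hA i), lt_iSup_iff]
    have hmono : ∀ i, Monotone fun m => {ω : ℕ → ℕ × (ℕ → E) | c i < partialSample m ω (A i)} :=
      fun i m m' h ω hω =>
        lt_of_lt_of_le (show c i < partialSample m ω (A i) from hω) (partialSample_mono ω (A i) h)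
    have hInter : ⋂ i ∈ S, f i = ⋃ m, ⋂ i ∈ S, {ω | c i < partialSample m ω (A i)} := by
      rw [Set.iInter₂_congr hU]
      ext ω
      simp only [Set.mem_iInter, Set.mem_iUnion]
      refine ⟨fun h => ?_, fun ⟨m, hm⟩ i hi => ⟨m, hm i hi⟩⟩
      have hev : ∀ i ∈ S, ∀ᶠ m in atTop, ω ∈ {ω | c i < partialSample m ω (A i)} := fun i hi => by
        obtain ⟨m, hm⟩ := h i hi
        exact (eventually_ge_atTop m).mono fun m' hm' => hmono i hm' hm
      exact ((S.eventually_all).2 hev).exists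
    rw [hInter, Finset.prod_congr rfl fun i hi => by rw [hU i hi]]
    have h1 := tendsto_measure_iUnion_atTop
      (μ := infinitePi fun n => poissonSample (a n) (μ n))
      (s := fun m => ⋂ i ∈ S, {ω | c i < partialSample m ω (A i)})
      (fun m m' h => Set.biInter_mono (fun _ h => h) fun i _ => hmono i h)
    have h2 := ENNReal.tendsto_finsetProd_of_ne_top S (fun i _ => tendsto_measure_iUnion_atTop
      (μ := infinitePi fun n => poissonSample (a n) (μ n)) (hmono i))
      fun i _ => measure_ne_top _ _
    refine tendsto_nhds_unique h1 (h2.congr fun m => ?_)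
    exact ((iIndepFun_iff_measure_inter_preimage_eq_mul.1
      (iIndepFun_partialSample_ennreal a μ m A hA hd) S
        (sets := fun i => Set.Ioi (c i)) fun i _ => measurableSet_Ioi)).symm

lemma tendsto_poissonMeasure_finite {b : ℕ → ℝ≥0} {b' : ℝ≥0} (hb : Tendsto b atTop (𝓝 b'))
    {S : Set ℕ} (hS : S.Finite) :
    Tendsto (fun m => poissonMeasure (b m) S) atTop (𝓝 (poissonMeasure b' S)) := by
  have h : ∀ r : ℝ≥0, poissonMeasure r S =
      ∑ n ∈ hS.toFinset, ofReal (exp (-r) * r ^ n / n.factorial) := by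
    intro r
    conv_lhs => rw [← Set.Finite.coe_toFinset hS]
    rw [← sum_measure_singleton]
    exact sum_congr rfl fun n _ => poissonMeasure_singleton r n
  simp only [h]
  refine tendsto_finsetSum _ fun n _ => ENNReal.tendsto_ofReal ?_
  have hb' : Tendsto (fun m => (b m : ℝ)) atTop (𝓝 b') := NNReal.tendsto_coe.2 hb
  exact (((Real.continuous_exp.tendsto _).comp hb'.neg).mul (hb'.pow n)).div_const _

lemma isPoissonRandomMeasure_fullSample {ν : Measure E}
    (hν : ν = sum fun n => a n • μ n) :
    IsPoissonRandomMeasure (fullSample : (ℕ → ℕ × (ℕ → E)) → Measure E) ν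
      (infinitePi fun n => poissonSample (a n) (μ n)) where
  measurable := measurable_fullSample
  indep l A hA hd := iIndepFun_fullSample a μ A hA hd
  poisson A hA hfin := by
    set P := infinitePi fun n => poissonSample (a n) (μ n)
    have hsum : HasSum (fun n => a n * (μ n A).toNNReal) (ν A).toNNReal := by
      rw [← ENNReal.hasSum_coe, coe_toNNReal hfin, hν, Measure.sum_apply _ hA]
      convert! ENNReal.summable.hasSum using 1
      refine tsum_congr fun n => ?_
      rw [Measure.smul_apply, ENNReal.smul_def, ENNReal.coe_mul,
        coe_toNNReal (measure_ne_top _ _), smul_eq_mul]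
    have hb := hsum.tendsto_sum_nat
    have hNm : Measurable fun ω : ℕ → ℕ × (ℕ → E) => fullSample ω A :=
      (measurable_coe hA).comp measurable_fullSample
    have hPm : ∀ m, Measurable fun ω : ℕ → ℕ × (ℕ → E) => partialSample m ω A :=
      fun m => (measurable_coe hA).comp (measurable_partialSample m)
    have : IsProbabilityMeasure (P.map fun ω => fullSample ω A) :=
      Measure.isProbabilityMeasure_map hNm.aemeasurable
    have hcast : Measurable fun n : ℕ => (n : ℝ≥0∞) := measurable_from_top
    have : IsProbabilityMeasure ((poissonMeasure (ν A).toNNReal).map fun n : ℕ => (n : ℝ≥0∞)) :=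
      Measure.isProbabilityMeasure_map hcast.aemeasurable
    refine Measure.ext_of_Iic _ _ fun c => ?_
    rw [map_apply hNm measurableSet_Iic, map_apply hcast measurableSet_Iic]
    by_cases hc : c = ∞
    · simp [hc]
    have hS : ((fun n : ℕ => (n : ℝ≥0∞)) ⁻¹' Iic c).Finite := by
      obtain ⟨k, hk⟩ := ENNReal.exists_nat_gt hc
      refine (Set.finite_lt_nat k).subset fun n hn => ?_
      have : (n : ℝ≥0∞) < k := lt_of_le_of_lt hn hk
      exact_mod_cast this
    have h1 := tendsto_poissonMeasure_finite hb hS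
    have hm : ∀ m, poissonMeasure (∑ n ∈ range m, a n * (μ n A).toNNReal)
        ((fun n : ℕ => (n : ℝ≥0∞)) ⁻¹' Iic c) = P {ω | partialSample m ω A ≤ c} := by
      intro m
      have h := congrArg (fun κ : Measure ℝ => κ (Iic c.toReal)) (map_partialSample a μ m hA)
      rw [map_apply (hPm m).ennreal_toReal measurableSet_Iic,
        map_apply (by fun_prop) measurableSet_Iic] at h
      convert h.symm using 2
      · ext n
        rw [mem_preimage, mem_preimage, mem_Iic, mem_Iic,
          ← ENNReal.toReal_le_toReal (natCast_ne_top n) hc, ENNReal.toReal_natCast]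
      · ext ω
        simp [ENNReal.toReal_le_toReal (partialSample_ne_top m ω A) hc]
    simp only [hm] at h1
    have h2 := tendsto_measure_iInter_atTop (μ := P) (s := fun m => {ω | partialSample m ω A ≤ c})
      (fun m => (measurableSet_le (hPm m) measurable_const).nullMeasurableSet)
      (fun m m' h ω hω => (partialSample_mono ω A h).trans hω) ⟨0, measure_ne_top _ _⟩
    rw [← tendsto_nhds_unique h2 h1]
    congr 1
    ext ω
    simp [fullSample_apply ω hA]

/-- Poisson random measures exist for every s-finite intensity. -/
lemma exists_isPoissonRandomMeasure [Nonempty E] (ν : Measure E) [SFinite ν] :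
    ∃ (Ω : Type) (_ : MeasurableSpace Ω) (P : Measure Ω) (_ : IsProbabilityMeasure P)
      (N : Ω → Measure E), IsPoissonRandomMeasure N ν P := by
  have h : ∀ n, ∃ (r : ℝ≥0) (ρ : Measure E), IsProbabilityMeasure ρ ∧ sfiniteSeq ν n = r • ρ := by
    intro n
    by_cases h0 : sfiniteSeq ν n = 0
    · exact ⟨0, dirac (Classical.arbitrary E), inferInstance, by simp [h0]⟩
    · refine ⟨(sfiniteSeq ν n univ).toNNReal, (sfiniteSeq ν n univ)⁻¹ • sfiniteSeq ν n,
        ?_, ?_⟩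
      · have : NeZero (sfiniteSeq ν n) := ⟨h0⟩
        infer_instance
      · rw [ENNReal.smul_def, coe_toNNReal (measure_ne_top _ _), smul_smul,
          ENNReal.mul_inv_cancel (by simpa using h0) (measure_ne_top _ _), one_smul]
  choose r ρ hρ hr using h
  refine ⟨ℕ → ℕ × (ℕ → E), inferInstance, infinitePi fun n => poissonSample (r n) (ρ n),
    inferInstance, fullSample, isPoissonRandomMeasure_fullSample r ρ ?_⟩
  simp only [← hr]
  exact (sum_sfiniteSeq ν).symm

end PoissonExistence

/-! ### Moments of the Poisson law and independence of Poisson measures on disjoint sets -/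

lemma poissonMeasure_singleton_succ (a : ℝ≥0) (n : ℕ) :
    ((n + 1 : ℕ) : ℝ≥0∞) * poissonMeasure a {n + 1} = a * poissonMeasure a {n} := by
  rw [poissonMeasure_singleton, poissonMeasure_singleton, ← ENNReal.ofReal_natCast,
    ← ofReal_mul (by positivity), ← ofReal_coe_nnreal,
    ← ofReal_mul (by positivity)]
  congr 1
  rw [Nat.factorial_succ]
  push_cast
  field_simp
  ring

lemma lintegral_poissonMeasure_natCast (a : ℝ≥0) :
    ∫⁻ n, (n : ℝ≥0∞) ∂(poissonMeasure a) = a := by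
  rw [lintegral_countable', tsum_eq_zero_add' ENNReal.summable]
  simp only [poissonMeasure_singleton_succ, Nat.cast_zero, zero_mul, zero_add]
  rw [ENNReal.tsum_mul_left]
  have h := lintegral_countable' (μ := poissonMeasure a) fun _ : ℕ => (1 : ℝ≥0∞)
  simp only [lintegral_const, measure_univ, mul_one, one_mul] at h
  rw [← h, mul_one]

lemma lintegral_poissonMeasure_two_le (a : ℝ≥0) :
    ∫⁻ n, (if 2 ≤ n then (n : ℝ≥0∞) else 0) ∂(poissonMeasure a) ≤ (a : ℝ≥0∞) ^ 2 := by
  rw [lintegral_countable', tsum_eq_zero_add' ENNReal.summable]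
  have h1 : ∀ n : ℕ, (if 2 ≤ n + 1 then ((n + 1 : ℕ) : ℝ≥0∞) else 0) * poissonMeasure a {n + 1} ≤
      a * ((n : ℝ≥0∞) * poissonMeasure a {n}) := by
    intro n
    by_cases hn : 2 ≤ n + 1
    · rw [if_pos hn, poissonMeasure_singleton_succ]
      gcongr
      rw [← one_mul (poissonMeasure a {n}), ← mul_assoc, mul_one]
      gcongr
      exact_mod_cast (by omega : 1 ≤ n)
    · simp [hn]
  refine (add_le_add le_rfl (tsum_le_tsum h1)).trans ?_
  rw [ENNReal.tsum_mul_left, ← lintegral_countable' (μ := poissonMeasure a)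
    fun n : ℕ => (n : ℝ≥0∞), lintegral_poissonMeasure_natCast]
  simp [sq]

section Independence

variable {α : Type*} {mα : MeasurableSpace α}

/-- Two independent families, each consisting of independent variables, form together one
independent family. -/
lemma iIndepFun_sumElim {ι κ : Type*} {f : ι → Ω → α} {g : κ → Ω → α}
    (hf : iIndepFun f P) (hg : iIndepFun g P)
    (h : Indep (⨆ i, mα.comap (f i)) (⨆ j, mα.comap (g j)) P) :
    iIndepFun (Sum.elim f g) P := by
  rw [iIndepFun_iff_measure_inter_preimage_eq_mul]
  intro S sets hS
  have hl := iIndepFun_iff_measure_inter_preimage_eq_mul.1 hf S.toLeft (sets := fun i => sets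
    (.inl i))
    fun i hi => hS _ (by simpa using hi)
  have hr := iIndepFun_iff_measure_inter_preimage_eq_mul.1 hg S.toRight
    (sets := fun i => sets (.inr i)) fun i hi => hS _ (by simpa using hi)
  rw [Finset.prod_sum_eq_prod_toLeft_mul_prod_toRight]
  have hs : ⋂ i ∈ S, Sum.elim f g i ⁻¹' sets i =
      (⋂ i ∈ S.toLeft, f i ⁻¹' sets (.inl i)) ∩ ⋂ i ∈ S.toRight, g i ⁻¹' sets (.inr i) := by
    ext ω
    simp
  rw [hs, (Indep_iff _ _ _).1 h]
  · simp only [Sum.elim_inl, Sum.elim_inr]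
    rw [hl, hr]
  · refine MeasurableSet.biInter (Finset.countable_toSet _) fun i hi => ?_
    exact le_iSup (fun i => mα.comap (f i)) i _ ⟨_, hS _ (by simpa using hi), rfl⟩
  · refine MeasurableSet.biInter (Finset.countable_toSet _) fun i hi => ?_
    exact le_iSup (fun i => mα.comap (g i)) i _ ⟨_, hS _ (by simpa using hi), rfl⟩

lemma IsPoissonRandomMeasure.iIndepFun_fintype {E : Type*} [MeasurableSpace E]
    {N : Ω → Measure E} {ν : Measure E} (hN : IsPoissonRandomMeasure N ν P) {ι : Type*} [Finite ι]
    {A : ι → Set E} (hA : ∀ i, MeasurableSet (A i))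
    (hd : Pairwise fun i j => Disjoint (A i) (A j)) : iIndepFun (fun i ω => N ω (A i)) P := by
  obtain ⟨n, ⟨e⟩⟩ := Finite.exists_equiv_fin ι
  have h := hN.indep n (fun i => A (e.symm i)) (fun i => hA _)
    fun i j hij => hd (e.symm.injective.ne hij)
  have h2 := h.precomp (g := e) e.injective
  simpa using h2

/-- Sets measurable with respect to a `σ`-algebra completed by null sets agree almost everywhere
with sets of the `σ`-algebra. -/
lemma exists_ae_eq_of_measurableSet_sup {m : MeasurableSpace Ω}
    (hA : MeasurableSet[m ⊔ MeasurableSpace.generateFrom {A | MeasurableSet[mΩ] A ∧ P A = 0}] A) :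
    ∃ A', MeasurableSet[m] A' ∧ A =ᵐ[P] A' := by
  have hle : m ⊔ MeasurableSpace.generateFrom {A | MeasurableSet[mΩ] A ∧ P A = 0} ≤
      eventuallyMeasurableSpace m (ae P) := by
    refine sup_le (le_eventuallyMeasurableSpace) (MeasurableSpace.generateFrom_le fun B hB => ?_)
    exact ⟨∅, @MeasurableSet.empty _ m, ae_eq_empty.2 hB.2⟩
  exact hle A hA

end Independence

/-! ### The combined Poisson measure -/

section Joint

variable {N : Ω → Measure CoagMark} {M : Ω → Measure FragMark}

/-- Inclusion of the coalescence events into the events of both kinds. -/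
def coagIncl (e : CoagMark) : ℝ≥0 × Mark := (e.1, .inl e.2)

/-- Inclusion of the fragmentation events into the events of both kinds. -/
def fragIncl (e : FragMark) : ℝ≥0 × Mark := (e.1, .inr e.2)

lemma measurable_coagIncl : Measurable coagIncl :=
  measurable_fst.prodMk (measurable_inl.comp measurable_snd)

lemma measurable_fragIncl : Measurable fragIncl :=
  measurable_fst.prodMk (measurable_inr.comp measurable_snd)

/-- The superposition of the two random measures, on the space of the events of both kinds. -/
def joint (N : Ω → Measure CoagMark) (M : Ω → Measure FragMark) (ω : Ω) : Measure (ℝ≥0 × Mark) :=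
  (N ω).map coagIncl + (M ω).map fragIncl

lemma joint_apply (ω : Ω) {A : Set (ℝ≥0 × Mark)} (hA : MeasurableSet A) :
    joint N M ω A = N ω (coagIncl ⁻¹' A) + M ω (fragIncl ⁻¹' A) := by
  rw [joint, Measure.add_apply, map_apply measurable_coagIncl hA,
    map_apply measurable_fragIncl hA]

lemma measurable_joint (hN : Measurable N) (hM : Measurable M) : Measurable (joint N M) := by
  refine Measure.measurable_of_measurable_coe _ fun A hA => ?_
  simp only [joint_apply _ hA]
  exact ((measurable_coe (measurable_coagIncl hA)).comp hN).add
    ((measurable_coe (measurable_fragIncl hA)).comp hM)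

lemma intensity_apply [SFinite β] {A : Set (ℝ≥0 × Mark)} (hA : MeasurableSet A) :
    leb.prod (markMeasure β) A =
      coagIntensity (coagIncl ⁻¹' A) + fragIntensity β (fragIncl ⁻¹' A) := by
  have h1 : coagIntensity.map coagIncl =
      leb.prod (((Measure.count : Measure IdxPair).prod leb).map Sum.inl : Measure Mark) := by
    have := Measure.map_prod_map leb ((Measure.count : Measure IdxPair).prod leb)
      (f := id) (g := (Sum.inl : _ → Mark)) measurable_id measurable_inl
    rw [Measure.map_id] at this
    rw [this]; rfl
  have h2 : (fragIntensity β).map fragIncl =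
      leb.prod (((Measure.count : Measure ℕ).prod (β.prod leb)).map Sum.inr : Measure Mark) := by
    have := Measure.map_prod_map leb ((Measure.count : Measure ℕ).prod (β.prod leb))
      (f := id) (g := (Sum.inr : _ → Mark)) measurable_id measurable_inr
    rw [Measure.map_id] at this
    rw [this]; rfl
  rw [markMeasure, Measure.prod_add, Measure.add_apply, ← h1, ← h2,
    map_apply measurable_coagIncl hA, map_apply measurable_fragIncl hA]

lemma IsDrivingPair.map_joint [SFinite β] (h : IsDrivingPair β N M P) {A : Set (ℝ≥0 × Mark)}
    (hA : MeasurableSet A) (hfin : leb.prod (markMeasure β) A ≠ ∞) :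
    P.map (fun ω => joint N M ω A) =
      (poissonMeasure (leb.prod (markMeasure β) A).toNNReal).map (fun n : ℕ => (n : ℝ≥0∞)) := by
  rw [intensity_apply hA] at hfin ⊢
  obtain ⟨h1, h2⟩ := ENNReal.add_ne_top.1 hfin
  have hA1 := measurable_coagIncl hA
  have hA2 := measurable_fragIncl hA
  have hN1 : Measurable fun ω => N ω (coagIncl ⁻¹' A) :=
    (measurable_coe hA1).comp h.coag.measurable
  have hM1 : Measurable fun ω => M ω (fragIncl ⁻¹' A) :=
    (measurable_coe hA2).comp h.frag.measurable
  have hind : IndepFun (fun ω => N ω (coagIncl ⁻¹' A)) (fun ω => M ω (fragIncl ⁻¹' A)) P :=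
    h.indep.comp (measurable_coe hA1) (measurable_coe hA2)
  have := (hind.hasLaw_add_map_cast_poissonMeasure ⟨hN1.aemeasurable, h.coag.poisson _ hA1 h1⟩
    ⟨hM1.aemeasurable, h.frag.poisson _ hA2 h2⟩).map_eq
  rw [ENNReal.toNNReal_add h1 h2]
  simp only [joint_apply _ hA]
  exact this

lemma IsDrivingPair.lintegral_joint [SFinite β] (h : IsDrivingPair β N M P)
    {A : Set (ℝ≥0 × Mark)} (hA : MeasurableSet A) (hfin : leb.prod (markMeasure β) A ≠ ∞) :
    ∫⁻ ω, joint N M ω A ∂P = leb.prod (markMeasure β) A := by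
  have hm : Measurable fun ω => joint N M ω A :=
    (measurable_coe hA).comp (measurable_joint h.coag.measurable h.frag.measurable)
  rw [← lintegral_map (f := fun x => x) measurable_id hm, h.map_joint hA hfin,
    lintegral_map (f := fun x => x) measurable_id (by fun_prop), lintegral_poissonMeasure_natCast,
    coe_toNNReal hfin]

lemma IsDrivingPair.lintegral_joint_two_le [SFinite β] (h : IsDrivingPair β N M P)
    {A : Set (ℝ≥0 × Mark)} (hA : MeasurableSet A) (hfin : leb.prod (markMeasure β) A ≠ ∞) :
    ∫⁻ ω, (if 2 ≤ joint N M ω A then joint N M ω A else 0) ∂P ≤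
      leb.prod (markMeasure β) A ^ 2 := by
  have hm : Measurable fun ω => joint N M ω A :=
    (measurable_coe hA).comp (measurable_joint h.coag.measurable h.frag.measurable)
  have hf : Measurable fun x : ℝ≥0∞ => if 2 ≤ x then x else 0 :=
    Measurable.ite measurableSet_Ici measurable_id measurable_const
  rw [← lintegral_map (f := fun x : ℝ≥0∞ => if 2 ≤ x then x else 0) hf hm, h.map_joint hA hfin,
    lintegral_map hf (by fun_prop)]
  have := lintegral_poissonMeasure_two_le (leb.prod (markMeasure β) A).toNNReal
  rw [coe_toNNReal hfin] at this
  refine le_trans (le_of_eq ?_) this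
  refine lintegral_congr fun n => ?_
  have : (2 ≤ (n : ℝ≥0∞)) ↔ 2 ≤ n := by exact_mod_cast Iff.rfl
  simp [this]

/-- Numbers of points are natural numbers. -/
lemma IsDrivingPair.ae_joint_mem [SFinite β] (h : IsDrivingPair β N M P)
    {A : Set (ℝ≥0 × Mark)} (hA : MeasurableSet A) (hfin : leb.prod (markMeasure β) A ≠ ∞) :
    ∀ᵐ ω ∂P, ∃ n : ℕ, joint N M ω A = n := by
  have hm : Measurable fun ω => joint N M ω A :=
    (measurable_coe hA).comp (measurable_joint h.coag.measurable h.frag.measurable)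
  have hS : MeasurableSet (Set.range fun n : ℕ => (n : ℝ≥0∞)) :=
    (Set.countable_range _).measurableSet
  have h1 : ∀ᵐ x ∂(P.map fun ω => joint N M ω A), x ∈ Set.range fun n : ℕ => (n : ℝ≥0∞) := by
    rw [h.map_joint hA hfin, ae_map_iff (p := fun x => x ∈ Set.range fun n : ℕ => (n : ℝ≥0∞))
      (Measurable.of_discrete).aemeasurable hS]
    exact .of_forall fun n => ⟨n, rfl⟩
  filter_upwards [ae_of_ae_map hm.aemeasurable h1] with ω hω
  obtain ⟨n, hn⟩ := hω
  exact ⟨n, hn.symm⟩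

lemma measurableSpace_measure_comap {E : Type*} [MeasurableSpace E] (N : Ω → Measure E) :
    MeasurableSpace.comap N inferInstance = ⨆ A : {A : Set E // MeasurableSet A},
      MeasurableSpace.comap (fun ω => N ω A) inferInstance := by
  have h : (inferInstance : MeasurableSpace (Measure E)) = ⨆ A : {A : Set E // MeasurableSet A},
      MeasurableSpace.comap (fun μ : Measure E => μ A) inferInstance := by
    rw [iSup_subtype]; rfl
  rw [h, MeasurableSpace.comap_iSup]
  simp only [MeasurableSpace.comap_comp]
  rfl

lemma pastSigma_eq {E : Type*} [MeasurableSpace E] (N : Ω → Measure (ℝ≥0 × E)) (t : ℝ≥0) :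
    pastSigma N t = ⨆ A : {A : Set (ℝ≥0 × E) // MeasurableSet A},
      MeasurableSpace.comap (fun ω => N ω ((Iic t ×ˢ univ) ∩ A)) inferInstance := by
  rw [pastSigma, measurableSpace_measure_comap]
  refine iSup_congr fun A => ?_
  congr 1
  funext ω
  rw [restrict_apply A.2, Set.inter_comm]

/-- The cells into which a finite family `G` of sets cuts the set `S`, and one further set `T`. -/
def cell {E : Type*} {p : Set E → Prop} (S T : Set E) (G : Finset {A : Set E // p A}) : Option
    (Set G) → Set E
  | none => T
  | some σ => S ∩ {x | ∀ A : G, x ∈ A.1.1 ↔ A ∈ σ}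

section Cells

variable {E : Type*} [MeasurableSpace E] {S T : Set E} (G : Finset {A : Set E // MeasurableSet A})

lemma measurableSet_cell (hS : MeasurableSet S) (hT : MeasurableSet T) (i : Option (Set G)) :
    MeasurableSet (cell S T G i) := by
  rcases i with _ | σ
  · exact hT
  · refine hS.inter ?_
    simp only [Set.ofPred_forall]
    refine MeasurableSet.iInter fun A => ?_
    by_cases hA : A ∈ σ
    · simp only [hA, iff_true]
      exact A.1.2
    · simp only [hA, iff_false]
      exact A.1.2.compl

lemma pairwise_disjoint_cell (hST : Disjoint S T) :
    Pairwise fun i j => Disjoint (cell S T G i) (cell S T G j) := by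
  have h1 : ∀ σ : Set G, Disjoint (cell S T G (some σ)) (cell S T G none) := fun σ =>
    hST.mono_left Set.inter_subset_left
  rintro (_ | σ) (_ | σ') h
  · exact absurd rfl h
  · exact (h1 σ').symm
  · exact h1 σ
  · refine Set.disjoint_left.2 fun x hx hx' => h ?_
    congr 1
    ext A
    exact (hx.2 A).symm.trans (hx'.2 A)

lemma comap_inter_le_iSup_cell (hS : MeasurableSet S) (hT : MeasurableSet T)
    (hST : Disjoint S T) (N : Ω → Measure E) (A : G) :
    MeasurableSpace.comap (fun ω => N ω (S ∩ A.1)) inferInstance ≤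
      ⨆ i ∈ Set.range (some : Set G → Option (Set G)),
        MeasurableSpace.comap (fun ω => N ω (cell S T G i)) inferInstance := by
  classical
  have h : ∀ ω, N ω (S ∩ A.1) =
      ∑ σ ∈ Finset.univ.filter (fun σ : Set G => A ∈ σ), N ω (cell S T G (some σ)) := by
    intro ω
    rw [← measure_biUnion_finset (fun σ _ σ' _ h => pairwise_disjoint_cell G hST
      (Option.some_injective _ |>.ne h)) fun σ _ => measurableSet_cell G hS hT _]
    congr 1
    ext x
    simp only [Set.mem_iUnion, mem_filter, Finset.mem_univ, true_and, cell]
    constructor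
    · intro hx
      exact ⟨{B | x ∈ B.1.1}, hx.2, hx.1, fun B => Iff.rfl⟩
    · rintro ⟨σ, hσ, hx⟩
      exact ⟨hx.1, (hx.2 A).2 hσ⟩
  simp only [h]
  refine Measurable.comap_le ?_
  refine Finset.measurable_fun_sum _ fun σ _ => ?_
  refine Measurable.mono (comap_measurable _) ?_ le_rfl
  exact le_iSup₂ (f := fun (i : Option (Set G)) (_ : i ∈ Set.range (some : Set G → Option
    (Set G))) =>
    MeasurableSpace.comap (fun ω => N ω (cell S T G i)) inferInstance) (some σ) ⟨σ, rfl⟩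

end Cells

/-- The past of the two driving measures is independent of the number of points in a later
rectangle. -/
lemma IsDrivingPair.indep_past [IsProbabilityMeasure P] (h : IsDrivingPair β N M P) {C : Set Mark}
    (hC : MeasurableSet C) :
    Indep (pastSigma N s ⊔ pastSigma M s)
      (MeasurableSpace.comap (fun ω => joint N M ω (Ioc s t ×ˢ C)) inferInstance) P := by
  have hA : MeasurableSet (Ioc s t ×ˢ C) := measurableSet_Ioc.prod hC
  have hNm := h.coag.measurable
  have hMm := h.frag.measurable
  set S1 : Set CoagMark := Iic s ×ˢ univ
  set S2 : Set FragMark := Iic s ×ˢ univ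
  set T1 : Set CoagMark := coagIncl ⁻¹' (Ioc s t ×ˢ C)
  set T2 : Set FragMark := fragIncl ⁻¹' (Ioc s t ×ˢ C)
  have hS1 : MeasurableSet S1 := measurableSet_Iic.prod .univ
  have hS2 : MeasurableSet S2 := measurableSet_Iic.prod .univ
  have hT1 : MeasurableSet T1 := measurable_coagIncl hA
  have hT2 : MeasurableSet T2 := measurable_fragIncl hA
  have hd1 : Disjoint S1 T1 := Set.disjoint_left.2 fun x hx hx' =>
    absurd (hx'.1.1 : s < x.1) (not_lt.2 hx.1)
  have hd2 : Disjoint S2 T2 := Set.disjoint_left.2 fun x hx hx' =>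
    absurd (hx'.1.1 : s < x.1) (not_lt.2 hx.1)
  have hev : ∀ {E : Type} [MeasurableSpace E] {N : Ω → Measure E} {A : Set E}, Measurable N →
      MeasurableSet A → MeasurableSpace.comap (fun ω => N ω A) inferInstance ≤ mΩ :=
    fun hN hA => ((measurable_coe hA).comp hN).comap_le
  let m : Finset {A : Set CoagMark // MeasurableSet A} × Finset
    {A : Set FragMark // MeasurableSet A}
      → MeasurableSpace Ω := fun G =>
    (⨆ A ∈ G.1, MeasurableSpace.comap (fun ω => N ω (S1 ∩ A)) inferInstance) ⊔
      ⨆ A ∈ G.2, MeasurableSpace.comap (fun ω => M ω (S2 ∩ A)) inferInstance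
  have hm : pastSigma N s ⊔ pastSigma M s ≤ ⨆ G, m G := by
    rw [pastSigma_eq, pastSigma_eq]
    refine sup_le (iSup_le fun A => ?_) (iSup_le fun A => ?_)
    · refine le_trans (le_trans ?_ le_sup_left) (le_iSup m ({A}, ∅))
      simp [S1]
    · refine le_trans (le_trans ?_ le_sup_right) (le_iSup m (∅, {A}))
      simp [S2]
  refine indep_of_indep_of_le_left ?_ hm
  refine indep_iSup_of_directed_le (fun G => ?_) (fun G => ?_)
    (hev (measurable_joint hNm hMm) hA) ?_
  · have hI : iIndepFun (Sum.elim (fun i ω => N ω (cell S1 T1 G.1 i))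
        (fun i ω => M ω (cell S2 T2 G.2 i))) P := by
      refine iIndepFun_sumElim
        (h.coag.iIndepFun_fintype (measurableSet_cell _ hS1 hT1) (pairwise_disjoint_cell _ hd1))
        (h.frag.iIndepFun_fintype (measurableSet_cell _ hS2 hT2) (pairwise_disjoint_cell _ hd2)) ?_
      refine indep_of_indep_of_le_left (indep_of_indep_of_le_right h.indep ?_) ?_
      · rw [measurableSpace_measure_comap]
        exact iSup_le fun i => le_iSup (fun A : {A : Set FragMark // MeasurableSet A} =>
          MeasurableSpace.comap (fun ω => M ω A) inferInstance)
            ⟨_, measurableSet_cell G.2 hS2 hT2 i⟩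
      · rw [measurableSpace_measure_comap]
        exact iSup_le fun i => le_iSup (fun A : {A : Set CoagMark // MeasurableSet A} =>
          MeasurableSpace.comap (fun ω => N ω A) inferInstance)
            ⟨_, measurableSet_cell G.1 hS1 hT1 i⟩
    rw [iIndepFun_iff_iIndep] at hI
    have hle : ∀ i, MeasurableSpace.comap ((Sum.elim (fun i ω => N ω (cell S1 T1 G.1 i))
        (fun i ω => M ω (cell S2 T2 G.2 i))) i) inferInstance ≤ mΩ := by
      rintro (i | i)
      · exact hev hNm (measurableSet_cell _ hS1 hT1 i)
      · exact hev hMm (measurableSet_cell _ hS2 hT2 i)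
    have hdis : Disjoint (Sum.inl '' (Set.range some) ∪ Sum.inr '' (Set.range some) :
        Set (Option (Set G.1) ⊕ Option (Set G.2))) {Sum.inl none, Sum.inr none} := by
      refine Set.disjoint_left.2 fun x hx hx' => ?_
      rcases hx' with rfl | rfl <;> simp at hx
    have := indep_iSup_of_disjoint hle hI hdis
    refine indep_of_indep_of_le_left (indep_of_indep_of_le_right this ?_) ?_
    · simp only [joint_apply _ hA]
      refine Measurable.comap_le (Measurable.add ?_ ?_)
      · refine Measurable.mono (comap_measurable _) ?_ le_rfl
        exact le_iSup₂_of_le (Sum.inl none) (by simp) le_rfl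
      · refine Measurable.mono (comap_measurable _) ?_ le_rfl
        exact le_iSup₂_of_le (Sum.inr none) (by simp) le_rfl
    · refine sup_le (iSup₂_le fun A hA => ?_) (iSup₂_le fun A hA => ?_)
      · refine (comap_inter_le_iSup_cell G.1 hS1 hT1 hd1 N ⟨A, hA⟩).trans ?_
        exact iSup₂_le fun i hi => le_iSup₂_of_le (Sum.inl i) (Or.inl ⟨i, hi, rfl⟩) le_rfl
      · refine (comap_inter_le_iSup_cell G.2 hS2 hT2 hd2 M ⟨A, hA⟩).trans ?_
        exact iSup₂_le fun i hi => le_iSup₂_of_le (Sum.inr i) (Or.inr ⟨i, hi, rfl⟩) le_rfl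
  · exact sup_le (iSup₂_le fun A _ => hev hNm (hS1.inter A.2))
      (iSup₂_le fun A _ => hev hMm (hS2.inter A.2))
  · classical
    intro G H
    refine ⟨(G.1 ∪ H.1, G.2 ∪ H.2), ?_, ?_⟩
    · exact sup_le_sup (biSup_mono fun A hA => Finset.mem_union_left _ hA)
        (biSup_mono fun A hA => Finset.mem_union_left _ hA)
    · exact sup_le_sup (biSup_mono fun A hA => Finset.mem_union_right _ hA)
        (biSup_mono fun A hA => Finset.mem_union_right _ hA)

/-- The compensation formula on rectangles, for events of the completed canonical filtration. -/
lemma IsDrivingPair.setLIntegral_joint [IsProbabilityMeasure P] [SFinite β]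
    (h : IsDrivingPair β N M P) {C : Set Mark} (hC : MeasurableSet C) (hst : s ≤ t)
    (hfin : markMeasure β C ≠ ∞)
    (hA : MeasurableSet[canonicalFiltration h.coag.measurable h.frag.measurable P s] A) :
    ∫⁻ ω in A, joint N M ω (Ioc s t ×ˢ C) ∂P = P A * ((t - s : ℝ≥0) * markMeasure β C) := by
  have hS : MeasurableSet (Ioc s t ×ˢ C) := measurableSet_Ioc.prod hC
  have hν : leb.prod (markMeasure β) (Ioc s t ×ˢ C) = (t - s : ℝ≥0) * markMeasure β C := by
    have : SFinite (markMeasure β) := by unfold markMeasure; infer_instance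
    rw [prod_prod, leb_Ioc hst]
  have hJm := measurable_joint h.coag.measurable h.frag.measurable
  obtain ⟨A', hA', hAA⟩ := exists_ae_eq_of_measurableSet_sup (P := P)
    (m := pastSigma N s ⊔ pastSigma M s) hA
  have hle : pastSigma N s ⊔ pastSigma M s ≤ mΩ :=
    sup_le (pastSigma_le h.coag.measurable s) (pastSigma_le h.frag.measurable s)
  rw [setLIntegral_congr hAA, measure_congr hAA, ← hν, ← h.lintegral_joint hS (by
    rw [hν]; exact mul_ne_top coe_ne_top hfin)]
  rw [← lintegral_indicator (hle _ hA')]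
  have hind := (h.indep_past (s := s) (t := t) hC)
  have hi : ∀ ω, A'.indicator (fun ω => joint N M ω (Ioc s t ×ˢ C)) ω =
      A'.indicator 1 ω * joint N M ω (Ioc s t ×ˢ C) := fun ω => by
    by_cases hω : ω ∈ A' <;> simp [hω]
  simp only [hi]
  have hf : Measurable[pastSigma N s ⊔ pastSigma M s] (A'.indicator (fun _ => (1 : ℝ≥0∞))) :=
    Measurable.indicator measurable_const hA'
  have key := lintegral_mul_eq_lintegral_mul_lintegral_of_independent_measurableSpace
    (f := A'.indicator fun _ => (1 : ℝ≥0∞)) (g := fun ω => joint N M ω (Ioc s t ×ˢ C)) hle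
    (((measurable_coe hS).comp hJm).comap_le) hind hf (comap_measurable _)
  refine key.trans ?_
  rw [lintegral_indicator_const (hle _ hA'), one_mul]

lemma measurable_joint_rect {hN : Measurable N} {hM : Measurable M} (s t : ℝ≥0) {C : Set Mark}
    (hC : MeasurableSet C) :
    Measurable[canonicalFiltration hN hM P t] fun ω => joint N M ω (Ioc s t ×ˢ C) := by
  have hS : MeasurableSet (Ioc s t ×ˢ C) := measurableSet_Ioc.prod hC
  have key : ∀ {E : Type} [MeasurableSpace E] (N : Ω → Measure (ℝ≥0 × E)) (A : Set (ℝ≥0 × E)),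
      MeasurableSet A → A ⊆ Iic t ×ˢ univ → Measurable[pastSigma N t] fun ω => N ω A := by
    intro E _ N A hA hsub
    have : (fun ω => N ω A) = fun ω => (N ω).restrict (Iic t ×ˢ univ) A := by
      funext ω
      rw [restrict_apply hA, Set.inter_eq_left.2 hsub]
    rw [this]
    exact (measurable_coe hA).comp (comap_measurable _)
  simp only [joint_apply _ hS]
  refine Measurable.add ?_ ?_
  · exact (key N _ (measurable_coagIncl hS) fun x hx => ⟨hx.1.2, trivial⟩).mono
      (le_sup_left.trans le_sup_left) le_rfl
  · exact (key M _ (measurable_fragIncl hS) fun x hx => ⟨hx.1.2, trivial⟩).mono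
      (le_sup_right.trans le_sup_left) le_rfl

end Joint

/-! ### The atoms of the driving measure -/

lemma exists_measurable_injective : ∃ f : ℝ≥0 × Mark → ℝ, Measurable f ∧ Function.Injective f := by
  let g : Mark → ℕ × ℕ × ℕ × ℝ≥0 × (ℕ → ℝ≥0) := Sum.elim
    (fun q => (0, q.1.1.1, q.1.1.2, q.2, 0)) (fun q => (1, q.1, 0, q.2.2, q.2.1.1))
  have hg : Measurable g := by
    refine Measurable.sumElim ?_ ?_
    · have h : Measurable fun q : IdxPair × ℝ≥0 => q.1.1 :=
        measurable_subtype_coe.comp measurable_fst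
      exact measurable_const.prodMk (h.fst.prodMk (h.snd.prodMk
        (measurable_snd.prodMk measurable_const)))
    · have h : Measurable fun q : ℕ × Ratios × ℝ≥0 => q.2.1.1 :=
        measurable_subtype_coe.comp measurable_snd.fst
      exact measurable_const.prodMk (measurable_fst.prodMk (measurable_const.prodMk
        (measurable_snd.snd.prodMk h)))
  have hgi : Function.Injective g := by
    rintro (⟨⟨⟨i, j⟩, hij⟩, z⟩ | ⟨i, θ, z⟩) (⟨⟨⟨i', j'⟩, hij'⟩, z'⟩ | ⟨i', θ', z'⟩) h
    · simp only [g, Sum.elim_inl, Prod.mk.injEq] at h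
      obtain ⟨-, rfl, rfl, rfl, -⟩ := h
      rfl
    · simp [g] at h
    · simp [g] at h
    · simp only [g, Sum.elim_inr, Prod.mk.injEq] at h
      obtain ⟨-, rfl, -, rfl, h⟩ := h
      rw [Subtype.ext h]
  refine ⟨fun x => embeddingReal (ℝ≥0 × ℕ × ℕ × ℕ × ℝ≥0 × (ℕ → ℝ≥0)) (x.1, g x.2),
    (measurableEmbedding_embeddingReal _).measurable.comp
      (measurable_fst.prodMk (hg.comp measurable_snd)), fun x y h => ?_⟩
  have := (measurableEmbedding_embeddingReal _).injective h
  exact Prod.ext (Prod.mk.injEq .. ▸ this).1 (hgi (Prod.mk.injEq .. ▸ this).2)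

/-- The region of the events before time `n` with marks in `markBox n`. -/
def window (n : ℕ) : Set (ℝ≥0 × Mark) := Iic (n : ℝ≥0) ×ˢ markBox n

lemma measurableSet_window (n : ℕ) : MeasurableSet (window n) :=
  measurableSet_Iic.prod (measurableSet_markBox n)

lemma exists_mem_window (x : ℝ≥0 × Mark) : ∃ n, x ∈ window n := by
  obtain ⟨n, hn⟩ := exists_nat_ge x.1
  obtain ⟨l, hl⟩ := exists_mem_markBox x.2
  exact ⟨max n l, hn.trans (by exact_mod_cast le_max_left _ _), markBox_mono (le_max_right _ _) hl⟩

/-- The times of the events of a configuration. -/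
def times (π : Measure (ℝ≥0 × Mark)) : Set ℝ≥0 := {r | π ({r} ×ˢ univ) ≠ 0}

instance : Nonempty Mark := ⟨.inr (0, ⟨0, antitone_const, one_pos⟩, 0)⟩

/-- The mark of the event at time `r`. -/
def markAt (π : Measure (ℝ≥0 × Mark)) (r : ℝ≥0) : Mark :=
  Classical.epsilon fun e => π {(r, e)} ≠ 0

/-- Marks with positive `z` and, for fragmentations, a ratio sequence without gain of mass and with
at most `k` fragments. -/
def IsGoodMark (k : ℕ) : Mark → Prop
  | .inl (_, z) => 0 < z
  | .inr (_, θ, z) => 0 < z ∧ IsGoodRatio k θ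

/-- The configurations of events that occur almost surely: Dirac masses at distinct positive times,
with good marks, finitely many in each window. -/
structure IsConfig (k : ℕ) (π : Measure (ℝ≥0 × Mark)) : Prop where
  eq_sum : π = sum fun r : times π => dirac ((r : ℝ≥0), markAt π r)
  pos : ∀ r ∈ times π, 0 < r
  finite : ∀ n t, {r | r ∈ times π ∧ r ≤ t ∧ markAt π r ∈ markBox n}.Finite
  good : ∀ r ∈ times π, IsGoodMark k (markAt π r)
  countable : (times π).Countable

/-- The windows cut by rational intervals separate points and have natural numbers as masses, so
that the mass of a point is `0` or `1` and almost all points are atoms. -/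
lemma isConfig_of_forall {π : Measure (ℝ≥0 × Mark)} {f : ℝ≥0 × Mark → ℝ} (hf : Measurable f)
    (hfi : Function.Injective f)
    (hnat : ∀ (n : ℕ) (p q : ℚ), ∃ j : ℕ, π (window n ∩ f ⁻¹' Ioo (p : ℝ) q) = j)
    (hfin : ∀ n, π (window n) < ∞) (hsimple : ∀ n r, π ({r} ×ˢ markBox n) < 2)
    (hzero : π ({0} ×ˢ univ) = 0) (hgood : π (univ ×ˢ {e | ¬ IsGoodMark k e}) = 0) :
    IsConfig k π := by
  have hsing : ∀ x : ℝ≥0 × Mark, MeasurableSet {x} := fun x => by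
    rw [← hfi.preimage_image {x}, Set.image_singleton]
    exact hf (measurableSet_singleton _)
  -- the mass of a point is approximated from above by the masses of small sets
  have happrox : ∀ n, ∀ x ∈ window n, ∀ c, π {x} < c → ∃ p q : ℚ, f x ∈ Ioo (p : ℝ) q ∧
      π {x} ≤ π (window n ∩ f ⁻¹' Ioo (p : ℝ) q) ∧
      π (window n ∩ f ⁻¹' Ioo (p : ℝ) q) < c := by
    intro n x hx c hc
    have ht := tendsto_measure_biInter_gt (μ := π) (a := (0 : ℝ))
      (s := fun ε => window n ∩ f ⁻¹' Ioo (f x - ε) (f x + ε))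
      (fun ε _ => ((measurableSet_window n).inter (hf measurableSet_Ioo)).nullMeasurableSet)
      (fun ε ε' _ h => Set.inter_subset_inter_right _ (Set.preimage_mono
        (Set.Ioo_subset_Ioo (by linarith) (by linarith))))
      ⟨1, one_pos, ((measure_mono Set.inter_subset_left).trans_lt (hfin n)).ne⟩
    have he : ⋂ ε > (0 : ℝ), window n ∩ f ⁻¹' Ioo (f x - ε) (f x + ε) = {x} := by
      ext y
      simp only [Set.mem_iInter, Set.mem_singleton_iff]
      constructor
      · intro h
        refine hfi (eq_of_forall_dist_le fun ε hε => ?_)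
        have := (h ε hε).2
        rw [Real.dist_eq]
        exact abs_le.2 ⟨by linarith [this.1], by linarith [this.2]⟩
      · rintro rfl ε hε
        exact ⟨hx, by simpa using hε⟩
    rw [he] at ht
    obtain ⟨ε, hε, hε0⟩ := ((ht.eventually (gt_mem_nhds hc)).and self_mem_nhdsWithin).exists
    have hε0' : (0 : ℝ) < ε := hε0
    obtain ⟨p, hp1, hp2⟩ := exists_rat_btwn (sub_lt_self (f x) hε0')
    obtain ⟨q, hq1, hq2⟩ := exists_rat_btwn (lt_add_of_pos_right (f x) hε0')
    refine ⟨p, q, ⟨hp2, hq1⟩, measure_mono ?_, (measure_mono ?_).trans_lt hε⟩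
    · rintro y rfl
      exact ⟨hx, hp2, hq1⟩
    · exact Set.inter_subset_inter_right _ (Set.preimage_mono
        (Set.Ioo_subset_Ioo hp1.le hq2.le))
  have hle1 : ∀ x, π {x} ≠ 0 → π {x} = 1 := by
    intro x hx
    obtain ⟨n, hn⟩ := exists_mem_window x
    have hlt2 : π {x} < 2 := (measure_mono (by
      rintro y rfl; exact ⟨rfl, hn.2⟩)).trans_lt (hsimple n x.1)
    obtain ⟨p, q, -, h1, h2⟩ := happrox n x hn 2 hlt2
    obtain ⟨j, hj⟩ := hnat n p q
    rw [hj] at h1 h2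
    have hj2 : j < 2 := by exact_mod_cast h2
    have h1' : π {x} ≤ 1 := h1.trans (by exact_mod_cast (by omega : j ≤ 1))
    refine le_antisymm h1' (not_lt.1 fun hlt => hx ?_)
    obtain ⟨p, q, -, h1, h2⟩ := happrox n x hn 1 hlt
    obtain ⟨j, hj⟩ := hnat n p q
    rw [hj] at h1 h2
    have hj0 : j = 0 := by
      have : j < 1 := by exact_mod_cast h2
      omega
    rw [hj0] at h1
    exact le_antisymm (by simpa using h1) bot_le
  set S : Set (ℝ≥0 × Mark) := {x | π {x} ≠ 0} with hS
  have hnull : π Sᶜ = 0 := by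
    have hsub : Sᶜ ⊆ ⋃ n, ⋃ v ∈ {v : ℚ × ℚ | π (window n ∩ f ⁻¹' Ioo (v.1 : ℝ) v.2) = 0},
        window n ∩ f ⁻¹' Ioo (v.1 : ℝ) v.2 := by
      intro x hx
      have hx0 : π {x} = 0 := not_not.1 hx
      obtain ⟨n, hn⟩ := exists_mem_window x
      obtain ⟨p, q, hxpq, -, h2⟩ := happrox n x hn 1 (by rw [hx0]; exact one_pos)
      obtain ⟨j, hj⟩ := hnat n p q
      have hj0 : j = 0 := by
        rw [hj] at h2
        have : j < 1 := by exact_mod_cast h2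
        omega
      refine Set.mem_iUnion.2 ⟨n, Set.mem_biUnion (x := (p, q)) ?_ ⟨hn, hxpq⟩⟩
      change π (window n ∩ f ⁻¹' Ioo (p : ℝ) q) = 0
      rw [hj, hj0, Nat.cast_zero]
    refine measure_mono_null hsub (measure_iUnion_null fun n => ?_)
    exact (measure_biUnion_null_iff (Set.to_countable _)).2 fun v hv => hv
  have hSfin : ∀ n, (S ∩ window n).Finite := by
    intro n
    refine (Measure.finite_const_le_meas_of_disjoint_iUnion π one_pos
      (As := fun x => {x} ∩ window n) (fun x => (hsing x).inter (measurableSet_window n))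
      (fun x y h => (Set.disjoint_singleton.2 h).mono Set.inter_subset_left Set.inter_subset_left)
      ((measure_mono (Set.iUnion_subset fun x => Set.inter_subset_right)).trans_lt
        (hfin n)).ne).subset ?_
    rintro x ⟨hx, hn⟩
    change 1 ≤ π ({x} ∩ window n)
    rw [Set.inter_eq_left.2 (Set.singleton_subset_iff.2 hn), hle1 x hx]
  have huniq : ∀ r e e', (r, e) ∈ S → (r, e') ∈ S → e = e' := by
    intro r e e' he he'
    by_contra hne
    obtain ⟨n, hn⟩ := exists_mem_window (r, e)
    obtain ⟨n', hn'⟩ := exists_mem_window (r, e')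
    have hdis : Disjoint ({(r, e)} : Set (ℝ≥0 × Mark)) {(r, e')} := by simp [hne]
    have h := measure_union (μ := π) hdis (hsing (r, e'))
    rw [hle1 _ he, hle1 _ he', one_add_one_eq_two] at h
    refine absurd (hsimple (max n n') r) (not_lt.2 (h ▸ measure_mono ?_))
    rintro x (rfl | rfl)
    · exact ⟨rfl, markBox_mono (le_max_left _ _) hn.2⟩
    · exact ⟨rfl, markBox_mono (le_max_right _ _) hn'.2⟩
  have hmark : ∀ r ∈ times π, (r, markAt π r) ∈ S := by
    intro r hr
    have : ∃ e, π {(r, e)} ≠ 0 := by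
      by_contra! h
      refine hr (measure_mono_null ?_ hnull)
      rintro ⟨r', e⟩ ⟨rfl, -⟩
      exact not_not.2 (h e)
    exact Classical.epsilon_spec (p := fun e => π {(r, e)} ≠ 0) this
  have htimes : ∀ x ∈ S, x.1 ∈ times π := by
    intro x hx h0
    refine hx (measure_mono_null ?_ h0)
    rintro y rfl
    exact ⟨rfl, trivial⟩
  have hSeq : ∀ x ∈ S, x = (x.1, markAt π x.1) := fun x hx =>
    Prod.ext rfl (huniq x.1 _ _ hx (hmark _ (htimes x hx)))
  have hSc : S.Countable := by
    refine (Set.countable_iUnion fun n => (hSfin n).countable).mono fun x hx => ?_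
    obtain ⟨n, hn⟩ := exists_mem_window x
    exact Set.mem_iUnion.2 ⟨n, hx, hn⟩
  have hTc : (times π).Countable := by
    have hsub : times π ⊆ Prod.fst '' S := fun r hr => ⟨(r, markAt π r), hmark r hr, rfl⟩
    exact (hSc.image Prod.fst).mono hsub
  refine ⟨?_, fun r hr => ?_, fun n t => ?_, fun r hr => ?_, hTc⟩
  · have := hTc.to_subtype
    refine Measure.ext fun A hA => ?_
    rw [Measure.sum_apply _ hA]
    have h1 : π A = π (⋃ r : times π, A ∩ {((r : ℝ≥0), markAt π r)}) := by
      refine le_antisymm ?_ (measure_mono (Set.iUnion_subset fun r => Set.inter_subset_left))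
      have hsub : A ⊆ (⋃ r : times π, A ∩ {((r : ℝ≥0), markAt π r)}) ∪ Sᶜ := by
        intro x hx
        by_cases hxS : x ∈ S
        · exact Or.inl (Set.mem_iUnion.2 ⟨⟨x.1, htimes x hxS⟩, hx, hSeq x hxS⟩)
        · exact Or.inr hxS
      refine (measure_mono hsub).trans ((measure_union_le _ _).trans ?_)
      rw [hnull, add_zero]
    rw [h1, measure_iUnion]
    · refine tsum_congr fun r => ?_
      rw [dirac_apply' _ hA]
      by_cases hr : ((r : ℝ≥0), markAt π r) ∈ A
      · rw [Set.inter_eq_right.2 (Set.singleton_subset_iff.2 hr), hle1 _ (hmark r r.2)]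
        simp [hr]
      · rw [Set.inter_singleton_eq_empty.2 hr]
        simp [hr]
    · intro r r' h
      refine Set.disjoint_left.2 fun x hx hx' => h (Subtype.ext ?_)
      exact (congrArg Prod.fst (hx.2 : x = _)).symm.trans (congrArg Prod.fst (hx'.2 : x = _))
    · exact fun r => hA.inter (hsing _)
  · refine pos_iff_ne_zero.2 ?_
    rintro rfl
    exact hr hzero
  · obtain ⟨l, hl⟩ := exists_nat_ge t
    refine ((hSfin (max n l)).image Prod.fst).subset fun r hr => ?_
    refine ⟨_, ⟨hmark r hr.1, ?_, markBox_mono (le_max_left _ _) hr.2.2⟩, rfl⟩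
    exact hr.2.1.trans (hl.trans (by exact_mod_cast le_max_right _ _))
  · by_contra hbad
    refine hmark r hr (measure_mono_null ?_ hgood)
    rintro y rfl
    exact ⟨trivial, hbad⟩

lemma measurableSet_isGoodMark (k : ℕ) : MeasurableSet {e | IsGoodMark k e} := by
  have h1 : Measurable fun q : IdxPair × ℝ≥0 => q.2 := measurable_snd
  have h2 : Measurable fun q : ℕ × Ratios × ℝ≥0 => q.2.2 := measurable_snd.snd
  have h3 : Measurable fun q : ℕ × Ratios × ℝ≥0 => q.2.1 := measurable_snd.fst
  have he : {e | IsGoodMark k e} = Sum.inl '' {q : IdxPair × ℝ≥0 | 0 < q.2} ∪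
      Sum.inr '' {q : ℕ × Ratios × ℝ≥0 | 0 < q.2.2 ∧ IsGoodRatio k q.2.1} := by
    ext (⟨p, z⟩ | ⟨i, θ, z⟩) <;> simp [IsGoodMark]
  rw [he]
  exact (measurableSet_inl_image.2 (measurableSet_lt measurable_const h1)).union
    (measurableSet_inr_image.2 ((measurableSet_lt measurable_const h2).inter
      (h3 (measurableSet_isGoodRatio k))))

lemma markMeasure_not_isGoodMark {β : Measure Ratios} [SFinite β] (hk : ∀ᵐ θ ∂β, IsGoodRatio k θ)
    : markMeasure β {e | ¬ IsGoodMark k e} = 0 := by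
  have hm : MeasurableSet {e | ¬ IsGoodMark k e} := (measurableSet_isGoodMark k).compl
  rw [← lintegral_indicator_one hm, lintegral_markMeasure (measurable_one.indicator hm)]
  have hz : ∀ᵐ z ∂leb, 0 < z := by
    have : ∀ᵐ z ∂leb, z ≠ 0 := by rw [ae_iff]; simp
    exact this.mono fun z hz => pos_iff_ne_zero.2 hz
  have e1 : ∀ p : IdxPair, ∫⁻ z, {e | ¬ IsGoodMark k e}.indicator 1 (Sum.inl (p, z)) ∂leb = 0 := by
    intro p
    rw [← lintegral_zero (μ := leb)]
    refine lintegral_congr_ae (hz.mono fun z hz => ?_)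
    simp [IsGoodMark, hz]
  have e2 : ∀ i : ℕ, ∫⁻ θ, ∫⁻ z, {e | ¬ IsGoodMark k e}.indicator 1 (Sum.inr (i, θ, z)) ∂leb ∂β
      = 0 := by
    intro i
    rw [← lintegral_zero (μ := β)]
    refine lintegral_congr_ae (hk.mono fun θ hθ => ?_)
    change _ = (0 : ℝ≥0∞)
    rw [← lintegral_zero (μ := leb)]
    refine lintegral_congr_ae (hz.mono fun z hz => ?_)
    simp [IsGoodMark, hz, hθ]
  simp [e1, e2]

section AlmostSure

variable {N : Ω → Measure CoagMark} {M : Ω → Measure FragMark}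

instance [SFinite β] : SFinite (markMeasure β) := by unfold markMeasure; infer_instance

lemma intensity_Ioc [SFinite β] (h : s ≤ t) (C : Set Mark) :
    leb.prod (markMeasure β) (Ioc s t ×ˢ C) = (t - s : ℝ≥0) * markMeasure β C := by
  rw [prod_prod, leb_Ioc h]

include hβ in
/-- Two simultaneous events in a box fall into the same cell of every grid; with `m + 1` cells the
probability that some cell holds two events is of order `1 / (m + 1)`. -/
lemma IsDrivingPair.ae_simple (h : IsDrivingPair β N M P) (n l : ℕ) :
    ∀ᵐ ω ∂P, ∀ r : ℝ≥0, 0 < r → r ≤ l → joint N M ω ({r} ×ˢ markBox n) < 2 := by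
  have := hβ.isFinite
  have hν := finite_markBox hβ n
  set ν := markMeasure β (markBox n)
  set Bad : Set Ω := {ω | ∃ r : ℝ≥0, 0 < r ∧ r ≤ l ∧ 2 ≤ joint N M ω ({r} ×ˢ markBox n)}
  have hJ : ∀ m : ℕ, P Bad ≤ (l * ν) ^ 2 / ((m + 1 : ℕ) : ℝ≥0∞) := by
    intro m
    -- two events at one time fall into the same interval of every subdivision of `(0, l]`
    set h0 : ℝ≥0 := (l : ℝ≥0) / (m + 1 : ℕ) with hh0
    have hm0 : ((m + 1 : ℕ) : ℝ≥0) ≠ 0 := by exact_mod_cast Nat.succ_ne_zero m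
    have hsub : Bad ⊆ ⋃ i ∈ range (m + 1),
        {ω | 2 ≤ joint N M ω (Ioc (i * h0) ((i + 1 : ℕ) * h0) ×ˢ markBox n)} := by
      rintro ω ⟨r, hr0, hrl, hr⟩
      have hl0 : 0 < h0 := by
        refine div_pos (hr0.trans_le hrl) (pos_iff_ne_zero.2 hm0)
      have hex : ∃ i : ℕ, r ≤ (i + 1 : ℕ) * h0 := by
        refine ⟨m, hrl.trans (le_of_eq ?_)⟩
        rw [hh0, mul_div_cancel₀ _ hm0]
      classical
      have hspec := Nat.find_spec hex
      set i := Nat.find hex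
      have him : i ≤ m := Nat.find_min' hex (hrl.trans (le_of_eq (by
        rw [hh0, mul_div_cancel₀ _ hm0])))
      have hlow : i * h0 < r := by
        rcases Nat.eq_zero_or_pos i with hi | hi
        · simpa [hi] using hr0
        · have := Nat.find_min hex (Nat.sub_lt hi one_pos)
          rw [show Nat.find hex - 1 + 1 = i from Nat.sub_add_cancel hi] at this
          exact not_le.1 this
      refine Set.mem_biUnion (x := i) (by simpa using Nat.lt_succ_of_le him) ?_
      exact le_trans hr (measure_mono (Set.prod_mono_left (by
        rintro _ rfl; exact ⟨hlow, hspec⟩)))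
    have hone : ∀ i : ℕ,
        P {ω | 2 ≤ joint N M ω (Ioc (i * h0) ((i + 1 : ℕ) * h0) ×ˢ markBox n)} ≤
          (h0 * ν) ^ 2 := by
      intro i
      have hle : i * h0 ≤ (i + 1 : ℕ) * h0 := by
        gcongr; exact Nat.le_succ i
      have hA : MeasurableSet (Ioc (i * h0) ((i + 1 : ℕ) * h0) ×ˢ markBox n) :=
        measurableSet_Ioc.prod (measurableSet_markBox n)
      have hi : leb.prod (markMeasure β) (Ioc (i * h0) ((i + 1 : ℕ) * h0) ×ˢ markBox n) =
          h0 * ν := by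
        rw [intensity_Ioc hle]
        congr 2
        push_cast
        rw [add_mul, one_mul, add_tsub_cancel_left]
      have h2 := h.lintegral_joint_two_le hA (by
        rw [hi]; exact mul_ne_top coe_ne_top hν.ne)
      rw [hi] at h2
      refine le_trans ?_ h2
      have hJm : Measurable fun ω =>
          joint N M ω (Ioc (i * h0) ((i + 1 : ℕ) * h0) ×ˢ markBox n) :=
        (measurable_coe hA).comp (measurable_joint h.coag.measurable h.frag.measurable)
      rw [← lintegral_indicator_one (measurableSet_le measurable_const hJm)]
      refine lintegral_mono fun ω => ?_
      by_cases hω : 2 ≤ joint N M ω (Ioc (i * h0) ((i + 1 : ℕ) * h0) ×ˢ markBox n)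
      · simp only [indicator, mem_ofPred_eq, hω, if_true, Pi.one_apply]
        exact le_trans (by norm_num) hω
      · simp only [indicator, mem_ofPred_eq, hω, if_false, le_refl]
    refine (measure_mono hsub).trans ((measure_biUnion_finset_le _ _).trans ?_)
    refine (sum_le_sum fun i _ => hone i).trans ?_
    rw [Finset.sum_const, card_range, nsmul_eq_mul]
    have hc : (h0 : ℝ≥0∞) = l / ((m + 1 : ℕ) : ℝ≥0∞) := by
      rw [hh0, ENNReal.coe_div hm0]; simp
    have hm1 : ((m + 1 : ℕ) : ℝ≥0∞) ≠ 0 := by exact_mod_cast Nat.succ_ne_zero m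
    have hm2 : ((m + 1 : ℕ) : ℝ≥0∞) ≠ ∞ := natCast_ne_top _
    rw [hc, div_eq_mul_inv, div_eq_mul_inv]
    calc ((m + 1 : ℕ) : ℝ≥0∞) * (l * ((m + 1 : ℕ) : ℝ≥0∞)⁻¹ * ν) ^ 2
        = (((m + 1 : ℕ) : ℝ≥0∞) * ((m + 1 : ℕ) : ℝ≥0∞)⁻¹) *
            ((l * ν) ^ 2 * ((m + 1 : ℕ) : ℝ≥0∞)⁻¹) := by ring
      _ ≤ _ := by rw [ENNReal.mul_inv_cancel hm1 hm2, one_mul]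
  have h0 : P Bad = 0 := by
    refine le_antisymm (ge_of_tendsto' (x := atTop) (f := fun m : ℕ => ((l : ℝ≥0∞) * ν) ^ 2 /
      ((m + 1 : ℕ) : ℝ≥0∞))
      ?_ hJ) bot_le
    have := ENNReal.Tendsto.const_div (a := ((l : ℝ≥0∞) * ν) ^ 2)
      ((tendsto_add_atTop_iff_nat 1).2 ENNReal.tendsto_nat_nhds_top) (Or.inr (by
        exact ENNReal.pow_ne_top (mul_ne_top (natCast_ne_top _) hν.ne)))
    simpa using this
  rw [ae_iff]
  refine measure_mono_null (fun ω hω => ?_) h0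
  simp only [mem_ofPred_eq, not_forall, not_lt] at hω
  obtain ⟨r, h1, h2, h3⟩ := hω
  exact ⟨r, h1, h2, h3⟩

include hβ in
/-- Almost surely the driving measure is a configuration. -/
lemma IsDrivingPair.ae_isConfig (h : IsDrivingPair β N M P) (hk : ∀ᵐ θ ∂β, IsGoodRatio k θ) :
    ∀ᵐ ω ∂P, IsConfig k (joint N M ω) := by
  have := hβ.isFinite
  obtain ⟨f, hf, hfi⟩ := exists_measurable_injective
  have hw : ∀ n, leb.prod (markMeasure β) (window n) < ∞ := fun n => by
    rw [window, prod_prod, leb_Iic]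
    exact mul_lt_top coe_lt_top (finite_markBox hβ n)
  have hnull : ∀ A, MeasurableSet A → leb.prod (markMeasure β) A = 0 →
      ∀ᵐ ω ∂P, joint N M ω A = 0 := by
    intro A hA h0
    have hi := h.lintegral_joint hA (by rw [h0]; exact ENNReal.zero_ne_top)
    have hm : Measurable fun ω => joint N M ω A := (measurable_coe hA).comp
      (measurable_joint h.coag.measurable h.frag.measurable)
    rw [h0, lintegral_eq_zero_iff hm] at hi
    exact hi
  have h1 : ∀ᵐ ω ∂P, ∀ (n : ℕ) (p q : ℚ), ∃ j : ℕ,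
      joint N M ω (window n ∩ f ⁻¹' Ioo (p : ℝ) q) = j := by
    simp only [ae_all_iff]
    intro n p q
    exact h.ae_joint_mem ((measurableSet_window n).inter (hf measurableSet_Ioo))
      ((measure_mono Set.inter_subset_left).trans_lt (hw n)).ne
  have h2 : ∀ᵐ ω ∂P, ∀ n : ℕ, joint N M ω (window n) < ∞ := by
    rw [ae_all_iff]
    intro n
    filter_upwards [h.ae_joint_mem (measurableSet_window n) (hw n).ne] with ω hω
    obtain ⟨j, hj⟩ := hω
    rw [hj]
    exact ENNReal.natCast_lt_top j
  have h3 : ∀ᵐ ω ∂P, ∀ n l : ℕ, ∀ r : ℝ≥0, 0 < r → r ≤ l →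
      joint N M ω ({r} ×ˢ markBox n) < 2 := by
    simp only [ae_all_iff]
    exact fun n l => by simpa only [ae_all_iff] using h.ae_simple hβ n l
  have h4 := hnull ({0} ×ˢ univ) ((measurableSet_singleton _).prod .univ) (by
    rw [prod_prod, leb_singleton, zero_mul])
  have h5 := hnull (univ ×ˢ {e | ¬ IsGoodMark k e})
    (MeasurableSet.univ.prod (measurableSet_isGoodMark k).compl) (by
      rw [prod_prod, markMeasure_not_isGoodMark hk, mul_zero])
  filter_upwards [h1, h2, h3, h4, h5] with ω h1 h2 h3 h4 h5
  refine isConfig_of_forall hf hfi h1 h2 (fun n r => ?_) h4 h5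
  rcases eq_or_ne r 0 with rfl | hr
  · exact ((measure_mono (Set.prod_mono_right (Set.subset_univ _))).trans_eq h4).trans_lt (by simp)
  · obtain ⟨l, hl⟩ := exists_nat_ge r
    exact h3 n l r (pos_iff_ne_zero.2 hr) hl

end AlmostSure

/-! ### Evolution driven by a configuration -/

section Evolution

variable {π : Measure (ℝ≥0 × Mark)}

variable (K F) in
open Classical in
/-- The action of a mark, frozen outside `levelSet K F n`. -/
def actTrunc (n : ℕ) (y : MassSeq) (e : Mark) : MassSeq :=
  if y ∈ levelSet K F n then act K F y e else y

include hK hF in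
lemma actTrunc_eq_self {e : Mark} (he : e ∉ markBox n) : actTrunc K F n y e = y := by
  unfold actTrunc
  split_ifs with hy
  · exact act_eq_self hK hF hy he
  · rfl

lemma actTrunc_of_notMem (hy : y ∉ levelSet K F n) (e : Mark) :
    actTrunc K F n y e = y := if_neg hy

lemma actTrunc_of_mem (hy : y ∈ levelSet K F n) (e : Mark) :
    actTrunc K F n y e = act K F y e := if_pos hy

include hK hF in
lemma measurable_actTrunc (n : ℕ) :
    Measurable fun q : MassSeq × Mark => actTrunc K F n q.1 q.2 :=
  Measurable.ite (measurable_fst (measurableSet_levelSet hK hF n)) (measurable_act hK hF)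
    measurable_fst

open Classical in
/-- The events before time `t` with marks in `markBox n` (the empty set for configurations with
infinitely many such events). -/
def events (π : Measure (ℝ≥0 × Mark)) (n : ℕ) (t : ℝ≥0) : Finset ℝ≥0 :=
  if h : {r | r ∈ times π ∧ r ≤ t ∧ markAt π r ∈ markBox n}.Finite then h.toFinset else ∅

lemma IsConfig.mem_events (h : IsConfig k π) {t r : ℝ≥0} :
    r ∈ events π n t ↔ r ∈ times π ∧ r ≤ t ∧ markAt π r ∈ markBox n := by
  rw [events, dif_pos (h.finite n t), Set.Finite.mem_toFinset]
  rfl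

variable (K F) in
/-- The state reached from `x` by the events at the times in `A`, in the order of time, frozen
outside `levelSet K F n`. -/
def run (n : ℕ) (mk : ℝ≥0 → Mark) (A : Finset ℝ≥0) (x : MassSeq) : MassSeq :=
  (A.sort (· ≥ ·)).foldr (fun r y => actTrunc K F n y (mk r)) x

variable {n : ℕ} {mk : ℝ≥0 → Mark}

@[simp] theorem run_empty (x : MassSeq) : run K F n mk ∅ x = x := by simp [run]

lemma run_insert {A : Finset ℝ≥0} {r : ℝ≥0} (h : ∀ a ∈ A, a < r) (x : MassSeq) :
    run K F n mk (insert r A) x = actTrunc K F n (run K F n mk A x) (mk r) := by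
  have hr : r ∉ A := fun hr => lt_irrefl _ (h r hr)
  rw [run, ← Finset.cons_eq_insert r A hr, Finset.sort_cons (r := (· ≥ ·)) fun b hb => (h b hb).le]
  rfl

include hK hF in
lemma run_filter (A : Finset ℝ≥0) (p : ℝ≥0 → Prop) [DecidablePred p]
    (hp : ∀ r ∈ A, ¬ p r → mk r ∉ markBox n) (x : MassSeq) :
    run K F n mk (A.filter p) x = run K F n mk A x := by
  induction A using induction_on_max with
  | empty => simp
  | insert r A hr ih =>
    have ih' := ih fun a ha => hp a (Finset.mem_insert_of_mem ha)
    rw [run_insert hr, Finset.filter_insert]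
    split_ifs with h
    · rw [run_insert fun a ha => hr a (Finset.mem_filter.1 ha).1, ih']
    · rw [ih', actTrunc_eq_self hK hF (hp r (Finset.mem_insert_self _ _) h)]

/-- Once outside the level set, the truncated evolution rests. -/
lemma run_union_of_notMem {A : Finset ℝ≥0} (hx : run K F n mk A x ∉ levelSet K F n)
    (B : Finset ℝ≥0) (h : ∀ a ∈ A, ∀ b ∈ B, a < b) :
    run K F n mk (A ∪ B) x = run K F n mk A x := by
  induction B using induction_on_max with
  | empty => simp
  | insert r B hr ih =>
    have ih' := ih fun a ha b hb => h a ha b (Finset.mem_insert_of_mem hb)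
    rw [Finset.union_insert, run_insert, ih', actTrunc_of_notMem hx]
    intro c hc
    rcases Finset.mem_union.1 hc with hc | hc
    · exact h c hc r (Finset.mem_insert_self _ _)
    · exact hr c hc

lemma run_eq_of_mem_levelSet {n' : ℕ} (hn : n ≤ n') (A : Finset ℝ≥0) (x : MassSeq)
    (hx : run K F n mk A x ∈ levelSet K F n) : run K F n' mk A x = run K F n mk A x := by
  induction A using induction_on_max with
  | empty => simp
  | insert r A hr ih =>
    rw [run_insert hr] at hx ⊢
    by_cases hA : run K F n mk A x ∈ levelSet K F n
    · rw [run_insert hr, ih hA, actTrunc_of_mem hA, actTrunc_of_mem (levelSet_mono K F hn hA)]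
    · rw [actTrunc_of_notMem hA] at hx
      exact absurd hx hA

variable (K F) in
/-- The truncated evolution started at `x`. -/
def truncPath (π : Measure (ℝ≥0 × Mark)) (n : ℕ) (t : ℝ≥0) (x : MassSeq) : MassSeq :=
  run K F n (markAt π) (events π n t) x

lemma truncPath_congr (h : IsConfig k π) (hst : s ≤ t)
    (hno : ∀ r ∈ times π, s < r → r ≤ t → markAt π r ∉ markBox n) (x : MassSeq) :
    truncPath K F π n t x = truncPath K F π n s x := by
  have : events π n t = events π n s := by
    ext r
    rw [h.mem_events, h.mem_events]
    refine ⟨fun ⟨h1, h2, h3⟩ => ⟨h1, ?_, h3⟩, fun ⟨h1, h2, h3⟩ => ⟨h1, h2.trans hst, h3⟩⟩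
    exact not_lt.1 fun hs => hno r h1 hs h2 h3
  rw [truncPath, this, truncPath]

lemma truncPath_zero (h : IsConfig k π) (x : MassSeq) : truncPath K F π n 0 x = x := by
  have : events π n 0 = ∅ := by
    refine Finset.eq_empty_of_forall_notMem fun r hr => ?_
    rw [h.mem_events] at hr
    exact absurd (h.pos r hr.1) (not_lt.2 hr.2.1)
  rw [truncPath, this, run_empty]

include hK hF in
lemma truncPath_step (h : IsConfig k π) (hst : s ≤ t) {r : ℝ≥0} (hr : r ∈ times π) (hsr : s < r)
    (hrt : r ≤ t) (hno : ∀ r' ∈ times π, s < r' → r' ≤ t → markAt π r' ∈ markBox n → r' = r)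
    (x : MassSeq) :
    truncPath K F π n t x = actTrunc K F n (truncPath K F π n s x) (markAt π r) := by
  classical
  by_cases hm : markAt π r ∈ markBox n
  · have : events π n t = insert r (events π n s) := by
      ext a
      rw [Finset.mem_insert, h.mem_events, h.mem_events]
      constructor
      · rintro ⟨h1, h2, h3⟩
        by_cases ha : a ≤ s
        · exact Or.inr ⟨h1, ha, h3⟩
        · exact Or.inl (hno a h1 (not_le.1 ha) h2 h3)
      · rintro (rfl | ⟨h1, h2, h3⟩)
        · exact ⟨hr, hrt, hm⟩
        · exact ⟨h1, h2.trans hst, h3⟩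
    rw [truncPath, this, run_insert fun a ha => (h.mem_events.1 ha).2.1.trans_lt hsr, truncPath]
  · rw [actTrunc_eq_self hK hF hm]
    exact truncPath_congr h hst (fun r' h1 h2 h3 h4 => hm (hno r' h1 h2 h3 h4 ▸ h4)) x

lemma truncPath_eq_of_notMem (h : IsConfig k π) (hst : s ≤ t)
    (hx : truncPath K F π n s x ∉ levelSet K F n) :
    truncPath K F π n t x = truncPath K F π n s x := by
  classical
  have : events π n t = events π n s ∪ (events π n t).filter (s < ·) := by
    ext a
    rw [Finset.mem_union, mem_filter, h.mem_events, h.mem_events]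
    constructor
    · rintro ⟨h1, h2, h3⟩
      by_cases ha : a ≤ s
      · exact Or.inl ⟨h1, ha, h3⟩
      · exact Or.inr ⟨⟨h1, h2, h3⟩, not_le.1 ha⟩
    · rintro (⟨h1, h2, h3⟩ | ⟨h1, -⟩)
      · exact ⟨h1, h2.trans hst, h3⟩
      · exact h1
  rw [truncPath, this]
  exact run_union_of_notMem hx _ fun a ha b hb =>
    (h.mem_events.1 ha).2.1.trans_lt (Finset.mem_filter.1 hb).2

lemma truncPath_mem_of_le (h : IsConfig k π) (hst : s ≤ t)
    (hx : truncPath K F π n t x ∈ levelSet K F n) : truncPath K F π n s x ∈ levelSet K F n := by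
  by_contra hs
  rw [truncPath_eq_of_notMem h hst hs] at hx
  exact hs hx

include hK hF in
lemma truncPath_consistent (h : IsConfig k π) {n' : ℕ} (hn : n ≤ n')
    (hx : truncPath K F π n t x ∈ levelSet K F n) :
    truncPath K F π n' t x = truncPath K F π n t x := by
  classical
  have he : events π n t = (events π n' t).filter fun r => markAt π r ∈ markBox n := by
    ext r
    rw [mem_filter, h.mem_events, h.mem_events]
    exact ⟨fun ⟨h1, h2, h3⟩ => ⟨⟨h1, h2, markBox_mono hn h3⟩, h3⟩, fun ⟨⟨h1, h2, _⟩, h3⟩ => ⟨h1, h2,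
      h3⟩⟩
  have hr : truncPath K F π n t x = run K F n (markAt π) (events π n' t) x := by
    rw [truncPath, he]
    exact run_filter hK hF _ _ (fun _ _ hr => hr) x
  rw [hr] at hx ⊢
  exact run_eq_of_mem_levelSet hn _ _ hx

variable (K F) in
open Classical in
/-- The path started at `x` (resting at `x` if no truncation level is sufficient). -/
def path (π : Measure (ℝ≥0 × Mark)) (t : ℝ≥0) (x : MassSeq) : MassSeq :=
  if h : ∃ n, truncPath K F π n t x ∈ levelSet K F n then truncPath K F π h.choose t x else x

include hK hF in
lemma path_eq (h : IsConfig k π) (hx : truncPath K F π n t x ∈ levelSet K F n) :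
    path K F π t x = truncPath K F π n t x := by
  have hex : ∃ n, truncPath K F π n t x ∈ levelSet K F n := ⟨n, hx⟩
  rw [path, dif_pos hex]
  rcases le_total n hex.choose with hle | hle
  · exact truncPath_consistent hK hF h hle hx
  · exact (truncPath_consistent hK hF h hle hex.choose_spec).symm

lemma path_zero (h : IsConfig k π) (x : MassSeq) : path K F π 0 x = x := by
  unfold path
  split_ifs
  · exact truncPath_zero h x
  · rfl

include hK hF in
open Classical in
/-- The path is the limit of its truncations. -/
lemma tendsto_truncPath (h : IsConfig k π) (t : ℝ≥0) (x : MassSeq) :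
    Tendsto (fun n => if truncPath K F π n t x ∈ levelSet K F n then
      truncPath K F π n t x else x) atTop (𝓝 (path K F π t x)) := by
  by_cases hex : ∃ n, truncPath K F π n t x ∈ levelSet K F n
  · obtain ⟨n, hn⟩ := hex
    refine tendsto_const_nhds.congr' ?_
    filter_upwards [eventually_ge_atTop n] with n' hn'
    have hc := truncPath_consistent hK hF h hn' hn
    rw [path_eq hK hF h hn, if_pos (by rw [hc]; exact levelSet_mono K F hn' hn), hc]
  · have : path K F π t x = x := by rw [path, dif_neg hex]
    rw [this]
    refine tendsto_const_nhds.congr fun n => ?_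
    rw [if_neg fun hn => hex ⟨n, hn⟩]

variable (K F) in
/-- The configuration `π` does not lead from `x` to an explosion. -/
def NoExplosion (π : Measure (ℝ≥0 × Mark)) (x : MassSeq) : Prop :=
  ∀ t, ∃ n, truncPath K F π n t x ∈ levelSet K F n

include hK hF in
lemma NoExplosion.exists_path_eq (h : IsConfig k π) (hx : NoExplosion K F π x) (t : ℝ≥0) :
    ∃ n, ∀ s ≤ t, path K F π s x = truncPath K F π n s x ∧
      truncPath K F π n s x ∈ levelSet K F n := by
  obtain ⟨n, hn⟩ := hx t
  exact ⟨n, fun s hs => ⟨path_eq hK hF h (truncPath_mem_of_le h hs hn),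
    truncPath_mem_of_le h hs hn⟩⟩

/-- The times of events in a box are locally finite from the right. -/
lemma IsConfig.exists_gt_forall (h : IsConfig k π) (n : ℕ) (t : ℝ≥0) :
    ∃ t' > t, ∀ r ∈ times π, t < r → r ≤ t' → markAt π r ∉ markBox n := by
  have hf := h.finite n (t + 1)
  have hev : ∀ r ∈ {r | r ∈ times π ∧ r ≤ t + 1 ∧ markAt π r ∈ markBox n},
      ∀ᶠ t' in 𝓝[>] t, ¬ (t < r ∧ r ≤ t') := by
    intro r _
    by_cases hr : t < r
    · filter_upwards [Ioo_mem_nhdsGT hr] with t' ht'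
      exact fun h => absurd ht'.2 (not_lt.2 h.2)
    · exact .of_forall fun t' h => hr h.1
  have h2 := (eventually_all_finite hf).2 hev
  obtain ⟨t', ht', h3⟩ := (h2.and (Ioo_mem_nhdsGT (lt_add_one t))).exists
  refine ⟨t', h3.1, fun r hr htr hrt hm => ht' r ⟨hr, hrt.trans h3.2.le, hm⟩ ⟨htr, hrt⟩⟩

lemma IsConfig.exists_lt_forall (h : IsConfig k π) (n : ℕ) (ht : 0 < t) :
    ∃ t' < t, ∀ r ∈ times π, t' < r → r < t → markAt π r ∉ markBox n := by
  have hf := h.finite n t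
  have : (𝓝[<] t).NeBot := nhdsLT_neBot_of_exists_lt ⟨0, ht⟩
  have hev : ∀ r ∈ {r | r ∈ times π ∧ r ≤ t ∧ markAt π r ∈ markBox n},
      ∀ᶠ t' in 𝓝[<] t, ¬ (t' < r ∧ r < t) := by
    intro r _
    by_cases hr : r < t
    · filter_upwards [Ioo_mem_nhdsLT hr] with t' ht'
      exact fun h => absurd ht'.1 (not_lt.2 h.1.le)
    · exact .of_forall fun t' h => hr h.2
  have h2 := (eventually_all_finite hf).2 hev
  obtain ⟨t', ht', h3⟩ := (h2.and self_mem_nhdsWithin).exists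
  exact ⟨t', h3, fun r hr htr hrt hm => ht' r ⟨hr, hrt.le, hm⟩ ⟨htr, hrt⟩⟩

include hK hF in
lemma NoExplosion.path_mem_finiteStates (h : IsConfig k π) (hx : NoExplosion K F π x) (t : ℝ≥0) :
    path K F π t x ∈ finiteStates := by
  obtain ⟨n, hn⟩ := hx.exists_path_eq hK hF h t
  rw [(hn t le_rfl).1]
  exact levelSet_subset_finiteStates n (hn t le_rfl).2

lemma truncPath_eventually_right (h : IsConfig k π) (n : ℕ) (t : ℝ≥0) (x : MassSeq) :
    ∀ᶠ s in 𝓝[>] t, truncPath K F π n s x = truncPath K F π n t x := by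
  obtain ⟨t', ht', h1⟩ := h.exists_gt_forall n t
  filter_upwards [Ioo_mem_nhdsGT ht'] with s hs
  exact truncPath_congr h hs.1.le (fun r hr h2 h3 => h1 r hr h2 (h3.trans hs.2.le)) x

include hK hF in
/-- The paths are locally constant from the right. -/
lemma NoExplosion.path_eventually_right (h : IsConfig k π) (hx : NoExplosion K F π x) (t : ℝ≥0) :
    ∀ᶠ s in 𝓝[>] t, path K F π s x = path K F π t x := by
  obtain ⟨n, hn⟩ := hx.exists_path_eq hK hF h (t + 1)
  filter_upwards [truncPath_eventually_right h n t x, Ioo_mem_nhdsGT (lt_add_one t)] with s hs hs'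
  rw [(hn s hs'.2.le).1, hs, (hn t (le_add_of_nonneg_right zero_le)).1]

include hK hF in
/-- The paths are locally constant from the left, away from the event at the time itself. -/
lemma NoExplosion.path_eventually_left (h : IsConfig k π) (hx : NoExplosion K F π x) (ht : 0 < t)
    :
    ∃ y ∈ finiteStates, ∀ᶠ s in 𝓝[<] t, path K F π s x = y := by
  obtain ⟨n, hn⟩ := hx.exists_path_eq hK hF h t
  obtain ⟨t', ht', h1⟩ := h.exists_lt_forall n ht
  obtain ⟨u, hu, hut⟩ := exists_between ht'
  refine ⟨path K F π u x, hx.path_mem_finiteStates hK hF h u, ?_⟩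
  filter_upwards [Ioo_mem_nhdsLT hut] with s hs
  rw [(hn s hs.2.le).1, (hn u hut.le).1]
  exact truncPath_congr h hs.1.le (fun r hr h2 h3 => h1 r hr (hu.trans h2) (h3.trans_lt hs.2)) x

lemma delta_self (lam : ℝ) (m : MassSeq) : delta lam m m = 0 := by simp [delta]

/-- Piecewise constant paths in the space of finite states belong to the Skorokhod space. -/
lemma isCadlag_of_eventually (hlam : 0 < lam) {x : ℝ≥0 → MassSeq} (hmem : ∀ t, x t ∈ finiteStates)
    (hr : ∀ t, ∀ᶠ s in 𝓝[>] t, x s = x t)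
    (hl : ∀ t, 0 < t → ∃ y ∈ finiteStates, ∀ᶠ s in 𝓝[<] t, x s = y) : IsCadlag lam x where
  mem t := finiteStates_subset_ell hlam (hmem t)
  right t := tendsto_const_nhds.congr' ((hr t).mono fun s hs => by simp only [hs, delta_self])
  left t ht := by
    obtain ⟨y, hy, h⟩ := hl t ht
    exact ⟨y, finiteStates_subset_ell hlam hy,
      tendsto_const_nhds.congr' (h.mono fun s hs => by simp only [hs, delta_self])⟩

include hlam hK hF in
lemma NoExplosion.isCadlag (h : IsConfig k π) (hx : NoExplosion K F π x) :
    IsCadlag lam fun t => path K F π t x :=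
  isCadlag_of_eventually hlam (hx.path_mem_finiteStates hK hF h)
    (hx.path_eventually_right hK hF h) fun _ ht => hx.path_eventually_left hK hF h ht

lemma mass_act_le {e : Mark} (he : IsGoodMark k e) (y : MassSeq) : mass (act K F y e) ≤ mass y := by
  rcases e with ⟨p, z⟩ | ⟨i, θ, z⟩
  · simp only [act]
    split_ifs
    · exact mass_coalesce_le p.2 y
    · exact le_rfl
  · simp only [act]
    split_ifs
    · exact mass_fragment_le i he.2.1 y
    · exact le_rfl

lemma act_mem_finiteStates {e : Mark} (he : IsGoodMark k e) (hy : y ∈ finiteStates) :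
    act K F y e ∈ finiteStates := by
  have hy' : y ∈ massSet (mass y) := ⟨hy, le_rfl⟩
  rcases e with ⟨p, z⟩ | ⟨i, θ, z⟩
  · simp only [act]
    split_ifs
    · exact (coalesce_mem_massSet p.2 hy').1
    · exact hy
  · simp only [act]
    split_ifs
    · exact (fragment_mem_massSet i he.2 hy').1
    · exact hy

lemma run_induction {p : MassSeq → Prop} {A : Finset ℝ≥0} (hx : p x)
    (h : ∀ r ∈ A, ∀ y, p y → p (act K F y (mk r))) : p (run K F n mk A x) := by
  induction A using induction_on_max with
  | empty => simpa using hx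
  | insert r A hr ih =>
    rw [run_insert hr]
    have ih' := ih fun a ha => h a (Finset.mem_insert_of_mem ha)
    unfold actTrunc
    split_ifs
    · exact h r (Finset.mem_insert_self _ _) _ ih'
    · exact ih'

lemma truncPath_mem_massSet (h : IsConfig k π) (hx : x ∈ massSet M) (t : ℝ≥0) :
    truncPath K F π n t x ∈ massSet M :=
  run_induction (p := fun y => y ∈ massSet M) hx fun r hr _ hy =>
    ⟨act_mem_finiteStates (h.good r (h.mem_events.1 hr).1) hy.1,
      (mass_act_le (h.good r (h.mem_events.1 hr).1) _).trans hy.2⟩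

/-! ### The truncated evolution as a limit of measurable maps -/

/-- A mark that leaves all states unchanged. -/
def restMark : Mark := .inr (0, ⟨0, antitone_const, one_pos⟩, 0)

lemma actTrunc_restMark (y : MassSeq) : actTrunc K F n y restMark = y := by
  unfold actTrunc restMark act
  simp

open Classical in
/-- The mark of the only event of the box in `(s, t]`, if there is exactly one. -/
def soleMark (π : Measure (ℝ≥0 × Mark)) (n : ℕ) (s t : ℝ≥0) : Mark :=
  if h : ∃ r, (events π n t).filter (s < ·) = {r} then markAt π h.choose else restMark

open Classical in
lemma IsConfig.apply_rect (h : IsConfig k π) (s t : ℝ≥0) {C : Set Mark} (hC : MeasurableSet C) :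
    π (Ioc s t ×ˢ (C ∩ markBox n)) =
      (((events π n t).filter fun r => s < r ∧ markAt π r ∈ C).card : ℝ≥0∞) := by
  classical
  have hA : MeasurableSet (Ioc s t ×ˢ (C ∩ markBox n)) :=
    measurableSet_Ioc.prod (hC.inter (measurableSet_markBox n))
  conv_lhs => rw [h.eq_sum]
  rw [Measure.sum_apply _ hA]
  simp only [dirac_apply' _ hA]
  set S : Finset ℝ≥0 := (events π n t).filter fun r => s < r ∧ markAt π r ∈ C
  have hS : ∀ r, r ∈ S ↔ r ∈ times π ∧ (r, markAt π r) ∈ Ioc s t ×ˢ (C ∩ markBox n) := by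
    intro r
    rw [mem_filter, h.mem_events]
    exact ⟨fun ⟨⟨h1, h2, h3⟩, h4, h5⟩ => ⟨h1, ⟨h4, h2⟩, h5, h3⟩,
      fun ⟨h1, ⟨h4, h2⟩, h5, h3⟩ => ⟨⟨h1, h2, h3⟩, h4, h5⟩⟩
  have e1 : ∀ r : times π, (Ioc s t ×ˢ (C ∩ markBox n)).indicator (1 : ℝ≥0 × Mark → ℝ≥0∞)
      ((r : ℝ≥0), markAt π r) = (S : Set ℝ≥0).indicator 1 (r : ℝ≥0) := by
    intro r
    by_cases hr : (r : ℝ≥0) ∈ S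
    · rw [indicator_of_mem ((hS r).1 hr).2, indicator_of_mem (by exact_mod_cast hr)]
      rfl
    · rw [indicator_of_notMem fun h' => hr ((hS r).2 ⟨r.2, h'⟩),
        indicator_of_notMem (by exact_mod_cast hr)]
  simp only [e1]
  rw [tsum_subtype (times π) ((S : Set ℝ≥0).indicator (1 : ℝ≥0 → ℝ≥0∞)), Set.indicator_indicator,
    Set.inter_eq_right.2 fun r hr => ((hS r).1 hr).1, ← tsum_subtype]
  simp

lemma IsConfig.soleMark_mem_iff (h : IsConfig k π) (s t : ℝ≥0) {C : Set Mark}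
    (hC : MeasurableSet C) : soleMark π n s t ∈ C ↔
      (π (Ioc s t ×ˢ markBox n) = 1 ∧ π (Ioc s t ×ˢ (C ∩ markBox n)) = 1) ∨
        (π (Ioc s t ×ˢ markBox n) ≠ 1 ∧ restMark ∈ C) := by
  classical
  have h1 := h.apply_rect (n := n) s t MeasurableSet.univ
  have h2 := h.apply_rect (n := n) s t hC
  simp only [Set.univ_inter, Set.mem_univ, and_true] at h1
  rw [h1, h2]
  have hone : (((events π n t).filter fun r => s < r).card : ℝ≥0∞) = 1 ↔
      ∃ r, (events π n t).filter (s < ·) = {r} := by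
    rw [← Finset.card_eq_one]; exact_mod_cast Iff.rfl
  rw [ne_eq, hone]
  unfold soleMark
  by_cases hex : ∃ r, (events π n t).filter (s < ·) = {r}
  · rw [dif_pos hex]
    simp only [hex, true_and, not_true_eq_false, false_and, or_false]
    have hsp := hex.choose_spec
    generalize hex.choose = r at hsp ⊢
    rw [← Finset.filter_filter, hsp]
    by_cases hr : markAt π r ∈ C
    · simp [hr, Finset.filter_singleton]
    · simp [hr, Finset.filter_singleton]
  · rw [dif_neg hex]
    simp [hex]

include hK hF in
/-- The state after a short time interval that contains at most one event of the box. -/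
lemma truncPath_eq_actTrunc_soleMark (h : IsConfig k π) (hst : s ≤ t)
    (hone : ∀ r ∈ events π n t, ∀ r' ∈ events π n t, s < r → s < r' → r = r') (x : MassSeq) :
    truncPath K F π n t x = actTrunc K F n (truncPath K F π n s x) (soleMark π n s t) := by
  classical
  by_cases hex : ∃ r, (events π n t).filter (s < ·) = {r}
  · rw [soleMark, dif_pos hex]
    have hr : hex.choose ∈ (events π n t).filter (s < ·) :=
      hex.choose_spec.ge (Finset.mem_singleton_self _)
    rw [mem_filter, h.mem_events] at hr
    refine truncPath_step hK hF h hst hr.1.1 hr.2 hr.1.2.1 (fun r' h1 h2 h3 h4 => ?_) x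
    exact hone r' (h.mem_events.2 ⟨h1, h3, h4⟩) _ (h.mem_events.2 hr.1) h2 hr.2
  · rw [soleMark, dif_neg hex, actTrunc_restMark]
    refine truncPath_congr h hst (fun r h1 h2 h3 h4 => hex ⟨r, ?_⟩) x
    have hr := h.mem_events.2 ⟨h1, h3, h4⟩
    ext a
    rw [mem_filter, Finset.mem_singleton]
    refine ⟨fun ha => hone a ha.1 r hr ha.2 h2, ?_⟩
    rintro rfl
    exact ⟨hr, h2⟩

variable (K F) in
/-- The evolution along the grid `0, t / m, 2 t / m, …` that takes into account one event in each
interval of the grid. -/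
def gridPath (π : Measure (ℝ≥0 × Mark)) (n : ℕ) (t : ℝ≥0) (m : ℕ) (x : MassSeq) :
    ℕ → MassSeq
  | 0 => x
  | i + 1 => actTrunc K F n (gridPath π n t m x i)
      (soleMark π n (i * (t / m)) ((i + 1 : ℕ) * (t / m)))

include hK hF in
lemma eventually_gridPath_eq (h : IsConfig k π) (n : ℕ) (t : ℝ≥0) (x : MassSeq) :
    ∀ᶠ m : ℕ in atTop, gridPath K F π n t m x m = truncPath K F π n t x := by
  have hmesh : Tendsto (fun m : ℕ => t / m) atTop (𝓝 0) := tendsto_const_div_atTop_nhds_zero_nat t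
  -- a fine grid separates the finitely many events
  have hsep : ∀ᶠ m : ℕ in atTop, ∀ r ∈ events π n t, ∀ r' ∈ events π n t, r < r' →
      r + t / m < r' := by
    rw [Finset.eventually_all]
    intro r _
    rw [Finset.eventually_all]
    intro r' _
    by_cases hr : r < r'
    · have : Tendsto (fun m : ℕ => r + t / m) atTop (𝓝 (r + 0)) := hmesh.const_add r
      rw [add_zero] at this
      filter_upwards [this.eventually (gt_mem_nhds hr)] with m hm _ using hm
    · exact .of_forall fun m h => absurd h hr
  filter_upwards [hsep, eventually_gt_atTop 0] with m hm hm0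
  have hm0' : (m : ℝ≥0) ≠ 0 := by exact_mod_cast hm0.ne'
  have key : ∀ i ≤ m, gridPath K F π n t m x i = truncPath K F π n (i * (t / m)) x := by
    intro i
    induction i with
    | zero => intro _; simp [gridPath, truncPath_zero h]
    | succ i ih =>
      intro hi
      have hle : (i : ℝ≥0) * (t / m) ≤ ((i + 1 : ℕ) : ℝ≥0) * (t / m) := by
        gcongr; exact Nat.le_succ i
      have htop : ((i + 1 : ℕ) : ℝ≥0) * (t / m) ≤ t := by
        calc ((i + 1 : ℕ) : ℝ≥0) * (t / m) ≤ m * (t / m) := by gcongr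
          _ = t := mul_div_cancel₀ _ hm0'
      rw [gridPath, ih (by omega)]
      refine (truncPath_eq_actTrunc_soleMark hK hF h hle ?_ x).symm
      intro r hr r' hr' h1 h2
      have hr3 := h.mem_events.1 hr
      have hr4 := h.mem_events.1 hr'
      have hcell : ∀ a b : ℝ≥0, (i : ℝ≥0) * (t / m) < a → b ≤ ((i + 1 : ℕ) : ℝ≥0) * (t / m) →
          ¬ a + t / m < b := by
        intro a b ha hb hab
        refine absurd (hab.trans_le hb) (not_lt.2 ?_)
        push_cast
        rw [add_mul, one_mul]
        gcongr
      rcases lt_trichotomy r r' with hlt | heq | hlt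
      · exact absurd (hm r (h.mem_events.2 ⟨hr3.1, hr3.2.1.trans htop, hr3.2.2⟩) r'
          (h.mem_events.2 ⟨hr4.1, hr4.2.1.trans htop, hr4.2.2⟩) hlt) (hcell r r' h1 hr4.2.1)
      · exact heq
      · exact absurd (hm r' (h.mem_events.2 ⟨hr4.1, hr4.2.1.trans htop, hr4.2.2⟩) r
          (h.mem_events.2 ⟨hr3.1, hr3.2.1.trans htop, hr3.2.2⟩) hlt) (hcell r' r h2 hr3.2.1)
  rw [key m le_rfl, mul_div_cancel₀ _ hm0']

end Evolution

attribute [local irreducible] path truncPath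

/-! ### Measurability of the evolution -/

section Measurability

instance : TopologicalSpace.PseudoMetrizableSpace MassSeq :=
  Topology.IsInducing.subtypeVal.pseudoMetrizableSpace

variable {m : MeasurableSpace Ω} {π : Ω → Measure (ℝ≥0 × Mark)}

lemma measurable_soleMark (hc : ∀ ω, IsConfig k (π ω)) (n : ℕ)
    (h : ∀ C, MeasurableSet C → Measurable fun ω => π ω (Ioc s t ×ˢ C)) :
    Measurable fun ω => soleMark (π ω) n s t := by
  intro C hC
  have he : (fun ω => soleMark (π ω) n s t) ⁻¹' C =
      ({ω | π ω (Ioc s t ×ˢ markBox n) = 1} ∩ {ω | π ω (Ioc s t ×ˢ (C ∩ markBox n)) = 1}) ∪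
        ({ω | π ω (Ioc s t ×ˢ markBox n) = 1}ᶜ ∩ {_ω | restMark ∈ C}) := by
    ext ω
    exact (hc ω).soleMark_mem_iff s t hC
  rw [he]
  have h1 : MeasurableSet {ω | π ω (Ioc s t ×ˢ markBox n) = 1} :=
    h _ (measurableSet_markBox n) (measurableSet_singleton 1)
  have h2 : MeasurableSet {ω | π ω (Ioc s t ×ˢ (C ∩ markBox n)) = 1} :=
    h _ (hC.inter (measurableSet_markBox n)) (measurableSet_singleton 1)
  exact (h1.inter h2).union (h1.compl.inter (MeasurableSet.const _))

include hK hF in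
lemma measurable_truncPath (hc : ∀ ω, IsConfig k (π ω)) (n : ℕ)
    (h : ∀ s t', t' ≤ t → ∀ C, MeasurableSet C → Measurable fun ω => π ω (Ioc s t' ×ˢ C)) :
    Measurable fun q : Ω × MassSeq => truncPath K F (π q.1) n t q.2 := by
  have hg : ∀ l i : ℕ, i ≤ l →
      Measurable fun q : Ω × MassSeq => gridPath K F (π q.1) n t l q.2 i := by
    intro l i
    induction i with
    | zero => exact fun _ => measurable_snd
    | succ i ih =>
      intro hi
      have hl : (l : ℝ≥0) ≠ 0 := by exact_mod_cast (by omega : l ≠ 0)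
      have htop : ((i + 1 : ℕ) : ℝ≥0) * (t / l) ≤ t := by
        calc ((i + 1 : ℕ) : ℝ≥0) * (t / l) ≤ l * (t / l) := by gcongr
          _ = t := mul_div_cancel₀ _ hl
      exact (measurable_actTrunc hK hF n).comp ((ih (by omega)).prodMk
        ((measurable_soleMark hc n (h _ _ htop)).comp measurable_fst))
  refine measurable_of_tendsto_metrizable (fun l => hg l l le_rfl) ?_
  rw [tendsto_pi_nhds]
  intro q
  exact tendsto_const_nhds.congr' ((eventually_gridPath_eq hK hF (hc q.1) n t q.2).mono
    fun l hl => hl.symm)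

include hK hF in
lemma measurable_path (hc : ∀ ω, IsConfig k (π ω))
    (h : ∀ s t', t' ≤ t → ∀ C, MeasurableSet C → Measurable fun ω => π ω (Ioc s t' ×ˢ C)) :
    Measurable fun q : Ω × MassSeq => path K F (π q.1) t q.2 := by
  classical
  have hZ := fun n => measurable_truncPath hK hF hc n h
  refine measurable_of_tendsto_metrizable (f := fun n (q : Ω × MassSeq) =>
    if truncPath K F (π q.1) n t q.2 ∈ levelSet K F n then truncPath K F (π q.1) n t q.2 else q.2)
    (fun n => Measurable.ite (hZ n (measurableSet_levelSet hK hF n)) (hZ n) measurable_snd) ?_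
  rw [tendsto_pi_nhds]
  exact fun q => tendsto_truncPath hK hF (hc q.1) t q.2

lemma measurable_uncurry_nat {S : Type*} [MeasurableSpace S] {W : ℕ → Ω → S}
    (hW : ∀ i, Measurable (W i)) : Measurable fun q : Ω × ℕ => W q.2 q.1 :=
  measurable_from_prod_countable_left hW

/-- A right-continuous process stopped at time `t` is jointly measurable with respect to the events
before `t`. -/
lemma measurable_uncurry_min {S : Type*} [TopologicalSpace S]
    [TopologicalSpace.PseudoMetrizableSpace S] [MeasurableSpace S] [BorelSpace S] {Y : ℝ≥0 → Ω → S}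
    (hm : ∀ s ≤ t, Measurable (Y s)) (hr : ∀ ω s, Tendsto (fun s => Y s ω) (𝓝[>] s) (𝓝 (Y s ω))) :
    Measurable fun q : Ω × ℝ≥0 => Y (min q.2 t) q.1 := by
  let g : ℕ → ℝ≥0 → ℝ≥0 := fun l s => min (((⌊s * (l + 1 : ℕ)⌋₊ + 1 : ℕ) : ℝ≥0) / (l + 1 : ℕ)) t
  have hl0 : ∀ l : ℕ, (0 : ℝ≥0) < (l + 1 : ℕ) := fun l => by exact_mod_cast Nat.succ_pos l
  have hg1 : ∀ (l : ℕ) (s : ℝ≥0), s < ((⌊s * (l + 1 : ℕ)⌋₊ + 1 : ℕ) : ℝ≥0) / (l + 1 : ℕ) :=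
    fun l s => by
    rw [lt_div_iff₀ (hl0 l)]
    exact_mod_cast Nat.lt_floor_add_one _
  have hg2 : ∀ (l : ℕ) (s : ℝ≥0), ((⌊s * (l + 1 : ℕ)⌋₊ + 1 : ℕ) : ℝ≥0) / (l + 1 : ℕ) ≤ s + 1 /
    (l + 1 : ℕ) := by
    intro l s
    rw [div_le_iff₀ (hl0 l), add_mul, div_mul_cancel₀ _ (hl0 l).ne']
    push_cast
    gcongr
    exact_mod_cast Nat.floor_le (zero_le (a := s * (l + 1 : ℕ)))
  refine measurable_of_tendsto_metrizable (f := fun l (q : Ω × ℝ≥0) => Y (g l q.2) q.1)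
    (fun l => ?_) ?_
  · have hform : ∃ (c : ℕ → ℝ≥0) (fl : ℝ≥0 → ℕ), (∀ i, c i ≤ t) ∧ Measurable fl ∧
        ∀ s, g l s = c (fl s) :=
      ⟨fun i => min (((i + 1 : ℕ) : ℝ≥0) / (l + 1 : ℕ)) t, fun s => ⌊s * (l + 1 : ℕ)⌋₊,
        fun i => min_le_right _ _, Nat.measurable_floor.comp (measurable_id.mul_const _),
        fun s => rfl⟩
    obtain ⟨c, fl, hct, hfl, hgc⟩ := hform
    simp only [hgc]
    exact (measurable_uncurry_nat (W := fun i => Y (c i)) fun i => hm _ (hct i)).comp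
      (measurable_fst.prodMk (hfl.comp measurable_snd))
  · rw [tendsto_pi_nhds]
    rintro ⟨ω, s⟩
    change Tendsto (fun l => Y (g l s) ω) atTop (𝓝 (Y (min s t) ω))
    rcases lt_or_ge s t with hst | hst
    · rw [min_eq_left hst.le]
      refine (hr ω s).comp (tendsto_nhdsWithin_iff.2 ⟨?_, .of_forall fun l => ?_⟩)
      · have hlim : Tendsto (fun l : ℕ => s + 1 / ((l + 1 : ℕ) : ℝ≥0)) atTop (𝓝 (s + 0)) :=
          (((tendsto_add_atTop_iff_nat 1).2
            (tendsto_const_div_atTop_nhds_zero_nat (1 : ℝ≥0)))).const_add s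
        rw [add_zero] at hlim
        exact tendsto_of_tendsto_of_tendsto_of_le_of_le tendsto_const_nhds hlim
          (fun l => le_min (hg1 l s).le hst.le) (fun l => (min_le_left _ _).trans (hg2 l s))
      · exact lt_min (hg1 l s) hst
    · rw [min_eq_right hst]
      refine tendsto_const_nhds.congr fun l => ?_
      rw [show g l s = t from min_eq_right (hst.trans (hg1 l s).le)]

lemma measurable_uncurry_of_right {S : Type*} [TopologicalSpace S]
    [TopologicalSpace.PseudoMetrizableSpace S] [MeasurableSpace S] [BorelSpace S]
    {Y : ℝ≥0 → Ω → S} (hm : ∀ s, Measurable (Y s))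
    (hr : ∀ ω s, Tendsto (fun s => Y s ω) (𝓝[>] s) (𝓝 (Y s ω))) :
    Measurable fun q : Ω × ℝ≥0 => Y q.2 q.1 := by
  refine measurable_of_tendsto_metrizable (f := fun (l : ℕ) (q : Ω × ℝ≥0) => Y (min q.2 l) q.1)
    (fun l => measurable_uncurry_min (fun s _ => hm s) hr) ?_
  rw [tendsto_pi_nhds]
  rintro ⟨ω, s⟩
  obtain ⟨l, hl⟩ := exists_nat_ge s
  refine tendsto_const_nhds.congr' ?_
  filter_upwards [eventually_ge_atTop l] with l' hl'
  have : s ≤ l' := hl.trans (by exact_mod_cast hl')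
  simp [min_eq_left this]

end Measurability

/-! ### The compensation formula -/

section Driver

variable {π : Ω → Measure (ℝ≥0 × Mark)}

/-- A random configuration with the properties of a Poisson measure with intensity `dt` times
`markMeasure β`, relative to the filtration `ℋ`, that the evolution depends on. -/
structure IsDriver (β : Measure Ratios) (k : ℕ) (ℋ : Filtration ℝ≥0 mΩ)
    (π : Ω → Measure (ℝ≥0 × Mark)) (P : Measure Ω) : Prop where
  config : ∀ ω, IsConfig k (π ω)
  measurable : ∀ s t C, MeasurableSet C → Measurable[ℋ t] fun ω => π ω (Ioc s t ×ˢ C)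
  compensation : ∀ s t n C, s ≤ t → MeasurableSet C → ∀ A, MeasurableSet[ℋ s] A →
    ∫⁻ ω in A, π ω (Ioc s t ×ˢ (C ∩ markBox n)) ∂P =
      P A * ((t - s : ℝ≥0) * markMeasure β (C ∩ markBox n))
  double : ∀ s t n, s ≤ t → ∫⁻ ω, (if 2 ≤ π ω (Ioc s t ×ˢ markBox n) then
    π ω (Ioc s t ×ˢ markBox n) else 0) ∂P ≤ ((t - s : ℝ≥0) * markMeasure β (markBox n)) ^ 2

lemma IsDriver.measurable_le (hd : IsDriver β k ℋ π P) (s t' : ℝ≥0) (ht : t' ≤ t) (C : Set Mark)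
    (hC : MeasurableSet C) : Measurable[ℋ t] fun ω => π ω (Ioc s t' ×ˢ C) :=
  (hd.measurable s t' C hC).mono (ℋ.mono ht) le_rfl

include hK hF in
lemma IsDriver.measurable_truncPath (hd : IsDriver β k ℋ π P) (n : ℕ) (t : ℝ≥0) (x : MassSeq) :
    Measurable[ℋ t] fun ω => truncPath K F (π ω) n t x :=
  (CoagFrag.measurable_truncPath (m := ℋ t) hK hF hd.config n hd.measurable_le).comp
    (measurable_prodMk_right (y := x))

include hK hF in
lemma IsDriver.measurable_path (hd : IsDriver β k ℋ π P) (t : ℝ≥0) (x : MassSeq) :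
    Measurable[ℋ t] fun ω => path K F (π ω) t x :=
  (CoagFrag.measurable_path (m := ℋ t) hK hF hd.config hd.measurable_le).comp
    (measurable_prodMk_right (y := x))

lemma IsConfig.lintegral_eq_tsum {π : Measure (ℝ≥0 × Mark)} (h : IsConfig k π)
    {g : ℝ≥0 × Mark → ℝ≥0∞} (hg : Measurable g) :
    ∫⁻ e, g e ∂π = ∑' r : times π, g ((r : ℝ≥0), markAt π r) := by
  have e : ∫⁻ e, g e ∂π =
      ∫⁻ e, g e ∂(sum fun r : times π => dirac ((r : ℝ≥0), markAt π r)) :=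
    congrArg (fun μ => ∫⁻ e, g e ∂μ) h.eq_sum
  rw [e, lintegral_sum_measure]
  exact tsum_congr fun r => lintegral_dirac' _ hg

open Classical in
lemma IsConfig.lintegral_rect {π : Measure (ℝ≥0 × Mark)} (h : IsConfig k π) (n : ℕ) (s t : ℝ≥0)
    {g : ℝ≥0 × Mark → ℝ≥0∞} (hg : Measurable g) :
    ∫⁻ e in Ioc s t ×ˢ markBox n, g e ∂π =
      ∑ r ∈ (events π n t).filter (s < ·), g (r, markAt π r) := by
  have hS : MeasurableSet (Ioc s t ×ˢ markBox n) :=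
    measurableSet_Ioc.prod (measurableSet_markBox n)
  have e0 : ∫⁻ e in Ioc s t ×ˢ markBox n, g e ∂π =
      ∑' r : times π, (Ioc s t ×ˢ markBox n).indicator g ((r : ℝ≥0), markAt π r) :=
    (lintegral_indicator hS _).symm.trans (h.lintegral_eq_tsum (hg.indicator hS))
  rw [e0]
  set T : Finset ℝ≥0 := (events π n t).filter (s < ·)
  have hT : ∀ r, r ∈ T ↔ r ∈ times π ∧ (r, markAt π r) ∈ Ioc s t ×ˢ markBox n := by
    intro r
    rw [mem_filter, h.mem_events]
    exact ⟨fun ⟨⟨h1, h2, h3⟩, h4⟩ => ⟨h1, ⟨h4, h2⟩, h3⟩, fun ⟨h1, ⟨h4, h2⟩, h3⟩ => ⟨⟨h1, h2, h3⟩,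
      h4⟩⟩
  have e1 : ∀ r : times π, (Ioc s t ×ˢ markBox n).indicator g
      ((r : ℝ≥0), markAt π r) = (T : Set ℝ≥0).indicator (fun r => g (r, markAt π r)) (r : ℝ≥0) := by
    intro r
    by_cases hr : (r : ℝ≥0) ∈ T
    · rw [indicator_of_mem ((hT r).1 hr).2, indicator_of_mem (by exact_mod_cast hr)]
    · rw [indicator_of_notMem fun h' => hr ((hT r).2 ⟨r.2, h'⟩),
        indicator_of_notMem (by exact_mod_cast hr)]
  simp only [e1]
  rw [tsum_subtype (times π) ((T : Set ℝ≥0).indicator fun r => g (r, markAt π r)),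
    Set.indicator_indicator, Set.inter_eq_right.2 fun r hr => ((hT r).1 hr).1, ← tsum_subtype]
  exact Finset.tsum_subtype T fun r => g (r, markAt π r)

open Classical in
lemma IsConfig.restrict_eq {π : Measure (ℝ≥0 × Mark)} (h : IsConfig k π) (n : ℕ) (s t : ℝ≥0) :
    π.restrict (Ioc s t ×ˢ markBox n) =
      ∑ r ∈ (events π n t).filter (s < ·), dirac (r, markAt π r) := by
  ext A hA
  have := h.lintegral_rect n s t (g := A.indicator 1) (measurable_one.indicator hA)
  rw [lintegral_indicator_one hA] at this
  rw [this, Measure.finsetSum_apply]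
  exact sum_congr rfl fun r _ => (dirac_apply' _ hA).symm

open Classical in
lemma IsConfig.apply_box {π : Measure (ℝ≥0 × Mark)} (h : IsConfig k π) (n : ℕ) (s t : ℝ≥0) :
    π (Ioc s t ×ˢ markBox n) = ((events π n t).filter (s < ·)).card := by
  have := h.lintegral_rect n s t (g := fun _ => 1) measurable_const
  simpa using this

variable [IsProbabilityMeasure P]

include hβ in
/-- The compensation formula for integrands that depend on the present state. -/
lemma IsDriver.integral_integral (hd : IsDriver β k ℋ π P) (n : ℕ) (hst : s ≤ t)
    (hA : MeasurableSet[ℋ s] A) {Z : Ω → MassSeq} (hZ : Measurable[ℋ s] Z) {G : MassSeq × Mark → ℝ}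
    (hG : Measurable G) {C : ℝ} (hC : ∀ q, |G q| ≤ C) :
    IntegrableOn (fun ω => ∫ e in Ioc s t ×ˢ markBox n, G (Z ω, e.2) ∂(π ω)) A P ∧
    ∫ ω in A, ∫ e in Ioc s t ×ˢ markBox n, G (Z ω, e.2) ∂(π ω) ∂P =
      (t - s : ℝ≥0) * ∫ ω in A, ∫ e in markBox n, G (Z ω, e) ∂(markMeasure β) ∂P := by
  have := hβ.isFinite
  have hbox := measurableSet_markBox n
  have hI : MeasurableSet (Ioc s t ×ˢ markBox n) := measurableSet_Ioc.prod hbox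
  have hfin : ∀ ω, π ω (Ioc s t ×ˢ markBox n) < ∞ := fun ω => by
    rw [(hd.config ω).apply_box]; exact ENNReal.natCast_lt_top _
  have hpair : ∀ ω, Measurable fun e : ℝ≥0 × Mark => (Z ω, e.2) := fun ω =>
    measurable_const.prodMk measurable_snd
  have hZ' : Measurable Z := hZ.mono (ℋ.le s) le_rfl
  let mk : Ω → Measure (MassSeq × Mark) := fun ω =>
    ((π ω).restrict (Ioc s t ×ˢ markBox n)).map fun e => (Z ω, e.2)
  have hmkf : ∀ ω, IsFiniteMeasure (mk ω) := fun ω => by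
    have : IsFiniteMeasure ((π ω).restrict (Ioc s t ×ˢ markBox n)) :=
      ⟨by rw [restrict_apply_univ]; exact hfin ω⟩
    infer_instance
  have hrect : ∀ ω (B : Set MassSeq) (C : Set Mark), MeasurableSet B → MeasurableSet C →
      mk ω (B ×ˢ C) = (Z ⁻¹' B).indicator (fun ω => π ω (Ioc s t ×ˢ (C ∩ markBox n))) ω := by
    intro ω B C hB hC
    rw [map_apply (hpair ω) (hB.prod hC), restrict_apply (hpair ω (hB.prod hC))]
    by_cases hω : Z ω ∈ B
    · rw [indicator_of_mem (show ω ∈ Z ⁻¹' B from hω)]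
      congr 1
      ext e
      simp only [Set.mem_inter_iff, mem_preimage, Set.mem_prod, hω, true_and]
      tauto
    · rw [indicator_of_notMem (show ω ∉ Z ⁻¹' B from hω)]
      convert measure_empty (μ := π ω)
      ext e
      simp [hω]
  have hπm : ∀ C, MeasurableSet C → Measurable fun ω => π ω (Ioc s t ×ˢ (C ∩ markBox n)) :=
    fun C hC => (hd.measurable s t _ (hC.inter hbox)).mono (ℋ.le t) le_rfl
  have hmk : Measurable mk := by
    refine Measurable.measure_of_isPiSystem generateFrom_prod.symm isPiSystem_prod ?_ ?_
    · rintro _ ⟨B, hB, C, hC, rfl⟩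
      simp only [hrect _ B C hB hC]
      exact (hπm C hC).indicator (hZ' hB)
    · simp only [← Set.univ_prod_univ, hrect _ _ _ MeasurableSet.univ MeasurableSet.univ]
      exact (hπm _ .univ).indicator (hZ' .univ)
  let κ : Kernel Ω (MassSeq × Mark) := ⟨mk, hmk⟩
  have hA' := ℋ.le s _ hA
  have hνfin : IsFiniteMeasure ((markMeasure β).restrict (markBox n)) :=
    ⟨by rw [restrict_apply_univ]; exact finite_markBox hβ n⟩
  have hsm : IsFiniteMeasure (((t - s : ℝ≥0) : ℝ≥0∞) • (markMeasure β).restrict (markBox n)) :=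
    Measure.smul_finite _ coe_ne_top
  have hQ : (κ ∘ₖ Kernel.const Unit (P.restrict A)) () = ((P.restrict A).map Z).prod
      (((t - s : ℝ≥0) : ℝ≥0∞) • (markMeasure β).restrict (markBox n)) := by
    refine (Measure.prod_eq fun B C hB hC => ?_).symm
    rw [Kernel.comp_apply' _ _ _ (hB.prod hC), Kernel.const_apply]
    change ∫⁻ ω in A, mk ω (B ×ˢ C) ∂P = _
    simp only [hrect _ B C hB hC]
    rw [lintegral_indicator (hZ' hB), Measure.restrict_restrict (hZ' hB),
      hd.compensation s t n C hst hC _ ((hZ hB).inter hA),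
      map_apply hZ' hB, restrict_apply (hZ' hB), Measure.smul_apply,
      restrict_apply hC, smul_eq_mul]
  have hint : Integrable G ((κ ∘ₖ Kernel.const Unit (P.restrict A)) ()) := by
    rw [hQ]
    exact Integrable.of_bound hG.aestronglyMeasurable C (ae_of_all _ hC)
  have hl : ∀ ω, ∫ e in Ioc s t ×ˢ markBox n, G (Z ω, e.2) ∂(π ω) = ∫ q, G q ∂(κ ω) :=
    fun ω => (integral_map (hpair ω).aemeasurable hG.aestronglyMeasurable).symm
  simp only [hl]
  refine ⟨hint.integral_comp, ?_⟩
  have h1 := Kernel.integral_comp hint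
  rw [Kernel.const_apply] at h1
  rw [← h1, hQ, integral_prod _ (by rwa [hQ] at hint),
    integral_map hZ'.aemeasurable hG.stronglyMeasurable.integral_prod_right'.aestronglyMeasurable]
  simp only [integral_smul_measure, coe_toReal, smul_eq_mul]
  rw [integral_const_mul]

end Driver

/-! ### Dynkin's formula for the truncated evolution -/

section Dynkin

variable {π : Ω → Measure (ℝ≥0 × Mark)}

variable (K F β) in
/-- The generator of the truncated evolution. -/
def truncGen (n : ℕ) (Φ : MassSeq → ℝ) (y : MassSeq) : ℝ :=
  ∫ e in markBox n, (Φ (actTrunc K F n y e) - Φ y) ∂(markMeasure β)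

include hK hF hβ in
lemma truncGen_of_mem (hy : y ∈ levelSet K F n) (hΦ : Measurable Φ) {C : ℝ} (hC : ∀ y, |Φ y| ≤ C)
    : truncGen K F β n Φ y = generator K F β Φ y := by
  have := hβ.isFinite
  have hνfin : IsFiniteMeasure ((markMeasure β).restrict (markBox n)) :=
    ⟨by rw [restrict_apply_univ]; exact finite_markBox hβ n⟩
  rw [← generator_add_const Φ C y]
  have h0 : ∀ y, 0 ≤ Φ y + C := fun y => by linarith [(abs_le.1 (hC y)).1]
  have h1 : ∀ y, Φ y + C ≤ C + C := fun y => by linarith [(abs_le.1 (hC y)).2]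
  have hm : Measurable fun y => Φ y + C := hΦ.add_const C
  have hyf := levelSet_subset_finiteStates n hy
  have ha : Measurable fun e : Mark => Φ (act K F y e) + C :=
    hm.comp ((measurable_act hK hF).comp (measurable_const.prodMk measurable_id))
  have hi : Integrable (fun e => Φ (act K F y e) + C) ((markMeasure β).restrict (markBox n)) :=
    Integrable.of_bound ha.aestronglyMeasurable (C + C)
      (ae_of_all _ fun e => by rw [norm_of_nonneg (h0 _)]; exact h1 _)
  rw [generator_eq hK hF hβ hyf hm h0 h1]
  have hl := lintegral_act (β := β) hK hF hβ hy (Ψ := fun y => ofReal (Φ y + C))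
    hm.ennreal_ofReal
  have hr := jumpRate_lt_top hK hF hβ hyf
  have hb := finite_markBox hβ n
  have hQ : jumpOp K F β (fun y => ofReal (Φ y + C)) y ≠ ∞ := by
    refine (lt_of_le_of_lt (jumpOp_mono (Ψ' := fun _ => ofReal (C + C))
      (fun y => ofReal_le_ofReal (h1 y)) y) ?_).ne
    rw [jumpOp_const]
    exact mul_lt_top hr ENNReal.ofReal_lt_top
  have hl' := congrArg ENNReal.toReal hl
  rw [toReal_add hi.lintegral_lt_top.ne (mul_ne_top hr.ne ofReal_ne_top),
    toReal_add hQ (mul_ne_top hb.ne ofReal_ne_top), toReal_mul,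
    toReal_mul, ENNReal.toReal_ofReal (h0 y), ← integral_eq_lintegral_of_nonneg_ae
      (ae_of_all _ fun _ => h0 _) ha.aestronglyMeasurable] at hl'
  have e : truncGen K F β n Φ y = (∫ e in markBox n, (Φ (act K F y e) + C) ∂(markMeasure β)) -
      (markMeasure β (markBox n)).toReal * (Φ y + C) := by
    have e1 : ∀ e, Φ (actTrunc K F n y e) - Φ y = (Φ (act K F y e) + C) - (Φ y + C) := fun e => by
      rw [actTrunc_of_mem hy]; ring
    unfold truncGen
    simp only [e1]
    rw [integral_sub hi (integrable_const _), integral_const, real,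
      restrict_apply_univ, smul_eq_mul]
  rw [e]
  linarith

lemma truncGen_of_notMem (hy : y ∉ levelSet K F n) (Φ : MassSeq → ℝ) :
    truncGen K F β n Φ y = 0 := by
  simp [truncGen, actTrunc_of_notMem hy]

include hK hF hβ in
lemma measurable_truncGen (n : ℕ) (hΦ : Measurable Φ) :
    Measurable (truncGen K F β n Φ) := by
  have := hβ.isFinite
  have h : Measurable fun q : MassSeq × Mark => Φ (actTrunc K F n q.1 q.2) - Φ q.1 :=
    (hΦ.comp (measurable_actTrunc hK hF n)).sub (hΦ.comp measurable_fst)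
  exact h.stronglyMeasurable.integral_prod_right'.measurable

include hβ in
lemma abs_truncGen_le (n : ℕ) {C : ℝ} (hC : ∀ y, |Φ y| ≤ C) (y : MassSeq) :
    |truncGen K F β n Φ y| ≤ 2 * C * (markMeasure β).real (markBox n) := by
  rw [← Real.norm_eq_abs, truncGen]
  refine norm_setIntegral_le_of_norm_le_const (finite_markBox hβ n) fun e _ => ?_
  exact (abs_sub _ _).trans (by linarith [hC (actTrunc K F n y e), hC y])

include hK hF in
open Classical in
/-- Over a time interval with at most one event of the box, the increment of `Φ` is the sum of the
changes that the events of the interval would cause in the state at its beginning. -/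
lemma abs_truncPath_sub_sub_le {π : Measure (ℝ≥0 × Mark)} (h : IsConfig k π) (n : ℕ) (hst : s ≤ t)
    (x : MassSeq) (hΦ : Measurable Φ) {C : ℝ} (hC : ∀ y, |Φ y| ≤ C) :
    |Φ (truncPath K F π n t x) - Φ (truncPath K F π n s x) -
      ∫ e in Ioc s t ×ˢ markBox n, (Φ (actTrunc K F n (truncPath K F π n s x) e.2) -
        Φ (truncPath K F π n s x)) ∂π| ≤
      4 * C * (if 2 ≤ π (Ioc s t ×ˢ markBox n) then
        π (Ioc s t ×ˢ markBox n) else 0).toReal := by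
  set y := truncPath K F π n s x
  have hC0 : 0 ≤ C := (abs_nonneg _).trans (hC y)
  have hg : StronglyMeasurable fun e : ℝ≥0 × Mark => Φ (actTrunc K F n y e.2) - Φ y :=
    ((hΦ.comp ((measurable_actTrunc hK hF n).comp
      (measurable_const.prodMk measurable_snd))).sub_const _).stronglyMeasurable
  rw [h.restrict_eq, integral_finsetSum_measure fun r _ => ?_]
  swap
  · refine Integrable.of_bound hg.aestronglyMeasurable (2 * C) (ae_of_all _ fun e => ?_)
    calc |Φ (actTrunc K F n y e.2) - Φ y| ≤ |Φ (actTrunc K F n y e.2)| + |Φ y| := abs_sub _ _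
      _ ≤ 2 * C := by linarith [hC (actTrunc K F n y e.2), hC y]
  simp only [integral_dirac' _ _ hg, h.apply_box]
  set T := (events π n t).filter (s < ·) with hT
  rcases lt_or_ge T.card 2 with hc | hc
  · have hif : ¬ (2 : ℝ≥0∞) ≤ T.card := by
      rw [not_le]; exact_mod_cast hc
    rw [if_neg hif, ENNReal.toReal_zero, mul_zero]
    have hone : ∀ r ∈ events π n t, ∀ r' ∈ events π n t, s < r → s < r' → r = r' :=
      fun r hr r' hr' h1 h2 => Finset.card_le_one.1 (by omega : T.card ≤ 1) r
        (Finset.mem_filter.2 ⟨hr, h1⟩) r' (Finset.mem_filter.2 ⟨hr', h2⟩)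
    rw [truncPath_eq_actTrunc_soleMark hK hF h hst hone]
    change |Φ (actTrunc K F n y _) - Φ y - _| ≤ 0
    have h01 : T.card = 0 ∨ T.card = 1 := by omega
    rcases h01 with h0 | h1
    · rw [Finset.card_eq_zero] at h0
      have hex : ¬ ∃ r, (events π n t).filter (s < ·) = {r} := by
        rintro ⟨r, hr⟩
        rw [← hT, h0] at hr
        exact absurd hr.symm (Finset.singleton_ne_empty r)
      rw [h0, soleMark, dif_neg hex, actTrunc_restMark]
      simp
    · obtain ⟨r, hr⟩ := Finset.card_eq_one.1 h1
      have hex : ∃ r, (events π n t).filter (s < ·) = {r} := ⟨r, hr⟩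
      have hch : hex.choose = r := by
        have : hex.choose ∈ T := hex.choose_spec.ge (Finset.mem_singleton_self _)
        rw [hr] at this
        exact Finset.mem_singleton.1 this
      rw [hr, soleMark, dif_pos hex, hch]
      simp
  · have hif : (2 : ℝ≥0∞) ≤ T.card := by exact_mod_cast hc
    rw [if_pos hif, ENNReal.toReal_natCast]
    have h1 : |∑ r ∈ T, (Φ (actTrunc K F n y (markAt π r)) - Φ y)| ≤ ∑ r ∈ T, 2 * C := by
      refine (Finset.abs_sum_le_sum_abs _ _).trans (sum_le_sum fun r _ => ?_)
      calc _ ≤ |Φ (actTrunc K F n y (markAt π r))| + |Φ y| := abs_sub _ _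
        _ ≤ 2 * C := by linarith [hC (actTrunc K F n y (markAt π r)), hC y]
    rw [Finset.sum_const, nsmul_eq_mul] at h1
    have h2 : (2 : ℝ) ≤ T.card := by exact_mod_cast hc
    have h3 := hC (truncPath K F π n t x)
    have h4 := hC y
    rw [abs_le] at h1 h3 h4 ⊢
    constructor <;> nlinarith

include hK hF in
lemma IsDriver.measurable_uncurry_truncPath (hd : IsDriver β k ℋ π P) (n : ℕ) (x : MassSeq) :
    Measurable fun q : Ω × ℝ≥0 => truncPath K F (π q.1) n q.2 x :=
  measurable_uncurry_of_right (Y := fun s ω => truncPath K F (π ω) n s x)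
    (fun s => (hd.measurable_truncPath hK hF n s x).mono (ℋ.le s) le_rfl) fun ω s =>
      tendsto_const_nhds.congr' ((truncPath_eventually_right (hd.config ω) n s x).mono
        fun _ h => h.symm)

variable [IsProbabilityMeasure P]

include hK hF hβ in
lemma IsDriver.expansion (hd : IsDriver β k ℋ π P) (n : ℕ) (x : MassSeq) (hst : s ≤ t)
    (hA : MeasurableSet[ℋ s] A) (hΦ : Measurable Φ) {C : ℝ} (hC : ∀ y, |Φ y| ≤ C) :
    |(∫ ω in A, Φ (truncPath K F (π ω) n t x) ∂P) - (∫ ω in A, Φ (truncPath K F (π ω) n s x) ∂P) -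
      (t - s : ℝ≥0) * ∫ ω in A, truncGen K F β n Φ (truncPath K F (π ω) n s x) ∂P| ≤
      4 * C * ((t - s : ℝ≥0) * (markMeasure β).real (markBox n)) ^ 2 := by
  have hC0 : 0 ≤ C := (abs_nonneg _).trans (hC x)
  have hm : ∀ t, Measurable fun ω => Φ (truncPath K F (π ω) n t x) := fun t =>
    hΦ.comp ((hd.measurable_truncPath hK hF n t x).mono (ℋ.le t) le_rfl)
  have hi : ∀ t, IntegrableOn (fun ω => Φ (truncPath K F (π ω) n t x)) A P := fun t =>
    Integrable.of_bound (hm t).aestronglyMeasurable C (ae_of_all _ fun ω => hC _)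
  have hG : Measurable fun q : MassSeq × Mark => Φ (actTrunc K F n q.1 q.2) - Φ q.1 :=
    (hΦ.comp (measurable_actTrunc hK hF n)).sub (hΦ.comp measurable_fst)
  obtain ⟨h1, h2⟩ := hd.integral_integral hβ n hst hA (hd.measurable_truncPath hK hF n s x) hG
    (C := 2 * C) fun q => (abs_sub _ _).trans (by
      linarith [hC (actTrunc K F n q.1 q.2), hC q.1])
  unfold truncGen
  rw [← h2, ← integral_sub (hi t) (hi s),
    ← integral_sub (f := fun ω => Φ (truncPath K F (π ω) n t x) - Φ (truncPath K F (π ω) n s x))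
      ((hi t).sub (hi s)) h1]
  have hD := hd.double s t n hst
  set J : Ω → ℝ≥0∞ := fun ω => if 2 ≤ π ω (Ioc s t ×ˢ markBox n) then
    π ω (Ioc s t ×ˢ markBox n) else 0 with hJ
  have hJm : Measurable J := by
    have := (hd.measurable s t _ (measurableSet_markBox n)).mono (ℋ.le t) le_rfl
    exact Measurable.ite (measurableSet_le measurable_const this) this measurable_const
  have hb : ((t - s : ℝ≥0) * markMeasure β (markBox n)) ^ 2 ≠ ∞ :=
    ENNReal.pow_ne_top (mul_ne_top coe_ne_top (finite_markBox hβ n).ne)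
  have hJi : Integrable (fun ω => (J ω).toReal) P :=
    integrable_toReal_of_lintegral_ne_top hJm.aemeasurable (ne_top_of_le_ne_top hb hD)
  have hJe : ∫ ω, (J ω).toReal ∂P ≤ ((t - s : ℝ≥0) * (markMeasure β).real (markBox n)) ^ 2 := by
    have := toReal_mono hb hD
    rw [ENNReal.toReal_pow, toReal_mul, coe_toReal] at this
    rwa [integral_toReal hJm.aemeasurable (ae_lt_top hJm (ne_top_of_le_ne_top hb hD))]
  rw [← Real.norm_eq_abs]
  calc _ ≤ ∫ ω in A, 4 * C * (J ω).toReal ∂P := by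
        refine norm_integral_le_of_norm_le (hJi.integrableOn.const_mul _) (ae_of_all _ fun ω => ?_)
        exact abs_truncPath_sub_sub_le hK hF (hd.config ω) n hst x hΦ hC
    _ ≤ ∫ ω, 4 * C * (J ω).toReal ∂P :=
        setIntegral_le_integral (hJi.const_mul _) (ae_of_all _ fun ω => by positivity)
    _ ≤ _ := by
        rw [integral_const_mul]
        gcongr

lemma eq_of_abs_sub_le_sq {D : ℝ≥0 → ℝ} {c : ℝ}
    (h : ∀ s t : ℝ≥0, s ≤ t → t ≤ s + 1 → |D t - D s| ≤ c * ((t - s : ℝ≥0) : ℝ) ^ 2) (t : ℝ≥0) :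
    D t = D 0 := by
  have key : ∀ N : ℕ, t ≤ N → 0 < N → |D t - D 0| ≤ c * (t : ℝ) ^ 2 / N := by
    intro N hN hN0
    have hN' : (0 : ℝ≥0) < N := by exact_mod_cast hN0
    have hδ1 : t / N ≤ 1 := div_le_one_of_le₀ hN zero_le
    have hi : ∀ i : ℕ, |D (i * (t / N)) - D 0| ≤ i * (c * ((t / N : ℝ≥0) : ℝ) ^ 2) := by
      intro i
      induction i with
      | zero => simp
      | succ i ih =>
        have e : ((i + 1 : ℕ) : ℝ≥0) * (t / N) = i * (t / N) + t / N := by push_cast; ring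
        have := h (i * (t / N)) (i * (t / N) + t / N) le_self_add (by gcongr)
        rw [add_tsub_cancel_left] at this
        rw [e]
        calc _ ≤ |D (i * (t / N) + t / N) - D (i * (t / N))| + |D (i * (t / N)) - D 0| :=
              abs_sub_le _ _ _
          _ ≤ c * ((t / N : ℝ≥0) : ℝ) ^ 2 + i * (c * ((t / N : ℝ≥0) : ℝ) ^ 2) := add_le_add this ih
          _ = _ := by push_cast; ring
    have := hi N
    rw [mul_div_cancel₀ _ hN'.ne'] at this
    refine this.trans_eq ?_
    have : (N : ℝ) ≠ 0 := by exact_mod_cast hN0.ne'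
    push_cast
    field_simp
  have hlim := tendsto_const_div_atTop_nhds_zero_nat (c * (t : ℝ) ^ 2)
  have : |D t - D 0| ≤ 0 := by
    refine ge_of_tendsto hlim ?_
    obtain ⟨N, hN⟩ := exists_nat_ge t
    filter_upwards [eventually_ge_atTop N, eventually_gt_atTop 0] with M hM hM0
    exact key M (hN.trans (by exact_mod_cast hM)) hM0
  exact sub_eq_zero.1 (abs_nonpos_iff.1 this)

include hK hF hβ in
/-- Both sides have increments that agree up to a multiple of the square of the time step. -/
lemma IsDriver.dynkin (hd : IsDriver β k ℋ π P) (n : ℕ) (x : MassSeq) (hst : s ≤ t)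
    (hA : MeasurableSet[ℋ s] A) (hΦ : Measurable Φ) {C : ℝ} (hC : ∀ y, |Φ y| ≤ C) :
    (∫ ω in A, Φ (truncPath K F (π ω) n t x) ∂P) = (∫ ω in A, Φ (truncPath K F (π ω) n s x) ∂P) +
      ∫ u in Ioc s t, ∫ ω in A, truncGen K F β n Φ (truncPath K F (π ω) n u x) ∂P ∂leb := by
  have hC0 : 0 ≤ C := (abs_nonneg _).trans (hC x)
  set b := (markMeasure β).real (markBox n) with hb
  have hb0 : 0 ≤ b := measureReal_nonneg
  set C' := 2 * C * b with hC'
  have hC'0 : 0 ≤ C' := by positivity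
  have hT := measurable_truncGen hK hF hβ n hΦ
  have hTC : ∀ y, |truncGen K F β n Φ y| ≤ C' := abs_truncGen_le hβ n hC
  have hZ := hd.measurable_uncurry_truncPath hK hF n x
  set ψ : ℝ≥0 → ℝ := fun u => ∫ ω in A, truncGen K F β n Φ (truncPath K F (π ω) n u x) ∂P with hψ
  have hψm : Measurable ψ :=
    ((hT.comp hZ).stronglyMeasurable.integral_prod_left' (μ := P.restrict A)).measurable
  have hbound : ∀ (Ψ : MassSeq → ℝ) (B : ℝ), 0 ≤ B → (∀ y, |Ψ y| ≤ B) → ∀ u,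
      |∫ ω in A, Ψ (truncPath K F (π ω) n u x) ∂P| ≤ B := by
    intro Ψ B hB0 hB u
    have := norm_setIntegral_le_of_norm_le_const (μ := P) (s := A) (measure_lt_top P A)
      (f := fun ω => Ψ (truncPath K F (π ω) n u x)) fun ω _ => hB _
    exact this.trans (mul_le_of_le_one_right hB0 measureReal_le_one)
  have hψi : ∀ a c : ℝ≥0, a ≤ c → IntegrableOn ψ (Ioc a c) leb := fun a c hac =>
    Measure.integrableOn_of_bounded (M := C') (by rw [leb_Ioc hac]; exact coe_ne_top)
      hψm.aestronglyMeasurable (ae_of_all _ fun u => hbound _ _ hC'0 hTC u)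
  set L := 2 * C' * b + 4 * C' * b ^ 2 with hL
  have hL0 : 0 ≤ L := by positivity
  have hlip : ∀ a c, s ≤ a → a ≤ c → c ≤ a + 1 → |ψ c - ψ a| ≤ L * ((c - a : ℝ≥0) : ℝ) := by
    intro a c hsa hac hca
    have h1 := hd.expansion hK hF hβ n x hac (ℋ.mono hsa _ hA) hT hTC
    have h2 := hbound (truncGen K F β n (truncGen K F β n Φ)) (2 * C' * b) (by positivity)
      (abs_truncGen_le hβ n hTC) a
    have hle : ((c - a : ℝ≥0) : ℝ) ≤ 1 := by exact_mod_cast tsub_le_iff_left.2 hca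
    have h0 : (0 : ℝ) ≤ ((c - a : ℝ≥0) : ℝ) := coe_nonneg _
    set δ : ℝ := ((c - a : ℝ≥0) : ℝ)
    have h3 : |ψ c - ψ a| ≤ δ * (2 * C' * b) + 4 * C' * (δ * b) ^ 2 := by
      set I := ∫ ω in A, truncGen K F β n (truncGen K F β n Φ) (truncPath K F (π ω) n a x) ∂P
      have e : ψ c - ψ a = (ψ c - ψ a - δ * I) + δ * I := by ring
      rw [e]
      refine (abs_add_le _ _).trans ?_
      rw [abs_mul, abs_of_nonneg h0, add_comm]
      exact add_le_add (by gcongr) h1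
    refine h3.trans ?_
    have : 4 * C' * (δ * b) ^ 2 ≤ 4 * C' * b ^ 2 * δ := by
      have : δ ^ 2 ≤ δ := by nlinarith
      calc 4 * C' * (δ * b) ^ 2 = 4 * C' * b ^ 2 * δ ^ 2 := by ring
        _ ≤ _ := by gcongr
    rw [hL]
    linarith
  let D : ℝ≥0 → ℝ := fun u => (∫ ω in A, Φ (truncPath K F (π ω) n (s + u) x) ∂P) -
    ∫ v in Ioc s (s + u), ψ v ∂leb
  have hD := eq_of_abs_sub_le_sq (D := D) (c := 4 * C * b ^ 2 + L) (fun u u' huu hu1 => ?_) (t - s)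
  · simp only [D, add_tsub_cancel_of_le hst, add_zero, Set.Ioc_self, Measure.restrict_empty,
      integral_zero_measure, sub_zero] at hD
    linarith
  have hac : s + u ≤ s + u' := by gcongr
  have e0 : s + u' - (s + u) = u' - u := add_tsub_add_eq_tsub_left _ _ _
  have hsplit : ∫ v in Ioc s (s + u'), ψ v ∂leb = (∫ v in Ioc s (s + u), ψ v ∂leb) +
      ∫ v in Ioc (s + u) (s + u'), ψ v ∂leb := by
    rw [← Set.Ioc_union_Ioc_eq_Ioc le_self_add hac]
    exact setIntegral_union (Set.Ioc_disjoint_Ioc_of_le le_rfl) measurableSet_Ioc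
      (hψi _ _ le_self_add) (hψi _ _ hac)
  have h1 := hd.expansion hK hF hβ n x hac (ℋ.mono le_self_add _ hA) hΦ hC
  rw [e0] at h1
  have h0 : (0 : ℝ) ≤ ((u' - u : ℝ≥0) : ℝ) := coe_nonneg _
  have h2 : |(∫ v in Ioc (s + u) (s + u'), ψ v ∂leb) - ((u' - u : ℝ≥0) : ℝ) * ψ (s + u)| ≤
      L * ((u' - u : ℝ≥0) : ℝ) ^ 2 := by
    have hvol : leb.real (Ioc (s + u) (s + u')) = ((u' - u : ℝ≥0) : ℝ) := by
      rw [real, leb_Ioc hac, e0, coe_toReal]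
    have e1 : ((u' - u : ℝ≥0) : ℝ) * ψ (s + u) = ∫ v in Ioc (s + u) (s + u'), ψ (s + u) ∂leb := by
      rw [setIntegral_const, hvol, smul_eq_mul]
    have hfin : leb (Ioc (s + u) (s + u')) < ∞ := by
      rw [leb_Ioc hac]; exact coe_lt_top
    rw [e1, ← integral_sub (hψi _ _ hac) (integrableOn_const hfin.ne), ← Real.norm_eq_abs]
    have := norm_setIntegral_le_of_norm_le_const (μ := leb) hfin (f := fun v => ψ v - ψ (s + u))
      (C := L * ((u' - u : ℝ≥0) : ℝ)) fun v hv => by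
        have hv1 : v ≤ s + u + 1 := hv.2.trans (by rw [add_assoc]; gcongr)
        refine (hlip _ v le_self_add hv.1.le hv1).trans ?_
        refine mul_le_mul_of_nonneg_left ?_ hL0
        rw [← e0]
        exact_mod_cast tsub_le_tsub_right hv.2 _
    rw [hvol] at this
    refine this.trans_eq (by ring)
  simp only [D]
  rw [hsplit]
  set δ : ℝ := ((u' - u : ℝ≥0) : ℝ)
  have h3 : 4 * C * (δ * b) ^ 2 = 4 * C * b ^ 2 * δ ^ 2 := by ring
  rw [h3] at h1
  rw [abs_le] at h1 h2 ⊢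
  change _ ≤ _ - _ - δ * ψ (s + u) ∧ _ - _ - δ * ψ (s + u) ≤ _ at h1
  constructor <;> linarith [h1.1, h1.2, h2.1, h2.2]

end Dynkin

lemma measurable_setIntegral_Iic {S Ω : Type*} {m : MeasurableSpace Ω} [TopologicalSpace S]
    [TopologicalSpace.PseudoMetrizableSpace S] [MeasurableSpace S] [BorelSpace S] {Y : ℝ≥0 → Ω → S}
    (hm : ∀ s ≤ t, Measurable (Y s)) (hr : ∀ ω s, Tendsto (fun s => Y s ω) (𝓝[>] s) (𝓝 (Y s ω)))
    {g : S → ℝ} (hg : Measurable g) :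
    Measurable fun ω => ∫ u in Iic t, g (Y u ω) ∂leb := by
  have h2 := (hg.comp (measurable_uncurry_min hm hr)).stronglyMeasurable.integral_prod_right'
    (ν := leb.restrict (Iic t))
  convert! h2.measurable using 2 with ω
  refine setIntegral_congr_fun measurableSet_Iic fun u hu => ?_
  simp only [Function.comp]
  rw [min_eq_left hu]

section Martingale

variable {π : Ω → Measure (ℝ≥0 × Mark)} [IsProbabilityMeasure P]

include hK hF hβ in
lemma IsDriver.martingale_truncPath (hd : IsDriver β k ℋ π P) (n : ℕ) (x : MassSeq)
    (hΦ : Measurable Φ) {C : ℝ} (hC : ∀ y, |Φ y| ≤ C) :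
    Martingale (fun t ω => Φ (truncPath K F (π ω) n t x) - Φ x -
      ∫ u in Iic t, truncGen K F β n Φ (truncPath K F (π ω) n u x) ∂leb) ℋ P := by
  have hC0 : 0 ≤ C := (abs_nonneg _).trans (hC x)
  set C' := 2 * C * (markMeasure β).real (markBox n) with hC'
  have hC'0 : 0 ≤ C' := mul_nonneg (by positivity) measureReal_nonneg
  have hT := measurable_truncGen (K := K) (F := F) hK hF hβ n hΦ
  have hTC : ∀ y, |truncGen K F β n Φ y| ≤ C' := abs_truncGen_le hβ n hC
  have hZ := hd.measurable_uncurry_truncPath hK hF n x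
  have hfin : ∀ t, IsFiniteMeasure (leb.restrict (Iic t)) := fun t =>
    ⟨by rw [restrict_apply_univ, leb_Iic]; exact coe_lt_top⟩
  have hZm : ∀ t, Measurable[ℋ t] fun ω => Φ (truncPath K F (π ω) n t x) := fun t =>
    hΦ.comp (hd.measurable_truncPath hK hF n t x)
  have hIm : ∀ t : ℝ≥0, Measurable[ℋ t] fun ω =>
      ∫ u in Iic t, truncGen K F β n Φ (truncPath K F (π ω) n u x) ∂leb := by
    exact fun t => measurable_setIntegral_Iic (m := ℋ t)
      (Y := fun s ω => truncPath K F (π ω) n s x)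
      (fun s hs => (hd.measurable_truncPath hK hF n s x).mono (ℋ.mono hs) le_rfl)
      (fun ω s => tendsto_const_nhds.congr'
        ((truncPath_eventually_right (hd.config ω) n s x).mono fun _ h => h.symm)) hT
  have hIi : ∀ t : ℝ≥0, Integrable (fun q : Ω × ℝ≥0 =>
      truncGen K F β n Φ (truncPath K F (π q.1) n q.2 x)) (P.prod (leb.restrict (Iic t))) :=
    fun t => Integrable.of_bound (hT.comp hZ).aestronglyMeasurable C' (ae_of_all _ fun q => hTC _)
  have hZi : ∀ t, Integrable (fun ω => Φ (truncPath K F (π ω) n t x)) P := fun t =>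
    Integrable.of_bound ((hZm t).mono (ℋ.le t) le_rfl).aestronglyMeasurable C
      (ae_of_all _ fun ω => hC _)
  have hMi : ∀ t : ℝ≥0, Integrable (fun ω => Φ (truncPath K F (π ω) n t x) - Φ x -
      ∫ u in Iic t, truncGen K F β n Φ (truncPath K F (π ω) n u x) ∂leb) P := fun t =>
    ((hZi t).sub (integrable_const _)).sub (hIi t).integral_prod_left
  have hMm : ∀ t : ℝ≥0, Measurable[ℋ t] (fun ω => Φ (truncPath K F (π ω) n t x) - Φ x -
      ∫ u in Iic t, truncGen K F β n Φ (truncPath K F (π ω) n u x) ∂leb) := fun t =>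
    ((hZm t).sub measurable_const).sub (hIm t)
  refine ⟨fun t => (hMm t).stronglyMeasurable, fun s t hst => ?_⟩
  refine (ae_eq_condExp_of_forall_setIntegral_eq (ℋ.le s) (hMi t)
    (fun A hA _ => (hMi s).integrableOn) (fun A hA _ => ?_)
    (hMm s).stronglyMeasurable.aestronglyMeasurable).symm
  have hsw : ∀ t : ℝ≥0, ∫ ω in A, (Φ (truncPath K F (π ω) n t x) - Φ x -
      ∫ u in Iic t, truncGen K F β n Φ (truncPath K F (π ω) n u x) ∂leb) ∂P =
      (∫ ω in A, Φ (truncPath K F (π ω) n t x) ∂P) - (∫ ω in A, Φ x ∂P) -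
      ∫ u in Iic t, ∫ ω in A, truncGen K F β n Φ (truncPath K F (π ω) n u x) ∂P ∂leb := by
    intro t
    have hIA : Integrable (fun q : Ω × ℝ≥0 => truncGen K F β n Φ (truncPath K F (π q.1) n q.2 x))
        ((P.restrict A).prod (leb.restrict (Iic t))) :=
      Integrable.of_bound (hT.comp hZ).aestronglyMeasurable C' (ae_of_all _ fun q => hTC _)
    rw [integral_sub (f := fun ω => Φ (truncPath K F (π ω) n t x) - Φ x)
      ((hZi t).integrableOn.sub (integrable_const _)) hIA.integral_prod_left,
      integral_sub (hZi t).integrableOn (integrable_const _), integral_integral_swap hIA]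
  rw [hsw, hsw, hd.dynkin hK hF hβ n x hst hA hΦ hC, ← Set.Iic_union_Ioc_eq_Iic hst]
  have hψ : ∀ S, MeasurableSet S → leb S < ∞ → IntegrableOn (fun u =>
      ∫ ω in A, truncGen K F β n Φ (truncPath K F (π ω) n u x) ∂P) S leb := by
    intro S hS hS'
    have : IsFiniteMeasure (leb.restrict S) := ⟨by rwa [restrict_apply_univ]⟩
    have hIA : Integrable (fun q : Ω × ℝ≥0 => truncGen K F β n Φ (truncPath K F (π q.1) n q.2 x))
        ((P.restrict A).prod (leb.restrict S)) :=
      Integrable.of_bound (hT.comp hZ).aestronglyMeasurable C' (ae_of_all _ fun q => hTC _)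
    exact hIA.integral_prod_right
  rw [setIntegral_union (Set.Iic_disjoint_Ioc le_rfl) measurableSet_Ioc
    (hψ _ measurableSet_Iic (by rw [leb_Iic]; exact coe_lt_top))
    (hψ _ measurableSet_Ioc (by rw [leb_Ioc hst]; exact coe_lt_top))]
  ring

end Martingale

/-! ### Non-explosion -/

/-- A weak form of Grönwall's inequality: over time intervals of length `h` with `c * h = 1 / 2`, a
bounded function grows at most by the factor `2`. -/
lemma le_two_pow_mul {u : ℝ≥0 → ℝ} {N c : ℝ} {h : ℝ≥0} (hch : c * h = 1 / 2) (hc : 0 ≤ c)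
    (hN : ∀ t, u t ≤ N)
    (hu0 : ∀ t, 0 ≤ u t)
    (hu : ∀ s t : ℝ≥0, s ≤ t → u t ≤ u s + c * ∫ v in Ioc s t, u v ∂leb) (j : ℕ) :
    ∀ t : ℝ≥0, t ≤ j * h → u t ≤ 2 ^ j * u 0 := by
  have step : ∀ s t : ℝ≥0, s ≤ t → t ≤ s + h → u t ≤ 2 * u s := by
    intro s t hst hth
    have hbdd : BddAbove (u '' Icc s (s + h)) := ⟨N, by rintro _ ⟨v, _, rfl⟩; exact hN v⟩
    set S := sSup (u '' Icc s (s + h)) with hS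
    have hle : ∀ v ∈ Icc s (s + h), u v ≤ S := fun v hv => le_csSup hbdd ⟨v, hv, rfl⟩
    have hS0 : 0 ≤ S := (hu0 s).trans (hle s ⟨le_rfl, le_self_add⟩)
    have hb : ∀ v ∈ Icc s (s + h), u v ≤ u s + S / 2 := by
      intro v hv
      have hvs : (v - s : ℝ≥0) ≤ h := tsub_le_iff_left.2 hv.2
      have h1 : ‖∫ w in Ioc s v, u w ∂leb‖ ≤ S * leb.real (Ioc s v) :=
        norm_setIntegral_le_of_norm_le_const (by rw [leb_Ioc hv.1]; exact coe_lt_top)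
          fun w hw => by
            rw [norm_of_nonneg (hu0 w)]
            exact hle w ⟨hw.1.le, hw.2.trans hv.2⟩
      have h2 : leb.real (Ioc s v) = ((v - s : ℝ≥0) : ℝ) := by
        rw [real, leb_Ioc hv.1, coe_toReal]
      have h3 : ((v - s : ℝ≥0) : ℝ) ≤ h := by exact_mod_cast hvs
      calc u v ≤ u s + c * ∫ w in Ioc s v, u w ∂leb := hu s v hv.1
        _ ≤ u s + c * (S * h) := by
            gcongr
            refine (le_abs_self _).trans (h1.trans ?_)
            rw [h2]
            gcongr
        _ = u s + S / 2 := by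
            have : c * (S * h) = S * (c * h) := by ring
            rw [this, hch]; ring
    have : S ≤ u s + S / 2 := csSup_le ⟨_, s, ⟨le_rfl, le_self_add⟩, rfl⟩ (by
      rintro _ ⟨v, hv, rfl⟩; exact hb v hv)
    have := hb t ⟨hst, hth⟩
    linarith
  induction j with
  | zero =>
    intro t ht
    have : t = 0 := by simpa using ht
    simp [this]
  | succ j ih =>
    intro t ht
    rcases le_total t (j * h) with h1 | h1
    · have := ih t h1
      have h0 := hu0 0
      calc u t ≤ 2 ^ j * u 0 := this
        _ ≤ 2 ^ (j + 1) * u 0 := by gcongr <;> norm_num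
    · have h2 := step _ t h1 (ht.trans_eq (by push_cast; ring))
      have h3 := ih (j * h) le_rfl
      calc u t ≤ 2 * u (j * h) := h2
        _ ≤ 2 * (2 ^ j * u 0) := by gcongr
        _ = _ := by ring

section NonExplosion

variable {π : Ω → Measure (ℝ≥0 × Mark)} [IsProbabilityMeasure P]

/-- The number of particles, capped at `N`. -/
def cappedCount (N : ℕ) (y : MassSeq) : ℝ := (min (count y) N).toReal

lemma measurable_cappedCount (N : ℕ) : Measurable (cappedCount N) :=
  (measurable_count.min measurable_const).ennreal_toReal

lemma cappedCount_nonneg (N : ℕ) (y : MassSeq) : 0 ≤ cappedCount N y := toReal_nonneg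

lemma cappedCount_le (N : ℕ) (y : MassSeq) : cappedCount N y ≤ N := by
  have := toReal_mono (natCast_ne_top N) (min_le_right (count y) N)
  rwa [ENNReal.toReal_natCast] at this

lemma ofReal_cappedCount (N : ℕ) (y : MassSeq) :
    ofReal (cappedCount N y) = min (count y) N :=
  ofReal_toReal (ne_top_of_le_ne_top (natCast_ne_top N) (min_le_right _ _))

include hK hF hβ in
lemma truncGen_cappedCount_le {M : ℝ≥0} {c : ℝ≥0}
    (hc : ∀ y ∈ massSet M, jumpOp K F β count y ≤ (jumpRate K F β y + c) * count y) (n N : ℕ)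
    (hy : y ∈ massSet M) : truncGen K F β n (cappedCount N) y ≤ c * cappedCount N y := by
  by_cases hyn : y ∈ levelSet K F n
  · rw [truncGen_of_mem hK hF hβ hyn (measurable_cappedCount N) (C := N) fun y => by
      rw [abs_of_nonneg (cappedCount_nonneg N y)]; exact cappedCount_le N y]
    rw [generator_eq hK hF hβ hy.1 (measurable_cappedCount N) (cappedCount_nonneg N)
      (cappedCount_le N)]
    simp only [ofReal_cappedCount]
    have hr := jumpRate_lt_top (β := β) hK hF hβ hy.1
    have h1 : jumpOp K F β (fun y => min (count y) N) y ≤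
        (jumpRate K F β y + c) * min (count y) N := by
      rcases le_total (count y) N with h | h
      · rw [min_eq_left h]
        exact (jumpOp_mono (fun y => min_le_left _ _) y).trans (hc y hy)
      · rw [min_eq_right h]
        refine (jumpOp_mono (Ψ' := fun _ => (N : ℝ≥0∞)) (fun y => min_le_right _ _) y).trans ?_
        rw [jumpOp_const]
        exact mul_le_mul_left le_self_add _
    have h2 := toReal_mono (mul_ne_top
      (ENNReal.add_ne_top.2 ⟨hr.ne, coe_ne_top⟩) (ne_top_of_le_ne_top
        (natCast_ne_top N) (min_le_right (count y) N))) h1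
    rw [toReal_mul, toReal_add hr.ne coe_ne_top, coe_toReal] at h2
    change _ ≤ _ * cappedCount N y at h2
    linarith
  · rw [truncGen_of_notMem hyn]
    exact mul_nonneg c.2 (cappedCount_nonneg N y)

lemma natCast_succ_le_count (h : y.1 n ≠ 0) : ((n + 1 : ℕ) : ℝ≥0∞) ≤ count y := by
  have h1 : ∀ k ∈ range (n + 1), (if y.1 k = 0 then (0 : ℝ≥0∞) else 1) = 1 := fun k hk =>
    if_neg fun h0 => h (apply_eq_zero_of_le h0 (Nat.lt_succ_iff.1 (Finset.mem_range.1 hk)))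
  calc ((n + 1 : ℕ) : ℝ≥0∞) = ∑ k ∈ range (n + 1), if y.1 k = 0 then (0 : ℝ≥0∞) else 1 := by
        rw [sum_congr rfl h1]; simp
    _ ≤ count y := sum_le_tsum _

include hK hF hβ in
/-- The number of particles has a finite mean, so that no truncation is ever left for good. -/
lemma IsDriver.ae_noExplosion (hd : IsDriver β k ℋ π P) (hx : x ∈ finiteStates) :
    ∀ᵐ ω ∂P, NoExplosion K F (π ω) x := by
  set M : ℝ≥0 := (mass x).toNNReal with hM
  have hxM : x ∈ massSet M := ⟨hx, by rw [hM, coe_toNNReal (mass_lt_top hx).ne]⟩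
  obtain ⟨c, hc⟩ := jumpOp_count_le (K := K) hF hβ M
  obtain ⟨L, hL⟩ := exists_mem_levelSet hK hF M
  set h : ℝ≥0 := 1 / (2 * (c + 1)) with hh
  have hch : ((c + 1 : ℝ≥0) : ℝ) * h = 1 / 2 := by
    have : ((c : ℝ) + 1) ≠ 0 := by positivity
    rw [hh]; push_cast; field_simp
  have hh0 : 0 < h := by positivity
  have hx0 := count_lt_top hx
  -- the mean of the capped number of particles grows at most exponentially
  have hmean : ∀ (n N j : ℕ) (t : ℝ≥0), t ≤ j * h →
      ∫ ω, cappedCount N (truncPath K F (π ω) n t x) ∂P ≤ 2 ^ j * (count x).toReal := by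
    intro n N j t ht
    have hT := measurable_truncGen (K := K) (F := F) hK hF hβ n (measurable_cappedCount N)
    have hCN : ∀ y, |cappedCount N y| ≤ N := fun y => by
      rw [abs_of_nonneg (cappedCount_nonneg N y)]; exact cappedCount_le N y
    have hZ := hd.measurable_uncurry_truncPath hK hF n x
    have hci : ∀ t, Integrable (fun ω => cappedCount N (truncPath K F (π ω) n t x)) P := fun t =>
      Integrable.of_bound ((measurable_cappedCount N).comp ((hd.measurable_truncPath hK hF n t
        x).mono (ℋ.le t) le_rfl)).aestronglyMeasurable N (ae_of_all _ fun ω => hCN _)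
    have hTi : ∀ t, Integrable (fun ω =>
        truncGen K F β n (cappedCount N) (truncPath K F (π ω) n t x)) P := fun t =>
      Integrable.of_bound (hT.comp ((hd.measurable_truncPath hK hF n t
        x).mono (ℋ.le t) le_rfl)).aestronglyMeasurable _
          (ae_of_all _ fun ω => abs_truncGen_le hβ n hCN _)
    refine (le_two_pow_mul (u := fun t => ∫ ω, cappedCount N (truncPath K F (π ω) n t x) ∂P)
      (N := N) hch (coe_nonneg _) (fun t => ?_) (fun t => integral_nonneg fun ω =>
        cappedCount_nonneg _ _) (fun s t hst => ?_) j t ht).trans ?_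
    · refine (integral_mono (hci t) (integrable_const (N : ℝ)) fun ω => cappedCount_le _ _).trans ?_
      simp
    · have hdyn := hd.dynkin hK hF hβ n x hst (MeasurableSet.univ) (measurable_cappedCount N) hCN
      simp only [restrict_univ] at hdyn
      change ∫ ω, cappedCount N (truncPath K F (π ω) n t x) ∂P ≤ _
      rw [hdyn, ← integral_const_mul]
      have hfin : IsFiniteMeasure (leb.restrict (Ioc s t)) :=
        ⟨by rw [restrict_apply_univ, leb_Ioc hst]; exact coe_lt_top⟩
      have hi1 : Integrable (fun q : Ω × ℝ≥0 => truncGen K F β n (cappedCount N)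
          (truncPath K F (π q.1) n q.2 x)) (P.prod (leb.restrict (Ioc s t))) :=
        Integrable.of_bound (hT.comp hZ).aestronglyMeasurable _
          (ae_of_all _ fun q => abs_truncGen_le hβ n hCN _)
      have hi2 : Integrable (fun q : Ω × ℝ≥0 => cappedCount N
          (truncPath K F (π q.1) n q.2 x)) (P.prod (leb.restrict (Ioc s t))) :=
        Integrable.of_bound ((measurable_cappedCount N).comp hZ).aestronglyMeasurable N
          (ae_of_all _ fun q => hCN _)
      gcongr ?_ + ?_
      · exact le_rfl
      refine integral_mono hi1.integral_prod_right (hi2.integral_prod_right.const_mul _)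
        fun u => ?_
      change _ ≤ _ * _
      rw [← integral_const_mul]
      refine integral_mono (hTi u) ((hci u).const_mul _) fun ω => ?_
      refine (truncGen_cappedCount_le hK hF hβ hc n N
        (truncPath_mem_massSet (hd.config ω) hxM u)).trans ?_
      have := cappedCount_nonneg N (truncPath K F (π ω) n u x)
      push_cast
      nlinarith
    · simp only [truncPath_zero (hd.config _), integral_const, probReal_univ, smul_eq_mul, one_mul]
      gcongr
      exact toReal_mono hx0.ne (min_le_left _ _)
  have hexit : ∀ (t : ℝ≥0), ∀ᵐ ω ∂P, ∃ n, truncPath K F (π ω) n t x ∈ levelSet K F n := by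
    intro t
    obtain ⟨j, hj⟩ := exists_nat_ge (t / h)
    rw [div_le_iff₀ hh0] at hj
    set B : ℝ := 2 ^ j * (count x).toReal
    have hmeas : ∀ n, MeasurableSet {ω | truncPath K F (π ω) n t x ∉ levelSet K F n} := fun n =>
      ((hd.measurable_truncPath hK hF n t x).mono (ℋ.le t) le_rfl
        (measurableSet_levelSet hK hF n)).compl
    have hbound : ∀ n, L ≤ n → P.real {ω | truncPath K F (π ω) n t x ∉ levelSet K F n} ≤
        B / (n + 1 : ℕ) := by
      intro n hn
      rw [le_div_iff₀ (by positivity), mul_comm]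
      have hci : Integrable (fun ω => cappedCount (n + 1) (truncPath K F (π ω) n t x)) P :=
        Integrable.of_bound ((measurable_cappedCount (n + 1)).comp ((hd.measurable_truncPath hK hF n
          t x).mono (ℋ.le t) le_rfl)).aestronglyMeasurable ((n + 1 : ℕ) : ℝ)
            (ae_of_all _ fun ω => by
              rw [norm_of_nonneg (cappedCount_nonneg _ _)]; exact cappedCount_le _ _)
      refine le_trans ?_ (hmean n (n + 1) j t hj)
      refine le_trans ?_ (mul_meas_ge_le_integral_of_nonneg (ae_of_all _ fun ω =>
        cappedCount_nonneg _ _) hci ((n + 1 : ℕ) : ℝ))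
      refine mul_le_mul_of_nonneg_left (measureReal_mono ?_ (measure_ne_top P _)) (by positivity)
      intro ω hω
      change ((n + 1 : ℕ) : ℝ) ≤ cappedCount (n + 1) _
      have hz := truncPath_mem_massSet (K := K) (F := F) (n := n) (hd.config ω) hxM t
      have h0 : (truncPath K F (π ω) n t x).1 n ≠ 0 := fun h0 =>
        hω (hL _ (by exact_mod_cast apply_zero_le_of_mem_massSet hz) n hn h0)
      rw [cappedCount, min_eq_right (natCast_succ_le_count h0), ENNReal.toReal_natCast]
    have hzero : P.real {ω | ∀ n, truncPath K F (π ω) n t x ∉ levelSet K F n} ≤ 0 := by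
      refine ge_of_tendsto ((tendsto_add_atTop_iff_nat 1).2
        (tendsto_const_div_atTop_nhds_zero_nat B)) ?_
      filter_upwards [eventually_ge_atTop L] with n hn
      have hsub : {ω | ∀ n, truncPath K F (π ω) n t x ∉ levelSet K F n} ⊆
          {ω | truncPath K F (π ω) n t x ∉ levelSet K F n} := fun ω hω => hω n
      exact (measureReal_mono hsub).trans (hbound n hn)
    have : P {ω | ∀ n, truncPath K F (π ω) n t x ∉ levelSet K F n} = 0 :=
      (measureReal_eq_zero_iff).1 (le_antisymm hzero measureReal_nonneg)
    rw [ae_iff]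
    simpa only [not_exists] using this
  have hall : ∀ᵐ ω ∂P, ∀ i : ℕ, ∃ n, truncPath K F (π ω) n i x ∈ levelSet K F n :=
    ae_all_iff.2 fun i => hexit i
  filter_upwards [hall] with ω hω t
  obtain ⟨i, hi⟩ := exists_nat_ge t
  obtain ⟨n, hn⟩ := hω i
  exact ⟨n, truncPath_mem_of_le (hd.config ω) hi hn⟩

end NonExplosion

/-! ### Drivers built from Poisson measures -/

section Build

variable {π : Ω → Measure (ℝ≥0 × Mark)}

lemma times_zero : times (0 : Measure (ℝ≥0 × Mark)) = ∅ := by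
  ext r
  simp [times]

lemma isConfig_zero (k : ℕ) : IsConfig k 0 where
  eq_sum := by
    have : IsEmpty (times (0 : Measure (ℝ≥0 × Mark))) := by rw [times_zero]; infer_instance
    rw [Measure.sum_of_isEmpty]
  pos r hr := by rw [times_zero] at hr; exact hr.elim
  finite n t := by simp [times_zero]
  good r hr := by rw [times_zero] at hr; exact hr.elim
  countable := by rw [times_zero]; exact Set.countable_empty

include hK hF in
lemma noExplosion_zero (hx : x ∈ finiteStates) : NoExplosion K F 0 x := by
  intro t
  obtain ⟨n, hn⟩ := exists_mem_levelSet_of_finite hK hF hx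
  refine ⟨n, ?_⟩
  rw [truncPath_congr (isConfig_zero 0) (zero_le (a := t)) (fun r hr => by
    rw [times_zero] at hr; exact hr.elim), truncPath_zero (isConfig_zero 0)]
  exact hn

open Classical in
/-- Configurations may be replaced by the empty one on a null event. -/
lemma isDriver_ite (hnull : ∀ S, MeasurableSet S → P S = 0 → ∀ t, MeasurableSet[ℋ t] S)
    {S : Set Ω} (hS : MeasurableSet S) (hS0 : P S = 0) (hcfg : ∀ ω ∉ S, IsConfig k (π ω))
    (hm : ∀ s t C, MeasurableSet C → Measurable[ℋ t] fun ω => π ω (Ioc s t ×ˢ C))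
    (hcomp : ∀ s t n C, s ≤ t → MeasurableSet C → ∀ A, MeasurableSet[ℋ s] A →
      ∫⁻ ω in A, π ω (Ioc s t ×ˢ (C ∩ markBox n)) ∂P =
        P A * ((t - s : ℝ≥0) * markMeasure β (C ∩ markBox n)))
    (hdbl : ∀ s t n, s ≤ t → ∫⁻ ω, (if 2 ≤ π ω (Ioc s t ×ˢ markBox n) then
      π ω (Ioc s t ×ˢ markBox n) else 0) ∂P ≤
        ((t - s : ℝ≥0) * markMeasure β (markBox n)) ^ 2) :
    IsDriver β k ℋ (fun ω => if ω ∈ S then 0 else π ω) P := by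
  have hae : ∀ᵐ ω ∂P, (if ω ∈ S then 0 else π ω) = π ω := by
    filter_upwards [measure_eq_zero_iff_ae_notMem.1 hS0] with ω hω
    exact if_neg hω
  refine ⟨fun ω => ?_, fun s t C hC => ?_, fun s t n C hst hC A hA => ?_, fun s t n hst => ?_⟩
  · by_cases hω : ω ∈ S
    · simp only [hω, if_true]
      exact isConfig_zero k
    · simp only [hω, if_false]
      exact hcfg ω hω
  · have : (fun ω => (if ω ∈ S then 0 else π ω) (Ioc s t ×ˢ C)) =
        fun ω => if ω ∈ S then 0 else π ω (Ioc s t ×ˢ C) := by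
      funext ω
      split_ifs <;> rfl
    rw [this]
    exact Measurable.ite (hnull S hS hS0 t) measurable_const (hm s t C hC)
  · rw [← hcomp s t n C hst hC A hA]
    refine lintegral_congr_ae (ae_restrict_of_ae ?_)
    filter_upwards [hae] with ω hω
    rw [hω]
  · refine le_trans (le_of_eq ?_) (hdbl s t n hst)
    refine lintegral_congr_ae ?_
    filter_upwards [hae] with ω hω
    rw [hω]

lemma measurableSet_canonicalFiltration_of_null {N : Ω → Measure CoagMark}
    {M : Ω → Measure FragMark} {hN : Measurable N} {hM : Measurable M} {S : Set Ω}
    (hS : MeasurableSet S) (h0 : P S = 0) (t : ℝ≥0) :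
    MeasurableSet[canonicalFiltration hN hM P t] S :=
  le_sup_right (a := pastSigma N t ⊔ pastSigma M t) _
    (MeasurableSpace.measurableSet_generateFrom ⟨hS, h0⟩)

variable [IsProbabilityMeasure P]

include hβ in
lemma IsDrivingPair.exists_isDriver {N : Ω → Measure CoagMark} {M : Ω → Measure FragMark}
    (h : IsDrivingPair β N M P) :
    ∃ k π, IsDriver β k (canonicalFiltration h.coag.measurable h.frag.measurable P) π P ∧
      ∀ᵐ ω ∂P, π ω = joint N M ω := by
  classical
  have := hβ.isFinite
  obtain ⟨k, hk⟩ := hβ.exists_isGoodRatio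
  have hae := h.ae_isConfig hβ hk
  set S := toMeasurable P {ω | ¬ IsConfig k (joint N M ω)}
  have hS : MeasurableSet S := measurableSet_toMeasurable _ _
  have hS0 : P S = 0 := (measure_toMeasurable _).trans hae
  have hν : ∀ n, markMeasure β (markBox n) ≠ ∞ := fun n => (finite_markBox hβ n).ne
  refine ⟨k, fun ω => if ω ∈ S then 0 else joint N M ω,
    isDriver_ite (fun S h1 h2 t => measurableSet_canonicalFiltration_of_null h1 h2 t) hS hS0
      (fun ω hω => ?_) (fun s t C hC => measurable_joint_rect s t hC)
      (fun s t n C hst hC A hA => h.setLIntegral_joint (hC.inter (measurableSet_markBox n)) hst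
        (measure_ne_top_of_subset Set.inter_subset_right (hν n)) hA) (fun s t n hst => ?_), ?_⟩
  · by_contra hc
    exact hω (subset_toMeasurable P _ hc)
  · have hsf : SFinite (markMeasure β) := by unfold markMeasure; infer_instance
    have e : leb.prod (markMeasure β) (Ioc s t ×ˢ markBox n) =
        (t - s : ℝ≥0) * markMeasure β (markBox n) := by
      rw [prod_prod, leb_Ioc hst]
    rw [← e]
    exact h.lintegral_joint_two_le (measurableSet_Ioc.prod (measurableSet_markBox n))
      (by rw [e]; exact mul_ne_top coe_ne_top (hν n))
  · filter_upwards [measure_eq_zero_iff_ae_notMem.1 hS0] with ω hω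
    exact if_neg hω

include hK hF hβ in
lemma IsDriver.exists_noExplosion (hd : IsDriver β k ℋ π P)
    (hnull : ∀ S, MeasurableSet S → P S = 0 → ∀ t, MeasurableSet[ℋ t] S) (hx : x ∈ finiteStates) :
    ∃ π', IsDriver β k ℋ π' P ∧ (∀ ω, NoExplosion K F (π' ω) x) ∧ ∀ᵐ ω ∂P, π' ω = π ω := by
  classical
  have hae := hd.ae_noExplosion hK hF hβ hx
  set S := toMeasurable P {ω | ¬ NoExplosion K F (π ω) x}
  have hS : MeasurableSet S := measurableSet_toMeasurable _ _
  have hS0 : P S = 0 := (measure_toMeasurable _).trans hae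
  refine ⟨fun ω => if ω ∈ S then 0 else π ω, isDriver_ite hnull hS hS0 (fun ω _ => hd.config ω)
    hd.measurable hd.compensation hd.double, fun ω => ?_, ?_⟩
  · by_cases hω : ω ∈ S
    · simp only [hω, if_true]
      exact noExplosion_zero hK hF hx
    · simp only [hω, if_false]
      by_contra hc
      exact hω (subset_toMeasurable P _ hc)
  · filter_upwards [measure_eq_zero_iff_ae_notMem.1 hS0] with ω hω
    exact if_neg hω

end Build

/-! ### The generator of the evolution -/

lemma untopA_coe (t : ℝ≥0) : (t : WithTop ℝ≥0).untopA = t := by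
  rw [WithTop.untopA_eq_untop WithTop.coe_ne_top, WithTop.untop_coe]

section Exit

variable {π : Measure (ℝ≥0 × Mark)} {x : MassSeq} {n : ℕ}

variable (K F) in
open Classical in
/-- The time at which the truncated evolution leaves `levelSet K F n`. -/
def exitTime (π : Measure (ℝ≥0 × Mark)) (x : MassSeq) (n : ℕ) : WithTop ℝ≥0 :=
  if ∃ t, truncPath K F π n t x ∉ levelSet K F n then
    ((sInf {t | truncPath K F π n t x ∉ levelSet K F n} : ℝ≥0) : WithTop ℝ≥0) else ⊤

lemma exitTime_le_iff (h : IsConfig k π) :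
    exitTime K F π x n ≤ t ↔ truncPath K F π n t x ∉ levelSet K F n := by
  unfold exitTime
  split_ifs with hex
  · rw [WithTop.coe_le_coe]
    refine ⟨fun hle hmem => ?_, fun ht => csInf_le (OrderBot.bddBelow _) ht⟩
    set r := sInf {t | truncPath K F π n t x ∉ levelSet K F n}
    have hr : truncPath K F π n r x ∈ levelSet K F n := truncPath_mem_of_le h hle hmem
    obtain ⟨t', ht', hno⟩ := h.exists_gt_forall n r
    obtain ⟨v, hv, hvt⟩ := (csInf_lt_iff (OrderBot.bddBelow _) hex).1 ht'
    refine hv (truncPath_mem_of_le h hvt.le ?_)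
    rw [truncPath_congr h ht'.le hno]
    exact hr
  · push Not at hex
    simp only [hex t, not_true, iff_false]
    exact not_le.2 (WithTop.coe_lt_top t)

lemma lt_exitTime_iff (h : IsConfig k π) :
    (t : WithTop ℝ≥0) < exitTime K F π x n ↔ truncPath K F π n t x ∈ levelSet K F n := by
  rw [← not_le, exitTime_le_iff h, not_not]

include hK hF in
lemma exitTime_mono (h : IsConfig k π) :
    Monotone (exitTime K F π x) := by
  intro n n' hn
  by_contra hlt
  rw [not_le] at hlt
  obtain ⟨r, hr⟩ := WithTop.ne_top_iff_exists.1 (ne_top_of_lt hlt)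
  rw [← hr, lt_exitTime_iff h] at hlt
  have h1 : exitTime K F π x n' ≤ r := hr.ge
  rw [exitTime_le_iff h, truncPath_consistent hK hF h hn hlt] at h1
  exact h1 (levelSet_mono K F hn hlt)

include hK hF in
/-- Up to the exit time included, the path agrees with the truncated evolution. -/
lemma NoExplosion.path_eq_of_forall_lt (h : IsConfig k π) (hx : NoExplosion K F π x) {r : ℝ≥0}
    (hr : ∀ s < r, truncPath K F π n s x ∈ levelSet K F n) :
    path K F π r x = truncPath K F π n r x := by
  rcases (zero_le (a := r)).eq_or_lt with h0 | h0
  · rw [← h0, path_zero h, truncPath_zero h]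
  · obtain ⟨n', hn'⟩ := hx r
    by_cases hle : n' ≤ n
    · rw [path_eq hK hF h hn', truncPath_consistent hK hF h hle hn']
    rw [not_le] at hle
    rw [path_eq hK hF h hn']
    obtain ⟨s, hs, hno⟩ := h.exists_lt_forall n' h0
    have hcons := truncPath_consistent hK hF h hle.le (hr s hs)
    have hno' : ∀ r' ∈ times π, s < r' → r' < r → markAt π r' ∉ markBox n := fun r' h1 h2 h3 h4 =>
      hno r' h1 h2 h3 (markBox_mono hle.le h4)
    by_cases hev : r ∈ times π
    · rw [truncPath_step hK hF h hs.le hev hs le_rfl (fun r' h1 h2 h3 h4 => by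
          rcases h3.eq_or_lt with h5 | h5
          · exact h5
          · exact absurd h4 (hno r' h1 h2 h5)),
        truncPath_step hK hF h hs.le hev hs le_rfl (fun r' h1 h2 h3 h4 => by
          rcases h3.eq_or_lt with h5 | h5
          · exact h5
          · exact absurd h4 (hno' r' h1 h2 h5)), hcons, actTrunc_of_mem (hr s hs),
        actTrunc_of_mem (levelSet_mono K F hle.le (hr s hs))]
    · rw [truncPath_congr h hs.le fun r' h1 h2 h3 => hno r' h1 h2
          (lt_of_le_of_ne h3 fun h4 => hev (h4 ▸ h1)),
        truncPath_congr h hs.le fun r' h1 h2 h3 => hno' r' h1 h2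
          (lt_of_le_of_ne h3 fun h4 => hev (h4 ▸ h1)), hcons]

end Exit

section Generator

variable {π : Ω → Measure (ℝ≥0 × Mark)}

include hK hF in
lemma IsDriver.isLocalizingSequence_exitTime (hd : IsDriver β k ℋ π P)
    (hx : ∀ ω, NoExplosion K F (π ω) x) :
    IsLocalizingSequence ℋ (fun n ω => exitTime K F (π ω) x n) P where
  isStoppingTime n t := by
    simp only [exitTime_le_iff (hd.config _)]
    exact (hd.measurable_truncPath hK hF n t x (measurableSet_levelSet hK hF n)).compl
  mono := ae_of_all _ fun ω => exitTime_mono hK hF (hd.config ω)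
  tendsto_top := ae_of_all _ fun ω => by
    rw [tendsto_order]
    refine ⟨fun a ha => ?_, fun a ha => absurd ha not_top_lt⟩
    obtain ⟨t, rfl⟩ := WithTop.ne_top_iff_exists.1 ha.ne
    obtain ⟨n, hn⟩ := hx ω t
    filter_upwards [eventually_ge_atTop n] with n' hn'
    exact ((lt_exitTime_iff (hd.config ω)).2 hn).trans_le
      (exitTime_mono hK hF (hd.config ω) hn')

variable [IsProbabilityMeasure P]

include hK hF hβ in
lemma IsDriver.hasGenerator_path (hd : IsDriver β k ℋ π P) (hx : ∀ ω, NoExplosion K F (π ω) x) :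
    HasGenerator K F β ℋ (fun t ω => path K F (π ω) t x) P := by
  rintro Φ hΦ ⟨C, hC⟩
  have hTm : ∀ n ω, Measurable fun u => truncGen K F β n Φ (truncPath K F (π ω) n u x) :=
    fun n ω => (measurable_truncGen hK hF hβ n hΦ).comp
      ((hd.measurable_uncurry_truncPath hK hF n x).comp measurable_prodMk_left)
  have heq : ∀ n ω u, truncPath K F (π ω) n u x ∈ levelSet K F n →
      generator K F β Φ (path K F (π ω) u x) = truncGen K F β n Φ (truncPath K F (π ω) n u x) :=
    fun n ω u hu => by rw [path_eq hK hF (hd.config ω) hu, truncGen_of_mem hK hF hβ hu hΦ hC]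
  refine ⟨ae_of_all _ fun ω t => ?_, _, hd.isLocalizingSequence_exitTime hK hF hx, fun n => ?_⟩
  · obtain ⟨n, hn⟩ := hx ω t
    refine IntegrableOn.congr_fun (f := fun u => truncGen K F β n Φ (truncPath K F (π ω) n u x)) ?_
      (fun u hu => (heq n ω u (truncPath_mem_of_le (hd.config ω) hu hn)).symm) measurableSet_Iic
    exact Measure.integrableOn_of_bounded (by rw [leb_Iic]; exact coe_ne_top)
      (hTm n ω).aestronglyMeasurable (ae_of_all _ fun u => abs_truncGen_le hβ n hC _)
  · convert! hd.martingale_truncPath hK hF hβ n x hΦ hC using 1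
    funext t ω
    have hc := hd.config ω
    unfold stoppedProcess
    -- the integrals up to the exit time agree
    have hint : ∀ r : ℝ≥0, r ≤ t → (∀ s < r, truncPath K F (π ω) n s x ∈ levelSet K F n) →
        (r < t → truncPath K F (π ω) n r x ∉ levelSet K F n) →
        ∫ u in Iic r, generator K F β Φ (path K F (π ω) u x) ∂leb =
          ∫ u in Iic t, truncGen K F β n Φ (truncPath K F (π ω) n u x) ∂leb := by
      intro r hrt h1 h2
      have e1 : ∫ u in Iic r, generator K F β Φ (path K F (π ω) u x) ∂leb =
          ∫ u in Set.Iio r, truncGen K F β n Φ (truncPath K F (π ω) n u x) ∂leb := by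
        rw [← setIntegral_congr_set (Iio_ae_eq_Iic (μ := leb) (a := r))]
        exact setIntegral_congr_fun measurableSet_Iio fun u hu => heq n ω u (h1 u hu)
      have e2 : ∫ u in Iic t, truncGen K F β n Φ (truncPath K F (π ω) n u x) ∂leb =
          ∫ u in Iic r, truncGen K F β n Φ (truncPath K F (π ω) n u x) ∂leb := by
        refine setIntegral_eq_of_subset_of_forall_sdiff_eq_zero measurableSet_Iic
          (Set.Iic_subset_Iic.2 hrt) fun u hu => truncGen_of_notMem (fun hmem => ?_) _
        have hru : r < u := not_le.1 hu.2
        exact h2 (hru.trans_le hu.1) (truncPath_mem_of_le hc hru.le hmem)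
      rw [e1, e2, setIntegral_congr_set (Iio_ae_eq_Iic (μ := leb) (a := r))]
    rcases lt_or_ge (t : WithTop ℝ≥0) (exitTime K F (π ω) x n) with ht | ht
    · have hmem := (lt_exitTime_iff hc).1 ht
      rw [min_eq_left ht.le, untopA_coe]
      beta_reduce
      rw [indicator_of_mem (show ω ∈ {ω | ⊥ < exitTime K F (π ω) x n} from bot_le.trans_lt ht)]
      rw [hint t le_rfl (fun s hs => truncPath_mem_of_le hc hs.le hmem)
        (fun h => absurd h (lt_irrefl t)), path_eq hK hF hc hmem, path_zero hc]
    · obtain ⟨r, hr⟩ := WithTop.ne_top_iff_exists.1 (ne_top_of_le_ne_top WithTop.coe_ne_top ht)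
      have hrt : r ≤ t := by rw [← hr] at ht; exact_mod_cast ht
      have h1 : ∀ s < r, truncPath K F (π ω) n s x ∈ levelSet K F n := fun s hs =>
        (lt_exitTime_iff hc).1 (by rw [← hr]; exact_mod_cast hs)
      have h2 : truncPath K F (π ω) n r x ∉ levelSet K F n := (exitTime_le_iff hc).1 hr.ge
      rw [min_eq_right ht, ← hr, untopA_coe]
      beta_reduce
      have e : ∀ g : Ω → ℝ, (r = 0 → g ω = 0) →
          {ω | ⊥ < exitTime K F (π ω) x n}.indicator g ω = g ω := by
        intro g hg
        by_cases h0 : r = 0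
        · rw [hg h0, Set.indicator_apply_eq_zero]
          exact fun _ => hg h0
        · refine indicator_of_mem ?_ _
          change ⊥ < exitTime K F (π ω) x n
          rw [← hr]
          exact WithTop.coe_lt_coe.2 (pos_iff_ne_zero.2 h0)
      rw [e]
      · rw [hint r hrt h1 (fun _ => h2), (hx ω).path_eq_of_forall_lt hK hF hc h1, path_zero hc,
          truncPath_eq_of_notMem hc hrt h2]
      · rintro rfl
        have : leb (Iic 0) = 0 := by rw [leb_Iic]; rfl
        simp [Measure.restrict_eq_zero.2 this]

end Generator

/-! ### The resolvent inequality for solutions of the martingale problem -/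

section Submartingale

variable {Y : ℝ≥0 → Ω → MassSeq}

variable (K F β) in
/-- The compensated process of the martingale problem. -/
def compensated (Y : ℝ≥0 → Ω → MassSeq) (Φ : MassSeq → ℝ) (t : ℝ≥0) (ω : Ω) : ℝ :=
  Φ (Y t ω) - Φ (Y 0 ω) - ∫ s in Iic t, generator K F β Φ (Y s ω) ∂leb

lemma setIntegral_Iic_add_Ioc {f : ℝ≥0 → ℝ} (hst : s ≤ t) (hf : IntegrableOn f (Iic t) leb) :
    ∫ u in Iic t, f u ∂leb = (∫ u in Iic s, f u ∂leb) + ∫ u in Ioc s t, f u ∂leb := by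
  rw [← Set.Iic_union_Ioc_eq_Iic hst]
  exact setIntegral_union (Set.Iic_disjoint_Ioc le_rfl) measurableSet_Ioc
    (hf.mono_set (Set.Iic_subset_Iic.2 hst)) (hf.mono_set fun u hu => hu.2)

/-- If the generator is bounded below along the path, then so is the increase of its integral. -/
lemma setIntegral_Ioc_ge {f : ℝ≥0 → ℝ} (hst : s ≤ t) {C : ℝ} (hC : 0 ≤ C)
    (hf : IntegrableOn f (Iic t) leb) (hfC : ∀ u, -C ≤ f u) :
    -(C * t) ≤ ∫ u in Ioc s t, f u ∂leb := by
  have hfin : leb (Ioc s t) < ∞ := by rw [leb_Ioc hst]; exact coe_lt_top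
  have h1 : ∫ _u in Ioc s t, -C ∂leb ≤ ∫ u in Ioc s t, f u ∂leb :=
    setIntegral_mono (integrableOn_const hfin.ne) (hf.mono_set fun u hu => hu.2) hfC
  refine le_trans ?_ h1
  rw [setIntegral_const, real, leb_Ioc hst, coe_toReal, smul_eq_mul]
  have : ((t - s : ℝ≥0) : ℝ) ≤ t := by simp
  nlinarith

variable (K F β) in
/-- The process `Y` solves the martingale problem, with right-continuous paths of finitely many
particles. -/
structure IsWeakSolution (ℱ : Filtration ℝ≥0 mΩ) (Y : ℝ≥0 → Ω → MassSeq) (P : Measure Ω) :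
    Prop where
  adapted : ∀ t, Measurable[ℱ t] (Y t)
  right : ∀ᵐ ω ∂P, ∀ t, Tendsto (fun s => Y s ω) (𝓝[>] t) (𝓝 (Y t ω))
  finite : ∀ᵐ ω ∂P, ∀ t, Y t ω ∈ finiteStates
  hasGenerator : HasGenerator K F β ℱ Y P

/-- A version with right-continuous paths without exception, which is jointly measurable. -/
lemma IsWeakSolution.exists_version (hY : IsWeakSolution K F β ℱ Y P) :
    ∃ Y' : ℝ≥0 → Ω → MassSeq, (Measurable fun q : Ω × ℝ≥0 => Y' q.2 q.1) ∧
      (∀ ω t, Tendsto (fun s => Y' s ω) (𝓝[>] t) (𝓝 (Y' t ω))) ∧ ∀ᵐ ω ∂P, ∀ t, Y' t ω = Y t ω := by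
  classical
  obtain ⟨S, hS1, hSm, hS0⟩ := exists_measurable_superset_of_null hY.right
  have hr : ∀ ω t, Tendsto (fun s => if ω ∈ S then ⟨fun _ => 0, antitone_const⟩ else Y s ω) (𝓝[>] t)
      (𝓝 (if ω ∈ S then (⟨fun _ => 0, antitone_const⟩ : MassSeq) else Y t ω)) := by
    intro ω t
    by_cases hω : ω ∈ S
    · simp only [hω, if_true]
      exact tendsto_const_nhds
    · simp only [hω, if_false]
      by_contra hc
      exact hω (hS1 fun h => hc (h t))
  refine ⟨_, measurable_uncurry_of_right (fun s => Measurable.ite hSm measurable_const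
    ((hY.adapted s).mono (ℱ.le s) le_rfl)) hr, hr, ?_⟩
  filter_upwards [measure_eq_zero_iff_ae_notMem.1 hS0] with ω hω t
  exact if_neg hω

variable [IsProbabilityMeasure P]

/-- The compensated process is a submartingale if the negative part of the generator is bounded. -/
lemma HasGenerator.exists_submartingale_bound (hgen : HasGenerator K F β ℱ Y P)
    (hΦ : Measurable Φ) {C C' : ℝ} (h0 : ∀ y, 0 ≤ Φ y) (hC : ∀ y, Φ y ≤ C) (hC' : 0 ≤ C')
    (hL : ∀ᵐ ω ∂P, ∀ s, -C' ≤ generator K F β Φ (Y s ω)) (ht : t₀ ≤ t) (hA : MeasurableSet[ℱ t₀] A)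
    :
    ∃ (AR : ℕ → Set Ω), (∀ R, MeasurableSet (AR R)) ∧ Monotone AR ∧ ⋃ R, AR R = A ∧
      (∀ᵐ ω ∂P, 0 ≤ C + C' * t - compensated K F β Y Φ t ω) ∧
      (∀ᵐ ω ∂P, 0 ≤ C + C' * t - compensated K F β Y Φ t₀ ω) ∧
      AEMeasurable (compensated K F β Y Φ t) P ∧ AEMeasurable (compensated K F β Y Φ t₀) P ∧
      (∀ R, ∫⁻ ω in AR R, ofReal (C + C' * t - compensated K F β Y Φ t₀ ω) ∂P < ∞) ∧
      ∀ R, ∫⁻ ω in AR R, ofReal (C + C' * t - compensated K F β Y Φ t ω) ∂P ≤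
        ∫⁻ ω in AR R, ofReal (C + C' * t - compensated K F β Y Φ t₀ ω) ∂P := by
  obtain ⟨hint, τ, hτ, hM⟩ := hgen Φ hΦ ⟨C, fun y => by rw [abs_of_nonneg (h0 y)]; exact hC y⟩
  have hC0 : 0 ≤ C := (h0 ⟨fun _ => 0, antitone_const⟩).trans (hC _)
  set N := compensated K F β Y Φ with hN
  set W : ℕ → ℝ≥0 → Ω → ℝ := fun n =>
    stoppedProcess (fun i => {ω | ⊥ < τ n ω}.indicator (N i)) (τ n) with hW
  replace hM : ∀ n, Martingale (W n) ℱ P := hM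
  -- the stopped processes in terms of the original one
  have hWN : ∀ n t ω, ∃ v ≤ t, W n t ω = 0 ∨ W n t ω = N v ω := by
    intro n t ω
    have hle : min (t : WithTop ℝ≥0) (τ n ω) ≤ t := min_le_left _ _
    obtain ⟨v, hv⟩ := WithTop.ne_top_iff_exists.1 (ne_top_of_le_ne_top WithTop.coe_ne_top hle)
    refine ⟨v, by rw [← hv] at hle; exact_mod_cast hle, ?_⟩
    simp only [hW, stoppedProcess, ← hv, untopA_coe, Set.indicator_apply]
    split_ifs
    · exact Or.inr rfl
    · exact Or.inl rfl
  have hWev : ∀ᵐ ω ∂P, ∀ t, ∀ᶠ n in atTop, W n t ω = N t ω := by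
    filter_upwards [hτ.tendsto_top] with ω hω t
    filter_upwards [hω.eventually (lt_mem_nhds (WithTop.coe_lt_top t))] with n hn
    simp only [hW, stoppedProcess, min_eq_left hn.le, untopA_coe]
    exact indicator_of_mem (show ω ∈ {ω | ⊥ < τ n ω} from bot_le.trans_lt hn) _
  -- one-sided bounds for the compensated process
  have hup : ∀ᵐ ω ∂P, ∀ v, ∀ t, v ≤ t → N v ω ≤ C + C' * t := by
    filter_upwards [hint, hL] with ω h1 h2 v t hv
    have h3 := setIntegral_Ioc_ge (s := 0) (zero_le (a := v)) hC' (h1 v) h2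
    have h4 := setIntegral_Iic_add_Ioc (s := 0) (zero_le (a := v)) (h1 v)
    have h5 : leb (Iic 0) = 0 := by rw [leb_Iic]; rfl
    rw [Measure.restrict_eq_zero.2 h5, integral_zero_measure, zero_add] at h4
    have h6 : C' * v ≤ C' * t := by gcongr
    have := hC (Y v ω)
    have := h0 (Y 0 ω)
    simp only [hN, compensated]
    linarith
  have hlow : ∀ᵐ ω ∂P, ∀ v ≤ t₀, N t₀ ω - 2 * C - C' * t₀ ≤ N v ω := by
    filter_upwards [hint, hL] with ω h1 h2 v hv
    have h3 := setIntegral_Ioc_ge hv hC' (h1 t₀) h2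
    have h4 := setIntegral_Iic_add_Ioc hv (h1 t₀)
    have := hC (Y t₀ ω)
    have := h0 (Y v ω)
    simp only [hN, compensated]
    linarith
  have hWm : ∀ n t, Measurable[ℱ t] (W n t) := fun n t => ((hM n).1 t).measurable
  have hWt : ∀ᵐ ω ∂P, ∀ t, Tendsto (fun n => W n t ω) atTop (𝓝 (N t ω)) :=
    hWev.mono fun ω hω t => tendsto_const_nhds.congr' ((hω t).mono fun n h => h.symm)
  -- the compensated process need not be adapted, but its version `V` at time `t₀` is
  let V : Ω → ℝ := fun ω => limUnder atTop fun n => W n t₀ ω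
  have hV : ∀ᵐ ω ∂P, V ω = N t₀ ω := hWt.mono fun ω hω => (hω t₀).limUnder_eq
  have hVm : Measurable[ℱ t₀] V :=
    (@StronglyMeasurable.limUnder _ _ _ (ℱ t₀) _ _ _ _ _ _ _ fun n => (hM n).1 t₀).measurable
  let AR : ℕ → Set Ω := fun R => A ∩ V ⁻¹' Metric.closedBall 0 R
  have hARm : ∀ R, MeasurableSet[ℱ t₀] (AR R) := fun R =>
    MeasurableSet.inter (m := ℱ t₀) hA (hVm measurableSet_closedBall)
  have hARb : ∀ R, ∀ᵐ ω ∂P, ω ∈ AR R → |N t₀ ω| ≤ R := fun R =>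
    hV.mono fun ω hω hmem => hω ▸ mem_closedBall_zero_iff.1 hmem.2
  have hNm : ∀ t, AEMeasurable (N t) P := fun t =>
    aemeasurable_of_tendsto_metrizable_ae atTop
      (fun n => ((hWm n t).mono (ℱ.le t) le_rfl).aemeasurable) (hWt.mono fun ω hω => hω t)
  set D : ℝ := C + C' * t with hD
  have hD0 : 0 ≤ D := by positivity
  have hWD : ∀ n, ∀ t' ≤ t, ∀ᵐ ω ∂P, 0 ≤ D - W n t' ω := by
    intro n t' ht'
    filter_upwards [hup] with ω hω
    obtain ⟨v, hv, h | h⟩ := hWN n t' ω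
    · rw [h]; linarith
    · rw [h]
      have := hω v t (hv.trans ht')
      linarith
  have hWi : ∀ n t, Integrable (W n t) P := fun n t => (hM n).integrable t
  have hlim : ∀ R, Tendsto (fun n => ∫ ω in AR R, W n t₀ ω ∂P) atTop
      (𝓝 (∫ ω in AR R, N t₀ ω ∂P)) := by
    intro R
    refine tendsto_integral_of_dominated_convergence (fun _ => R + 2 * C + C' * t + D)
      (fun n => (hWi n t₀).aestronglyMeasurable.restrict) (integrable_const _) (fun n => ?_)
      (ae_restrict_of_ae (hWt.mono fun ω hω => hω t₀))
    rw [ae_restrict_iff' (ℱ.le _ _ (hARm R))]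
    filter_upwards [hARb R, hlow, hup] with ω h1 h2 h3 hmem
    have h4 := abs_le.1 (h1 hmem)
    have hRR : (0 : ℝ) ≤ R := Nat.cast_nonneg R
    have htt : C' * t₀ ≤ C' * t := by gcongr
    have hct : 0 ≤ C' * t := by positivity
    rw [Real.norm_eq_abs, abs_le]
    obtain ⟨v, hv, h | h⟩ := hWN n t₀ ω
    · rw [h]; constructor <;> linarith
    · rw [h]
      have := h2 v hv
      have := h3 v t (hv.trans ht)
      constructor <;> linarith
  have hNi : ∀ R, IntegrableOn (N t₀) (AR R) P := by
    intro R
    refine Integrable.of_bound (hNm t₀).aestronglyMeasurable.restrict R ?_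
    rw [ae_restrict_iff' (ℱ.le _ _ (hARm R))]
    exact hARb R
  have hnonneg : ∀ t' ≤ t, ∀ᵐ ω ∂P, 0 ≤ D - N t' ω := fun t' ht' =>
    hup.mono fun ω hω => sub_nonneg.2 (hω t' t ht')
  have hfinal : ∀ R, ∫⁻ ω in AR R, ofReal (D - N t₀ ω) ∂P =
      ofReal (∫ ω in AR R, (D - N t₀ ω) ∂P) := fun R =>
    (ofReal_integral_eq_lintegral_ofReal ((integrable_const D).sub (hNi R))
      (ae_restrict_of_ae (hnonneg t₀ ht))).symm
  refine ⟨AR, fun R => ℱ.le _ _ (hARm R), ?_, ?_, hnonneg t le_rfl,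
    hnonneg t₀ ht, hNm t, hNm t₀, fun R => ?_, fun R => ?_⟩
  · exact fun R R' hR ω hω => ⟨hω.1, Metric.closedBall_subset_closedBall (Nat.cast_le.2 hR) hω.2⟩
  · rw [← Set.inter_iUnion, ← Set.preimage_iUnion, Metric.iUnion_closedBall_nat, Set.preimage_univ,
      Set.inter_univ]
  · rw [hfinal]; exact ENNReal.ofReal_lt_top
  · have hlim2 : Tendsto (fun n => ∫⁻ ω in AR R, ofReal (D - W n t ω) ∂P) atTop
        (𝓝 (∫⁻ ω in AR R, ofReal (D - N t₀ ω) ∂P)) := by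
      have e : ∀ n, ∫⁻ ω in AR R, ofReal (D - W n t ω) ∂P =
          ofReal ((∫ _ω in AR R, D ∂P) - ∫ ω in AR R, W n t₀ ω ∂P) := by
        intro n
        rw [← ofReal_integral_eq_lintegral_ofReal (f := fun ω => D - W n t ω)
          ((integrable_const D).sub (hWi n t).integrableOn)
          (ae_restrict_of_ae (hWD n t le_rfl)), integral_sub (integrable_const D)
          (hWi n t).integrableOn, (hM n).setIntegral_eq ht (hARm R)]
      simp only [e]
      rw [hfinal, integral_sub (integrable_const D) (hNi R)]
      exact ENNReal.tendsto_ofReal ((hlim R).const_sub _)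
    rw [← hlim2.liminf_eq]
    refine le_trans (le_of_eq (lintegral_congr_ae (ae_restrict_of_ae ?_)))
      (lintegral_liminf_le' fun n =>
        ((((hWm n t).mono (ℱ.le t) le_rfl).const_sub D).ennreal_ofReal).aemeasurable)
    filter_upwards [hWt] with ω hω
    exact (Tendsto.liminf_eq (ENNReal.tendsto_ofReal ((hω t).const_sub D))).symm

include hK hF hβ in
/-- Dynkin's formula as an inequality. A local martingale bounded on one side is compared at two
times by Fatou's lemma. -/
lemma IsWeakSolution.lintegral_add_le (hY : IsWeakSolution K F β ℱ Y P) {Y' : ℝ≥0 → Ω → MassSeq}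
    (hm : Measurable fun q : Ω × ℝ≥0 => Y' q.2 q.1) (hY' : ∀ᵐ ω ∂P, ∀ t, Y' t ω = Y t ω)
    (hΨ : Measurable Ψ) {C C' : ℝ≥0} (hC : ∀ y, Ψ y ≤ C) (hC' : ∀ y, jumpRate K F β y * Ψ y ≤ C')
    (ht : t₀ ≤ t) (hA : MeasurableSet[ℱ t₀] A) :
    (∫⁻ ω in A, Ψ (Y' t₀ ω) ∂P) +
        ∫⁻ ω in A, ∫⁻ s in Ioc t₀ t, jumpOp K F β Ψ (Y' s ω) ∂leb ∂P ≤
      (∫⁻ ω in A, Ψ (Y' t ω) ∂P) +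
        ∫⁻ ω in A, ∫⁻ s in Ioc t₀ t, jumpRate K F β (Y' s ω) * Ψ (Y' s ω) ∂leb ∂P := by
  have := hβ.isFinite
  have hΨt : ∀ y, Ψ y ≠ ∞ := fun y => ne_top_of_le_ne_top coe_ne_top (hC y)
  set Φ : MassSeq → ℝ := fun y => (Ψ y).toReal with hΦ
  have hΦm : Measurable Φ := hΨ.ennreal_toReal
  have hof : ∀ y, ofReal (Φ y) = Ψ y := fun y => ofReal_toReal (hΨt y)
  have h0 : ∀ y, 0 ≤ Φ y := fun y => toReal_nonneg
  have hΦC : ∀ y, Φ y ≤ C := fun y => toReal_mono coe_ne_top (hC y)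
  set ρ : MassSeq → ℝ≥0∞ := fun y => jumpRate K F β y * Ψ y with hρ
  have hρm : Measurable ρ := (measurable_jumpRate hK hF).mul hΨ
  have hqm : Measurable (jumpOp K F β Ψ) := measurable_jumpOp hK hF hΨ
  have hρt : ∀ y, ρ y ≠ ∞ := fun y => ne_top_of_le_ne_top coe_ne_top (hC' y)
  have hgen : ∀ y ∈ finiteStates,
      generator K F β Φ y = (jumpOp K F β Ψ y).toReal - (ρ y).toReal := by
    intro y hy
    rw [generator_eq hK hF hβ hy hΦm h0 hΦC]
    rw [show (fun y => ofReal (Φ y)) = Ψ from funext hof]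
    simp only [hρ, toReal_mul, hΦ]
  have hqt : ∀ y ∈ finiteStates, jumpOp K F β Ψ y ≠ ∞ := fun y hy => by
    refine (lt_of_le_of_lt (jumpOp_mono hC y) ?_).ne
    rw [jumpOp_const]
    exact mul_lt_top (jumpRate_lt_top hK hF hβ hy) coe_lt_top
  have hL : ∀ᵐ ω ∂P, ∀ s, -(C' : ℝ) ≤ generator K F β Φ (Y s ω) := by
    filter_upwards [hY.finite] with ω hω s
    rw [hgen _ (hω s)]
    have h1 : (ρ (Y s ω)).toReal ≤ C' := toReal_mono coe_ne_top (hC' _)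
    have h2 : 0 ≤ (jumpOp K F β Ψ (Y s ω)).toReal := toReal_nonneg
    linarith
  obtain ⟨AR, hARm, hmono, hU, hn1, hn2, hm1, hm2, hfin, hle⟩ :=
    hY.hasGenerator.exists_submartingale_bound hΦm h0 hΦC (coe_nonneg C') hL ht hA
  obtain ⟨hint, -⟩ := hY.hasGenerator Φ hΦm ⟨C, fun y => by rw [abs_of_nonneg (h0 y)]; exact hΦC y⟩
  set D : ℝ := C + C' * t
  set N := compensated K F β Y Φ with hN
  have hI : ∀ g : MassSeq → ℝ≥0∞, Measurable g →
      Measurable fun ω => ∫⁻ s in Ioc t₀ t, g (Y' s ω) ∂leb := fun g hg =>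
    (hg.comp hm).lintegral_prod_right'
  have hYm : ∀ s, Measurable fun ω => Ψ (Y' s ω) := fun s =>
    hΨ.comp (hm.comp measurable_prodMk_right)
  have hYI : ∀ (s : ℝ≥0) (g : MassSeq → ℝ≥0∞), Measurable g →
      Measurable fun ω => Ψ (Y' s ω) + ∫⁻ s in Ioc t₀ t, g (Y' s ω) ∂leb := fun s g hg =>
    (hYm s).add (hI g hg)
  -- the pathwise identity behind the inequality, in additive form
  have hpt : ∀ᵐ ω ∂P, ofReal (D - N t ω) +
      (Ψ (Y' t ω) + ∫⁻ s in Ioc t₀ t, ρ (Y' s ω) ∂leb) =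
      ofReal (D - N t₀ ω) +
        (Ψ (Y' t₀ ω) + ∫⁻ s in Ioc t₀ t, jumpOp K F β Ψ (Y' s ω) ∂leb) := by
    filter_upwards [hn1, hn2, hint, hY.finite, hY'] with ω h1 h2 h3 h4 h5
    have hm' : Measurable fun s => Y' s ω := hm.comp measurable_prodMk_left
    have hfinI : leb (Ioc t₀ t) ≠ ∞ := by rw [leb_Ioc ht]; exact coe_ne_top
    have hρi : IntegrableOn (fun s => (ρ (Y' s ω)).toReal) (Ioc t₀ t) leb :=
      Measure.integrableOn_of_bounded hfinI (hρm.comp hm').ennreal_toReal.aestronglyMeasurable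
        (M := C') (ae_of_all _ fun s => by
          rw [norm_of_nonneg toReal_nonneg]
          exact toReal_mono coe_ne_top (hC' _))
    have hLi : IntegrableOn (fun s => generator K F β Φ (Y s ω)) (Ioc t₀ t) leb :=
      (h3 t).mono_set fun u hu => hu.2
    have e3 : ∀ s, generator K F β Φ (Y s ω) + (ρ (Y' s ω)).toReal =
        (jumpOp K F β Ψ (Y' s ω)).toReal := fun s => by
      rw [h5 s, hgen _ (h4 s), sub_add_cancel]
    have hqi : IntegrableOn (fun s => (jumpOp K F β Ψ (Y' s ω)).toReal) (Ioc t₀ t) leb := by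
      simp only [← e3]
      exact hLi.add hρi
    have e1 : ∀ g : ℝ≥0 → ℝ≥0∞, IntegrableOn (fun s => (g s).toReal) (Ioc t₀ t) leb →
        (∀ s, g s ≠ ∞) → ∫⁻ s in Ioc t₀ t, g s ∂leb =
          ofReal (∫ s in Ioc t₀ t, (g s).toReal ∂leb) := fun g hg hg' => by
      rw [ofReal_integral_eq_lintegral_ofReal hg (ae_of_all _ fun s => toReal_nonneg)]
      exact lintegral_congr fun s => (ofReal_toReal (hg' s)).symm
    have h0' : ∀ g : ℝ≥0 → ℝ≥0∞, 0 ≤ ∫ s in Ioc t₀ t, (g s).toReal ∂leb := fun g =>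
      integral_nonneg fun s => toReal_nonneg
    have e4 := setIntegral_Iic_add_Ioc ht (h3 t)
    rw [e1 _ hρi fun s => hρt _, e1 _ hqi fun s => hqt _ (by rw [h5 s]; exact h4 s), ← hof (Y' t ω),
      ← hof (Y' t₀ ω), ← ofReal_add (h0 _) (h0' _), ← ofReal_add (h0 _) (h0' _),
      ← ofReal_add h1 (add_nonneg (h0 _) (h0' _)),
      ← ofReal_add h2 (add_nonneg (h0 _) (h0' _)), h5 t, h5 t₀]
    congr 1
    simp only [hN, compensated, ← e3]
    rw [e4, integral_add hLi hρi]
    ring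
  have key : ∀ R, ∫⁻ ω in AR R, (Ψ (Y' t₀ ω) + ∫⁻ s in Ioc t₀ t, jumpOp K F β Ψ (Y' s ω) ∂leb) ∂P
      ≤ ∫⁻ ω in A, (Ψ (Y' t ω) + ∫⁻ s in Ioc t₀ t, ρ (Y' s ω) ∂leb) ∂P := by
    intro R
    have h1 := lintegral_congr_ae (ae_restrict_of_ae (s := AR R) hpt)
    rw [lintegral_add_right _ (hYI t ρ hρm),
      lintegral_add_right _ (hYI t₀ _ hqm)] at h1
    refine le_trans ?_ (lintegral_mono_set (hU ▸ Set.subset_iUnion AR R))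
    refine (ENNReal.add_le_add_iff_left (hfin R).ne).1 ?_
    rw [← h1]
    exact add_le_add_left (hle R) _
  rw [← lintegral_add_left (hYm t₀), ← lintegral_add_left (hYm t)]
  conv_lhs => rw [← hU, setLIntegral_iUnion_of_directed _ hmono.directed_le]
  exact iSup_le fun R => key R

end Submartingale

/-! ### Laplace transforms -/

/-- The weight `exp (-α s)`. -/
def expWeight (α s : ℝ≥0) : ℝ≥0∞ := ofReal (exp (-(α * s)))

lemma measurable_expWeight (α : ℝ≥0) : Measurable (expWeight α) := by
  unfold expWeight
  fun_prop

lemma expWeight_add (α γ s : ℝ≥0) : expWeight (α + γ) s = expWeight α s * expWeight γ s := by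
  rw [expWeight, expWeight, expWeight, ← ofReal_mul (Real.exp_nonneg _), ← Real.exp_add]
  congr 2
  push_cast
  ring

lemma lintegral_leb {g : ℝ≥0 → ℝ≥0∞} (hg : Measurable g) :
    ∫⁻ s, g s ∂leb = ∫⁻ x in Ici (0 : ℝ), g x.toNNReal := by
  have := lintegral_map (μ := leb) (g := fun x : ℝ≥0 => (x : ℝ)) (f := fun x : ℝ => g x.toNNReal)
    (hg.comp measurable_real_toNNReal) measurable_coe_nnreal_real
  rw [← map_coe_leb, this]
  simp only [Real.toNNReal_coe]

lemma setLIntegral_Ioc_add {f : ℝ≥0 → ℝ≥0∞} (hf : Measurable f) (a s : ℝ≥0) :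
    ∫⁻ u in Ioc a (a + s), f u ∂leb = ∫⁻ u in Ioc 0 s, f (a + u) ∂leb := by
  rw [← lintegral_indicator measurableSet_Ioc, ← lintegral_indicator measurableSet_Ioc,
    lintegral_leb (hf.indicator measurableSet_Ioc),
    lintegral_leb ((show Measurable fun u => f (a + u) from
      hf.comp (measurable_const_add a)).indicator measurableSet_Ioc),
    ← lintegral_indicator measurableSet_Ici, ← lintegral_indicator measurableSet_Ici,
    ← lintegral_add_left_eq_self _ (a : ℝ)]
  refine lintegral_congr fun x => ?_
  rcases lt_or_ge x 0 with hx | hx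
  · rw [indicator_of_notMem (show x ∉ Ici 0 from not_le.2 hx), Set.indicator_apply]
    split_ifs with h
    · refine indicator_of_notMem (fun h' => ?_) _
      have h1 : (a : ℝ) < ((a : ℝ) + x).toNNReal := by exact_mod_cast h'.1
      rw [Real.coe_toNNReal _ h] at h1
      linarith
    · rfl
  · have e : ((a : ℝ) + x).toNNReal = a + x.toNNReal := by
      rw [Real.toNNReal_add (coe_nonneg a) hx, Real.toNNReal_coe]
    rw [indicator_of_mem (show x ∈ Ici 0 from hx),
      indicator_of_mem (show (a : ℝ) + x ∈ Ici 0 from add_nonneg a.2 hx), e]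
    simp only [Set.indicator_apply, Set.mem_Ioc, lt_add_iff_pos_right, add_le_add_iff_left]

lemma mul_setLIntegral_expWeight (hα : 0 < α) (u : ℝ≥0) :
    α * ∫⁻ s in Ici u, expWeight α s ∂leb = expWeight α u := by
  have hα' : (0 : ℝ) < α := hα
  rw [← lintegral_indicator measurableSet_Ici, lintegral_leb
    ((measurable_expWeight α).indicator measurableSet_Ici), ← lintegral_indicator measurableSet_Ici]
  have e : ∀ x : ℝ, (Ici (0 : ℝ)).indicator
      (fun x => (Ici u).indicator (expWeight α) x.toNNReal) x =
      (Ici (u : ℝ)).indicator (fun x => ofReal (exp (-α * x))) x := by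
    intro x
    by_cases hx : (u : ℝ) ≤ x
    · have hx0 : 0 ≤ x := u.2.trans hx
      rw [indicator_of_mem (show x ∈ Ici 0 from hx0),
        indicator_of_mem (show x ∈ Ici (u : ℝ) from hx), indicator_of_mem
        (show x.toNNReal ∈ Ici u from NNReal.le_toNNReal_of_coe_le hx), expWeight,
        Real.coe_toNNReal _ hx0, neg_mul]
    · rw [indicator_of_notMem (show x ∉ Ici (u : ℝ) from hx), Set.indicator_apply]
      split_ifs with h
      · refine indicator_of_notMem (fun h' => hx ?_) _
        have : (u : ℝ) ≤ x.toNNReal := by exact_mod_cast h'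
        rwa [Real.coe_toNNReal _ h] at this
      · rfl
  simp only [e]
  rw [lintegral_indicator measurableSet_Ici, setLIntegral_congr Ioi_ae_eq_Ici.symm,
    ← ofReal_integral_eq_lintegral_ofReal (integrableOn_exp_mul_Ioi (neg_lt_zero.2 hα') _)
      (ae_of_all _ fun x => Real.exp_nonneg _), integral_exp_mul_Ioi (neg_lt_zero.2 hα'),
    expWeight, ← ofReal_coe_nnreal, ← ofReal_mul hα'.le]
  congr 1
  field_simp

lemma mul_lintegral_expWeight (hα : 0 < α) : α * ∫⁻ s, expWeight α s ∂leb = 1 := by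
  have h := mul_setLIntegral_expWeight hα 0
  rwa [show Ici (0 : ℝ≥0) = univ from Set.eq_univ_of_forall fun s => Set.mem_Ici.2 zero_le,
    restrict_univ, expWeight, NNReal.coe_zero, mul_zero, neg_zero, Real.exp_zero,
    ENNReal.ofReal_one] at h

/-- A finite measure on `[0, ∞)` is determined by its Laplace transform at the natural numbers:
these are the moments of its image under `s ↦ exp (-s)`. -/
lemma eq_of_lintegral_expWeight {μ ν : Measure ℝ≥0} [IsFiniteMeasure μ] [IsFiniteMeasure ν]
    (h : ∀ n : ℕ, ∫⁻ s, expWeight n s ∂μ = ∫⁻ s, expWeight n s ∂ν) : μ = ν := by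
  let X : BoundedContinuousFunction ℝ≥0 ℝ :=
    .ofNormedAddCommGroup (fun s => exp (-s)) (by fun_prop) 1 fun s => by
      rw [norm_of_nonneg (Real.exp_nonneg _), Real.exp_le_one_iff]
      exact neg_nonpos.2 s.2
  have hpow (ρ : Measure ℝ≥0) (n : ℕ) :
      ∫ s : ℝ≥0, exp (-s) ^ n ∂ρ = (∫⁻ s, expWeight n s ∂ρ).toReal := by
    rw [integral_eq_lintegral_of_nonneg_ae (ae_of_all _ fun s => pow_nonneg (Real.exp_nonneg _) n)
      (by fun_prop)]
    refine congrArg _ (lintegral_congr fun s => congrArg _ ?_)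
    rw [← Real.exp_nat_mul, mul_neg]
    rfl
  refine ext_of_forall_mem_subalgebra_integral_eq_of_pseudoEMetric_complete_countable (𝕜 := ℝ)
    (A := ⟨Algebra.adjoin ℝ {X}, fun {a} ha => ha⟩) ?_ fun g hg => ?_
  · intro s t hst
    refine ⟨_, ⟨_, ⟨X, Algebra.subset_adjoin rfl, rfl⟩, rfl⟩, fun he => hst ?_⟩
    exact NNReal.coe_injective (neg_injective (Real.exp_injective he))
  · obtain ⟨p, hp : Polynomial.aeval X p = g⟩ :=
      (Algebra.adjoin_singleton_eq_range_aeval ℝ X ▸ hg :)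
    subst hp
    clear hg
    induction p using Polynomial.induction_on' with
    | add p q hp hq =>
      simp only [map_add, BoundedContinuousFunction.add_apply]
      have hi := @BoundedContinuousFunction.integrable ℝ≥0 _ _
      rw [integral_add (hi _ _) (hi _ _), integral_add (hi _ _) (hi _ _), hp, hq]
    | monomial n a =>
      have he (s : ℝ≥0) : Polynomial.aeval X (Polynomial.monomial n a) s = a * exp (-s) ^ n := by
        simp [Polynomial.aeval_monomial, X]
      simp only [he, integral_const_mul, hpow, h]

/-- Right-continuous bounded functions with the same Laplace transform for large arguments agree. -/
lemma eq_of_laplace {f g : ℝ≥0 → ℝ≥0∞} (hf : Measurable f) (hg : Measurable g)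
    (hf1 : ∀ s, f s ≤ 1) (hg1 : ∀ s, g s ≤ 1)
    (hfr : ∀ t, Tendsto f (𝓝[>] t) (𝓝 (f t))) (hgr : ∀ t, Tendsto g (𝓝[>] t) (𝓝 (g t))) {c : ℝ≥0}
    (h : ∀ α, c < α → ∫⁻ s, expWeight α s * f s ∂leb = ∫⁻ s, expWeight α s * g s ∂leb) : f = g := by
  set α : ℝ≥0 := c + 1
  have hα : 0 < α := by positivity
  have hfin : ∫⁻ s, expWeight α s ∂leb ≠ ∞ := fun hinf => by
    have h1 := mul_lintegral_expWeight hα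
    rw [hinf, ENNReal.mul_top (by exact_mod_cast hα.ne')] at h1
    exact ENNReal.top_ne_one h1
  have hle : ∀ f : ℝ≥0 → ℝ≥0∞, (∀ s, f s ≤ 1) → ∫⁻ s, expWeight α s * f s ∂leb ≠ ∞ := fun f hf1 =>
    ne_top_of_le_ne_top hfin (lintegral_mono fun s => mul_le_of_le_one_right' (hf1 s))
  have hm : ∀ f : ℝ≥0 → ℝ≥0∞, Measurable f → Measurable fun s => expWeight α s * f s :=
    fun f hf => (measurable_expWeight α).mul hf
  have hfm : ∀ f : ℝ≥0 → ℝ≥0∞, (∀ s, f s ≤ 1) →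
      IsFiniteMeasure (leb.withDensity fun s => expWeight α s * f s) := fun f hf1 =>
    isFiniteMeasure_withDensity (hle f hf1)
  have := hfm f hf1
  have := hfm g hg1
  have heq : (leb.withDensity fun s => expWeight α s * f s) =
      leb.withDensity fun s => expWeight α s * g s := by
    refine eq_of_lintegral_expWeight fun n => ?_
    have hw := measurable_expWeight n
    rw [lintegral_withDensity_eq_lintegral_mul _ (hm f hf) hw,
      lintegral_withDensity_eq_lintegral_mul _ (hm g hg) hw]
    have := h (α + n) (by rw [add_assoc]; exact lt_add_of_pos_right _ (by positivity))
    simp only [expWeight_add] at this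
    simp only [Pi.mul_apply]
    convert! this using 3 <;> ring
  have hae := (withDensity_eq_iff (hm f hf).aemeasurable (hm g hg).aemeasurable (hle f hf1)).1 heq
  funext t
  have hfreq : ∃ᶠ s in 𝓝[>] t, f s = g s := by
    rw [frequently_iff]
    intro U hU
    obtain ⟨u, hu, hsub⟩ := (mem_nhdsGT_iff_exists_Ioo_subset).1 hU
    obtain ⟨v, hv, hvu⟩ := exists_between (show t < u from hu)
    have hpos : leb (Ioc t v) ≠ 0 := by
      rw [leb_Ioc hv.le]
      exact_mod_cast (tsub_pos_of_lt hv).ne'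
    by_contra! hne
    have hsub' : Ioc t v ⊆ {s | ¬ expWeight α s * f s = expWeight α s * g s} := fun s hs hs' =>
      hne s (hsub ⟨hs.1, hs.2.trans_lt hvu⟩) ((ENNReal.mul_right_inj
      (ENNReal.ofReal_pos.2 (Real.exp_pos _)).ne' ofReal_ne_top).1 hs')
    exact hpos (measure_mono_null hsub' (ae_iff.1 hae))
  exact tendsto_nhds_unique_of_frequently_eq (hfr t) (hgr t) hfreq

/-! ### Occupation measures and the resolvent -/

section Resolvent

lemma tsum_iSup_of_monotone {ι : Type} {f : ℕ → ι → ℝ≥0∞} (hf : Monotone f) :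
    ∑' i, ⨆ n, f n i = ⨆ n, ∑' i, f n i := by
  let _ : MeasurableSpace ι := ⊤
  have h : ∀ g : ι → ℝ≥0∞, ∑' i, g i = ∫⁻ i, g i ∂Measure.count := fun g =>
    (lintegral_count g).symm
  simp only [h]
  exact lintegral_iSup (fun n => measurable_from_top) hf

lemma jumpOp_iSup {Ψ : ℕ → MassSeq → ℝ≥0∞} (hΨ : ∀ n, Measurable (Ψ n)) (hmono : Monotone Ψ)
    (y : MassSeq) : jumpOp K F β (fun z => ⨆ n, Ψ n z) y = ⨆ n, jumpOp K F β (Ψ n) y := by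
  have hm : ∀ z, Monotone fun n => Ψ n z := fun z _ _ h => hmono h z
  simp only [jumpOp]
  have h1 : ∀ i, ∫⁻ θ, ⨆ n, Ψ n (fragment i θ y) ∂β = ⨆ n, ∫⁻ θ, Ψ n (fragment i θ y) ∂β :=
    fun i => lintegral_iSup (fun n => measurable_comp_fragment (hΨ n) i y) fun _ _ h θ =>
      hmono h _
  have hmi : ∀ i, Monotone fun n => ∫⁻ θ, Ψ n (fragment i θ y) ∂β := fun i _ _ h =>
    lintegral_mono fun θ => hmono h _
  simp only [h1, ENNReal.mul_iSup]
  rw [tsum_iSup_of_monotone (f := fun n (p : IdxPair) =>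
      (K (y.1 p.1.1) (y.1 p.1.2) : ℝ≥0∞) * Ψ n (coalesce p.1.1 p.1.2 y))
      fun _ _ h _ => mul_le_mul_right (hm _ h) _,
    tsum_iSup_of_monotone (f := fun n i => (F (y.1 i) : ℝ≥0∞) * ∫⁻ θ, Ψ n (fragment i θ y) ∂β)
      fun _ _ h i => mul_le_mul_right (hmi i h) _]
  exact ENNReal.iSup_add_iSup_of_monotone
    (fun _ _ h => tsum_le_tsum fun _ => mul_le_mul_right (hm _ h) _)
    fun _ _ h => tsum_le_tsum fun i => mul_le_mul_right (hmi i h) _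

/-- Discounting an integrated inequality: `α e^{-α s} ds` turns `∫₀ˢ q` into
`∫ e^{-α u} q(u) du`. -/
lemma add_lintegral_expWeight_le (hα : 0 < α) {a : ℝ≥0∞} {p q r : ℝ≥0 → ℝ≥0∞} (hp : Measurable p)
    (hq : Measurable q) (hr : Measurable r)
    (h : ∀ s, a + ∫⁻ u in Ioc 0 s, q u ∂leb ≤ p s + ∫⁻ u in Ioc 0 s, r u ∂leb) :
    a + ∫⁻ s, expWeight α s * q s ∂leb ≤ ∫⁻ s, expWeight α s * (α * p s + r s) ∂leb := by
  have he := measurable_expWeight α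
  have hswap : ∀ q : ℝ≥0 → ℝ≥0∞, Measurable q →
      α * ∫⁻ s, expWeight α s * ∫⁻ u in Ioc 0 s, q u ∂leb ∂leb =
        ∫⁻ s, expWeight α s * q s ∂leb ∧
      Measurable fun s => ∫⁻ u in Ioc 0 s, q u ∂leb := by
    intro q hq
    have hS : MeasurableSet {z : ℝ≥0 × ℝ≥0 | z.2 ∈ Ioc 0 z.1} := by
      simp only [Set.mem_Ioc]
      exact (measurableSet_lt measurable_const measurable_snd).inter
        (measurableSet_le (f := fun z : ℝ≥0 × ℝ≥0 => z.2) (g := fun z => z.1) measurable_snd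
          measurable_fst)
    have hi : Measurable fun z : ℝ≥0 × ℝ≥0 => (Ioc 0 z.1).indicator q z.2 :=
      (hq.comp measurable_snd).indicator hS
    simp only [← lintegral_indicator measurableSet_Ioc]
    refine ⟨?_, hi.lintegral_prod_right'⟩
    have e1 : ∀ s, expWeight α s * ∫⁻ u, (Ioc 0 s).indicator q u ∂leb =
        ∫⁻ u, expWeight α s * (Ioc 0 s).indicator q u ∂leb := fun s =>
      (lintegral_const_mul _ (hq.indicator measurableSet_Ioc)).symm
    simp only [e1]
    rw [lintegral_lintegral_swap ((he.comp measurable_fst).mul hi).aemeasurable,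
      ← lintegral_const_mul _ (Measurable.lintegral_prod_left'
        (f := fun z : ℝ≥0 × ℝ≥0 => expWeight α z.1 * (Ioc 0 z.1).indicator q z.2)
        ((he.comp measurable_fst).mul hi))]
    refine lintegral_congr_ae ?_
    have h0 : ∀ᵐ u ∂leb, u ≠ 0 := by
      rw [ae_iff]
      simp
    filter_upwards [h0] with u hu
    rw [← mul_setLIntegral_expWeight hα u, mul_assoc,
      ← lintegral_mul_const _ he, ← lintegral_indicator measurableSet_Ici]
    refine congrArg _ (lintegral_congr fun s => ?_)
    by_cases hs : u ≤ s
    · rw [indicator_of_mem (show u ∈ Ioc 0 s from ⟨pos_iff_ne_zero.2 hu, hs⟩),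
        indicator_of_mem (show s ∈ Ici u from hs)]
    · rw [indicator_of_notMem (fun h' => hs h'.2), mul_zero,
        indicator_of_notMem (show s ∉ Ici u from hs)]
  calc a + ∫⁻ s, expWeight α s * q s ∂leb
      = α * ∫⁻ s, expWeight α s * (a + ∫⁻ u in Ioc 0 s, q u ∂leb) ∂leb := by
        simp only [mul_add]
        rw [lintegral_add_left (he.mul_const a), mul_add, (hswap q hq).1, lintegral_mul_const _ he,
          ← mul_assoc, mul_lintegral_expWeight hα, one_mul]
    _ ≤ α * ∫⁻ s, expWeight α s * (p s + ∫⁻ u in Ioc 0 s, r u ∂leb) ∂leb := by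
        exact mul_le_mul_right (lintegral_mono fun s => mul_le_mul_right (h s) _) _
    _ = ∫⁻ s, expWeight α s * (α * p s + r s) ∂leb := by
        simp only [mul_add]
        rw [lintegral_add_left (f := fun s => expWeight α s * p s) (he.mul hp), mul_add,
          (hswap r hr).1, lintegral_add_left (f := fun s => expWeight α s * (α * p s))
            (he.mul (hp.const_mul _)),
          ← lintegral_const_mul (f := fun s => expWeight α s * p s) _ (he.mul hp)]
        simp only [mul_left_comm]

variable (K F β) in
/-- For `α > c`, the resolvent inequality `μ R + U Q R ≤ U` with `α U(1) = μ(1)` determines the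
discounted occupation measure `U` of a process with initial law `μ` on states of mass at most
`M`. -/
def GreenUnique (M c : ℝ≥0) : Prop :=
  ∀ α : ℝ≥0, c < α → ∀ μ U : Measure MassSeq, IsFiniteMeasure μ →
    (∀ᵐ y ∂μ, y ∈ massSet M) → α * U univ = μ univ →
    (∀ Ψ, Measurable Ψ → (∫⁻ y, dwell K F β α Ψ y ∂μ) +
      (∫⁻ y, jumpOp K F β (dwell K F β α Ψ) y ∂U) ≤ ∫⁻ y, Ψ y ∂U) →
    ∀ Ψ, Measurable Ψ → (∀ y, Ψ y ≤ 1) →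
      ∫⁻ y, Ψ y ∂U = ∫⁻ y, ⨆ n, green K F β α n Ψ y ∂μ

variable {Y Y' : ℝ≥0 → Ω → MassSeq} [IsProbabilityMeasure P]

include hK hF hβ in
/-- The discounted occupation of a weak solution after time `t₀` on an event of the past, in which
the mass is at most `M`, is given by the Green operators. -/
lemma IsWeakSolution.lintegral_expWeight (hY : IsWeakSolution K F β ℱ Y P)
    (hm : Measurable fun q : Ω × ℝ≥0 => Y' q.2 q.1) (hY' : ∀ᵐ ω ∂P, ∀ t, Y' t ω = Y t ω) {M c : ℝ≥0}
    (hc : GreenUnique K F β M c) (hα : c < α) {t₀ : ℝ≥0} (hA : MeasurableSet[ℱ t₀] A)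
    (hAM : ∀ᵐ ω ∂P, ω ∈ A → Y' t₀ ω ∈ massSet M) (hΨ : Measurable Ψ) (hΨ1 : ∀ y, Ψ y ≤ 1) :
    ∫⁻ s, expWeight α s * ∫⁻ ω in A, Ψ (Y' (t₀ + s) ω) ∂P ∂leb =
      ∫⁻ ω in A, ⨆ n, green K F β α n Ψ (Y' t₀ ω) ∂P := by
  have := hβ.isFinite
  have hα0 : 0 < α := lt_of_le_of_lt zero_le hα
  have hAm : MeasurableSet A := ℱ.le _ _ hA
  have he := measurable_expWeight α
  have hm0 : ∀ t, Measurable (Y' t) := fun t => hm.comp (measurable_id.prodMk measurable_const)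
  have hms : Measurable fun q : ℝ≥0 × Ω => Y' (t₀ + q.1) q.2 :=
    hm.comp (measurable_snd.prodMk (measurable_fst.const_add _))
  set μ : Measure MassSeq := (P.restrict A).map (Y' t₀) with hμ
  set U : Measure MassSeq := ((leb.withDensity (expWeight α)).prod (P.restrict A)).map
    (fun q : ℝ≥0 × Ω => Y' (t₀ + q.1) q.2) with hU
  have hUi : ∀ Ψ, Measurable Ψ →
      ∫⁻ y, Ψ y ∂U = ∫⁻ s, expWeight α s * ∫⁻ ω in A, Ψ (Y' (t₀ + s) ω) ∂P ∂leb := by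
    intro Ψ hΨ
    rw [hU, lintegral_map hΨ hms, lintegral_prod (fun z : ℝ≥0 × Ω => Ψ (Y' (t₀ + z.1) z.2))
      (hΨ.comp hms).aemeasurable]
    exact lintegral_withDensity_eq_lintegral_mul _ he (hΨ.comp hms).lintegral_prod_right'
  have hμi : ∀ Ψ, Measurable Ψ → ∫⁻ y, Ψ y ∂μ = ∫⁻ ω in A, Ψ (Y' t₀ ω) ∂P := fun Ψ hΨ =>
    lintegral_map hΨ (hm0 t₀)
  rw [← hUi Ψ hΨ, ← hμi _ (Measurable.iSup fun n => measurable_green hK hF α n hΨ)]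
  refine hc α hα μ U inferInstance ?_ ?_ ?_ Ψ hΨ hΨ1
  · rw [hμ, ae_map_iff (p := fun y => y ∈ massSet M) (hm0 t₀).aemeasurable
      (measurableSet_massSet _)]
    exact (ae_restrict_iff' hAm).2 hAM
  · have h1 := hUi (fun _ => 1) measurable_const
    simp only [lintegral_one, restrict_apply MeasurableSet.univ, Set.univ_inter] at h1
    rw [h1, lintegral_mul_const _ he, ← mul_assoc, mul_lintegral_expWeight hα0, one_mul, hμ,
      map_apply (hm0 t₀) MeasurableSet.univ, Set.preimage_univ, restrict_apply_univ]
  -- The inequality for bounded `Ψ` is the discounted Dynkin inequality for `dwell Ψ`.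
  have hbdd : ∀ Ψ : MassSeq → ℝ≥0∞, Measurable Ψ → ∀ C : ℝ≥0, (∀ y, Ψ y ≤ C) → (∫⁻ y,
    dwell K F β α Ψ y ∂μ) +
      (∫⁻ y, jumpOp K F β (dwell K F β α Ψ) y ∂U) ≤ ∫⁻ y, Ψ y ∂U := by
    intro Ψ hΨ C hC
    set ρ : MassSeq → ℝ≥0∞ := fun y => jumpRate K F β y * dwell K F β α Ψ y with hρ
    have hd : Measurable (dwell K F β α Ψ) := measurable_dwell hK hF α hΨ
    have hj := measurable_jumpOp (β := β) hK hF hd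
    have hρm : Measurable ρ := (measurable_jumpRate hK hF).mul hd
    have hdC : ∀ y, dwell K F β α Ψ y ≤ (α⁻¹ * C : ℝ≥0) := fun y => by
      rw [ENNReal.coe_mul, ENNReal.coe_inv hα0.ne']
      exact mul_le_mul' (ENNReal.inv_le_inv.2 le_self_add) (hC y)
    have hρC : ∀ y, ρ y ≤ C := fun y => by
      rw [hρ]
      simp only [dwell]
      rw [← mul_assoc]
      refine (mul_le_of_le_one_left' ?_).trans (hC y)
      rw [← div_eq_mul_inv]
      exact ENNReal.div_le_of_le_mul (by rw [one_mul]; exact le_add_self)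
    have hI : ∀ Φ : MassSeq → ℝ≥0∞, Measurable Φ → ∀ s,
        ∫⁻ ω in A, ∫⁻ u in Ioc t₀ (t₀ + s), Φ (Y' u ω) ∂leb ∂P =
          ∫⁻ u in Ioc 0 s, ∫⁻ ω in A, Φ (Y' (t₀ + u) ω) ∂P ∂leb := by
      intro Φ hΦ s
      rw [lintegral_lintegral_swap (f := fun ω u => Φ (Y' u ω)) (hΦ.comp hm).aemeasurable]
      exact setLIntegral_Ioc_add (Measurable.lintegral_prod_left' (hΦ.comp hm)) t₀ s
    have key := add_lintegral_expWeight_le hα0 (a := ∫⁻ y, dwell K F β α Ψ y ∂μ)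
      (p := fun s => ∫⁻ ω in A, dwell K F β α Ψ (Y' (t₀ + s) ω) ∂P)
      (q := fun s => ∫⁻ ω in A, jumpOp K F β (dwell K F β α Ψ) (Y' (t₀ + s) ω) ∂P)
      (r := fun s => ∫⁻ ω in A, ρ (Y' (t₀ + s) ω) ∂P)
      (hd.comp hms).lintegral_prod_right' (hj.comp hms).lintegral_prod_right'
      (hρm.comp hms).lintegral_prod_right' (fun s => by
        have := hY.lintegral_add_le hK hF hβ hm hY' hd hdC hρC (le_self_add (a := t₀) (b := s)) hA
        rw [hI _ hj, hI _ hρm, ← hμi _ hd] at this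
        exact this)
    rw [hUi _ hj, hUi _ hΨ]
    refine key.trans (lintegral_mono_ae ?_)
    filter_upwards with s
    refine mul_le_mul_right ?_ _
    rw [← lintegral_const_mul (f := fun ω => dwell K F β α Ψ (Y' (t₀ + s) ω)) _ (hd.comp (hm0 _)),
      ← lintegral_add_left (f := fun ω => α * dwell K F β α Ψ (Y' (t₀ + s) ω))
        ((hd.comp (hm0 _)).const_mul _)]
    refine lintegral_mono fun ω => ?_
    rw [hρ]
    simp only [dwell]
    rw [← add_mul, ← mul_assoc]
    exact mul_le_of_le_one_left' (ENNReal.mul_inv_le_one _)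
  intro Ψ hΨ
  have hmin : ∀ n : ℕ, Measurable fun y => min (Ψ y) n := fun n => hΨ.min measurable_const
  have hmono : Monotone fun (n : ℕ) y => min (Ψ y) n := fun _ _ h y =>
    min_le_min le_rfl (by exact_mod_cast h)
  have hsup : ∀ y, Ψ y = ⨆ n : ℕ, min (Ψ y) n := fun y => by
    have := inf_iSup_eq (Ψ y) fun n : ℕ => (n : ℝ≥0∞)
    rw [ENNReal.iSup_natCast, inf_top_eq] at this
    exact this
  have hdsup : dwell K F β α Ψ = fun y => ⨆ n : ℕ, dwell K F β α (fun y => min (Ψ y) n) y := by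
    funext y
    simp only [dwell]
    rw [← ENNReal.mul_iSup, ← hsup]
  have hdm : ∀ n : ℕ, Measurable (dwell K F β α fun y => min (Ψ y) n) := fun n =>
    measurable_dwell hK hF α (hmin n)
  have hdmono : Monotone fun n : ℕ => dwell K F β α fun y => min (Ψ y) n := fun _ _ h y =>
    mul_le_mul_right (hmono h y) _
  have hjmono : Monotone fun n : ℕ => jumpOp K F β (dwell K F β α fun y => min (Ψ y) n) :=
    fun _ _ h y => by
      refine add_le_add (tsum_le_tsum fun _ => mul_le_mul_right (hdmono h _) _)
        (tsum_le_tsum fun _ => mul_le_mul_right (lintegral_mono fun _ => hdmono h _) _)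
  rw [hdsup]
  simp only [jumpOp_iSup hdm hdmono]
  rw [lintegral_iSup hdm hdmono, lintegral_iSup (fun n => measurable_jumpOp hK hF (hdm n)) hjmono,
    ENNReal.iSup_add_iSup_of_monotone (fun _ _ h => lintegral_mono (hdmono h))
      fun _ _ h => lintegral_mono (hjmono h)]
  exact iSup_le fun n => (hbdd _ (hmin n) n fun y => by exact_mod_cast min_le_right _ _).trans
    (lintegral_mono fun y => min_le_left _ _)

end Resolvent

/-! ### The Markov property of weak solutions -/

section Markov

variable {κ : Kernel MassSeq (ℝ≥0 → MassSeq)}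

variable (K F β) in
/-- Each `κ y` with `y` a finite state is the law of a weak solution started at `y`. -/
def IsLawFamily (κ : Kernel MassSeq (ℝ≥0 → MassSeq)) : Prop :=
  ∀ y ∈ finiteStates, ∃ (Ω : Type) (mΩ : MeasurableSpace Ω) (P : Measure Ω)
    (_ : IsProbabilityMeasure P) (ℱ : Filtration ℝ≥0 mΩ) (Y : ℝ≥0 → Ω → MassSeq),
    IsWeakSolution K F β ℱ Y P ∧ (∀ᵐ ω ∂P, Y 0 ω = y) ∧ P.map (fun ω t => Y t ω) = κ y

variable {Y Y' : ℝ≥0 → Ω → MassSeq}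

lemma IsWeakSolution.measurable (hY : IsWeakSolution K F β ℱ Y P) (t : ℝ≥0) :
    Measurable (Y t) := (hY.adapted t).mono (ℱ.le t) le_rfl

lemma tendsto_lintegral_right [IsFiniteMeasure P] (hm : ∀ t, Measurable (Y' t))
    (hr : ∀ᵐ ω ∂P, ∀ t, Tendsto (fun s => Y' s ω) (𝓝[>] t) (𝓝 (Y' t ω))) {ψ : MassSeq → ℝ≥0∞}
    (hψ : Continuous ψ) (hψ1 : ∀ y, ψ y ≤ 1) (t₀ t : ℝ≥0) :
    Tendsto (fun s => ∫⁻ ω, ψ (Y' (t₀ + s) ω) ∂P) (𝓝[>] t)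
      (𝓝 (∫⁻ ω, ψ (Y' (t₀ + t) ω) ∂P)) := by
  have hshift : Tendsto (fun s => t₀ + s) (𝓝[>] t) (𝓝[>] (t₀ + t)) :=
    tendsto_nhdsWithin_iff.2 ⟨((continuous_const_add t₀).tendsto t).mono_left nhdsWithin_le_nhds,
      eventually_mem_nhdsWithin.mono fun s hs => add_lt_add_right hs t₀⟩
  refine tendsto_lintegral_filter_of_dominated_convergence (fun _ => 1)
    (Eventually.of_forall fun s => hψ.measurable.comp (hm _))
    (Eventually.of_forall fun s => ae_of_all _ fun ω => hψ1 _)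
    (by rw [lintegral_one]; exact measure_ne_top _ _) ?_
  filter_upwards [hr] with ω hω
  exact (hψ.tendsto _).comp ((hω _).comp hshift)

lemma exists_mem_massSet (hy : y ∈ finiteStates) : ∃ n : ℕ, y ∈ massSet (n : ℝ≥0) := by
  obtain ⟨n, hn⟩ := ENNReal.exists_nat_gt (mass_lt_top hy).ne
  exact ⟨n, hy, by exact_mod_cast hn.le⟩

lemma IsLawFamily.lintegral_apply (hκ : IsLawFamily K F β κ) (hy : y ∈ finiteStates) :
    ∃ (Ω : Type) (mΩ : MeasurableSpace Ω) (P : Measure Ω) (_ : IsProbabilityMeasure P)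
      (ℱ : Filtration ℝ≥0 mΩ) (Y : ℝ≥0 → Ω → MassSeq), IsWeakSolution K F β ℱ Y P ∧
      (∀ᵐ ω ∂P, Y 0 ω = y) ∧ ∀ h : (ℝ≥0 → MassSeq) → ℝ≥0∞, Measurable h →
        ∫⁻ x, h x ∂κ y = ∫⁻ ω, h (fun t => Y t ω) ∂P := by
  obtain ⟨Ω, mΩ, P, hP, ℱ, Y, hY, h0, hmap⟩ := hκ y hy
  refine ⟨Ω, mΩ, P, hP, ℱ, Y, hY, h0, fun h hh => ?_⟩
  rw [← hmap, lintegral_map hh (measurable_pi_lambda _ hY.measurable)]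

/-- A finite measure is determined by its integrals of continuous functions with values in
`[0, 1]`. -/
lemma ext_of_lintegral_le_one {μ ν : Measure MassSeq} [IsFiniteMeasure μ]
    (h : ∀ ψ : MassSeq → ℝ≥0∞, Continuous ψ → (∀ y, ψ y ≤ 1) → ∫⁻ y, ψ y ∂μ = ∫⁻ y, ψ y ∂ν) :
    μ = ν := by
  refine ext_of_forall_lintegral_eq_of_IsFiniteMeasure fun φ => ?_
  set C : ℝ≥0 := nndist φ 0 + 1
  have hC : (C : ℝ≥0∞) ≠ 0 := by positivity
  have hm : Measurable fun y => (φ y : ℝ≥0∞) := φ.continuous.measurable.coe_nnreal_ennreal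
  have := h (fun y => (C : ℝ≥0∞)⁻¹ * φ y) ((ENNReal.continuous_const_mul
    (ENNReal.inv_ne_top.2 hC)).comp
    (ENNReal.continuous_coe.comp φ.continuous)) fun y => by
      rw [mul_comm, ← div_eq_mul_inv]
      exact ENNReal.div_le_of_le_mul (by
        rw [one_mul]
        exact_mod_cast (BoundedContinuousFunction.NNReal.upper_bound φ y).trans le_self_add)
  rw [lintegral_const_mul _ hm, lintegral_const_mul _ hm] at this
  exact (ENNReal.mul_right_inj (ENNReal.inv_ne_zero.2 coe_ne_top)
    (ENNReal.inv_ne_top.2 hC)).1 this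

include hK hF hβ in
/-- One step of the Markov property: both sides have the same discounted integrals over `s`. -/
lemma IsWeakSolution.lintegral_add [IsProbabilityMeasure P] (hκ : IsLawFamily K F β κ)
    (hY : IsWeakSolution K F β ℱ Y P) (t₀ s : ℝ≥0) (hA : MeasurableSet[ℱ t₀] A) {h : MassSeq → ℝ≥0∞}
    (hh : Measurable h) :
    ∫⁻ ω in A, h (Y (t₀ + s) ω) ∂P = ∫⁻ ω in A, ∫⁻ x, h (x s) ∂κ (Y t₀ ω) ∂P := by
  have := hβ.isFinite
  have hev : ∀ s, Measurable fun x : ℝ≥0 → MassSeq => x s := measurable_pi_apply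
  -- continuous test functions, states of bounded mass
  have h1 : ∀ ψ : MassSeq → ℝ≥0∞, Continuous ψ → (∀ y, ψ y ≤ 1) → ∀ (M : ℕ) (A : Set Ω),
      MeasurableSet[ℱ t₀] A → (∀ ω ∈ A, Y t₀ ω ∈ massSet (M : ℝ≥0)) →
      ∫⁻ ω in A, ψ (Y (t₀ + s) ω) ∂P = ∫⁻ ω in A, ∫⁻ x, ψ (x s) ∂κ (Y t₀ ω) ∂P := by
    intro ψ hψ hψ1 M A hA hAM
    have hψm := hψ.measurable
    have hψs : ∀ s, Measurable fun x : ℝ≥0 → MassSeq => ψ (x s) := fun s => hψm.comp (hev s)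
    obtain ⟨Y', hm, hr, hY'⟩ := hY.exists_version
    have hm0 : ∀ t, Measurable (Y' t) := fun t => hm.comp (measurable_id.prodMk measurable_const)
    obtain ⟨c, hc⟩ := lintegral_eq_green hK hF hβ M
    have hAm : MeasurableSet A := ℱ.le _ _ hA
    have hAM' : ∀ᵐ ω ∂P, ω ∈ A → Y' t₀ ω ∈ massSet (M : ℝ≥0) := by
      filter_upwards [hY'] with ω hω hωA
      rw [hω]
      exact hAM ω hωA
    have hGr : ∀ y ∈ finiteStates, ∀ t, Tendsto (fun s => ∫⁻ x, ψ (x s) ∂κ y) (𝓝[>] t)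
        (𝓝 (∫⁻ x, ψ (x t) ∂κ y)) := by
      intro y hy t
      obtain ⟨_, _, P', _, _, Z, hZ, -, hl⟩ := hκ.lintegral_apply hy
      simp only [hl _ (hψs _)]
      simpa only [zero_add] using tendsto_lintegral_right hZ.measurable hZ.right hψ hψ1 0 t
    have hG1 : ∀ s, ∀ y ∈ finiteStates, ∫⁻ x, ψ (x s) ∂κ y ≤ 1 := by
      intro s y hy
      obtain ⟨_, _, P', _, _, Z, hZ, -, hl⟩ := hκ.lintegral_apply hy
      rw [hl _ (hψs s)]
      exact (lintegral_mono fun ω => hψ1 _).trans_eq (by rw [lintegral_one, measure_univ])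
    have hGl : ∀ α, c < α → ∀ y ∈ massSet (M : ℝ≥0),
        ∫⁻ s, expWeight α s * ∫⁻ x, ψ (x s) ∂κ y ∂leb = ⨆ n, green K F β α n ψ y := by
      intro α hα y hy
      obtain ⟨_, _, P', _, _, Z, hZ, h0, hl⟩ := hκ.lintegral_apply hy.1
      obtain ⟨Z', hZm, -, hZ'⟩ := hZ.exists_version
      have := hZ.lintegral_expWeight hK hF hβ hZm hZ' hc hα (t₀ := 0) (A := univ)
        MeasurableSet.univ (by
          filter_upwards [h0, hZ'] with ω h1 h2 _
          rwa [h2, h1]) hψm hψ1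
      simp only [restrict_univ, zero_add] at this
      have e1 : ∀ s, ∫⁻ x, ψ (x s) ∂κ y = ∫⁻ ω, ψ (Z' s ω) ∂P' := fun s => by
        rw [hl _ (hψs s)]
        refine lintegral_congr_ae ?_
        filter_upwards [hZ'] with ω hω
        rw [hω]
      simp only [e1]
      rw [this]
      have e2 : ∫⁻ ω, ⨆ n, green K F β α n ψ (Z' 0 ω) ∂P' =
          ∫⁻ _, ⨆ n, green K F β α n ψ y ∂P' := by
        refine lintegral_congr_ae ?_
        filter_upwards [h0, hZ'] with ω h1 h2
        rw [h2, h1]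
      rw [e2, lintegral_const, measure_univ, mul_one]
    -- the transition function, made right-continuous in every state
    set G : ℝ≥0 → MassSeq → ℝ≥0∞ := fun s => finiteStates.indicator fun y => ∫⁻ x, ψ (x s) ∂κ y
      with hG
    have hGm : ∀ s, Measurable (G s) := fun s =>
      ((hψm.comp (hev s)).lintegral_kernel).indicator measurableSet_finiteStates
    have hGr' : ∀ y t, Tendsto (fun s => G s y) (𝓝[>] t) (𝓝 (G t y)) := by
      intro y t
      by_cases hy : y ∈ finiteStates
      · simp only [hG, indicator_of_mem hy]
        exact hGr y hy t
      · simp only [hG, indicator_of_notMem hy]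
        exact tendsto_const_nhds
    have hG1' : ∀ s y, G s y ≤ 1 := fun s y => by
      by_cases hy : y ∈ finiteStates
      · simp only [hG, indicator_of_mem hy]
        exact hG1 s y hy
      · simp only [hG, indicator_of_notMem hy]
        exact zero_le
    have hGu : Measurable fun q : MassSeq × ℝ≥0 => G q.2 q.1 :=
      measurable_uncurry_of_right hGm hGr'
    have hP1 : ∀ ζ : Ω → ℝ≥0∞, (∀ ω, ζ ω ≤ 1) → ∫⁻ ω in A, ζ ω ∂P ≤ 1 := fun ζ hζ =>
      (lintegral_mono hζ).trans (by
        rw [lintegral_one, restrict_apply_univ]; exact prob_le_one)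
    have hfg := eq_of_laplace (c := c) (f := fun s => ∫⁻ ω in A, ψ (Y' (t₀ + s) ω) ∂P)
      (g := fun s => ∫⁻ ω in A, G s (Y' t₀ ω) ∂P)
      (Measurable.lintegral_prod_left' (f := fun q : Ω × ℝ≥0 => ψ (Y' (t₀ + q.2) q.1))
        (hψm.comp (hm.comp (measurable_fst.prodMk (measurable_snd.const_add _)))))
      (Measurable.lintegral_prod_left' (f := fun q : Ω × ℝ≥0 => G q.2 (Y' t₀ q.1))
        (hGu.comp (((hm0 t₀).comp measurable_fst).prodMk measurable_snd)))
      (fun s => hP1 _ fun ω => hψ1 _) (fun s => hP1 _ fun ω => hG1' _ _)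
      (tendsto_lintegral_right hm0 (ae_of_all _ hr) hψ hψ1 t₀)
      (fun t => tendsto_lintegral_filter_of_dominated_convergence (fun _ => 1)
        (Eventually.of_forall fun s => (hGm s).comp (hm0 t₀))
        (Eventually.of_forall fun s => ae_of_all _ fun ω => hG1' _ _)
        (by rw [lintegral_one]; exact measure_ne_top _ _) (ae_of_all _ fun ω => hGr' _ _))
      (fun α hα => by
        rw [hY.lintegral_expWeight hK hF hβ hm hY' hc hα hA hAM' hψm hψ1]
        have hGe : Measurable fun q : Ω × ℝ≥0 => expWeight α q.2 * G q.2 (Y' t₀ q.1) :=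
          ((measurable_expWeight α).comp measurable_snd).mul
            (hGu.comp (((hm0 t₀).comp measurable_fst).prodMk measurable_snd))
        have e3 : ∀ s, expWeight α s * ∫⁻ ω in A, G s (Y' t₀ ω) ∂P =
            ∫⁻ ω in A, expWeight α s * G s (Y' t₀ ω) ∂P := fun s =>
          (lintegral_const_mul _ ((hGm s).comp (hm0 t₀))).symm
        simp only [e3]
        rw [lintegral_lintegral_swap (f := fun s ω => expWeight α s * G s (Y' t₀ ω))
          (hGe.comp measurable_swap).aemeasurable]
        refine setLIntegral_congr_fun_ae hAm ?_
        filter_upwards [hAM'] with ω hω hωA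
        rw [← hGl α hα _ (hω hωA)]
        simp only [hG, indicator_of_mem (hω hωA).1])
    have := congrFun hfg s
    beta_reduce at this
    rw [show ∫⁻ ω in A, ψ (Y (t₀ + s) ω) ∂P = ∫⁻ ω in A, ψ (Y' (t₀ + s) ω) ∂P from
      lintegral_congr_ae (ae_restrict_of_ae (hY'.mono fun ω hω => congrArg ψ (hω _).symm)), this]
    refine setLIntegral_congr_fun_ae hAm ?_
    filter_upwards [hAM', hY'] with ω hω hω' hωA
    simp only [hG, indicator_of_mem (hω hωA).1]
    rw [hω']
  have h2 : ∀ ψ : MassSeq → ℝ≥0∞, Continuous ψ → (∀ y, ψ y ≤ 1) →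
      ∫⁻ ω in A, ψ (Y (t₀ + s) ω) ∂P = ∫⁻ ω in A, ∫⁻ x, ψ (x s) ∂κ (Y t₀ ω) ∂P := by
    intro ψ hψ hψ1
    set S : ℕ → Set Ω := fun n => A ∩ Y t₀ ⁻¹' massSet ((n : ℝ≥0) : ℝ≥0∞) with hS
    have hSm : Monotone S := fun a b hab ω hω => ⟨hω.1, hω.2.1, hω.2.2.trans
      (by exact_mod_cast hab)⟩
    have hU : A =ᵐ[P] ⋃ n, S n := by
      filter_upwards [hY.finite] with ω hω
      refine propext ⟨fun hωA => ?_, fun hωA => ?_⟩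
      · obtain ⟨n, hn⟩ := exists_mem_massSet (hω t₀)
        exact Set.mem_iUnion.2 ⟨n, hωA, hn⟩
      · obtain ⟨n, hn⟩ := Set.mem_iUnion.1 hωA
        exact hn.1
    rw [setLIntegral_congr hU, setLIntegral_congr hU,
      setLIntegral_iUnion_of_directed _ hSm.directed_le,
      setLIntegral_iUnion_of_directed _ hSm.directed_le]
    exact iSup_congr fun n => h1 ψ hψ hψ1 n (S n)
      (MeasurableSet.inter (m := ℱ t₀) hA (hY.adapted t₀ (measurableSet_massSet _)))
        fun ω hω => hω.2
  have hk : Measurable fun ω => (κ.map fun x => x s) (Y t₀ ω) :=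
    (κ.map fun x => x s).measurable.comp (hY.measurable t₀)
  have h3 : (P.restrict A).map (Y (t₀ + s)) =
      (P.restrict A).bind fun ω => (κ.map fun x => x s) (Y t₀ ω) := by
    refine ext_of_lintegral_le_one fun ψ hψ hψ1 => ?_
    have hψm := hψ.measurable
    rw [lintegral_map hψm (hY.measurable _),
      Measure.lintegral_bind hk.aemeasurable hψm.aemeasurable,
      h2 ψ hψ hψ1]
    simp only [Kernel.map_apply _ (hev s), lintegral_map hψm (hev s)]
  have := congrArg (fun μ : Measure MassSeq => ∫⁻ y, h y ∂μ) h3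
  beta_reduce at this
  rw [lintegral_map hh (hY.measurable _),
    Measure.lintegral_bind hk.aemeasurable hh.aemeasurable] at this
  simpa only [Kernel.map_apply _ (hev s), lintegral_map hh (hev s)] using this

end Markov

section StrongMarkov

variable {κ : Kernel MassSeq (ℝ≥0 → MassSeq)} {Y : ℝ≥0 → Ω → MassSeq}

lemma measurableSet_cylinder (I : Finset ℝ≥0) {B : ℝ≥0 → Set MassSeq}
    (hB : ∀ i, MeasurableSet (B i)) : MeasurableSet {x : ℝ≥0 → MassSeq | ∀ i ∈ I, x i ∈ B i} :=
  MeasurableSet.pi (s := (I : Set ℝ≥0)) I.countable_toSet fun i _ => hB i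

lemma measure_ext_of_cylinder {μ ν : Measure (ℝ≥0 → MassSeq)} [IsFiniteMeasure μ]
    (h : ∀ (I : Finset ℝ≥0) (B : ℝ≥0 → Set MassSeq), (∀ i, MeasurableSet (B i)) →
      μ {x | ∀ i ∈ I, x i ∈ B i} = ν {x | ∀ i ∈ I, x i ∈ B i}) : μ = ν := by
  refine ext_of_generate_finite (squareCylinders fun _ => {s : Set MassSeq | MeasurableSet s})
    generateFrom_squareCylinders.symm (isPiSystem_squareCylinders
      (fun _ => MeasurableSpace.isPiSystem_measurableSet) fun _ => by simp) ?_ ?_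
  · rintro _ ⟨I, B, hB, rfl⟩
    exact h I B fun i => hB i trivial
  · simpa using h ∅ (fun _ => univ) fun _ => MeasurableSet.univ

/-- The Markov property of `Y` for cylinders over `l` times. -/
def CylinderMarkov (κ : Kernel MassSeq (ℝ≥0 → MassSeq)) (ℱ : Filtration ℝ≥0 mΩ)
    (Y : ℝ≥0 → Ω → MassSeq) (P : Measure Ω) (l : ℕ) : Prop :=
  ∀ I : Finset ℝ≥0, I.card = l → ∀ B : ℝ≥0 → Set MassSeq, (∀ i, MeasurableSet (B i)) →
    ∀ (t₀ : ℝ≥0) (A : Set Ω), MeasurableSet[ℱ t₀] A →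
      P (A ∩ {ω | ∀ i ∈ I, Y (t₀ + i) ω ∈ B i}) =
        ∫⁻ ω in A, κ (Y t₀ ω) {x | ∀ i ∈ I, x i ∈ B i} ∂P

variable (K F β) in
/-- All weak solutions have the Markov property for cylinders over `l` times. -/
def ForallCylinderMarkov (κ : Kernel MassSeq (ℝ≥0 → MassSeq)) (l : ℕ) : Prop :=
  ∀ (Ω : Type) (mΩ : MeasurableSpace Ω) (P : Measure Ω) (_ : IsProbabilityMeasure P)
    (ℱ : Filtration ℝ≥0 mΩ) (Y : ℝ≥0 → Ω → MassSeq),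
    IsWeakSolution K F β ℱ Y P → CylinderMarkov κ ℱ Y P l

include hK hF hβ in
lemma CylinderMarkov.measure_inter [IsProbabilityMeasure P] {l : ℕ}
    (hl : CylinderMarkov κ ℱ Y P l) (hκ : IsLawFamily K F β κ) (hY : IsWeakSolution K F β ℱ Y P)
    {J : Finset ℝ≥0} (hJ : J.card = l) (a : ℝ≥0) {B : ℝ≥0 → Set MassSeq}
    (hB : ∀ i, MeasurableSet (B i)) (t₀ : ℝ≥0) (hA : MeasurableSet[ℱ t₀] A) :
    P (A ∩ {ω | Y (t₀ + a) ω ∈ B a ∧ ∀ j ∈ J, Y (t₀ + (a + j)) ω ∈ B (a + j)}) =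
      ∫⁻ ω in A, ∫⁻ x, (B a).indicator (fun y => κ y {x | ∀ j ∈ J, x j ∈ B (a + j)}) (x a)
        ∂κ (Y t₀ ω) ∂P := by
  have hAm : MeasurableSet A := ℱ.le _ _ hA
  have hc := measurableSet_cylinder J fun j => hB (a + j)
  have hBY : MeasurableSet (Y (t₀ + a) ⁻¹' B a) := hY.measurable _ (hB a)
  rw [← hY.lintegral_add hK hF hβ hκ t₀ a hA ((κ.measurable_coe hc).indicator (hB a))]
  have h1 := hl J hJ (fun j => B (a + j)) (fun j => hB _) (t₀ + a) (A ∩ Y (t₀ + a) ⁻¹' B a)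
    (MeasurableSet.inter (m := ℱ (t₀ + a)) (ℱ.mono le_self_add _ hA) (hY.adapted _ (hB a)))
  have h2 : A ∩ {ω | Y (t₀ + a) ω ∈ B a ∧ ∀ j ∈ J, Y (t₀ + (a + j)) ω ∈ B (a + j)} =
      A ∩ Y (t₀ + a) ⁻¹' B a ∩ {ω | ∀ i ∈ J, Y (t₀ + a + i) ω ∈ B (a + i)} := by
    ext ω
    simp only [add_assoc, Set.mem_inter_iff, mem_ofPred_eq, mem_preimage, and_assoc]
  rw [h2, h1, Set.inter_comm, ← Measure.restrict_restrict hBY, ← lintegral_indicator hBY]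
  rfl

include hK hF hβ in
/-- The Chapman-Kolmogorov equation. -/
lemma IsLawFamily.measure_cylinder (hκ : IsLawFamily K F β κ) {l : ℕ}
    (hl : ForallCylinderMarkov K F β κ l)
    (hy : y ∈ finiteStates) {J : Finset ℝ≥0} (hJ : J.card = l) (a : ℝ≥0) {B : ℝ≥0 → Set MassSeq}
    (hB : ∀ i, MeasurableSet (B i)) :
    κ y {x | x a ∈ B a ∧ ∀ j ∈ J, x (a + j) ∈ B (a + j)} =
      ∫⁻ x, (B a).indicator (fun y => κ y {x | ∀ j ∈ J, x j ∈ B (a + j)}) (x a) ∂κ y := by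
  obtain ⟨Ω, mΩ, P, hP, ℱ, Y, hY, h0, hmap⟩ := hκ y hy
  have h := (hl Ω mΩ P hP ℱ Y hY).measure_inter hK hF hβ hκ hY hJ a hB 0 (A := univ)
    MeasurableSet.univ
  have hS : MeasurableSet {x : ℝ≥0 → MassSeq | x a ∈ B a ∧ ∀ j ∈ J, x (a + j) ∈ B (a + j)} := by
    have := (measurable_pi_apply (X := fun _ : ℝ≥0 => MassSeq) a (hB a)).inter
      (MeasurableSet.biInter J.countable_toSet fun j _ =>
        measurable_pi_apply (X := fun _ : ℝ≥0 => MassSeq) (a + j) (hB (a + j)))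
    convert! this
    ext x
    simp
  simp only [zero_add, Set.univ_inter, restrict_univ] at h
  rw [← hmap, map_apply (measurable_pi_lambda _ hY.measurable) hS, hmap]
  refine h.trans ?_
  rw [lintegral_congr_ae (h0.mono fun ω hω => by rw [hω]), lintegral_const, measure_univ, mul_one]

include hK hF hβ in
/-- The induction step: the Markov property at the first time, and that of the process restarted
there for the others. -/
lemma CylinderMarkov.succ [IsProbabilityMeasure P] {l : ℕ} (hl : CylinderMarkov κ ℱ Y P l)
    (hl' : ForallCylinderMarkov K F β κ l) (hκ : IsLawFamily K F β κ)
    (hY : IsWeakSolution K F β ℱ Y P) :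
    CylinderMarkov κ ℱ Y P (l + 1) := by
  classical
  intro I hI B hB t₀ A hA
  have hne : I.Nonempty := Finset.card_pos.1 (by omega)
  set a := I.min' hne
  -- the remaining times, counted from the first one
  set J := (I.erase a).image (· - a)
  have hle : ∀ i ∈ I.erase a, a ≤ i := fun i hi => I.min'_le i (Finset.mem_of_mem_erase hi)
  have hJ : J.card = l := by
    rw [Finset.card_image_of_injOn, Finset.card_erase_of_mem (I.min'_mem hne), hI,
      Nat.add_sub_cancel]
    intro i hi j hj hij
    exact (tsub_left_inj (hle i hi) (hle j hj)).1 hij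
  have key : ∀ x : ℝ≥0 → MassSeq, (∀ i ∈ I, x i ∈ B i) ↔
      x a ∈ B a ∧ ∀ j ∈ J, x (a + j) ∈ B (a + j) := by
    intro x
    constructor
    · refine fun h => ⟨h a (I.min'_mem hne), fun j hj => ?_⟩
      obtain ⟨i, hi, rfl⟩ := Finset.mem_image.1 hj
      rw [add_tsub_cancel_of_le (hle i hi)]
      exact h i (Finset.mem_of_mem_erase hi)
    · rintro ⟨h1, h2⟩ i hi
      by_cases hia : i = a
      · rwa [hia]
      · have hi' := Finset.mem_erase.2 ⟨hia, hi⟩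
        have := h2 (i - a) (Finset.mem_image.2 ⟨i, hi', rfl⟩)
        rwa [add_tsub_cancel_of_le (hle i hi')] at this
  have h1 := hl.measure_inter hK hF hβ hκ hY hJ a hB t₀ hA
  have h2 : ∀ ω, (∀ i ∈ I, Y (t₀ + i) ω ∈ B i) ↔ _ := fun ω => key fun i => Y (t₀ + i) ω
  simp only [h2, key]
  rw [h1]
  refine lintegral_congr_ae (ae_restrict_of_ae ?_)
  filter_upwards [hY.finite] with ω hω
  exact (hκ.measure_cylinder hK hF hβ hl' (hω t₀) hJ a hB).symm

lemma CylinderMarkov.zero [IsMarkovKernel κ] : CylinderMarkov κ ℱ Y P 0 := by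
  intro I hI B hB t₀ A hA
  rw [Finset.card_eq_zero] at hI
  subst hI
  simp

include hK hF hβ

lemma IsWeakSolution.cylinderMarkov [IsProbabilityMeasure P] [IsMarkovKernel κ]
    (hκ : IsLawFamily K F β κ) (hY : IsWeakSolution K F β ℱ Y P) (l : ℕ) :
    CylinderMarkov κ ℱ Y P l := by
  have h0 : ∀ l, ForallCylinderMarkov K F β κ l := by
    intro l
    induction l with
    | zero => exact fun _ _ _ _ _ _ _ => CylinderMarkov.zero
    | succ l ih => exact fun Ω mΩ P hP ℱ Y hY => (ih Ω mΩ P hP ℱ Y hY).succ hK hF hβ ih hκ hY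
  induction l with
  | zero => exact CylinderMarkov.zero
  | succ l ih => exact ih.succ hK hF hβ (h0 l) hκ hY

/-- The Markov property at a fixed time. -/
lemma IsWeakSolution.markov [IsProbabilityMeasure P] [IsMarkovKernel κ] (hκ : IsLawFamily K F β κ)
    (hY : IsWeakSolution K F β ℱ Y P) (t₀ : ℝ≥0) (hA : MeasurableSet[ℱ t₀] A)
    {B : Set (ℝ≥0 → MassSeq)} (hB : MeasurableSet B) :
    P (A ∩ {ω | (fun t => Y (t₀ + t) ω) ∈ B}) = ∫⁻ ω in A, κ (Y t₀ ω) B ∂P := by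
  have hm : Measurable fun ω t => Y (t₀ + t) ω := measurable_pi_lambda _ fun t => hY.measurable _
  have hk : Measurable fun ω => κ (Y t₀ ω) := κ.measurable.comp (hY.measurable _)
  have hAm : MeasurableSet A := ℱ.le _ _ hA
  have h : (P.restrict A).map (fun ω t => Y (t₀ + t) ω) =
      (P.restrict A).bind fun ω => κ (Y t₀ ω) := by
    refine measure_ext_of_cylinder fun I C hC => ?_
    have hcyl := measurableSet_cylinder I hC
    rw [map_apply hm hcyl, bind_apply hcyl hk.aemeasurable,
      restrict_apply (hm hcyl), Set.inter_comm]
    exact hY.cylinderMarkov hK hF hβ hκ _ I rfl C hC t₀ A hA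
  have h' := congrArg (fun μ : Measure (ℝ≥0 → MassSeq) => μ B) h
  beta_reduce at h'
  rw [map_apply hm hB, bind_apply hB hk.aemeasurable,
    restrict_apply (hm hB), Set.inter_comm] at h'
  exact h'

lemma IsWeakSolution.map_eq [IsProbabilityMeasure P] [IsMarkovKernel κ] (hκ : IsLawFamily K F β κ)
    (hY : IsWeakSolution K F β ℱ Y P) {m : MassSeq} (h0 : ∀ᵐ ω ∂P, Y 0 ω = m) :
    P.map (fun ω t => Y t ω) = κ m := by
  ext B hB
  have h := hY.markov hK hF hβ hκ 0 (A := univ) MeasurableSet.univ hB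
  simp only [zero_add, Set.univ_inter, restrict_univ] at h
  rw [map_apply (measurable_pi_lambda _ hY.measurable) hB]
  refine h.trans ?_
  rw [lintegral_congr_ae (h0.mono fun ω hω => by rw [hω]), lintegral_const, measure_univ, mul_one]

omit hK hF hβ

end StrongMarkov

section StrongMarkov

variable {κ : Kernel MassSeq (ℝ≥0 → MassSeq)} {Y : ℝ≥0 → Ω → MassSeq}

include hK hF hβ in
/-- A weak solution with right-locally constant paths is strong Markov: a stopping time is
approximated from above by the points of a grid of mesh `1 / (l + 1)`. -/
lemma IsWeakSolution.hasStrongMarkovProperty [IsProbabilityMeasure P] [IsMarkovKernel κ]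
    (hκ : IsLawFamily K F β κ) (hY : IsWeakSolution K F β ℱ Y P)
    (hm : Measurable fun q : Ω × ℝ≥0 => Y q.2 q.1) (hr : ∀ ω t, ∀ᶠ s in 𝓝[>] t, Y s ω = Y t ω) :
    HasStrongMarkovProperty κ ℱ Y P := by
  intro τ hτ A hA B hB
  have hT : Measurable fun ω => (τ ω).untopD 0 := hτ.measurable'.untopD 0
  set T : Ω → ℝ≥0 := fun ω => (τ ω).untopD 0 with hTdef
  have hAm : MeasurableSet A := (iSup_le ℱ.le) _ hA.1
  set S : Set Ω := {ω | ω ∈ A ∧ τ ω ≠ ⊤} with hS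
  have hSm : MeasurableSet S := hAm.inter (hτ.measurable' (measurableSet_singleton ⊤)).compl
  have hYm : ∀ (ζ : Ω → ℝ≥0), Measurable ζ → Measurable fun ω => Y (ζ ω) ω := fun ζ hζ =>
    hm.comp (measurable_id.prodMk hζ)
  have hk : Measurable fun ω => κ (Y (T ω) ω) := κ.measurable.comp (hYm T hT)
  have hpath : ∀ ζ : Ω → ℝ≥0, Measurable ζ → Measurable fun ω t => Y (ζ ω + t) ω := fun ζ hζ =>
    measurable_pi_lambda _ fun t => hYm _ (hζ.add_const t)
  suffices h : (P.restrict S).map (fun ω t => Y (T ω + t) ω) =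
      (P.restrict S).bind fun ω => κ (Y (T ω) ω) by
    have h' := congrArg (fun μ : Measure (ℝ≥0 → MassSeq) => μ B) h
    beta_reduce at h'
    rw [map_apply (hpath T hT) hB, bind_apply hB hk.aemeasurable,
      restrict_apply (hpath T hT hB)] at h'
    rw [← h']
    congr 1
    ext ω
    simp only [hS, mem_ofPred_eq, Set.mem_inter_iff, mem_preimage]
    tauto
  refine measure_ext_of_cylinder fun I C hC => ?_
  have hcyl := measurableSet_cylinder I hC
  set D : Set (ℝ≥0 → MassSeq) := {x | ∀ i ∈ I, x i ∈ C i} with hD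
  rw [map_apply (hpath T hT) hcyl, bind_apply hcyl hk.aemeasurable,
    ← lintegral_indicator_one (hpath T hT hcyl)]
  -- the grid approximation of the stopping time
  set N : ℕ → Ω → ℕ := fun l ω => ⌈T ω * (l + 1)⌉₊ with hN
  set q : ℕ → ℕ → ℝ≥0 := fun l j => j / (l + 1) with hq
  have hl0 : ∀ l : ℕ, (0 : ℝ≥0) < l + 1 := fun l => by positivity
  have hNle : ∀ l ω j, N l ω ≤ j ↔ T ω ≤ q l j := fun l ω j => by
    rw [hN, hq]
    simp only
    rw [Nat.ceil_le, le_div_iff₀ (hl0 l)]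
  have hNm : ∀ l, Measurable (N l) := fun l => Nat.measurable_ceil.comp (hT.mul_const _)
  have hτm : ∀ l, Measurable fun ω => q l (N l ω) := fun l =>
    (measurable_from_nat (f := q l)).comp (hNm l)
  have hgrid : ∀ l, ∫⁻ ω in S, ((fun ω t => Y (q l (N l ω) + t) ω) ⁻¹' D).indicator 1 ω ∂P =
      ∫⁻ ω in S, κ (Y (q l (N l ω)) ω) D ∂P := by
    intro l
    set E : ℕ → Set Ω := fun j => S ∩ N l ⁻¹' {j} with hE
    have hEm : ∀ j, MeasurableSet (E j) := fun j => hSm.inter (hNm l (measurableSet_singleton j))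
    have hEd : Pairwise (Function.onFun Disjoint E) := fun i j hij =>
      Set.disjoint_left.2 fun ω hi hj => hij (hi.2.symm.trans hj.2)
    have hEU : S = ⋃ j, E j := by
      rw [hE, ← Set.inter_iUnion, ← Set.preimage_iUnion, Set.iUnion_of_singleton, Set.preimage_univ,
        Set.inter_univ]
    have hEa : ∀ j, MeasurableSet[ℱ (q l j)] (E j) := by
      intro j
      have hle : ∀ i, MeasurableSet[ℱ (q l i)] (A ∩ {ω | τ ω ≤ (q l i : WithTop ℝ≥0)}) :=
        fun i => hA.2 (q l i)
      have hmem : ∀ i ω, ω ∈ A ∩ {ω | τ ω ≤ (q l i : WithTop ℝ≥0)} ↔ ω ∈ S ∧ N l ω ≤ i := by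
        intro i ω
        rw [hNle, hTdef, hS]
        simp only [Set.mem_inter_iff, mem_ofPred_eq, and_assoc]
        refine and_congr_right fun _ => ?_
        cases h : τ ω with
        | top => exact iff_of_false (WithTop.coe_lt_top _).not_ge fun h => h.1 rfl
        | coe a => exact ⟨fun h => ⟨WithTop.coe_ne_top, WithTop.coe_le_coe.1 h⟩,
            fun h => WithTop.coe_le_coe.2 h.2⟩
      have e : E j = (A ∩ {ω | τ ω ≤ (q l j : WithTop ℝ≥0)}) \
          ⋃ i ∈ range j, A ∩ {ω | τ ω ≤ (q l i : WithTop ℝ≥0)} := by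
        ext ω
        simp only [Set.mem_sdiff, Set.mem_iUnion, hmem, Finset.mem_range, hE, Set.mem_inter_iff,
          mem_preimage, Set.mem_singleton_iff]
        constructor
        · rintro ⟨h1, h2⟩
          refine ⟨⟨h1, h2.le⟩, ?_⟩
          rintro ⟨i, hi, -, h3⟩
          omega
        · rintro ⟨⟨h1, h2⟩, h3⟩
          refine ⟨h1, le_antisymm h2 (not_lt.1 fun h4 => h3 ⟨N l ω, h4, h1, le_rfl⟩)⟩
      rw [e]
      refine MeasurableSet.diff (m := ℱ (q l j)) (hle j) (Finset.measurableSet_biUnion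
        (m := ℱ (q l j)) _ fun i hi => ℱ.mono ?_ _ (hle i))
      have := (Finset.mem_range.1 hi).le
      simp only [hq]
      gcongr
    rw [hEU, lintegral_iUnion hEm hEd, lintegral_iUnion hEm hEd]
    refine tsum_congr fun j => ?_
    have h1 := hY.markov hK hF hβ hκ (q l j) (hEa j) hcyl
    have h2 : MeasurableSet {ω | (fun t => Y (q l j + t) ω) ∈ D} :=
      hpath (fun _ => q l j) measurable_const hcyl
    have h3 : ∫⁻ ω in E j, κ (Y (q l (N l ω)) ω) D ∂P = ∫⁻ ω in E j, κ (Y (q l j) ω) D ∂P :=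
      setLIntegral_congr_fun (hEm j) fun ω hω => by
        rw [show N l ω = j from hω.2]
    rw [h3, ← h1, Set.inter_comm, ← restrict_apply h2,
      ← lintegral_indicator_one h2]
    refine setLIntegral_congr_fun (hEm j) fun ω hω => ?_
    refine Set.indicator_eq_indicator ?_ rfl
    simp only [mem_preimage, mem_ofPred_eq, show N l ω = j from hω.2]
  have hlim : ∀ ω, ∀ i : ℝ≥0, ∀ᶠ l in atTop, Y (q l (N l ω) + i) ω = Y (T ω + i) ω := by
    intro ω i
    have hr' : ∀ᶠ s in 𝓝[≥] (T ω + i), Y s ω = Y (T ω + i) ω := by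
      rw [← Set.Ioi_insert, nhdsWithin_insert, eventually_sup]
      exact ⟨rfl, hr ω _⟩
    have hge : ∀ l, T ω ≤ q l (N l ω) := fun l => (hNle l ω _).1 le_rfl
    refine Tendsto.eventually (f := fun l => q l (N l ω) + i) (tendsto_nhdsWithin_iff.2 ⟨?_,
      Eventually.of_forall fun l => add_le_add_left (hge l) i⟩) hr'
    refine Tendsto.add_const i ?_
    have h1 : Tendsto (fun l : ℕ => T ω + 1 / ((l : ℝ≥0) + 1)) atTop (𝓝 (T ω)) := by
      simpa using tendsto_one_div_add_atTop_nhds_zero_nat.const_add (T ω)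
    refine tendsto_of_tendsto_of_tendsto_of_le_of_le tendsto_const_nhds h1 hge fun l => ?_
    simp only [hq, hN]
    rw [div_le_iff₀ (hl0 l), add_mul, one_div, inv_mul_cancel₀ (hl0 l).ne']
    exact (Nat.ceil_lt_add_one zero_le).le
  have hL : Tendsto (fun l => ∫⁻ ω in S, ((fun ω t => Y (q l
    (N l ω) + t) ω) ⁻¹' D).indicator 1 ω ∂P)
      atTop (𝓝 (∫⁻ ω in S, ((fun ω t => Y (T ω + t) ω) ⁻¹' D).indicator 1 ω ∂P)) := by
    refine tendsto_lintegral_of_dominated_convergence (fun _ => 1)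
      (fun l => measurable_one.indicator (hpath _ (hτm l) hcyl))
      (fun l => ae_of_all _ fun ω => Set.indicator_le_self _ _ ω)
      (by rw [lintegral_one]; exact measure_ne_top _ _) (ae_of_all _ fun ω => ?_)
    refine tendsto_const_nhds.congr' ?_
    filter_upwards [(Finset.eventually_all I).2 fun i _ => hlim ω i] with l hl
    have : ω ∈ (fun ω t => Y (q l (N l ω) + t) ω) ⁻¹' D ↔ ω ∈ (fun ω t => Y (T ω + t) ω) ⁻¹' D := by
      refine forall₂_congr fun i hi => ?_
      beta_reduce
      rw [hl i hi]
    exact Set.indicator_eq_indicator this.symm rfl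
  have hR : Tendsto (fun l => ∫⁻ ω in S, κ (Y (q l (N l ω)) ω) D ∂P) atTop
      (𝓝 (∫⁻ ω in S, κ (Y (T ω) ω) D ∂P)) := by
    refine tendsto_lintegral_of_dominated_convergence (fun _ => 1)
      (fun l => (κ.measurable_coe hcyl).comp (hYm _ (hτm l)))
      (fun l => ae_of_all _ fun ω => prob_le_one)
      (by rw [lintegral_one]; exact measure_ne_top _ _) (ae_of_all _ fun ω => ?_)
    refine tendsto_const_nhds.congr' ?_
    filter_upwards [hlim ω 0] with l hl
    rw [add_zero, add_zero] at hl
    rw [hl]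
  simp only [hgrid] at hL
  exact tendsto_nhds_unique hL hR

end StrongMarkov

/-! ### The family of laws and the coalescence-fragmentation process -/

section Existence

variable {κ : Kernel MassSeq (ℝ≥0 → MassSeq)} {X : ℝ≥0 → Ω → MassSeq} {π : Ω → Measure (ℝ≥0 × Mark)}

lemma tendsto_of_delta (hlam : 0 < lam) {ι : Type*} {l : Filter ι} {x : ι → MassSeq}
    (h : Tendsto (fun s => delta lam (x s) y) l (𝓝 0)) : Tendsto x l (𝓝 y) := by
  rw [tendsto_subtype_rng, tendsto_pi_nhds]
  intro j
  have h1 : Tendsto (fun s => (x s).1 j ^ lam) l (𝓝 (y.1 j ^ lam)) := by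
    rw [tendsto_iff_edist_tendsto_0]
    exact tendsto_of_tendsto_of_tendsto_of_le_of_le tendsto_const_nhds h (fun _ => zero_le)
      fun s => ENNReal.le_tsum j
  have h2 := h1.nnrpow (tendsto_const_nhds (x := lam⁻¹)) (Or.inr (inv_pos.2 hlam))
  simpa only [NNReal.rpow_rpow_inv hlam.ne'] using h2

lemma IsFiniteCFProcess.isWeakSolution (hlam : 0 < lam) {m : MassSeq}
    (h : IsFiniteCFProcess K F β lam m κ ℱ X P) : IsWeakSolution K F β ℱ X P where
  adapted := h.adapted
  right := h.cadlag.mono fun _ hω t => tendsto_of_delta hlam (hω.right t)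
  finite := h.finite
  hasGenerator := h.hasGenerator

lemma IsPoissonRandomMeasure.comp {E Ω' : Type*} [MeasurableSpace E] {mΩ' : MeasurableSpace Ω'}
    {P' : Measure Ω'} {N : Ω → Measure E} {ν : Measure E} [IsProbabilityMeasure P]
    [IsProbabilityMeasure P'] (h : IsPoissonRandomMeasure N ν P) {f : Ω' → Ω}
    (hf : MeasurePreserving f P' P) : IsPoissonRandomMeasure (fun ω => N (f ω)) ν P' where
  measurable := h.measurable.comp hf.measurable
  poisson A hA hν := by
    rw [← h.poisson A hA hν, ← hf.map_eq, Measure.map_map (g := fun ω => N ω A)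
      ((measurable_coe hA).comp h.measurable) hf.measurable]
    rfl
  indep n A hA hd := by
    have hm : ∀ i, Measurable fun ω => N ω (A i) := fun i =>
      (measurable_coe (hA i)).comp h.measurable
    have h1 := (iIndepFun_iff_map_fun_eq_pi_map fun i => (hm i).aemeasurable).1 (h.indep n A hA hd)
    refine (iIndepFun_iff_map_fun_eq_pi_map fun i => ((hm i).comp hf.measurable).aemeasurable).2 ?_
    rw [← hf.map_eq, Measure.map_map (measurable_pi_lambda _ hm) hf.measurable] at h1
    refine h1.trans (congrArg Measure.pi (funext fun i => ?_))
    rw [Measure.map_map (hm i) hf.measurable]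

lemma exists_isDrivingPair (β : Measure Ratios) [SFinite β] :
    ∃ (Ω : Type) (_ : MeasurableSpace Ω) (P : Measure Ω) (_ : IsProbabilityMeasure P)
      (N : Ω → Measure CoagMark) (M : Ω → Measure FragMark), IsDrivingPair β N M P := by
  have : Nonempty IdxPair := ⟨⟨(0, 1), zero_lt_one⟩⟩
  have : Nonempty Ratios := ⟨⟨0, antitone_const, one_pos⟩⟩
  have : SFinite coagIntensity := by unfold coagIntensity; infer_instance
  have : SFinite (fragIntensity β) := by unfold fragIntensity; infer_instance
  obtain ⟨Ω₁, _, P₁, _, N, hN⟩ := exists_isPoissonRandomMeasure coagIntensity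
  obtain ⟨Ω₂, _, P₂, _, M, hM⟩ := exists_isPoissonRandomMeasure (fragIntensity β)
  exact ⟨Ω₁ × Ω₂, inferInstance, P₁.prod P₂, inferInstance, fun ω => N ω.1, fun ω => M ω.2,
    hN.comp measurePreserving_fst, hM.comp measurePreserving_snd,
    indepFun_prod hN.measurable hM.measurable⟩

variable [IsProbabilityMeasure P] {x : MassSeq}

include hK hF hβ in
lemma IsDriver.isWeakSolution_path (hd : IsDriver β k ℋ π P) (hx : ∀ ω, NoExplosion K F (π ω) x) :
    IsWeakSolution K F β ℋ (fun t ω => path K F (π ω) t x) P where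
  adapted t := hd.measurable_path hK hF t x
  right := ae_of_all _ fun ω t => tendsto_const_nhds.congr'
    (((hx ω).path_eventually_right hK hF (hd.config ω) t).mono fun _ h => h.symm)
  finite := ae_of_all _ fun ω => (hx ω).path_mem_finiteStates hK hF (hd.config ω)
  hasGenerator := hd.hasGenerator_path hK hF hβ hx

include hK hF hβ in
/-- The laws of the paths driven by Poisson measures. -/
lemma exists_isLawFamily :
    ∃ κ : Kernel MassSeq (ℝ≥0 → MassSeq), IsMarkovKernel κ ∧ IsLawFamily K F β κ := by
  have := hβ.isFinite
  obtain ⟨Ω, mΩ, P, _, N, M, hNM⟩ := exists_isDrivingPair β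
  obtain ⟨k, π, hd, -⟩ := hNM.exists_isDriver hβ
  have hf : Measurable fun (q : MassSeq × Ω) t => path K F (π q.2) t q.1 :=
    measurable_pi_lambda _ fun t => (measurable_path hK hF hd.config fun s t' _ C hC =>
      (hd.measurable s t' C hC).mono (Filtration.le _ _) le_rfl).comp measurable_swap
  refine ⟨(Kernel.id ×ₖ Kernel.const MassSeq P).map fun q t => path K F (π q.2) t q.1,
    Kernel.IsMarkovKernel.map _ hf, fun y hy => ?_⟩
  obtain ⟨π', hd', hx, hae⟩ := hd.exists_noExplosion hK hF hβ
    (fun S hS h0 => measurableSet_canonicalFiltration_of_null hS h0) hy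
  refine ⟨Ω, mΩ, P, inferInstance, _, _, hd'.isWeakSolution_path hK hF hβ hx,
    ae_of_all _ fun ω => path_zero (hd'.config ω) y, ?_⟩
  rw [Kernel.map_apply _ hf, Kernel.prod_apply, Kernel.id_apply, Kernel.const_apply,
    Measure.dirac_prod, Measure.map_map hf measurable_prodMk_left]
  exact Measure.map_congr (hae.mono fun ω hω => by simp only [Function.comp_apply, hω])

lemma IsDriver.isFiniteCFProcess_path [IsMarkovKernel κ] (hκ : IsLawFamily K F β κ)
    (hlam : 0 < lam) (hd : IsDriver β k ℋ π P) (hK : IsCoagKernel K) (hF : IsFragKernel F)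
    (hβ : IsFiniteDislocation β) (hx : ∀ ω, NoExplosion K F (π ω) x) :
    IsFiniteCFProcess K F β lam x κ ℋ (fun t ω => path K F (π ω) t x) P where
  adapted t := hd.measurable_path hK hF t x
  start := ae_of_all _ fun ω => path_zero (hd.config ω) x
  cadlag := ae_of_all _ fun ω => (hx ω).isCadlag hlam hK hF (hd.config ω)
  finite := ae_of_all _ fun ω => (hx ω).path_mem_finiteStates hK hF (hd.config ω)
  strongMarkov := by
    have hr := fun ω => (hx ω).path_eventually_right hK hF (hd.config ω)
    exact (hd.isWeakSolution_path hK hF hβ hx).hasStrongMarkovProperty hK hF hβ hκ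
      (measurable_uncurry_of_right (fun s => (hd.measurable_path hK hF s x).mono (ℋ.le s) le_rfl)
        fun ω t => tendsto_const_nhds.congr' ((hr ω t).mono fun _ h => h.symm)) hr
  hasGenerator := hd.hasGenerator_path hK hF hβ hx

include hK hF hβ in
lemma NoExplosion.iSup_lt_top {π : Measure (ℝ≥0 × Mark)} (hx : NoExplosion K F π x)
    (h : IsConfig k π) (t : ℝ≥0) : (⨆ s ∈ Iic t, numParticles (path K F π s x)) < ⊤ ∧
      (⨆ s ∈ Iic t, (coagRate K (path K F π s x) + fragRate F β (path K F π s x))) < ∞ := by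
  obtain ⟨n, hn⟩ := hx.exists_path_eq hK hF h t
  obtain ⟨C, hC, hle⟩ := exists_jumpRate_le (β := β) hK hF hβ n
  refine ⟨(iSup₂_le fun s hs => ?_).trans_lt (ENat.natCast_lt_top n),
    (iSup₂_le fun s hs => ?_).trans_lt hC⟩
  · have h1 := (hn s hs).2.1
    rw [← (hn s hs).1] at h1
    have : {j | 0 < (path K F π s x).1 j} ⊆ (range n : Set ℕ) := fun j hj => by
      rw [Finset.coe_range, Set.mem_Iio]
      exact not_le.1 fun hnj => hj.ne' (apply_eq_zero_of_le h1 hnj)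
    exact (Set.encard_le_encard this).trans (by rw [Set.encard_coe_eq_coe_finsetCard, card_range])
  · rw [(hn s hs).1]
    exact hle _ (hn s hs).2

end Existence

/-! ### Solutions of the equation for a fixed configuration -/

section PathSolution

variable {π : Measure (ℝ≥0 × Mark)} {m : MassSeq} {x y : ℝ≥0 → MassSeq}

/-- Real induction from `a` to `b`: the property passes to limits from the left, and holds at some
later time whenever it holds before `b`. -/
lemma real_induction {a b : ℝ≥0} (hab : a ≤ b) (p : ℝ≥0 → Prop) (h0 : p a)
    (hl : ∀ t, a < t → t ≤ b → (∃ᶠ s in 𝓝[<] t, a ≤ s ∧ p s) → p t)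
    (hr : ∀ t, a ≤ t → t < b → p t → ∃ s, t < s ∧ s ≤ b ∧ p s) : p b := by
  set A : Set ℝ≥0 := {s | a ≤ s ∧ s ≤ b ∧ p s}
  have hne : A.Nonempty := ⟨a, le_rfl, hab, h0⟩
  have hbd : BddAbove A := ⟨b, fun s hs => hs.2.1⟩
  have hle : sSup A ≤ b := csSup_le hne fun s hs => hs.2.1
  have ha : a ≤ sSup A := le_csSup hbd ⟨le_rfl, hab, h0⟩
  have hp : p (sSup A) := by
    by_contra hc
    refine hc (hl _ (lt_of_le_of_ne ha fun h => hc (h ▸ h0)) hle ?_)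
    rw [frequently_iff]
    intro U hU
    obtain ⟨u, hu, hsub⟩ := (mem_nhdsLT_iff_exists_Ioo_subset' (lt_of_le_of_ne ha fun h =>
      hc (h ▸ h0))).1 hU
    obtain ⟨s, hs, hus⟩ := exists_lt_of_lt_csSup hne hu
    exact ⟨s, hsub ⟨hus, lt_of_le_of_ne (le_csSup hbd hs) fun h => hc (h ▸ hs.2.2)⟩, hs.1, hs.2.2⟩
  rcases hle.lt_or_eq with h | h
  · obtain ⟨s, h1, h2, h3⟩ := hr _ ha h hp
    exact absurd (le_csSup hbd ⟨ha.trans h1.le, h2, h3⟩) (not_le.2 h1)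
  · exact h ▸ hp

/-- The events in the time interval `(s, t]`. -/
def strip (s t : ℝ≥0) : Set (ℝ≥0 × Mark) := Ioc s t ×ˢ univ

lemma measurableSet_strip (s t : ℝ≥0) : MeasurableSet (strip s t) :=
  measurableSet_Ioc.prod MeasurableSet.univ

variable (K F) in
/-- The jump of the `j`-th coordinate that the equation prescribes at the event `e`. -/
def jump (y : ℝ≥0 → MassSeq) (j : ℕ) (e : ℝ≥0 × Mark) : ℝ :=
  ((act K F (leftLim y e.1) e.2).1 j : ℝ) - (leftLim y e.1).1 j

variable (K F) in
/-- The path `y` solves the equation driven by the configuration `π`. -/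
structure IsPathSolution (lam : ℝ) (π : Measure (ℝ≥0 × Mark)) (m : MassSeq)
    (y : ℝ≥0 → MassSeq) : Prop where
  cadlag : IsCadlag lam y
  integrable : ∀ t j, IntegrableOn (jump K F y j) (strip 0 t) π
  eq : ∀ t j, ((y t).1 j : ℝ) = (m.1 j : ℝ) + ∫ e in strip 0 t, jump K F y j e ∂π

instance : MeasurableSingletonClass (ℝ≥0 × Mark) := by
  obtain ⟨f, hf, hfi⟩ := exists_measurable_injective
  refine ⟨fun x => ?_⟩
  rw [← hfi.preimage_image {x}, Set.image_singleton]
  exact hf (measurableSet_singleton _)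

lemma IsConfig.ae_of_forall (h : IsConfig k π) {p : ℝ≥0 × Mark → Prop}
    (hp : ∀ r ∈ times π, p (r, markAt π r)) : ∀ᵐ e ∂π, p e := by
  have := h.countable.to_subtype
  rw [h.eq_sum, Measure.ae_sum_iff]
  exact fun r => by rw [ae_dirac_eq]; exact eventually_pure.2 (hp r r.2)

lemma IsConfig.apply_singleton (h : IsConfig k π) {r : ℝ≥0} (hr : r ∈ times π) :
    π ({r} ×ˢ univ) = 1 := by
  have hS : MeasurableSet ({r} ×ˢ (univ : Set Mark)) :=
    (measurableSet_singleton r).prod MeasurableSet.univ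
  rw [← lintegral_indicator_one hS, h.lintegral_eq_tsum (measurable_one.indicator hS),
    tsum_eq_single ⟨r, hr⟩]
  · rw [indicator_of_mem (show (r, _) ∈ ({r} ×ˢ univ : Set (ℝ≥0 × Mark)) from ⟨rfl, trivial⟩)]; rfl
  · exact fun r' hne => indicator_of_notMem (fun h' => hne (Subtype.ext h'.1)) _

/-- If almost all the jumps of `g` in `(s, t]` occur at time `t`, there is at most one of them. -/
lemma IsConfig.setIntegral_strip (h : IsConfig k π) (hst : s < t) {g : ℝ≥0 × Mark → ℝ} {c : ℝ}
    (h0 : ∀ r ∈ times π, s < r → r < t → g (r, markAt π r) = 0)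
    (ht : t ∈ times π → g (t, markAt π t) = c) (hc : t ∉ times π → c = 0) :
    ∫ e in strip s t, g e ∂π = c := by
  have hS : MeasurableSet ({t} ×ˢ (univ : Set Mark)) :=
    (measurableSet_singleton t).prod MeasurableSet.univ
  have hae : ∀ᵐ e ∂π, e ∈ strip s t → g e = ({t} ×ˢ univ).indicator (fun _ => c) e := by
    refine h.ae_of_forall fun r hr hrs => ?_
    rcases hrs.1.2.lt_or_eq with hlt | heq
    · rw [h0 r hr hrs.1.1 hlt, indicator_of_notMem fun h' => hlt.ne h'.1]
    · change r = t at heq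
      subst heq
      rw [ht hr, indicator_of_mem
        (show (r, _) ∈ ({r} ×ˢ univ : Set (ℝ≥0 × Mark)) from ⟨rfl, trivial⟩)]
  rw [setIntegral_congr_ae (measurableSet_strip s t) hae, setIntegral_indicator hS,
    show strip s t ∩ {t} ×ˢ univ = {t} ×ˢ univ from
      Set.inter_eq_right.2 (Set.prod_mono (Set.singleton_subset_iff.2 ⟨hst, le_rfl⟩) subset_rfl),
    setIntegral_const, smul_eq_mul, measureReal_def]
  by_cases hm : t ∈ times π
  · rw [h.apply_singleton hm, ENNReal.toReal_one, one_mul]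
  · rw [hc hm, mul_zero]

lemma strip_union {s t u : ℝ≥0} (h1 : s ≤ t) (h2 : t ≤ u) : strip s t ∪ strip t u = strip s u := by
  rw [strip, strip, ← Set.union_prod, Set.Ioc_union_Ioc_eq_Ioc h1 h2]; rfl

lemma disjoint_strip (s t u : ℝ≥0) : Disjoint (strip s t) (strip t u) :=
  Set.disjoint_left.2 fun _ h1 h2 => absurd h1.1.2 (not_le.2 h2.1.1)

lemma strip_subset {s s' t t' : ℝ≥0} (hs : s' ≤ s) (ht : t ≤ t') : strip s t ⊆ strip s' t' :=
  Set.prod_mono (Set.Ioc_subset_Ioc hs ht) subset_rfl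

lemma setIntegral_strip_add {g : ℝ≥0 × Mark → ℝ} (hg : ∀ t, IntegrableOn g (strip 0 t) π)
    (hst : s ≤ t) :
    ∫ e in strip 0 t, g e ∂π = (∫ e in strip 0 s, g e ∂π) + ∫ e in strip s t, g e ∂π := by
  rw [← setIntegral_union (disjoint_strip 0 s t) (measurableSet_strip s t) (hg s)
    ((hg t).mono_set (strip_subset zero_le le_rfl)), strip_union zero_le hst]

include hK hF in
open Classical in
lemma NoExplosion.path_step (h : IsConfig k π) {s t T : ℝ≥0} (hst : s < t) (htT : t ≤ T)
    (hn : ∀ u ≤ T, path K F π u m = truncPath K F π n u m ∧ truncPath K F π n u m ∈ levelSet K F n)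
    (hno : ∀ r ∈ times π, s < r → r < t → markAt π r ∉ markBox n) :
    (∀ u, s ≤ u → u < t → path K F π u m = path K F π s m) ∧
      path K F π t m = if t ∈ times π then act K F (path K F π s m) (markAt π t)
        else path K F π s m := by
  have hs := hn s (hst.le.trans htT)
  constructor
  · intro u hu hut
    rw [hs.1, (hn u (hut.le.trans htT)).1]
    exact truncPath_congr h hu (fun r hr h1 h2 => hno r hr h1 (h2.trans_lt hut)) m
  · rw [hs.1, (hn t htT).1]
    split_ifs with ht
    · rw [truncPath_step hK hF h hst.le ht hst le_rfl fun r hr h1 h2 h3 => h2.eq_or_lt.elim id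
        fun h4 => absurd h3 (hno r hr h1 h4), actTrunc_of_mem hs.2]
    · exact truncPath_congr h hst.le (fun r hr h1 h2 => hno r hr h1
        (lt_of_le_of_ne h2 fun h3 => ht (h3 ▸ hr))) m

lemma leftLim_eq_of_forall (hst : s < t) {z : MassSeq} (h : ∀ u, s ≤ u → u < t → x u = z) :
    leftLim x t = z := by
  have : (𝓝[<] t).NeBot := nhdsLT_neBot_of_exists_lt ⟨s, hst⟩
  refine leftLim_eq_of_tendsto (tendsto_const_nhds.congr' ?_)
  filter_upwards [Ioo_mem_nhdsLT hst] with u hu using (h u hu.1.le hu.2).symm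

include hlam hK hF in
/-- The path constructed from the configuration solves the equation. -/
lemma NoExplosion.isPathSolution (h : IsConfig k π) (hm : NoExplosion K F π m) :
    IsPathSolution K F lam π m fun t => path K F π t m := by
  classical
  set x : ℝ≥0 → MassSeq := fun t => path K F π t m with hx
  have hzero : ∀ n T, (∀ u ≤ T, path K F π u m = truncPath K F π n u m ∧
      truncPath K F π n u m ∈ levelSet K F n) → ∀ r ∈ times π, r ≤ T → markAt π r ∉ markBox n →
      ∀ j, jump K F x j (r, markAt π r) = 0 := by
    intro n T hn r hr hrT hb j
    obtain ⟨s, hs, hno⟩ := h.exists_lt_forall n (h.pos r hr)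
    have hl := leftLim_eq_of_forall hs (NoExplosion.path_step hK hF h hs hrT hn hno).1
    have hmem := (hn s (hs.le.trans hrT))
    rw [← hmem.1] at hmem
    rw [jump, hl, act_eq_self hK hF hmem.2 hb, sub_self]
  have hint : ∀ t j, IntegrableOn (jump K F x j) (strip 0 t) π := by
    intro t j
    obtain ⟨n, hn⟩ := hm.exists_path_eq hK hF h t
    have hb := measurableSet_markBox n
    have h1 : strip 0 t = (Ioc 0 t ×ˢ markBox n) ∪ (Ioc 0 t ×ˢ (markBox n)ᶜ) := by
      rw [← Set.prod_union, Set.union_compl_self]; rfl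
    rw [h1]
    refine IntegrableOn.union ?_ ?_
    · rw [IntegrableOn, h.restrict_eq]
      exact integrable_finsetSum_measure.2 fun r _ => integrable_dirac (by simp)
    · refine IntegrableOn.congr_fun_ae integrableOn_zero ((ae_restrict_iff'
        (measurableSet_Ioc.prod hb.compl)).2 (h.ae_of_forall fun r hr hr' => ?_))
      exact (hzero n t hn r hr hr'.1.2 hr'.2 j).symm
  refine ⟨hm.isCadlag hlam hK hF h, hint, fun T => ?_⟩
  obtain ⟨n, hn⟩ := hm.exists_path_eq hK hF h T
  have hstep : ∀ s t, s < t → t ≤ T → (∀ r ∈ times π, s < r → r < t → markAt π r ∉ markBox n) →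
      (∀ j, ((x s).1 j : ℝ) = m.1 j + ∫ e in strip 0 s, jump K F x j e ∂π) →
      ∀ j, ((x t).1 j : ℝ) = m.1 j + ∫ e in strip 0 t, jump K F x j e ∂π := by
    intro s t hst htT hno hp j
    obtain ⟨h1, h2⟩ := NoExplosion.path_step hK hF h hst htT hn hno
    have hl := leftLim_eq_of_forall (x := x) hst h1
    rw [setIntegral_strip_add (fun t => hint t j) hst.le, ← add_assoc, ← hp j,
      h.setIntegral_strip hst (c := (x t).1 j - (x s).1 j)
      (fun r hr h3 h4 => hzero n T hn r hr (h4.le.trans htT) (hno r hr h3 h4) j)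
      (fun ht => by rw [jump, hl]; simp only [hx, h2, if_pos ht])
      (fun ht => by simp only [hx, h2, if_neg ht, sub_self])]
    ring
  refine real_induction (zero_le (a := T)) (fun t => ∀ j, ((x t).1 j : ℝ) = m.1 j +
    ∫ e in strip 0 t, jump K F x j e ∂π) (fun j => ?_) (fun t ht htT hf => ?_) fun t _ htT hp => ?_
  · have : strip 0 0 = ∅ := by simp [strip]
    rw [this, setIntegral_empty, add_zero, hx]
    simp only [path_zero h]
  · obtain ⟨u, hu, hno⟩ := h.exists_lt_forall n ht
    obtain ⟨s, hs, hs'⟩ := (hf.and_eventually (Ioo_mem_nhdsLT hu)).exists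
    exact hstep s t hs'.2 htT (fun r hr h1 h2 => hno r hr (hs'.1.trans h1) h2) hs.2
  · obtain ⟨u, hu, hno⟩ := h.exists_gt_forall n t
    refine ⟨min u T, lt_min hu htT, min_le_right _ _, hstep t _ (lt_min hu htT) (min_le_right _ _)
      (fun r hr h1 h2 => hno r hr h1 (h2.le.trans (min_le_left _ _))) hp⟩

lemma IsPathSolution.sub_eq (hy : IsPathSolution K F lam π m y) (hst : s ≤ t) (j : ℕ) :
    ((y t).1 j : ℝ) - (y s).1 j = ∫ e in strip s t, jump K F y j e ∂π := by
  rw [hy.eq t, hy.eq s, setIntegral_strip_add (fun t => hy.integrable t j) hst]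
  ring

lemma IsCadlag.tendsto_right (hlam : 0 < lam) (hy : IsCadlag lam y) (t : ℝ≥0) :
    Tendsto y (𝓝[>] t) (𝓝 (y t)) := tendsto_of_delta hlam (hy.right t)

lemma IsCadlag.tendsto_left (hlam : 0 < lam) (hy : IsCadlag lam y) (ht : 0 < t) :
    Tendsto y (𝓝[<] t) (𝓝 (leftLim y t)) := by
  have : (𝓝[<] t).NeBot := nhdsLT_neBot_of_exists_lt ⟨0, ht⟩
  obtain ⟨z, -, hz⟩ := hy.left t ht
  have h := tendsto_of_delta hlam hz
  rwa [leftLim_eq_of_tendsto h]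

lemma tendsto_coord {ι : Type*} {l : Filter ι} {f : ι → MassSeq} {z : MassSeq}
    (h : Tendsto f l (𝓝 z)) (j : ℕ) : Tendsto (fun s => ((f s).1 j : ℝ)) l (𝓝 (z.1 j : ℝ)) :=
  (NNReal.continuous_coe.tendsto _).comp
    (((continuous_apply j).comp continuous_subtype_val).tendsto z |>.comp h)

open Classical in
/-- A solution jumps exactly as prescribed by the event at the time of the jump. -/
lemma IsPathSolution.apply_eq (hlam : 0 < lam) (hy : IsPathSolution K F lam π m y)
    (h : IsConfig k π) (ht : 0 < t) :
    y t = if t ∈ times π then act K F (leftLim y t) (markAt π t)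
      else leftLim y t := by
  set z := if t ∈ times π then act K F (leftLim y t) (markAt π t)
    else leftLim y t with hz
  have hne : (𝓝[<] t).NeBot := nhdsLT_neBot_of_exists_lt ⟨0, ht⟩
  obtain ⟨u, hu', hu, hlim⟩ := exists_seq_strictMono_tendsto' ht
  refine Subtype.ext (funext fun j => NNReal.coe_injective ?_)
  have hlt : Tendsto u atTop (𝓝[<] t) :=
    tendsto_nhdsWithin_iff.2 ⟨hlim, Eventually.of_forall fun n => (hu n).2⟩
  have h1 := (tendsto_coord (hy.cadlag.tendsto_left hlam ht) j).comp hlt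
  -- the integrals over `(u n, t]` tend to the contribution of time `t`
  have h2 : Tendsto (fun n => ∫ e in strip (u n) t, jump K F y j e ∂π) atTop
      (𝓝 ((y t).1 j - (leftLim y t).1 j)) := by
    refine (tendsto_const_nhds.sub h1).congr fun n => ?_
    exact hy.sub_eq (hu n).2.le j
  have hS : ∀ n, strip (u n) t ⊆ strip 0 t := fun n => strip_subset zero_le le_rfl
  have h3 := tendsto_setIntegral_of_antitone (μ := π) (f := jump K F y j)
    (fun n => measurableSet_strip (u n) t)
    (fun a b hab => strip_subset (hu'.monotone hab) le_rfl) ⟨0, (hy.integrable t j).mono_set (hS 0)⟩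
  have hinter : ⋂ n, strip (u n) t = {t} ×ˢ univ := by
    ext e
    simp only [strip, Set.mem_iInter, Set.mem_prod, Set.mem_Ioc, Set.mem_univ, and_true,
      Set.mem_singleton_iff]
    refine ⟨fun h' => le_antisymm (h' 0).2 (le_of_tendsto' hlim fun n => (h' n).1.le),
      fun h' n => by rw [h']; exact ⟨(hu n).2, le_rfl⟩⟩
  have hc : ∫ e in {t} ×ˢ univ, jump K F y j e ∂π = (z.1 j : ℝ) - (leftLim y t).1 j := by
    by_cases htm : t ∈ times π
    · have hae : ∀ᵐ e ∂π, e ∈ ({t} ×ˢ univ : Set (ℝ≥0 × Mark)) →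
          jump K F y j e = (z.1 j : ℝ) - (leftLim y t).1 j := by
        refine h.ae_of_forall fun r _ hr' => ?_
        obtain rfl : r = t := hr'.1
        rw [hz, if_pos htm, jump]
      rw [setIntegral_congr_ae ((measurableSet_singleton t).prod MeasurableSet.univ) hae,
        setIntegral_const, measureReal_def, h.apply_singleton htm, ENNReal.toReal_one, one_smul]
    · rw [Measure.restrict_eq_zero.2 (not_not.1 htm), integral_zero_measure, hz, if_neg htm,
        sub_self]
  rw [hinter, hc] at h3
  exact sub_left_injective (tendsto_nhds_unique h2 h3)

end PathSolution

/-! ### Pathwise uniqueness -/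

section PathUniqueness

variable {π : Measure (ℝ≥0 × Mark)} {m : MassSeq} {x y : ℝ≥0 → MassSeq}

lemma sub_le_rpow_sub_rpow (hlam : 0 < lam) (hlam1 : lam ≤ 1) {a b A : ℝ} (hb : 0 ≤ b)
    (hba : b ≤ a) (haA : a ≤ A) : a - b ≤ A ^ (1 - lam) / lam * (a ^ lam - b ^ lam) := by
  rcases (hb.trans hba).eq_or_lt with h0 | ha
  · obtain rfl : b = 0 := le_antisymm (h0 ▸ hba) hb
    rw [← h0]; simp
  have hal := Real.rpow_pos_of_pos ha lam
  have h1 : b ^ lam ≤ a ^ lam := Real.rpow_le_rpow hb hba hlam.le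
  have h2 := one_add_mul_self_le_rpow_one_add (s := b ^ lam / a ^ lam - 1)
    (by linarith [div_nonneg (Real.rpow_nonneg hb lam) hal.le]) (p := 1 / lam)
    ((one_le_div hlam).2 hlam1)
  rw [add_sub_cancel, Real.div_rpow (Real.rpow_nonneg hb lam) hal.le, ← Real.rpow_mul hb,
    ← Real.rpow_mul ha.le, mul_one_div_cancel hlam.ne', Real.rpow_one, Real.rpow_one,
    le_div_iff₀ ha] at h2
  have h3 : a - b ≤ a ^ (1 - lam) / lam * (a ^ lam - b ^ lam) := by
    have h4 : a ^ (1 - lam) = a / a ^ lam := by rw [Real.rpow_sub ha, Real.rpow_one]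
    have h5 : (1 + 1 / lam * (b ^ lam / a ^ lam - 1)) * a =
        a - a / a ^ lam / lam * (a ^ lam - b ^ lam) := by
      field_simp
      ring
    rw [h4]
    linarith
  refine h3.trans ?_
  gcongr

lemma mass_le_add_delta (hlam : 0 < lam) (hlam1 : lam ≤ 1) {y z : MassSeq} {A : ℝ≥0}
    (hy : y.1 0 ≤ A) :
    mass y ≤ mass z + ofReal (A ^ (1 - lam) / lam) * delta lam y z := by
  rw [mass, mass, delta, ← ENNReal.tsum_mul_left, ← tsum_add]
  refine tsum_le_tsum fun j => ?_
  rcases le_total (y.1 j) (z.1 j) with h | h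
  · exact le_add_right (ENNReal.coe_le_coe.2 h)
  have h1 := sub_le_rpow_sub_rpow hlam hlam1 (z.1 j).2 (NNReal.coe_le_coe.2 h)
    (NNReal.coe_le_coe.2 ((y.2 (zero_le (a := j))).trans hy))
  rw [edist_dist, NNReal.dist_eq, ← ofReal_mul (by positivity),
    ← ofReal_coe_nnreal, ← ofReal_coe_nnreal,
    ← ofReal_add NNReal.zero_le_coe (by positivity)]
  refine ofReal_le_ofReal ?_
  rw [abs_of_nonneg (sub_nonneg.2 (NNReal.coe_le_coe.2 (NNReal.rpow_le_rpow h hlam.le))),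
    NNReal.coe_rpow, NNReal.coe_rpow]
  exact sub_le_iff_le_add'.1 h1

lemma eq_of_le_of_mass_le {y z : MassSeq} (h : ∀ j, y.1 j ≤ z.1 j) (hm : mass z ≤ mass y)
    (hfin : mass y ≠ ∞) : y = z := by
  by_contra hne
  obtain ⟨j, hj⟩ : ∃ j, y.1 j ≠ z.1 j := by
    by_contra! hc
    exact hne (Subtype.ext (funext hc))
  exact absurd hm (not_le.2 (ENNReal.tsum_lt_tsum hfin (fun j => ENNReal.coe_le_coe.2 (h j))
    (ENNReal.coe_lt_coe.2 (lt_of_le_of_ne (h j) hj))))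

lemma IsCadlag.tendsto_leftLim_coord (hlam : 0 < lam) (hy : IsCadlag lam y) (ht : 0 < t) (j : ℕ) :
    Tendsto (fun s => (y s).1 j) (𝓝[<] t) (𝓝 ((leftLim y t).1 j)) :=
  ((continuous_apply j).comp continuous_subtype_val).tendsto _ |>.comp (hy.tendsto_left hlam ht)

/-- A bound on a coordinate up to time `r` passes to the left limit. -/
lemma IsCadlag.leftLim_apply_le (hlam : 0 < lam) (hy : IsCadlag lam y) {t r : ℝ≥0} (htr : t < r)
    {j : ℕ} {c : ℝ≥0} (h : ∀ u, t < u → u < r → (y u).1 j ≤ c) : (leftLim y r).1 j ≤ c := by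
  have : (𝓝[<] r).NeBot := nhdsLT_neBot_of_exists_lt ⟨t, htr⟩
  refine le_of_tendsto (hy.tendsto_leftLim_coord hlam (zero_le.trans_lt htr) j) ?_
  filter_upwards [Ioo_mem_nhdsLT htr] with u hu using h u hu.1 hu.2

lemma IsPathSolution.mass_le_of_frequently (hlam : 0 < lam) (hy : IsPathSolution K F lam π m y)
    (h : IsConfig k π) (ht : 0 < t) {c : ℝ≥0∞} (hf : ∃ᶠ s in 𝓝[<] t, mass (y s) ≤ c) :
    mass (y t) ≤ c := by
  classical
  have h1 : mass (leftLim y t) ≤ c := by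
    refine mass_le_iff.2 fun n => ?_
    have h2 : Tendsto (fun s => ((∑ j ∈ range n, (y s).1 j : ℝ≥0) : ℝ≥0∞)) (𝓝[<] t)
        (𝓝 (∑ j ∈ range n, (leftLim y t).1 j : ℝ≥0)) :=
      ENNReal.tendsto_coe.2
        (tendsto_finsetSum _ fun j _ => hy.cadlag.tendsto_leftLim_coord hlam ht j)
    exact le_of_tendsto_of_frequently h2 (hf.mono fun s hs => (sum_range_le_mass _ n).trans hs)
  rw [hy.apply_eq hlam h ht]
  split_ifs with htm
  · exact (mass_act_le (h.good t htm) _).trans h1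
  · exact h1

variable (K F) in
/-- The jump of the total mass of the first `l` particles. -/
def sumJump (y : ℝ≥0 → MassSeq) (l : ℕ) (e : ℝ≥0 × Mark) : ℝ :=
  ∑ j ∈ range l, jump K F y j e

lemma IsPathSolution.integrable_sumJump (hy : IsPathSolution K F lam π m y) (l : ℕ) (s t : ℝ≥0) :
    IntegrableOn (sumJump K F y l) (strip s t) π :=
  integrable_finsetSum _ fun j _ => (hy.integrable t j).mono_set (strip_subset zero_le le_rfl)

lemma IsPathSolution.sum_sub_eq (hy : IsPathSolution K F lam π m y) (l : ℕ) (hst : s ≤ t) :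
    ((∑ j ∈ range l, (y t).1 j : ℝ≥0) : ℝ) - (∑ j ∈ range l, (y s).1 j : ℝ≥0) =
      ∫ e in strip s t, sumJump K F y l e ∂π := by
  simp only [sumJump]
  rw [integral_finsetSum _ fun j _ => (hy.integrable t j).mono_set (strip_subset zero_le le_rfl)]
  push_cast
  rw [← Finset.sum_sub_distrib]
  exact sum_congr rfl fun j _ => hy.sub_eq hst j

/-- If the mass never increases while there are more than `l` particles, it does not increase. While
there are at most `l` particles, the mass is that of the first `l` particles; its variation due to
the events outside a large box is as small as desired, and the remaining events are locally
finite. -/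
lemma IsPathSolution.mass_le_of_excursions (hlam : 0 < lam) (hlam1 : lam ≤ 1)
    (hy : IsPathSolution K F lam π m y) (h : IsConfig k π) (l : ℕ) {a b : ℝ≥0} (hab : a ≤ b)
    (hex : ∀ u v, a ≤ u → u ≤ v → v ≤ b → (∀ s, u ≤ s → s ≤ v → (y s).1 l ≠ 0) →
      mass (y v) ≤ mass (y u)) : mass (y b) ≤ mass (y a) := by
  set g : ℝ≥0 × Mark → ℝ := fun e => ‖sumJump K F y l e‖ with hg
  set S : ℕ → ℝ≥0 → ℝ≥0 → Set (ℝ≥0 × Mark) := fun q s t => Ioc s t ×ˢ (markBox q)ᶜ with hS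
  have hSm : ∀ q s t, MeasurableSet (S q s t) := fun q s t =>
    measurableSet_Ioc.prod (measurableSet_markBox q).compl
  have hgi : ∀ q s t, IntegrableOn g (S q s t) π := fun q s t =>
    IntegrableOn.mono_set (hy.integrable_sumJump l s t).norm (Set.prod_mono subset_rfl
      (Set.subset_univ _))
  have hlim : Tendsto (fun q => ∫ e in S q a b, g e ∂π) atTop (𝓝 0) := by
    have h1 := tendsto_setIntegral_of_antitone (μ := π) (f := g) (fun q => hSm q a b)
      (fun q q' hq => Set.prod_mono subset_rfl (Set.compl_subset_compl.2 (markBox_mono hq)))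
      ⟨0, hgi 0 a b⟩
    have h2 : ⋂ q, S q a b = ∅ := by
      refine Set.eq_empty_of_forall_notMem fun e he => ?_
      obtain ⟨q, hq⟩ := exists_mem_markBox e.2
      exact (Set.mem_iInter.1 he q).2 hq
    rwa [h2, setIntegral_empty] at h1
  refine ENNReal.le_of_forall_pos_le_add fun ε hε _ => ?_
  obtain ⟨q, hq⟩ := (hlim.eventually_lt_const (NNReal.coe_pos.2 hε)).exists
  set V : ℝ≥0 → ℝ := fun s => ∫ e in S q a s, g e ∂π with hV
  have hV0 : ∀ s, 0 ≤ V s := fun s => integral_nonneg fun e => norm_nonneg _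
  have hVmono : Monotone V := fun s t hst =>
    setIntegral_mono_set (hgi q a t) (ae_of_all _ fun e => norm_nonneg _)
      (Set.prod_mono (Set.Ioc_subset_Ioc_right hst) subset_rfl).eventuallyLE
  have hVadd : ∀ s t, a ≤ s → s ≤ t → V t = V s + ∫ e in S q s t, g e ∂π := by
    intro s t has hst
    rw [hV]
    beta_reduce
    rw [← setIntegral_union (Set.disjoint_prod.2 (Or.inl (Set.Ioc_disjoint_Ioc_of_le le_rfl)))
      (hSm q s t) (hgi q a s) (hgi q s t), hS]
    beta_reduce
    rw [← Set.union_prod, Set.Ioc_union_Ioc_eq_Ioc has hst]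
  have hzero : ∀ s, (y s).1 l = 0 → mass (y s) =
      ofReal (∑ j ∈ range l, (y s).1 j : ℝ≥0) := fun s hs => by
    rw [mass_eq_sum hs, ofReal_coe_nnreal]
  suffices hmain : mass (y b) ≤ mass (y a) + ofReal (V b) by
    refine hmain.trans (add_le_add_right ?_ _)
    rw [← ofReal_coe_nnreal]
    exact ofReal_le_ofReal hq.le
  refine real_induction hab (fun s => mass (y s) ≤ mass (y a) + ofReal (V s)) le_self_add
    (fun t hat htb hf => ?_) fun t hat htb hp => ?_
  · refine hy.mass_le_of_frequently hlam h (zero_le.trans_lt hat) ?_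
    refine (hf.and_eventually self_mem_nhdsWithin).mono fun s hs => hs.1.2.trans ?_
    gcongr
    exact hVmono hs.2.le
  · obtain ⟨t', htt', hno⟩ := h.exists_gt_forall q t
    have hne : (𝓝[>] t).NeBot := nhdsGT_neBot_of_exists_gt ⟨t', htt'⟩
    suffices hs : ∃ s, t < s ∧ s ≤ b ∧ (mass (y s) ≤ mass (y t) ∨
        s ≤ t' ∧ (y t).1 l = 0 ∧ (y s).1 l = 0) by
      obtain ⟨s, hts, hsb, hs | ⟨hst', h0, h0'⟩⟩ := hs
      · refine ⟨s, hts, hsb, hs.trans (hp.trans ?_)⟩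
        gcongr
        exact hVmono hts.le
      · refine ⟨s, hts, hsb, ?_⟩
        have h1 : ∫ e in strip t s, sumJump K F y l e ∂π ≤ ∫ e in S q t s, g e ∂π := by
          have h2 : ∀ᵐ e ∂π, e ∈ strip t s → e ∉ S q t s → sumJump K F y l e = 0 ∧ False :=
            h.ae_of_forall fun r hr hrs hrS =>
              absurd (show (r, markAt π r) ∈ S q t s from
                ⟨hrs.1, hno r hr hrs.1.1 (hrs.1.2.trans hst')⟩) hrS
          have h3 : (strip t s : Set _) =ᵐ[π] S q t s := by
            filter_upwards [h2] with e he
            refine propext ⟨fun h4 => ?_, fun h4 => ⟨h4.1, trivial⟩⟩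
            by_contra h5
            exact (he h4 h5).2
          rw [setIntegral_congr_set h3]
          refine setIntegral_mono ((hy.integrable_sumJump l t s).mono_set
            (Set.prod_mono subset_rfl (Set.subset_univ _))) (hgi q t s) fun e => le_abs_self _
        have h6 := hy.sum_sub_eq l hts.le
        rw [hzero s h0']
        rw [hzero t h0] at hp
        calc ofReal (∑ j ∈ range l, (y s).1 j : ℝ≥0)
            ≤ ofReal ((∑ j ∈ range l, (y t).1 j : ℝ≥0) +
                ∫ e in S q t s, g e ∂π) := ofReal_le_ofReal (by linarith)
          _ ≤ ofReal (∑ j ∈ range l, (y t).1 j : ℝ≥0) +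
                ofReal (∫ e in S q t s, g e ∂π) := ENNReal.ofReal_add_le
          _ ≤ mass (y a) + ofReal (V t) + ofReal (∫ e in S q t s, g e ∂π) := by
                gcongr
          _ = mass (y a) + ofReal (V s) := by
                rw [add_assoc, ← ofReal_add (hV0 t)
                  (integral_nonneg fun e => norm_nonneg _), ← hVadd t s hat hts.le]
    by_cases hex0 : ∃ v, t < v ∧ v ≤ b ∧ ∀ s, t < s → s ≤ v → (y s).1 l ≠ 0
    · -- the mass does not increase on `[u, v]` for `u` close to `t`, hence on `[t, v]`
      obtain ⟨v, htv, hvb, hv⟩ := hex0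
      refine ⟨v, htv, hvb, Or.inl ?_⟩
      have hd := hy.cadlag.right t
      have h0 : ∀ᶠ u in 𝓝[>] t, (y u).1 0 ≤ (y t).1 0 + 1 :=
        ((((continuous_apply 0).comp continuous_subtype_val).tendsto (y t)).comp
          (hy.cadlag.tendsto_right hlam t)).eventually_le_const (lt_add_one _)
      have hC := ENNReal.Tendsto.const_mul (a := ofReal
        (((y t).1 0 + 1 : ℝ≥0) ^ (1 - lam) / lam)) hd (Or.inr ofReal_ne_top)
      rw [mul_zero] at hC
      have hC' := hC.const_add (mass (y t))
      rw [add_zero] at hC'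
      refine ge_of_tendsto hC' ?_
      filter_upwards [h0, Ioc_mem_nhdsGT htv] with u hu huv
      exact (hex u v (hat.trans huv.1.le) huv.2 hvb fun s hs hsv => hv s
        (huv.1.trans_le hs) hsv).trans
        (mass_le_add_delta hlam hlam1 hu)
    · push Not at hex0
      obtain ⟨s, hts, hsv, hs⟩ := hex0 (min t' b) (lt_min htt' htb) (min_le_right _ _)
      refine ⟨s, hts, hsv.trans (min_le_right _ _), Or.inr ⟨hsv.trans (min_le_left _ _), ?_, hs⟩⟩
      -- zeros accumulate at `t` from the right
      by_contra h0
      have h1 := (((continuous_apply l).comp continuous_subtype_val).tendsto (y t)).comp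
          (hy.cadlag.tendsto_right hlam t)
      have h2 : ∀ᶠ u in 𝓝[>] t, (y u).1 l ≠ 0 := h1.eventually_ne h0
      obtain ⟨v, hv, hsub⟩ := mem_nhdsGT_iff_exists_Ioc_subset.1 h2
      obtain ⟨s', h3, h4, h5⟩ := hex0 (min v b) (lt_min hv htb) (min_le_right _ _)
      exact hsub ⟨h3, h4.trans (min_le_left _ _)⟩ h5

/-- The mass of a solution with finitely many particles does not increase. -/
lemma IsPathSolution.mass_antitone_of_finite (hlam : 0 < lam) (hlam1 : lam ≤ 1)
    (hy : IsPathSolution K F lam π m y) (h : IsConfig k π) (hfin : ∀ t, y t ∈ finiteStates) :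
    Antitone fun t => mass (y t) := by
  intro a b hab
  by_contra hc
  -- nested intervals on which the mass increases and the number of particles exceeds `l`
  let G := {p : ℝ≥0 × ℝ≥0 // p.1 ≤ p.2 ∧ mass (y p.1) < mass (y p.2)}
  have hstep : ∀ (l : ℕ) (p : G), ∃ q : G, p.1.1 ≤ q.1.1 ∧ q.1.2 ≤ p.1.2 ∧
      ∀ s, q.1.1 ≤ s → s ≤ q.1.2 → (y s).1 l ≠ 0 := by
    rintro l ⟨⟨u, v⟩, huv, hm⟩
    by_contra! hc'
    refine absurd (hy.mass_le_of_excursions hlam hlam1 h l huv fun u' v' h1 h2 h3 h4 => ?_)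
      (not_le.2 hm)
    by_contra hlt
    obtain ⟨s, h5, h6, h7⟩ := hc' ⟨⟨u', v'⟩, h2, not_le.1 hlt⟩ h1 h3
    exact h4 s h5 h6 h7
  choose nxt hn1 hn2 hn3 using hstep
  let I : ℕ → G := fun n => Nat.rec ⟨⟨a, b⟩, hab, not_le.1 hc⟩ (fun l p => nxt l p) n
  have hanti : Antitone fun n => Icc (I n).1.1 (I n).1.2 :=
    antitone_nat_of_succ_le fun n => Set.Icc_subset_Icc (hn1 n (I n)) (hn2 n (I n))
  have hmem := ciSup_mem_iInter_Icc_of_antitone_Icc hanti fun n => (I n).2.1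
  obtain ⟨l, hl⟩ := hfin (⨆ n, (I n).1.1)
  have := Set.mem_iInter.1 hmem (l + 1)
  exact hn3 l (I l) _ this.1 this.2 hl

include hlam hK hF in
/-- After a time at which it has finitely many particles, a solution whose mass does not increase is
constant for a while: the particles present at that time cannot lose mass before the next event in
some box. -/
lemma IsPathSolution.eventually_const (hy : IsPathSolution K F lam π m y) (h : IsConfig k π)
    (hanti : Antitone fun t => mass (y t)) (ht : y t ∈ finiteStates) :
    ∃ s, t < s ∧ ∀ u, t ≤ u → u ≤ s → y u = y t := by
  obtain ⟨k₀, hk₀⟩ := ht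
  have hfin : mass (y t) ≠ ∞ := (mass_lt_top ⟨k₀, hk₀⟩).ne
  set A := (mass (y t)).toNNReal with hA
  have hle : ∀ u, t ≤ u → ∀ i, (y u).1 i ≤ A := fun u hu i => ENNReal.coe_le_coe.1 <| by
    rw [hA, coe_toNNReal hfin]
    exact (apply_le_mass _ i).trans (hanti hu)
  obtain ⟨C₁, hC₁⟩ := hK.locallyBounded A
  obtain ⟨C₂, hC₂⟩ := hF.locallyBounded A
  obtain ⟨n₀, hn₀⟩ := exists_nat_ge (max C₁ C₂)
  set n := max n₀ k₀
  have hn : max C₁ C₂ ≤ n := hn₀.trans (Nat.cast_le.2 (le_max_left _ _))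
  obtain ⟨s, hts, hno⟩ := h.exists_gt_forall n t
  refine ⟨s, hts, fun u htu hus => (eq_of_le_of_mass_le (fun j => ?_) (hanti htu) hfin).symm⟩
  rcases le_or_gt n j with hj | hj
  · exact ((y t).2 ((le_max_right _ _).trans hj)).trans (hk₀.le.trans zero_le)
  rw [← NNReal.coe_le_coe, ← sub_nonneg, hy.sub_eq htu]
  refine integral_nonneg_of_ae ((ae_restrict_iff' (measurableSet_strip t u)).2
    (h.ae_of_forall fun r hr hrs => ?_))
  have hb := hno r hr hrs.1.1 (hrs.1.2.trans hus)
  have hl : ∀ i, (leftLim y r).1 i ≤ A := fun i =>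
    hy.cadlag.leftLim_apply_le hlam hrs.1.1 fun v hv _ => hle v hv.le i
  simp only [Pi.zero_apply, jump, sub_nonneg, NNReal.coe_le_coe]
  generalize markAt π r = e at hb
  rcases e with ⟨p, z⟩ | ⟨i, θ, z⟩
  · simp only [act]
    split_ifs with hz
    · refine le_coalesce_apply (hj.trans_le ?_) _
      by_contra hlt
      exact hb (inl_mem_markBox.2 ⟨not_le.1 hlt, (hz.2.trans (hC₁ _ (hl _) _ (hl _))).trans
        ((le_max_left _ _).trans hn)⟩)
    · exact le_rfl
  · simp only [act]
    split_ifs with hz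
    · refine le_fragment_apply (hj.trans_le ?_) _ _
      by_contra hlt
      exact hb (inr_mem_markBox.2 ⟨not_le.1 hlt, (hz.2.trans (hC₂ _ (hl _))).trans
        ((le_max_right _ _).trans hn)⟩)
    · exact le_rfl

/-- By real induction: agreement passes to left limits, which determine the jump, and persists for a
while since both solutions are constant after the time. -/
lemma IsPathSolution.eq_of_antitone (hlam : 0 < lam) (hx : IsPathSolution K F lam π m x)
    (hy : IsPathSolution K F lam π m y) (hK : IsCoagKernel K) (hF : IsFragKernel F)
    (h : IsConfig k π) (hfin : ∀ t, x t ∈ finiteStates) (hax : Antitone fun t => mass (x t))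
    (hay : Antitone fun t => mass (y t)) (t : ℝ≥0) : y t = x t := by
  refine real_induction (zero_le (a := t)) (fun s => ∀ u ≤ s, y u = x u) (fun u hu => ?_)
    (fun s hs _ hf => ?_) (fun s _ hst hp => ?_) t le_rfl
  · obtain rfl : u = 0 := le_antisymm hu zero_le
    have hs : strip 0 0 = ∅ := by simp [strip]
    refine Subtype.ext (funext fun j => NNReal.coe_injective ?_)
    rw [hx.eq, hy.eq, hs, setIntegral_empty, setIntegral_empty]
  · classical
    have hlt : ∀ u < s, y u = x u := fun u hu => by
      have : (𝓝[<] s).NeBot := nhdsLT_neBot_of_exists_lt ⟨0, hs⟩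
      obtain ⟨v, hv, hv'⟩ := (hf.and_eventually (Ioo_mem_nhdsLT hu)).exists
      exact hv.2 u hv'.1.le
    have hlim : leftLim y s = leftLim x s := by
      have : (𝓝[<] s).NeBot := nhdsLT_neBot_of_exists_lt ⟨0, hs⟩
      refine tendsto_nhds_unique (hy.cadlag.tendsto_left hlam hs)
        ((hx.cadlag.tendsto_left hlam hs).congr' ?_)
      filter_upwards [self_mem_nhdsWithin] with u hu using (hlt u hu).symm
    intro u hu
    rcases hu.lt_or_eq with hu | rfl
    · exact hlt u hu
    · rw [hx.apply_eq hlam h hs, hy.apply_eq hlam h hs, hlim]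
  · obtain ⟨s₁, h1, hx1⟩ := hx.eventually_const hlam hK hF h hax (hfin s)
    obtain ⟨s₂, h2, hy2⟩ := hy.eventually_const hlam hK hF h hay (hp s le_rfl ▸ hfin s)
    refine ⟨min (min s₁ s₂) t, lt_min (lt_min h1 h2) hst, min_le_right _ _, fun u hu => ?_⟩
    rcases le_total u s with hus | hsu
    · exact hp u hus
    · rw [hx1 u hsu (hu.trans ((min_le_left _ _).trans (min_le_left _ _))),
        hy2 u hsu (hu.trans ((min_le_left _ _).trans (min_le_right _ _))), hp s le_rfl]

end PathUniqueness

section SmallExponent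

variable {π : Measure (ℝ≥0 × Mark)} {m : MassSeq} {x y : ℝ≥0 → MassSeq}

/-- A bound, up to a constant, on the gain of mass of the first `l` particles at a coalescence with
rate at most `q` in a state with bounded `1 / p`-moment. -/
def pairWeight (p : ℝ) (q l : ℕ) : Mark → ℝ :=
  Sum.elim (fun a => if a.2 ≤ q then ((max l a.1.1.2 : ℕ) + 1 : ℝ) ^ (-p) else 0) 0

lemma measurable_pairWeight (p : ℝ) (q l : ℕ) : Measurable (pairWeight p q l) :=
  Measurable.sumElim (Measurable.ite (measurableSet_le measurable_snd measurable_const)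
    ((measurable_of_countable fun a : IdxPair => ((max l a.1.2 : ℕ) + 1 : ℝ) ^ (-p)).comp
      measurable_fst) measurable_const) measurable_const

lemma pairWeight_nonneg (p : ℝ) (q l : ℕ) (e : Mark) : 0 ≤ pairWeight p q l e := by
  rcases e with ⟨a, z⟩ | e
  · simp only [pairWeight, Sum.elim_inl]
    split_ifs <;> positivity
  · exact le_rfl

lemma pairWeight_le {p : ℝ} (hp : 0 < p) (q l : ℕ) (e : Mark) :
    pairWeight p q l e ≤ pairWeight p q 0 e := by
  rcases e with ⟨a, z⟩ | e
  · simp only [pairWeight, Sum.elim_inl, Nat.zero_max]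
    split_ifs
    · refine Real.rpow_le_rpow_of_nonpos (by positivity) ?_ (by linarith)
      gcongr
      exact le_max_right _ _
    · exact le_rfl
  · exact le_rfl

lemma tendsto_pairWeight {p : ℝ} (hp : 0 < p) (q : ℕ) (e : Mark) :
    Tendsto (fun l => pairWeight p q l e) atTop (𝓝 0) := by
  rcases e with ⟨a, z⟩ | e
  · simp only [pairWeight, Sum.elim_inl]
    split_ifs
    · refine (tendsto_rpow_neg_atTop hp).comp (tendsto_atTop_add_const_right _ _
        (tendsto_natCast_atTop_atTop.comp (tendsto_atTop_mono (fun l =>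
          le_max_left l _) tendsto_id)))
    · exact tendsto_const_nhds
  · exact tendsto_const_nhds

/-- A bounded `λ`-moment controls the decay of the masses. -/
lemma apply_le_of_moment_le (hlam : 0 < lam) {z : MassSeq} {B : ℝ≥0} (h : moment lam z ≤ B)
    (j : ℕ) :
    z.1 j ≤ B ^ (1 / lam) * (j + 1 : ℝ≥0) ^ (-(1 / lam)) := by
  have h1 : ((j + 1 : ℝ≥0) * z.1 j ^ lam : ℝ≥0) ≤ B := by
    refine ENNReal.coe_le_coe.1 (le_trans ?_ ((sum_le_tsum (range (j + 1))).trans h))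
    rw [← ENNReal.ofNNReal_finsetSum, ENNReal.coe_le_coe]
    refine le_trans (by simp) (Finset.card_nsmul_le_sum _ _ (z.1 j ^ lam) fun i hi => ?_)
    exact NNReal.rpow_le_rpow (z.2 (Nat.lt_succ_iff.1 (Finset.mem_range.1 hi))) hlam.le
  have h2 := NNReal.rpow_le_rpow h1 (z := 1 / lam) (by positivity)
  rw [NNReal.mul_rpow, ← NNReal.rpow_mul, mul_one_div_cancel hlam.ne', NNReal.rpow_one] at h2
  rwa [NNReal.rpow_neg, ← div_eq_mul_inv, le_div_iff₀ (NNReal.rpow_pos (by positivity)), mul_comm]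

include hlam hK in
/-- If the pairs of indices have a finite total weight, the mass does not increase, whatever the
number of particles: the gain of mass of the first `l` particles tends to `0` as `l` grows. -/
lemma IsPathSolution.mass_antitone_of_pairWeight (hy : IsPathSolution K F lam π m y)
    (h : IsConfig k π)
    (hw : ∀ q t, IntegrableOn (fun e => pairWeight (1 / lam) q 0 e.2) (strip 0 t) π) :
    Antitone fun t => mass (y t) := by
  intro a b hab
  refine real_induction hab (fun s => mass (y s) ≤ mass (y a)) le_rfl
    (fun t hat _ hf => hy.mass_le_of_frequently hlam h (zero_le.trans_lt hat)
      (hf.mono fun s hs => hs.2)) fun t hat htb hp => ?_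
  have hp0 : 0 < 1 / lam := by positivity
  obtain ⟨s', hs', hsub⟩ := mem_nhdsGT_iff_exists_Ioc_subset.1
    ((hy.cadlag.right t).eventually (ge_mem_nhds one_pos))
  have hfin : moment lam (y t) < ∞ := hy.cadlag.mem t
  set B : ℝ≥0 := (moment lam (y t)).toNNReal + 1 with hB
  have hmom : ∀ u, t < u → u ≤ s' → moment lam (y u) ≤ B := fun u h1 h2 => by
    rw [hB, ENNReal.coe_add, coe_toNNReal hfin.ne, ENNReal.coe_one]
    refine le_trans ?_ (add_le_add_right (hsub ⟨h1, h2⟩) _)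
    rw [moment, moment, delta, ← tsum_add]
    refine tsum_le_tsum fun j => ?_
    rw [← tsub_le_iff_left, ← ENNReal.coe_sub, edist_nndist, ENNReal.coe_le_coe, NNReal.nndist_eq]
    exact le_max_left _ _
  set C : ℝ≥0 := B ^ (1 / lam) with hC
  obtain ⟨C₁, hC₁⟩ := hK.locallyBounded C
  obtain ⟨q, hq⟩ := exists_nat_ge C₁
  set s := min s' b
  have hts : t < s := lt_min hs' htb
  refine ⟨s, hts, min_le_right _ _, le_trans ?_ hp⟩
  have hjump : ∀ l, ∀ᵐ e ∂π, e ∈ strip t s →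
      sumJump K F y l e ≤ C * pairWeight (1 / lam) q l e.2 := by
    refine fun l => h.ae_of_forall fun r hr hrs => ?_
    have hl : ∀ i : ℕ, (leftLim y r).1 i ≤ C * (i + 1 : ℝ≥0) ^ (-(1 / lam)) := fun i =>
      hy.cadlag.leftLim_apply_le hlam hrs.1.1 fun u h1 h2 =>
        apply_le_of_moment_le hlam (hmom u h1 (h2.le.trans (hrs.1.2.trans (min_le_left _ _)))) i
    have hlC : ∀ i, (leftLim y r).1 i ≤ C := fun i => (hl i).trans
      (mul_le_of_le_one_right zero_le (NNReal.rpow_le_one_of_one_le_of_nonpos (by simp)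
        (by linarith)))
    have hnn : 0 ≤ C * pairWeight (1 / lam) q l (markAt π r) :=
      mul_nonneg C.2 (pairWeight_nonneg _ _ _ _)
    have hg := h.good r hr
    simp only [sumJump, jump]
    rw [Finset.sum_sub_distrib, sub_le_iff_le_add']
    generalize markAt π r = e at hg hnn
    rcases e with ⟨p, z⟩ | ⟨i, θ, z⟩
    · simp only [act]
      split_ifs with hz
      · have h1 := (sum_range_coalesce_le p.2 (leftLim y r) l).trans
          (add_le_add_right (hl (max l p.1.2)) _)
        have hzq : z ≤ q := (hz.2.trans (hC₁ _ (hlC _) _ (hlC _))).trans hq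
        simp only [pairWeight, Sum.elim_inl, if_pos hzq]
        exact_mod_cast h1
      · linarith
    · simp only [act]
      split_ifs with hz
      · have h1 := NNReal.coe_le_coe.2 (sum_range_fragment_le i hg.2.1 (leftLim y r) l)
        push_cast at h1
        linarith
      · linarith
  have hwi : ∀ l, IntegrableOn (fun e => pairWeight (1 / lam) q l e.2) (strip t s) π := fun l =>
    ((hw q s).mono_set (strip_subset zero_le le_rfl)).mono'
      ((measurable_pairWeight _ q l).comp measurable_snd).aestronglyMeasurable
      (ae_of_all _ fun e => by
        rw [norm_of_nonneg (pairWeight_nonneg _ _ _ _)]; exact pairWeight_le hp0 q l e.2)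
  have hlim : Tendsto (fun l => ∫ e in strip t s, pairWeight (1 / lam) q l e.2 ∂π) atTop (𝓝 0) := by
    rw [← integral_zero (ℝ≥0 × Mark) ℝ (μ := π.restrict (strip t s))]
    exact tendsto_integral_of_dominated_convergence _ (fun l => (hwi l).aestronglyMeasurable)
      (hwi 0)
      (fun l => ae_of_all _ fun e => by
        rw [norm_of_nonneg (pairWeight_nonneg _ _ _ _)]; exact pairWeight_le hp0 q l e.2)
      (ae_of_all _ fun e => tendsto_pairWeight hp0 q e.2)
  refine mass_le_iff.2 fun n => ?_
  have h0 := (ENNReal.tendsto_ofReal (hlim.const_mul (C : ℝ))).const_add (mass (y t))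
  rw [mul_zero, ENNReal.ofReal_zero, add_zero] at h0
  refine ge_of_tendsto h0 ((eventually_ge_atTop n).mono fun l hl => ?_)
  have h1 := setIntegral_mono_on_ae (hy.integrable_sumJump l t s) ((hwi l).const_mul (C : ℝ))
    (measurableSet_strip t s) (hjump l)
  rw [← hy.sum_sub_eq l hts.le, integral_const_mul] at h1
  calc ((∑ j ∈ range n, (y s).1 j : ℝ≥0) : ℝ≥0∞)
      ≤ (∑ j ∈ range l, (y s).1 j : ℝ≥0) := ENNReal.coe_le_coe.2
        (Finset.sum_le_sum_of_subset (Finset.range_mono hl))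
    _ ≤ ofReal ((∑ j ∈ range l, (y t).1 j : ℝ≥0) +
          C * ∫ e in strip t s, pairWeight (1 / lam) q l e.2 ∂π) := by
        rw [← ofReal_coe_nnreal]
        exact ofReal_le_ofReal (by linarith)
    _ ≤ mass (y t) + ofReal (C * ∫ e in strip t s, pairWeight (1 / lam) q l e.2 ∂π) := by
        refine ENNReal.ofReal_add_le.trans (add_le_add_left ?_ _)
        rw [ofReal_coe_nnreal]
        exact sum_range_le_mass _ l

end SmallExponent

/-! ### The equation driven by the Poisson measures -/

section Equation

variable {m : MassSeq} {N : Ω → Measure CoagMark} {M : Ω → Measure FragMark}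

lemma measurableEmbedding_coagIncl : MeasurableEmbedding coagIncl :=
  MeasurableEmbedding.prodMap .id ⟨Sum.inl_injective, measurable_inl, fun _ hs =>
    measurableSet_inl_image.2 hs⟩

lemma measurableEmbedding_fragIncl : MeasurableEmbedding fragIncl :=
  MeasurableEmbedding.prodMap .id ⟨Sum.inr_injective, measurable_inr, fun _ hs =>
    measurableSet_inr_image.2 hs⟩

/-- The marks with `z = 0` and the events at time `0` are negligible, so that the equation driven by
the joint measure is the equation driven by the two Poisson measures. -/
lemma IsConfig.ae_joint {ω : Ω} (hc : IsConfig k (joint N M ω)) (y : ℝ≥0 → MassSeq) (t : ℝ≥0)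
    (j : ℕ) :
    ((∀ᵐ e ∂N ω, jump K F y j (coagIncl e) = coagJump K y j e) ∧
        coagIncl ⁻¹' strip 0 t =ᵐ[N ω] Iic t ×ˢ univ) ∧
      (∀ᵐ e ∂M ω, jump K F y j (fragIncl e) = fragJump F y j e) ∧
        fragIncl ⁻¹' strip 0 t =ᵐ[M ω] Iic t ×ˢ univ := by
  have hae : ∀ᵐ e ∂joint N M ω, 0 < e.1 ∧ IsGoodMark k e.2 :=
    hc.ae_of_forall fun r hr => ⟨hc.pos r hr, hc.good r hr⟩
  obtain ⟨hN, hM⟩ := ae_add_measure_iff.1 hae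
  have hN := ae_of_ae_map measurable_coagIncl.aemeasurable hN
  have hM := ae_of_ae_map measurable_fragIncl.aemeasurable hM
  refine ⟨⟨?_, ?_⟩, ?_, ?_⟩
  · filter_upwards [hN] with e he
    have hz : 0 < e.2.2 := he.2
    simp only [jump, coagIncl, act, coagJump, hz, true_and]
    split_ifs <;> simp
  · filter_upwards [hN] with e he
    exact propext ⟨fun h => ⟨h.1.2, trivial⟩, fun h => ⟨⟨he.1, h.1⟩, trivial⟩⟩
  · filter_upwards [hM] with e he
    have hz : 0 < e.2.2.2 := he.2.1
    simp only [jump, fragIncl, act, fragJump, hz, true_and]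
    split_ifs <;> simp
  · filter_upwards [hM] with e he
    exact propext ⟨fun h => ⟨h.1.2, trivial⟩, fun h => ⟨⟨he.1, h.1⟩, trivial⟩⟩

lemma IsConfig.integrableOn_joint_iff {ω : Ω} (hc : IsConfig k (joint N M ω)) (y : ℝ≥0 → MassSeq)
    (t : ℝ≥0) (j : ℕ) :
    IntegrableOn (jump K F y j) (strip 0 t) (joint N M ω) ↔
      IntegrableOn (coagJump K y j) (Iic t ×ˢ univ) (N ω) ∧
        IntegrableOn (fragJump F y j) (Iic t ×ˢ univ) (M ω) := by
  obtain ⟨⟨h1, h2⟩, h3, h4⟩ := hc.ae_joint (K := K) (F := F) y t j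
  rw [joint, integrableOn_add_measure, measurableEmbedding_coagIncl.integrableOn_map_iff,
    measurableEmbedding_fragIncl.integrableOn_map_iff, integrableOn_congr_set_ae h2,
    integrableOn_congr_set_ae h4, integrableOn_congr_fun_ae (f := jump K F y j ∘ coagIncl)
      (ae_restrict_of_ae h1),
    integrableOn_congr_fun_ae (f := jump K F y j ∘ fragIncl) (ae_restrict_of_ae h3)]

lemma IsConfig.setIntegral_joint {ω : Ω} (hc : IsConfig k (joint N M ω)) (y : ℝ≥0 → MassSeq)
    (t : ℝ≥0) (j : ℕ) (hi : IntegrableOn (jump K F y j) (strip 0 t) (joint N M ω)) :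
    ∫ e in strip 0 t, jump K F y j e ∂joint N M ω =
      (∫ e in Iic t ×ˢ univ, coagJump K y j e ∂N ω) +
        ∫ e in Iic t ×ˢ univ, fragJump F y j e ∂M ω := by
  obtain ⟨⟨h1, h2⟩, h3, h4⟩ := hc.ae_joint (K := K) (F := F) y t j
  rw [joint, integrableOn_add_measure] at hi
  rw [joint, Measure.restrict_add, integral_add_measure hi.1 hi.2,
    measurableEmbedding_coagIncl.setIntegral_map, measurableEmbedding_fragIncl.setIntegral_map,
    setIntegral_congr_set h2, setIntegral_congr_set h4, integral_congr_ae (ae_restrict_of_ae h1),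
    integral_congr_ae (ae_restrict_of_ae h3)]

/-- It suffices to have the equation at a dense set of times, by right continuity. -/
lemma isPathSolution_of_dense {π : Measure (ℝ≥0 × Mark)} {y : ℝ≥0 → MassSeq} (hlam : 0 < lam)
    (hy : IsCadlag lam y) {D : Set ℝ≥0} (hD : Dense D)
    (h : ∀ t ∈ D, ∀ j, IntegrableOn (jump K F y j) (strip 0 t) π ∧
      ((y t).1 j : ℝ) = m.1 j + ∫ e in strip 0 t, jump K F y j e ∂π) :
    IsPathSolution K F lam π m y := by
  have hseq := fun t => hD.exists_seq_strictAnti_tendsto t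
  refine ⟨hy, fun t j => ?_, fun t j => ?_⟩ <;> obtain ⟨u, hu, hut, hlim⟩ := hseq t
  · exact (h (u 0) (hut 0).2 j).1.mono_set (strip_subset le_rfl (hut 0).1.le)
  · have h1 := tendsto_setIntegral_of_antitone (μ := π) (f := jump K F y j)
      (fun n => measurableSet_strip 0 (u n))
      (fun a b hab => strip_subset le_rfl (hu.antitone hab)) ⟨0, (h (u 0) (hut 0).2 j).1⟩
    have h2 : ⋂ n, strip 0 (u n) = strip 0 t := by
      refine subset_antisymm (fun e he => ?_) (Set.subset_iInter fun n =>
        strip_subset le_rfl (hut n).1.le)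
      have he' := Set.mem_iInter.1 he
      exact ⟨⟨(he' 0).1.1, ge_of_tendsto' hlim fun n => (he' n).1.2⟩, trivial⟩
    rw [h2] at h1
    refine tendsto_nhds_unique ((tendsto_coord (hy.tendsto_right hlam t) j).comp
      (tendsto_nhdsWithin_iff.2 ⟨hlim, Eventually.of_forall fun n => (hut n).1⟩)) ?_
    exact (h1.const_add (m.1 j : ℝ)).congr fun n => ((h (u n) (hut n).2 j).2).symm

lemma IsSDESolution.ae_isPathSolution {ℋ : Filtration ℝ≥0 mΩ} {Y : ℝ≥0 → Ω → MassSeq}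
    {π : Ω → Measure (ℝ≥0 × Mark)} (hlam : 0 < lam) (hY : IsSDESolution K F lam m N M ℋ Y P)
    (hc : ∀ ω, IsConfig k (π ω)) (hπ : ∀ᵐ ω ∂P, π ω = joint N M ω) :
    ∀ᵐ ω ∂P, IsPathSolution K F lam (π ω) m fun t => Y t ω := by
  obtain ⟨D, hDc, hD⟩ := TopologicalSpace.exists_countable_dense ℝ≥0
  have hall := (ae_ball_iff hDc).2 fun t _ => hY.equation t
  filter_upwards [hY.cadlag, hall, hπ] with ω h1 h2 h3
  refine isPathSolution_of_dense hlam h1 hD fun t ht j => ?_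
  have hc' := hc ω
  rw [h3] at hc' ⊢
  obtain ⟨h4, h5, h6⟩ := h2 t ht j
  have hi := (hc'.integrableOn_joint_iff (K := K) (F := F) (fun t => Y t ω) t j).2 ⟨h4, h5⟩
  exact ⟨hi, by rw [hc'.setIntegral_joint _ t j hi, ← add_assoc]; exact h6⟩

lemma isSDESolution_path {ℋ : Filtration ℝ≥0 mΩ} {π : Ω → Measure (ℝ≥0 × Mark)} (hlam : 0 < lam)
    (hd : IsDriver β k ℋ π P) (hK : IsCoagKernel K) (hF : IsFragKernel F)
    (hm : ∀ ω, NoExplosion K F (π ω) m) (hπ : ∀ᵐ ω ∂P, π ω = joint N M ω) :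
    IsSDESolution K F lam m N M ℋ (fun t ω => path K F (π ω) t m) P where
  adapted t := hd.measurable_path hK hF t m
  cadlag := ae_of_all _ fun ω => (hm ω).isCadlag hlam hK hF (hd.config ω)
  equation t := by
    filter_upwards [hπ] with ω hω j
    have hs := (hm ω).isPathSolution hlam hK hF (hd.config ω)
    have hc := hd.config ω
    set x : ℝ≥0 → MassSeq := fun t => path K F (π ω) t m with hx
    clear_value x
    have hi := hs.integrable t j
    have he := hs.eq t j
    rw [hω] at hi he hc
    rw [hc.setIntegral_joint _ t j hi, ← add_assoc] at he
    rw [← congrFun hx t]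
    exact ⟨((hc.integrableOn_joint_iff _ t j).1 hi).1, ((hc.integrableOn_joint_iff _ t j).1 hi).2,
      he⟩

lemma summable_pairWeight {p : ℝ} (hp : 2 < p) :
    Summable fun a : IdxPair => ((a.1.2 : ℝ) + 1) ^ (-p) := by
  have h1 : Summable fun n : ℕ => ((n : ℝ) + 1) ^ (-(p / 2)) := by
    have := (summable_nat_add_iff 1).2 (Real.summable_nat_rpow (p := -(p / 2)).2 (by linarith))
    simpa using this
  have h2 := h1.mul_of_nonneg h1 (fun n => by positivity) (fun n => by positivity)
  refine (h2.comp_injective Subtype.val_injective).of_nonneg_of_le (fun a => by positivity)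
    fun a : IdxPair => ?_
  have h3 : -p = -(p / 2) + -(p / 2) := by ring
  rw [h3, Real.rpow_add (by positivity)]
  refine mul_le_mul_of_nonneg_right ?_ (by positivity)
  exact Real.rpow_le_rpow_of_nonpos (by positivity)
    (add_le_add_left (Nat.cast_le.2 a.2.le) _) (by linarith)

/-- For `λ < 1/2` the pairs of indices have a finite total weight. -/
lemma IsDrivingPair.ae_integrable_pairWeight [SFinite β] (hd : IsDrivingPair β N M P) {p : ℝ}
    (hp : 2 < p) :
    ∀ᵐ ω ∂P, ∀ (q : ℕ) (t : ℝ≥0),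
      IntegrableOn (fun e => pairWeight p q 0 e.2) (strip 0 t) (joint N M ω) := by
  suffices h : ∀ q T : ℕ, ∀ᵐ ω ∂P,
      IntegrableOn (fun e => pairWeight p q 0 e.2) (strip 0 T) (joint N M ω) by
    filter_upwards [ae_all_iff.2 fun q => ae_all_iff.2 (h q)] with ω hω q t
    obtain ⟨T, hT⟩ := exists_nat_ge t
    exact (hω q T).mono_set (strip_subset le_rfl hT)
  intro q T
  set A : IdxPair → Set (ℝ≥0 × Mark) := fun a =>
    Iic (T : ℝ≥0) ×ˢ (Sum.inl '' ({a} ×ˢ Iic (q : ℝ≥0))) with hA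
  have hAi : ∀ a, MeasurableSet (Sum.inl '' ({a} ×ˢ Iic (q : ℝ≥0)) : Set Mark) := fun a =>
    measurableSet_inl_image.2 ((measurableSet_singleton a).prod measurableSet_Iic)
  have hAm : ∀ a, MeasurableSet (A a) := fun a => measurableSet_Iic.prod (hAi a)
  have hAv : ∀ a, leb.prod (markMeasure β) (A a) = T * q := fun a => by
    have h0 : (Sum.inr ⁻¹' (Sum.inl '' ({a} ×ˢ Iic (q : ℝ≥0))) :
        Set (ℕ × Ratios × ℝ≥0)) = ∅ := by ext; simp
    rw [hA, prod_prod, leb_Iic, markMeasure, Measure.add_apply,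
      map_apply measurable_inl (hAi a), map_apply measurable_inr (hAi a), h0,
      Set.preimage_image_eq _ Sum.inl_injective, prod_prod, leb_Iic, measure_empty,
      Measure.count_singleton, one_mul, add_zero, ENNReal.coe_natCast, ENNReal.coe_natCast]
  set w : IdxPair → ℝ≥0∞ := fun a => ofReal (((a.1.2 : ℝ) + 1) ^ (-p)) with hw
  have hmeas : ∀ a, Measurable fun ω => w a * joint N M ω (A a) := fun a =>
    ((measurable_coe (hAm a)).comp (measurable_joint hd.coag.measurable
      hd.frag.measurable)).const_mul _
  have hfin : ∫⁻ ω, ∑' a, w a * joint N M ω (A a) ∂P ≠ ∞ := by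
    rw [lintegral_tsum fun a => (hmeas a).aemeasurable]
    have h1 : ∀ a, ∫⁻ ω, w a * joint N M ω (A a) ∂P = w a * (T * q) := fun a => by
      rw [lintegral_const_mul' _ _ ofReal_ne_top, hd.lintegral_joint (hAm a)
        (by rw [hAv]; finiteness), hAv]
    simp only [h1]
    rw [ENNReal.tsum_mul_right]
    exact mul_ne_top (summable_pairWeight hp).tsum_ofReal_lt_top.ne (by finiteness)
  filter_upwards [ae_lt_top (Measurable.tsum hmeas) hfin] with ω hω
  refine ⟨((measurable_pairWeight p q 0).comp measurable_snd).aestronglyMeasurable, ?_⟩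
  refine lt_of_le_of_lt ?_ hω
  calc ∫⁻ e in strip 0 T, ‖pairWeight p q 0 e.2‖ₑ ∂joint N M ω
      ≤ ∫⁻ e in strip 0 T, ∑' a, (A a).indicator (fun _ => w a) e ∂joint N M ω := by
        refine setLIntegral_mono_ae' (measurableSet_strip 0 T) (ae_of_all _ ?_)
        rintro ⟨r, ⟨a, z⟩ | e⟩ he
        · simp only [pairWeight, Sum.elim_inl]
          split_ifs with hz
          · refine le_trans ?_ (ENNReal.le_tsum a)
            rw [indicator_of_mem (show (r, _) ∈ A a from ⟨he.1.2, (a, z), ⟨rfl, hz⟩, rfl⟩), hw,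
              Real.enorm_of_nonneg (by positivity), Nat.zero_max]
          · simp
        · simp [pairWeight]
    _ ≤ ∫⁻ e, ∑' a, (A a).indicator (fun _ => w a) e ∂joint N M ω := setLIntegral_le_lintegral _ _
    _ = ∑' a, w a * joint N M ω (A a) := by
        rw [lintegral_tsum fun a => (measurable_const.indicator (hAm a)).aemeasurable]
        simp only [lintegral_indicator_const (hAm _)]

end Equation

end

end CoagFrag

theorem mainTheorem4
    (lam : ℝ) (hlam0 : 0 < lam) (hlam1 : lam ≤ 1)
    (K : ℝ≥0 → ℝ≥0 → ℝ≥0) (hK : CoagFrag.IsCoagKernel K)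
    (F : ℝ≥0 → ℝ≥0) (hF : CoagFrag.IsFragKernel F)
    (β : Measure CoagFrag.Ratios) (hβ : CoagFrag.IsFiniteDislocation β) :
    ∃ κ : Kernel CoagFrag.MassSeq (ℝ≥0 → CoagFrag.MassSeq), IsMarkovKernel κ ∧
      ∀ m ∈ CoagFrag.finiteStates,
        -- existence of the process in law, with law `κ m`
        (∃ (Ω : Type) (mΩ : MeasurableSpace Ω) (P : Measure Ω) (_ : IsProbabilityMeasure P)
            (𝓕 : Filtration ℝ≥0 mΩ) (X : ℝ≥0 → Ω → CoagFrag.MassSeq),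
          CoagFrag.IsFiniteCFProcess K F β lam m κ 𝓕 X P ∧
          P.map (fun ω t => X t ω) = κ m) ∧
        -- uniqueness in law
        (∀ (Ω : Type*) (mΩ : MeasurableSpace Ω) (P : Measure Ω) (_ : IsProbabilityMeasure P)
            (𝓕 : Filtration ℝ≥0 mΩ) (X : ℝ≥0 → Ω → CoagFrag.MassSeq)
            (κ' : Kernel CoagFrag.MassSeq (ℝ≥0 → CoagFrag.MassSeq)),
          CoagFrag.IsFiniteCFProcess K F β lam m κ' 𝓕 X P →
          P.map (fun ω t => X t ω) = κ m) ∧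
        -- the Poisson-driven equation
        (∀ (Ω : Type*) (mΩ : MeasurableSpace Ω) (P : Measure Ω) (_ : IsProbabilityMeasure P)
            (N : Ω → Measure CoagFrag.CoagMark) (M : Ω → Measure CoagFrag.FragMark)
            (hNM : CoagFrag.IsDrivingPair β N M P),
          ∃ X : ℝ≥0 → Ω → CoagFrag.MassSeq,
            CoagFrag.IsSDESolution K F lam m N M
              (CoagFrag.canonicalFiltration hNM.coag.measurable hNM.frag.measurable P) X P ∧
            CoagFrag.IsFiniteCFProcess K F β lam m κ
              (CoagFrag.canonicalFiltration hNM.coag.measurable hNM.frag.measurable P) X P ∧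
            -- no explosion
            (∀ᵐ ω ∂P, ∀ t : ℝ≥0,
              (⨆ s ∈ Set.Iic t, CoagFrag.numParticles (X s ω)) < ⊤ ∧
              (⨆ s ∈ Set.Iic t,
                (CoagFrag.coagRate K (X s ω) + CoagFrag.fragRate F β (X s ω))) < ∞) ∧
            -- pathwise uniqueness
            (∀ Y : ℝ≥0 → Ω → CoagFrag.MassSeq,
              CoagFrag.IsSDESolution K F lam m N M
                (CoagFrag.canonicalFiltration hNM.coag.measurable hNM.frag.measurable P) Y P →
              (lam < 1 / 2 ∨ ∀ᵐ ω ∂P, ∀ t, Y t ω ∈ CoagFrag.finiteStates) →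
              ∀ᵐ ω ∂P, ∀ t, Y t ω = X t ω)) := by
  obtain ⟨κ, hκM, hκ⟩ := CoagFrag.exists_isLawFamily hK hF hβ
  have := hβ.isFinite
  refine ⟨κ, hκM, fun m hm => ⟨?_, fun Ω mΩ P hP 𝓕 X κ' hX => ?_, fun Ω mΩ P hP N M hNM => ?_⟩⟩
  · obtain ⟨Ω, mΩ, P, hP, N, M, hNM⟩ := CoagFrag.exists_isDrivingPair β
    obtain ⟨k, π₀, hd₀, -⟩ := hNM.exists_isDriver hβ
    obtain ⟨π, hd, hno, -⟩ := hd₀.exists_noExplosion hK hF hβ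
      (fun S hS h0 => CoagFrag.measurableSet_canonicalFiltration_of_null hS h0) hm
    have hX := CoagFrag.IsDriver.isFiniteCFProcess_path hκ hlam0 hd hK hF hβ hno
    exact ⟨Ω, mΩ, P, hP, _, _, hX,
      CoagFrag.IsWeakSolution.map_eq hK hF hβ hκ (hX.isWeakSolution hlam0) hX.start⟩
  · exact CoagFrag.IsWeakSolution.map_eq hK hF hβ hκ (hX.isWeakSolution hlam0) hX.start
  · obtain ⟨k, π₀, hd₀, hπ₀⟩ := hNM.exists_isDriver hβ
    obtain ⟨π, hd, hno, hπ⟩ := hd₀.exists_noExplosion hK hF hβ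
      (fun S hS h0 => CoagFrag.measurableSet_canonicalFiltration_of_null hS h0) hm
    have hπN : ∀ᵐ ω ∂P, π ω = CoagFrag.joint N M ω := by
      filter_upwards [hπ, hπ₀] with ω h1 h2 using h1.trans h2
    refine ⟨fun t ω => CoagFrag.path K F (π ω) t m,
      CoagFrag.isSDESolution_path hlam0 hd hK hF hno hπN,
      CoagFrag.IsDriver.isFiniteCFProcess_path hκ hlam0 hd hK hF hβ hno,
      ae_of_all _ fun ω => (hno ω).iSup_lt_top hK hF hβ (hd.config ω), fun Y hY hcase => ?_⟩
    have hYs := hY.ae_isPathSolution hlam0 hd.config hπN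
    have hanti : ∀ᵐ ω ∂P, Antitone fun t => CoagFrag.mass (Y t ω) := by
      rcases hcase with hlam | hfin
      · have hp : 2 < 1 / lam := by
          rw [lt_div_iff₀ hlam0]
          linarith
        filter_upwards [hYs, hNM.ae_integrable_pairWeight hp, hπN] with ω h1 h2 h3
        exact h1.mass_antitone_of_pairWeight hlam0 hK (hd.config ω) (h3 ▸ h2)
      · filter_upwards [hYs, hfin] with ω h1 h2
        exact h1.mass_antitone_of_finite hlam0 hlam1 (hd.config ω) h2
    filter_upwards [hYs, hanti] with ω h1 h2 t
    have hx := (hno ω).isPathSolution hlam0 hK hF (hd.config ω)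
    have hxf : ∀ t, CoagFrag.path K F (π ω) t m ∈ CoagFrag.finiteStates :=
      (hno ω).path_mem_finiteStates hK hF (hd.config ω)
    exact hx.eq_of_antitone hlam0 h1 hK hF (hd.config ω) hxf
      (hx.mass_antitone_of_finite hlam0 hlam1 (hd.config ω) hxf) h2 t
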